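/- **Setting.** Let $n\ge 0$, $m\in\frac12\mathbb Z$, and let $k_1\ne 0$, $k_2=mk_1$ be real. Let $R_0\subset\mathbb R^n$ be the root system of type $B_n$ with long roots $\pm e_i\pm e_j$ (label $k_1$) and short roots $\pm e_i$ (label $k_2$), and let $W_0$ be its Weyl group (signed permutations). *Central characters.* For a non-empty affine subspace $L\subset\mathbb R^n$ let $R_L$ be the set of roots that are constant on $L$. $L$ is residual if $|\{\alpha\in R_L:\alpha(L)=k_\alpha\}|=|\{\alpha\in R_L:\alpha(L)=0\}|+\operatorname{codim}L$. Its center $c_L$ is the intersection of $L$ with the span of $R_L$. Let $\mathcal C_m(n)$ be the set of orbits $W_0c_L$, $L$ residual. (By results of Opdam and Delorme–Opdam, not part of the statement, these are the central characters of the irreducible tempered representations with real central character of the graded Hecke algebra with labels $k_1,k_2$.) *Characters and symbols.* $\hat W_0$ is the set of irreducible complex characters of $W_0$, labelled $\chi_{(\xi,\eta)}$ by pairs of partitions with $|\xi|+|\eta|=n$, where $\chi_{((n),-)}$ is trivial and $\chi_{(-,(1^n))}$ is the sign character: $\chi_{(\xi,\eta)}$ is induced from $W(B_{|\xi|})\times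 W(B_{|\eta|})$ of $\chi_\xi\otimes(\chi_\eta\cdot\text{product of signs})$. Parts are written in increasing order, with zeros allowed. For $m\ge0$ the $m$-symbol of $(\xi,\eta)$ has rows $(\xi_i+2(i-1))_{1\le i\le N+\lceil m\rceil}$ and $(\eta_i+2(i-1)+s)_{1\le i\le N}$, where $s=0$ if $m\in\mathbb Z$ and $s=1$ otherwise; here $N=n$. The $(-m)$-symbol of $(\xi,\eta)$ is the $m$-symbol of $(\eta,\xi)$ with its rows interchanged. Write $\sim_m$ for having the same multiset of symbol entries. Let $a_m$ be the sum of $\min(x,y)$ over unordered pairs of entries, minus its value for the empty double partition with rows of the same lengths. For a character $\chi'$ of a subgroup $W'$, $\mathrm{tr}_m\text{-Ind}_{W'}^{W_0}\chi'$ consists of the constituents of $\mathrm{Ind}_{W'}^{W_0}\chi'$ with maximal $a_m$. *Springer correspondents.* Let $c$ be a residual point for $B_l$, and let $M_x$ be the number of its coordinates equal to $\pm xk_1$. Its jumps are the $x\in m+\mathbb Z$ with $x\ge|m|$ and $M_x=M_{x+1}+1$, or with $0<x<|m|$ and $M_x=M_{x+1}$; one adds $0$ (if $m\in\mathbb Z$)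 or $-\frac12$ (otherwise) if needed to have $\lceil|m|\rceil+2r$ jumps $j_1<j_2<\cdots$ with $r\in\mathbb Z_{\ge0}$. For $m\ge0$ put $$\xi(c)=(j_1,j_3,\dots,j_{2r+1},j_{2r+2}-1,\dots,j_{2r+m}-(m-1)),\quad \eta(c)=(j_2+1,j_4+1,\dots,j_{2r}+1)$$ if $m\in\mathbb Z$ (for $m=0$: $\xi(c)=(j_1,j_3,\dots,j_{2r-1})$), and $$\xi(c)=(j_1+\tfrac12,j_3+\tfrac12,\dots,j_{2r+1}+\tfrac12,j_{2r+2}-\tfrac12,j_{2r+3}-\tfrac32,\dots),\quad \eta(c)=(j_2+\tfrac12,\dots,j_{2r}+\tfrac12)$$ otherwise. Let $\Sigma_m(c)$ be the $\sim_m$-class of $(\xi(c),\eta(c))$ for $m\ge0$, and of $(\eta(c),\xi(c))$, with $\xi(c),\eta(c)$ formed from the same jumps for $|m|$, for $m<0$. If $L$ is residual with $R_L=A_\lambda\times B_l$, where $A_\lambda=\prod_i A_{\lambda_i-1}$ and $|\lambda|+l=n$, let $c_{L,B}$ be the $B_l$-component of $c_L$ and $$\Sigma_m(W_0c_L)=\bigcup_{(\alpha,\beta)\in\Sigma_m(c_{L,B})}\mathrm{tr}_m\text{-Ind}_{W_0(R_L)}^{W_0}\bigl(\mathrm{triv}\otimes\chi_{(\alpha,\beta)}\bigr).$$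 *Generalized unipotent classes.* $\mathcal U_m(n)$ is the set of partitions of $2n+\lfloor m^2\rfloor$ in which the parts $\equiv 2m \pmod 2$ have even multiplicity and at least $\lfloor|m|\rfloor$ different other parts have odd multiplicity. For $\lambda\in\mathcal U_m(n)$, $f^{BC}_m(\lambda)=W_0c_L$ for the residual $L$ with $R_L=A_d\times B_l$, in which each $x$ occurs $\lfloor r_x/2\rfloor$ times in $d$ ($r_x$ being the multiplicity of $x$ in $\lambda$), and such that the non-negative jumps $j$ of the residual point of $B_l$ are the numbers $\frac{x-1}2$ with $r_x$ odd. For $m\ge0$ and a class $\Sigma\in\hat W_0/\sim_m$, $\psi_m(\Sigma)$ is obtained as follows. Let $e_1\le e_2\le\cdots$ be the symbol entries of $\Sigma$. Distribute them increasingly: $e_1,e_3,\dots,e_{2N-1},e_{2N+1},e_{2N+2},e_{2N+3},\dots$ to the first row and $e_2,e_4,\dots,e_{2N}$ to the second. Subtract $0,2,4,\dots$ from the first row and $s,s+2,s+4,\dots$ from the second, to get compositions $\xi,\eta$; drop the first part of $\xi$ if $m\notin\mathbb Z$. Put $\xi^*_i=\xi_i+i-1$, $\eta^*_i=\eta_i+i-1$.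 Arrange the $2N$ numbers $2\xi^*_i+1$, $2\eta^*_i$ ($i\le N$) increasingly and subtract $0,1,\dots,2N-1$; append the numbers $2\xi^*_i+1-(2N-s)$ for $i>N$. Finally replace consecutive entries $(x+1,x-1)$ by $(x,x)$ and remove zeros. For $m>0$, $\psi_{-m}(\Sigma)=\psi_m(\Sigma\otimes\chi_{(-,(n))})$. **Theorem.** Every residual subspace has a unique center, and the right hand side in the definition of $\Sigma_m(W_0c_L)$ depends only on $W_0c_L$. Moreover: (i) $W_0c_L\mapsto\Sigma_m(W_0c_L)$ is a bijection from $\mathcal C_m(n)$ onto $\{\Sigma_m(W_0c_L)\}$, and the latter set is equal to the set $\hat W_0/\sim_m$ of similarity classes; (ii) $\psi_m:\hat W_0/\sim_m\to\mathcal U_m(n)$ and $f^{BC}_m:\mathcal U_m(n)\to\mathcal C_m(n)$ are (well-defined) bijections, and $f^{BC}_m(\psi_m(\Sigma_m(W_0c_L)))=W_0c_L$ for all $W_0c_L\in\mathcal C_m(n)$. -/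

import Mathlib

noncomputable section

namespace TypeB

/-! Throughout, a half-integer `m` is given by the integer `h = 2 m`. -/

/-! ### The Weyl group of type `B` and its irreducible characters -/

/-- The Weyl group of type `B` on the coordinates `ι`: signed permutations, as the semidirect
product of the sign changes and the permutations of the coordinates. -/
abbrev W (ι : Type) : Type := (ι → ℤˣ) ⋊[mulAutArrow] Equiv.Perm ι

instance instFintypeW (ι : Type) [Fintype ι] [DecidableEq ι] : Fintype (W ι) :=
  Fintype.ofEquiv ((ι → ℤˣ) × Equiv.Perm ι) SemidirectProduct.equivProd.symm

/-- The action of a signed permutation on `ℝ^ι`: `(ε, σ)` sends `e_i` to `ε_{σ i} e_{σ i}`. -/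
def act {ι : Type} (w : W ι) (x : ι → ℝ) : ι → ℝ :=
  fun i => ((w.left i : ℤ) : ℝ) * x (w.right⁻¹ i)

/-- The orbit `W x`. -/
def orbit {ι : Type} (x : ι → ℝ) : Set (ι → ℝ) := Set.range fun w : W ι => act w x

/-- The irreducible complex characters of a group `G`. -/
def Irr (G : Type) [Group G] : Set (G → ℂ) :=
  {χ | ∃ (d : ℕ) (ρ : Representation ℂ G (Fin d → ℂ)), ρ.IsIrreducible ∧ χ = ρ.character}

/-- The function on `G` induced from the restriction to `H` of `f`. -/
def indChar {G : Type} [Group G] [Fintype G] (H : Subgroup G) (f : G → ℂ) : G → ℂ :=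
  open Classical in
  fun g => (Nat.card H : ℂ)⁻¹ * ∑ x : G, if x⁻¹ * g * x ∈ H then f (x⁻¹ * g * x) else 0

/-- The inner product of class functions. If `f` is a character and `χ` an irreducible
character, this is the multiplicity of `χ` in `f`. -/
def charInner {G : Type} [Group G] [Fintype G] (f χ : G → ℂ) : ℂ :=
  (Fintype.card G : ℂ)⁻¹ * ∑ g : G, f g * starRingEnd ℂ (χ g)

/-- The irreducible character of the symmetric group on `ι` attached to a partition `p` of `|ι|`
(given by its positive parts; `(n)` gives the trivial character), by the Frobenius formula: with
`p₀ ≤ ⋯ ≤ p_{r-1}` the parts, the value at `σ` is the coefficient of `∏ x_i ^ (p_i + i)` in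
`∑_w sgn(w) ∏ x_i ^ (w i)` times the product of the power sums for the cycle lengths of `σ`; the
latter product is the sum over `σ`-invariant `f : ι → {0, …, r-1}` of `∏ x_i ^ |f⁻¹(i)|`. -/
def symChar {ι : Type} (p : Multiset ℕ) (σ : Equiv.Perm ι) : ℂ :=
  ∑ w : Equiv.Perm (Fin p.card), ((Equiv.Perm.sign w : ℤ) : ℂ) *
    (Nat.card {f : ι → Fin p.card // (∀ x, f (σ x) = f x) ∧
      ∀ i, Nat.card {x // f x = i} + (w i : ℕ) = (p.sort (· ≤ ·)).getD i 0 + i} : ℂ)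

/-- The irreducible character `χ_(p, q)` of the Weyl group of type `B` attached to a pair of
partitions with `|p| + |q| = |ι|`. It is induced from the stabiliser `B_a × B_b` of a subset of
`a = |p|` coordinates, of the tensor product of `symChar p` on `B_a` and `symChar q` times the
product of all signs on `B_b`; the cosets of `B_a × B_b` are the subsets `S` with `a` elements.
In particular `((n), ∅)` is the trivial and `(∅, (1^n))` the sign character. -/
def bChar {ι : Type} [Fintype ι] [DecidableEq ι] (p q : Multiset ℕ) (w : W ι) : ℂ :=
  open Classical in
  ∑ S : Finset ι,
    if hS : S.card = p.sum ∧ ∀ x, w.right x ∈ S ↔ x ∈ S then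
      symChar p (w.right.subtypePerm (p := (· ∈ S)) hS.2) *
      (symChar q (w.right.subtypePerm (p := (· ∉ S)) fun x => not_congr (hS.2 x)) *
        ∏ i ∈ Sᶜ, ((w.left i : ℤ) : ℂ))
    else 0

/-- Double partitions of `n`; partitions are multisets of positive integers. -/
structure Bipartition (n : ℕ) where
  fst : Multiset ℕ
  snd : Multiset ℕ
  fst_pos : 0 ∉ fst
  snd_pos : 0 ∉ snd
  sum_eq : fst.sum + snd.sum = n

/-- The irreducible character of `W(B_n)` attached to a double partition of `n`. -/
def chi {n : ℕ} (A : Bipartition n) : W (Fin n) → ℂ := bChar A.fst A.snd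

/-! ### Symbols, similarity, the `a`-function, truncated induction -/

/-- The row `(p₁ + s, p₂ + s + 2, p₃ + s + 4, …)` of a symbol, where `p₁ ≤ p₂ ≤ ⋯ ≤ p_N` are the
parts of `p`, preceded by zeros. -/
def symbolRow (s N : ℕ) (p : Multiset ℕ) : Multiset ℕ :=
  (((p + Multiset.replicate (N - p.card) 0).sort (· ≤ ·)).mapIdx fun i x => x + (2 * i + s) :
    List ℕ)

/-- The multiset of entries of the `m`-symbol of `(p, q)`, with rows of lengths `N + ⌈|m|⌉`
and `N`. For `m ≥ 0` the first row is made from `p`, the second from `q`, the second one being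
shifted by `1` if `m` is not an integer; the `-m`-symbol of `(p, q)` is the `m`-symbol
of `(q, p)` with its rows interchanged. -/
def symbolEntries (h : ℤ) (N : ℕ) (p q : Multiset ℕ) : Multiset ℕ :=
  if 0 ≤ h then
    symbolRow 0 (N + (h.natAbs + 1) / 2) p + symbolRow (h.natAbs % 2) N q
  else
    symbolRow 0 (N + (h.natAbs + 1) / 2) q + symbolRow (h.natAbs % 2) N p

/-- Similarity `A ∼_m B` of double partitions: their symbols have the same entries with the same
multiplicities. -/
def Similar (h : ℤ) {n : ℕ} (A B : Bipartition n) : Prop :=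
  symbolEntries h n A.fst A.snd = symbolEntries h n B.fst B.snd

/-- The similarity class in the set of irreducible characters of `W(B_n)`. -/
def simClass (h : ℤ) {n : ℕ} (χ : W (Fin n) → ℂ) : Set (W (Fin n) → ℂ) :=
  {χ' | χ' ∈ Irr (W (Fin n)) ∧ ∃ A B : Bipartition n, χ = chi A ∧ χ' = chi B ∧ Similar h A B}

/-- The set of `∼_m`-classes of irreducible characters of `W(B_n)`. -/
def simClasses (h : ℤ) (n : ℕ) : Set (Set (W (Fin n) → ℂ)) :=
  {S | ∃ χ ∈ Irr (W (Fin n)), S = simClass h χ}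

/-- The sum of `min x y` over all unordered pairs of elements of a multiset. -/
def pairMin (S : Multiset ℕ) : ℕ :=
  ∑ i ∈ Finset.range S.card, ∑ j ∈ Finset.range i,
    min ((S.sort (· ≤ ·)).getD i 0) ((S.sort (· ≤ ·)).getD j 0)

/-- The function `a_m` on double partitions of `n`. -/
def aFun (h : ℤ) {n : ℕ} (A : Bipartition n) : ℤ :=
  (pairMin (symbolEntries h n A.fst A.snd) : ℤ) - pairMin (symbolEntries h n 0 0)

/-- The set of constituents of the truncated induction from `H` to `W(B_n)` of a character `f`
of `H`: the constituents of the induced character with maximal value of `a_m`. -/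
def trInd (h : ℤ) {n : ℕ} (H : Subgroup (W (Fin n))) (f : W (Fin n) → ℂ) :
    Set (W (Fin n) → ℂ) :=
  {χ | ∃ A : Bipartition n, χ = chi A ∧ charInner (indChar H f) (chi A) ≠ 0 ∧
    ∀ B : Bipartition n, charInner (indChar H f) (chi B) ≠ 0 → aFun h B ≤ aFun h A}

/-! ### Residual subspaces -/

/-- The short roots `± e_i`; they have label `k₂`. -/
def shortRoots (n : ℕ) : Set (Fin n → ℝ) :=
  {α | ∃ (i : Fin n) (s : ℤˣ), α = Pi.single i (((s : ℤ) : ℝ))}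

/-- The long roots `± e_i ± e_j`, `i ≠ j`; they have label `k₁`. -/
def longRoots (n : ℕ) : Set (Fin n → ℝ) :=
  {α | ∃ (i j : Fin n) (s t : ℤˣ), i ≠ j ∧
    α = Pi.single i (((s : ℤ) : ℝ)) + Pi.single j (((t : ℤ) : ℝ))}

/-- The label `k_α` of a root `α`. -/
def label (k₁ k₂ : ℝ) {n : ℕ} (α : Fin n → ℝ) : ℝ :=
  open Classical in if α ∈ shortRoots n then k₂ else k₁

/-- `R_L`: the roots that are constant on `L`. -/
def rootsOf {n : ℕ} (L : AffineSubspace ℝ (Fin n → ℝ)) : Set (Fin n → ℝ) :=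
  {α | α ∈ shortRoots n ∪ longRoots n ∧ ∀ x ∈ L, ∀ y ∈ L, α ⬝ᵥ x = α ⬝ᵥ y}

/-- `L` is a residual subspace for the labels `k₁, k₂`:
`#{α ∈ R_L | α(L) = k_α} = #{α ∈ R_L | α(L) = 0} + codim L`. -/
def IsResidual (k₁ k₂ : ℝ) {n : ℕ} (L : AffineSubspace ℝ (Fin n → ℝ)) : Prop :=
  (L : Set (Fin n → ℝ)).Nonempty ∧
  Set.ncard {α | α ∈ rootsOf L ∧ ∀ x ∈ L, α ⬝ᵥ x = label k₁ k₂ α} =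
    Set.ncard {α | α ∈ rootsOf L ∧ ∀ x ∈ L, α ⬝ᵥ x = 0} +
      (n - Module.finrank ℝ L.direction)

/-- `c` is the center of `L`: the point of intersection of `L` and the span of `R_L`. -/
def IsCenter {n : ℕ} (L : AffineSubspace ℝ (Fin n → ℝ)) (c : Fin n → ℝ) : Prop :=
  c ∈ L ∧ c ∈ Submodule.span ℝ (rootsOf L)

/-- `𝓒_m(n)`: the set of `W`-orbits of centers of residual subspaces. -/
def centers (k₁ k₂ : ℝ) (n : ℕ) : Set (Set (Fin n → ℝ)) :=
  {O | ∃ (L : AffineSubspace ℝ (Fin n → ℝ)) (c : Fin n → ℝ),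
    IsResidual k₁ k₂ L ∧ IsCenter L c ∧ O = orbit c}

/-- The coordinates carrying the factor of type `B` of `R_L`. -/
def bPart {n : ℕ} (L : AffineSubspace ℝ (Fin n → ℝ)) : Finset (Fin n) :=
  open Classical in Finset.univ.filter fun i => Pi.single i 1 ∈ rootsOf L

/-- If `R_L = A_{d₁-1} × ⋯ × A_{d_r-1} × B_l` with `d₁ + ⋯ + d_r + l = n`, this is the
multiset of the `d_i` (parts `1` included): the sizes of the blocks of coordinates outside the
factor of type `B` that are linked by roots `± e_i ± e_j` of `R_L`. -/
def aType {n : ℕ} (L : AffineSubspace ℝ (Fin n → ℝ)) : Multiset ℕ :=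
  open Classical in
  let block (i : Fin n) : Finset (Fin n) := Finset.univ.filter fun j =>
    j = i ∨ (Pi.single i 1 + Pi.single j 1 : Fin n → ℝ) ∈ rootsOf L ∨
      (Pi.single i 1 - Pi.single j 1 : Fin n → ℝ) ∈ rootsOf L
  (((bPart L)ᶜ.image block).val).map Finset.card

/-- `W(R_L)`: the subgroup generated by the reflections in the roots of `R_L`. -/
def weylOf {n : ℕ} (L : AffineSubspace ℝ (Fin n → ℝ)) : Subgroup (W (Fin n)) :=
  Subgroup.closure {w | ∃ α ∈ rootsOf L, ∀ x, act w x = x - (2 * (α ⬝ᵥ x) / (α ⬝ᵥ α)) • α}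

/-- The character `triv ⊗ χ_(p, q)` of `W(R_L) = W(A-part) × W(B_l)`: an element acts on the
factor `B_l` by its restriction to the coordinates in `bPart L`. -/
def trivTensor {n : ℕ} (L : AffineSubspace ℝ (Fin n → ℝ)) (p q : Multiset ℕ)
    (w : W (Fin n)) : ℂ :=
  open Classical in
  if hw : ∀ x, w.right x ∈ bPart L ↔ x ∈ bPart L then
    bChar p q (⟨fun i => w.left i, w.right.subtypePerm hw⟩ : W {x // x ∈ bPart L})
  else 0

/-! ### Jumps and Springer correspondents

Let `c` be a residual point for a root system of type `B` on the coordinates in `T`, with labels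
`k₁` and `k₂ = m k₁`. A jump `j` of `c` is recorded as the natural number `2 j + 1`; so the
jumps `0` and `-1/2` are recorded as `1` and `0`. -/

/-- The number of coordinates of `c` in `T` that are equal to `± x k₁`, where `p = 2 x + 1`. -/
def coordMult (k₁ : ℝ) {n : ℕ} (T : Finset (Fin n)) (c : Fin n → ℝ) (p : ℕ) : ℕ :=
  open Classical in (T.filter fun i => 2 * |c i| = ((p : ℝ) - 1) * |k₁|).card

/-- The jumps before adding `0` or `-1/2`: the `x ≡ m (mod 1)` with `x ≥ |m|`, `x ≥ 0` and
`M_x = M_{x+1} + 1`, or with `0 < x < |m|` and `M_x = M_{x+1}`. -/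
def jumpSet (h : ℤ) (k₁ : ℝ) {n : ℕ} (T : Finset (Fin n)) (c : Fin n → ℝ) : Set ℕ :=
  {p | (p + h.natAbs) % 2 = 1 ∧
    ((h.natAbs + 1 ≤ p ∧ coordMult k₁ T c p = coordMult k₁ T c (p + 2) + 1) ∨
      (1 < p ∧ p < h.natAbs + 1 ∧ coordMult k₁ T c p = coordMult k₁ T c (p + 2)))}

theorem jumpSet_finite (h : ℤ) (k₁ : ℝ) {n : ℕ} (T : Finset (Fin n)) (c : Fin n → ℝ) :
    (jumpSet h k₁ T c).Finite := by
  classical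
  apply Set.Finite.subset ((Finset.range (h.natAbs + 1) ∪
    T.image fun i => ⌊2 * |c i| / |k₁| + 1⌋₊).finite_toSet)
  rintro p ⟨-, ⟨-, hM⟩ | ⟨-, hp, -⟩⟩
  · by_cases hk : k₁ = 0
    · subst hk
      simp [coordMult] at hM
    · have hpos : 0 < coordMult k₁ T c p := by omega
      rw [coordMult, Finset.card_pos] at hpos
      obtain ⟨i, hi⟩ := hpos
      rw [Finset.mem_filter] at hi
      have hk' : |k₁| ≠ 0 := abs_ne_zero.mpr hk
      have : 2 * |c i| / |k₁| + 1 = (p : ℝ) := by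
        rw [hi.2]; field_simp; ring
      simp only [Finset.coe_union, Finset.coe_image, Set.mem_union, Set.mem_image]
      right
      exact ⟨i, hi.1, by rw [this]; exact Nat.floor_natCast p⟩
  · simp only [Finset.coe_union, Set.mem_union]
    left
    simpa using hp

/-- The jumps of `c`: if necessary, `0` (for `m` an integer) or `-1/2` (otherwise) is added in
order to have `⌈|m|⌉ + 2 r` jumps. -/
def jumps (h : ℤ) (k₁ : ℝ) {n : ℕ} (T : Finset (Fin n)) (c : Fin n → ℝ) : Finset ℕ :=
  if (jumpSet_finite h k₁ T c).toFinset.card % 2 = (h.natAbs + 1) / 2 % 2 then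
    (jumpSet_finite h k₁ T c).toFinset
  else insert ((h.natAbs + 1) % 2) (jumpSet_finite h k₁ T c).toFinset

/-- For jumps `j₁ < j₂ < ⋯ < j_{⌈m⌉+2r}`, `m ≥ 0`, the partition
`ξ = (j₁, j₃, …, j_{2r+1}, j_{2r+2} - 1, j_{2r+3} - 2, …)` if `m` is an integer, and
`ξ = (j₁ + 1/2, j₃ + 1/2, …, j_{2r+1} + 1/2, j_{2r+2} - 1/2, j_{2r+3} - 3/2, …)` otherwise
(zero parts are dropped). Here `J` is the set of the numbers `2 j + 1`. -/
def xiOf (h : ℤ) (J : Finset ℕ) : Multiset ℕ :=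
  (((List.range J.card).filter fun i =>
      decide (i % 2 = 0 ∨ J.card - (h.natAbs + 1) / 2 ≤ i)).map fun i =>
    (J.sort (· ≤ ·)).getD i 0 / 2 - (i - (J.card - (h.natAbs + 1) / 2)) :
      Multiset ℕ).filter (· ≠ 0)

/-- The partition `η = (j₂ + 1, j₄ + 1, …, j_{2r} + 1)` if `m` is an integer, and
`η = (j₂ + 1/2, j₄ + 1/2, …, j_{2r} + 1/2)` otherwise (zero parts are dropped). -/
def etaOf (h : ℤ) (J : Finset ℕ) : Multiset ℕ :=
  (((List.range J.card).filter fun i =>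
      decide (i % 2 = 1 ∧ i < J.card - (h.natAbs + 1) / 2)).map fun i =>
    ((J.sort (· ≤ ·)).getD i 0 + 1) / 2 : Multiset ℕ).filter (· ≠ 0)

/-- The entries of the `m`-symbol of `(ξ, η)` for `m ≥ 0` and of `(η, ξ)` for `m < 0`. -/
def jumpSymbol (h : ℤ) (l : ℕ) (J : Finset ℕ) : Multiset ℕ :=
  if 0 ≤ h then symbolEntries h l (xiOf h J) (etaOf h J)
  else symbolEntries h l (etaOf h J) (xiOf h J)

/-- The Springer correspondents (as double partitions of `l`) of a residual point for `B_l` with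
set of jumps `J`: a similarity class. -/
def pointCorr (h : ℤ) (l : ℕ) (J : Finset ℕ) : Set (Bipartition l) :=
  {B | symbolEntries h l B.fst B.snd = jumpSymbol h l J}

/-- The Springer correspondents of a residual subspace `L` with center `c`: the union of the
`tr_m-Ind (triv ⊗ (α, β))` from `W(R_L)` to `W(B_n)`, where `(α, β)` runs over the Springer
correspondents of the residual point in the factor of type `B`. -/
def subspaceCorr (h : ℤ) (k₁ : ℝ) {n : ℕ} (L : AffineSubspace ℝ (Fin n → ℝ))
    (c : Fin n → ℝ) : Set (W (Fin n) → ℂ) :=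
  ⋃ B ∈ pointCorr h (bPart L).card (jumps h k₁ (bPart L) c),
    trInd h (weylOf L) (trivTensor L B.fst B.snd)

/-- `Σ_m` on the set of orbits of centers: `Σ_m(W c_L)` is the set of Springer correspondents
of `L`. -/
def Sigma (h : ℤ) (k₁ k₂ : ℝ) {n : ℕ} (O : Set (Fin n → ℝ)) : Set (W (Fin n) → ℂ) :=
  {χ | ∃ (L : AffineSubspace ℝ (Fin n → ℝ)) (c : Fin n → ℝ),
    IsResidual k₁ k₂ L ∧ IsCenter L c ∧ O = orbit c ∧ χ ∈ subspaceCorr h k₁ L c}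

/-! ### Generalized unipotent classes -/

/-- `𝓤_m(n)`: the partitions of `2 n + ⌊m²⌋` in which the parts `≡ 2 m (mod 2)` have even
multiplicity, and at least `⌊|m|⌋` different other parts have odd multiplicity. -/
def unipotent (h : ℤ) (n : ℕ) : Set (Multiset ℕ) :=
  {p | 0 ∉ p ∧ p.sum = 2 * n + h.natAbs ^ 2 / 4 ∧
    (∀ i, i % 2 = h.natAbs % 2 → Even (p.count i)) ∧
    h.natAbs / 2 ≤ (p.toFinset.filter fun i => i % 2 ≠ h.natAbs % 2 ∧ Odd (p.count i)).card}

/-- The generalized Bala–Carter map `f_m`. It sends `p` to the orbit of centers of the residual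
subspaces `L` such that each `d` occurs `⌊r/2⌋` times in the type of the `A`-part of `R_L`, where
`r` is the multiplicity of `d` in `p`, and such that the parts of `p` with odd multiplicity are
the positive numbers `2 j + 1` for the jumps `j` of the residual point in the `B`-part. -/
def balaCarter (h : ℤ) (k₁ k₂ : ℝ) (n : ℕ) (p : Multiset ℕ) : Set (Fin n → ℝ) :=
  {c | ∃ L : AffineSubspace ℝ (Fin n → ℝ), IsResidual k₁ k₂ L ∧ IsCenter L c ∧
    (∀ d, (aType L).count d = p.count d / 2) ∧
    ∀ i, 0 < i → (i ∈ jumps h k₁ (bPart L) c ↔ Odd (p.count i))}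

/-- Replaces consecutive entries `x + 1, x - 1` by `x, x`. -/
def mergePairs : List ℤ → List ℤ
  | [] => []
  | [x] => [x]
  | x :: y :: t => if x = y + 2 then (x - 1) :: (y + 1) :: mergePairs t
      else x :: mergePairs (y :: t)

/-- `ξ*_{k+1}`, from the increasing list `e` of the entries of an `m`-symbol with rows of lengths
`N + ⌈m⌉` and `N`. Rearranging them as an increasing symbol, the first row consists of
`e₀, e₂, …, e_{2N-2}, e_{2N}, e_{2N+1}, e_{2N+2}, …`; subtracting `0, 2, 4, …` gives `ξ`, whose
first part is omitted if `m` is not an integer, and adding `0, 1, 2, …` gives `ξ*`. -/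
def xiStar (h : ℤ) (N : ℕ) (e : List ℕ) (k : ℕ) : ℤ :=
  let i := k + h.natAbs % 2
  ((e.getD (if i < N then 2 * i else N + i) 0 : ℕ) : ℤ) - 2 * i + k

/-- `η*_{k+1}`: the second row of the increasing symbol consists of `e₁, e₃, …, e_{2N-1}`;
subtracting `s, s + 2, s + 4, …`, with `s = 0` if `m` is an integer and `s = 1` otherwise, gives
`η`, and adding `0, 1, 2, …` gives `η*`. -/
def etaStar (h : ℤ) (e : List ℕ) (k : ℕ) : ℤ :=
  ((e.getD (2 * k + 1) 0 : ℕ) : ℤ) - (2 * k + (h.natAbs % 2 : ℕ)) + k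

/-- The composition `μ`: the numbers `2 ξ*_k + 1`, `2 η*_k` for `k ≤ N`, in increasing order,
diminished by `0, 1, …, 2 N - 1`, followed by the `⌊m⌋` numbers `2 ξ*_k + 1` for `k > N`,
diminished by `2 N` if `m` is an integer and by `2 N - 1` otherwise. -/
def muList (h : ℤ) (N : ℕ) (e : List ℕ) : List ℤ :=
  ((((List.range N).map (fun k => 2 * xiStar h N e k + 1) ++
      (List.range N).map (fun k => 2 * etaStar h e k) : List ℤ) : Multiset ℤ).sort
        (· ≤ ·)).mapIdx (fun i x => x - (i : ℤ)) ++
    (List.range (h.natAbs / 2)).map fun i =>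
      2 * xiStar h N e (N + i) + 1 - (2 * (N : ℤ) - (h.natAbs % 2 : ℕ))

/-- The map `ψ_m` on double partitions: its value depends on the entries of the symbol only. -/
def psiBip (h : ℤ) {n : ℕ} (A : Bipartition n) : Multiset ℕ :=
  ((mergePairs (muList h n ((symbolEntries h n A.fst A.snd).sort (· ≤ ·)))).map Int.toNat :
    Multiset ℕ).filter (· ≠ 0)

/-- The map `ψ_m` on similarity classes of characters, computed from any member of the class. -/
def psi (h : ℤ) {n : ℕ} (S : Set (W (Fin n) → ℂ)) : Multiset ℕ :=
  open Classical in
  if hS : ∃ A : Bipartition n, chi A ∈ S then psiBip h hS.choose else 0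

end TypeB

end

noncomputable section

namespace TypeB

open Equiv (Perm sumCongr)
open Function (Injective comp comp_assoc comp_def update update_self)
open Multiset (Nodup card_add card_nsmul coe_card coe_eq_coe coe_le coe_sort cons_coe count_add
  count_eq_of_nodup count_eq_zero count_nsmul count_pos count_replicate filter_add filter_add_not
  filter_eq_nil filter_le insert_eq_cons map_coe map_id' map_le_map range_le range_succ replicate
  sum_add)
open Sum (elim_comp_inl elim_comp_inr elim_inl elim_inr inl inr)
open Fintype (card_coe card_congr card_prod card_units_int mem_piFinset piFinset sum_prod_type
  sum_sum_type)
open Int (cast_one even_iff units_eq_one_or)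
open Submodule (finrank_eq_zero smul_mem smul_mem_iff span span_le subset_span)
open List (cons_append ext_getElem length_cons map_append map_nil ofFn ofFn_succ pairwise_map
  range_succ_eq_map)

set_option linter.unusedSectionVars false

/-! ### Virtual characters of norm one -/

section Irreducible
open Finset

variable {G : Type} [Group G]

variable {V : Type}

/-! Both sides are compared with the partitions in `unipotent h n`. Such a partition is the set of
its parts of odd multiplicity together with twice a multiset. The former will be the positive jumps
of a residual point of type B, the latter the sizes of the factors of type A.

Geometry. After scaling by `2 / k₁`, counting roots turns residuality into an identity between `2
dim L` and a sum of contributions of the blocks of coordinates and of the B-part (`isResidual_iff`).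
Summation by parts shows that a block contributes a sum of squares, and the B-part half a sum of
terms `d (d + w)` with integers `d` and `|w| ≤ 1`. Thus a block contributes at least 2 and the
B-part at least 0, whereas `dim L` is at most the number of blocks. All estimates are therefore
equalities (`IsResidual.structure`): at a center every block is an arithmetic progression symmetric
about 0, and the B-part is governed by a set of jumps. The multiplicities of the coordinates of a
center determine the partition and conversely (`IsResidual.hasType`, `HasType.unique`,
`HasType.exists_act`), and each partition occurs (`exists_center`).

Characters. The Frobenius formula makes the characters `chi A` an orthonormal system exhausting the
irreducible ones, and the Pieri rule expresses the multiplicities in the characters induced from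
parabolic subgroups as numbers of chains of strips (`charInner_indChar_ne_zero_iff`).

Combinatorics. Let `e_0 ≤ e_1 ≤ ⋯` be the entries of a symbol and `M_0 ≤ M_1 ≤ ⋯` the parts of a
partition padded by zeros. They match if all partial sums of `2 (e_j - j) + 1 - s` exceed those of
`M_j` by 0 or 1 (`Matches`). Under the parity condition `EvenParts` either of them determines the
other (`Matches.entries_unique`, `Matches.partition_unique`), and `psiBip` computes the partition
from the symbol (`psiBip_eq`). For the symbol of a set of jumps all these differences vanish
(`defect_jumpRows`). Replacing two zeros of the partition by `d, d` corresponds to a suitable strip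
of size `d` (`exists_strip_right`, `exists_strip_left`), while an arbitrary strip still respects the
upper bound 1 (`Dominated.strip`). Since `a_m` is, up to a constant, the sum of the partial sums of
the ordered entries, the constituents with maximal `a_m` are precisely those whose symbol matches
the enlarged partition (`mem_subspaceCorr_iff`).

Consequently the Springer correspondents of an orbit with partition `p` form the fibre of `psiBip h`
over `p` (`sigma_balaCarter`). That every fibre is non-empty also comes from geometry: a subspace
with partition `p` exists and has correspondents (`exists_psiBip_eq`). The bijections are then
formal. -/

theorem irr_of_isIrreducible [AddCommGroup V] [Module ℂ V] [FiniteDimensional ℂ V]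
    (ρ : Representation ℂ G V) (hρ : ρ.IsIrreducible) : ρ.character ∈ Irr G := by
  let e : V ≃ₗ[ℂ] (Fin (Module.finrank ℂ V) → ℂ) := (Module.finBasis ℂ V).equivFun
  let σ : Representation ℂ G (Fin (Module.finrank ℂ V) → ℂ) :=
    { toFun := fun g => e.conj (ρ g)
      map_one' := by ext; simp
      map_mul' := fun g h => by rw [map_mul]; exact e.conj_comp _ _ }
  refine ⟨_, σ, ?_, ?_⟩
  · let o : Subrepresentation ρ ≃o Subrepresentation σ :=
      { toFun := fun p => ⟨p.toSubmodule.map e.toLinearMap, by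
          rintro g _ ⟨v, hv, rfl⟩
          refine ⟨ρ g v, p.apply_mem_toSubmodule g hv, ?_⟩
          simp [σ, LinearEquiv.conj_apply]⟩
        invFun := fun p => ⟨p.toSubmodule.comap e.toLinearMap, by
          intro g v hv
          have := p.apply_mem_toSubmodule g hv
          simpa [σ, LinearEquiv.conj_apply] using this⟩
        left_inv := fun p => by
          ext v; simp
        right_inv := fun p => by
          apply Subrepresentation.toSubmodule_injective
          exact Submodule.map_comap_eq_of_surjective e.surjective _
        map_rel_iff' := by
          exact Submodule.map_le_map_iff_of_injective e.injective _ _ }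
    exact o.isSimpleOrder_iff.mp hρ
  · ext g
    exact (LinearMap.trace_conj' (ρ g) e).symm

variable [Fintype G]

/-- The bilinear form on functions on `G` for which irreducible characters are orthonormal. -/
def pair (f g : G → ℂ) : ℂ := (Fintype.card G : ℂ)⁻¹ * ∑ x, f x * g x⁻¹

theorem pair_add_left (f f' g : G → ℂ) : pair (f + f') g = pair f g + pair f' g := by
  simp [pair, add_mul, sum_add_distrib, mul_add]

theorem pair_zero_left (g : G → ℂ) : pair 0 g = 0 := by simp [pair]

theorem pair_smul_left (c : ℂ) (f g : G → ℂ) : pair (c • f) g = c * pair f g := by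
  simp only [pair, Pi.smul_apply, smul_eq_mul, mul_assoc, ← mul_sum]
  ring

theorem pair_comm (f g : G → ℂ) : pair f g = pair g f := by
  unfold pair
  congr 1
  exact Fintype.sum_equiv (Equiv.inv G) _ _ fun x => by simp [mul_comm]

theorem pair_irr {χ ψ : G → ℂ} (hχ : χ ∈ Irr G) (hψ : ψ ∈ Irr G) [Decidable (χ = ψ)] :
    pair χ ψ = if χ = ψ then 1 else 0 := by
  classical
  obtain ⟨d, ρ, hρ, rfl⟩ := hχ
  obtain ⟨e, σ, hσ, rfl⟩ := hψ
  have key : ∀ {d e : ℕ} (ρ : Representation ℂ G (Fin d → ℂ))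
      (σ : Representation ℂ G (Fin e → ℂ)) [ρ.IsIrreducible] [σ.IsIrreducible],
      pair ρ.character σ.character = if Nonempty (σ.Equiv ρ) then 1 else 0 := by
    intro d e ρ σ _ _
    rw [← Representation.char_orthonormal, pair, Nat.card_eq_fintype_card]
  by_cases h : Nonempty (σ.Equiv ρ)
  · have : ρ.character = σ.character := (Representation.char_iso h.some).symm
    rw [key, if_pos h, if_pos this]
  -- Non-isomorphic irreducible representations cannot share their character: its norm would be both
  -- 0 and 1.
  · rw [key, if_neg h, if_neg]
    have h1 := key σ σ
    rw [if_pos ⟨Representation.Equiv.refl _⟩] at h1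
    grind

/-- Induction on the dimension: by Maschke's theorem a proper subrepresentation has an invariant
complement, and traces add up over the two summands. -/
theorem character_mem_closure [AddCommGroup V] [Module ℂ V] [FiniteDimensional ℂ V]
    (ρ : Representation ℂ G V) : ρ.character ∈ AddSubmonoid.closure (Irr G) := by
  induction hn : Module.finrank ℂ V using Nat.strong_induction_on generalizing V with
  | _ n ih =>
  rcases subsingleton_or_nontrivial V with hV | hV
  · have : ρ.character = 0 := by
      ext g
      simp [Representation.character, Subsingleton.elim (ρ g) 0]
    rw [this]
    exact zero_mem _
  by_cases hirr : ρ.IsIrreducible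
  · exact AddSubmonoid.subset_closure (irr_of_isIrreducible ρ hirr)
  have hnt : Nontrivial (Subrepresentation ρ) := by
    refine ⟨⊥, ⊤, fun h => ?_⟩
    have := congrArg Subrepresentation.toSubmodule h
    exact bot_ne_top (α := Submodule ℂ V) this
  obtain ⟨p, hp⟩ : ∃ p : Subrepresentation ρ, ¬ (p = ⊥ ∨ p = ⊤) := by
    by_contra! h
    exact hirr ⟨h⟩
  push Not at hp
  obtain ⟨q, hpq⟩ := exists_isCompl p
  have hc : IsCompl p.toSubmodule q.toSubmodule := by
    constructor
    · rw [disjoint_iff]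
      exact congrArg Subrepresentation.toSubmodule hpq.inf_eq_bot
    · rw [codisjoint_iff]
      exact congrArg Subrepresentation.toSubmodule hpq.sup_eq_top
  have hchar : ρ.character = p.toRepresentation.character + q.toRepresentation.character := by
    ext g
    have hN : DirectSum.IsInternal (fun b : Bool => cond b p.toSubmodule q.toSubmodule) := by
      rw [DirectSum.isInternal_submodule_iff_isCompl _ (i := true) (j := false) (by decide)
        (by ext b; cases b <;> simp)]
      exact hc
    have ht := LinearMap.trace_eq_sum_trace_restrict hN (f := ρ g) (fun b => by
      cases b
      · exact q.apply_mem_toSubmodule g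
      · exact p.apply_mem_toSubmodule g)
    rw [Fintype.sum_bool] at ht
    exact ht
  have hfr := Submodule.finrank_add_eq_of_isCompl hc
  have h1 : Module.finrank ℂ p.toSubmodule ≠ 0 := by
    intro h
    exact hp.1 (Subrepresentation.toSubmodule_injective (finrank_eq_zero.mp h))
  have h2 : Module.finrank ℂ q.toSubmodule ≠ 0 := by
    intro h
    apply hp.2
    have hq := finrank_eq_zero.mp h
    apply Subrepresentation.toSubmodule_injective
    have := hc.sup_eq_top
    rw [hq, sup_bot_eq] at this
    exact this
  rw [hchar]
  exact add_mem (ih _ (by omega) p.toRepresentation rfl) (ih _ (by omega) q.toRepresentation rfl)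

/-- An integral combination of orthonormal elements with norm 1 is plus or minus one of them. The
pairing with the genuine character `c` excludes the minus sign. -/
theorem irr_of_norm_one {f c : G → ℂ} (hf : f ∈ AddSubgroup.closure (Irr G))
    (hf1 : pair f f = 1) (hc : c ∈ AddSubmonoid.closure (Irr G)) (hcf : pair c f = 1) :
    f ∈ Irr G := by
  classical
  have h1 : ∃ n : (Irr G) →₀ ℤ, f = n.sum fun χ k => (k : ℂ) • χ.1 := by
    clear hf1 hcf
    induction hf using AddSubgroup.closure_induction with
    | mem x hx => exact ⟨Finsupp.single ⟨x, hx⟩ 1, by simp⟩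
    | zero => exact ⟨0, by simp⟩
    | add x y _ _ hx hy =>
      obtain ⟨m, rfl⟩ := hx
      obtain ⟨n, rfl⟩ := hy
      exact ⟨m + n, by rw [Finsupp.sum_add_index'] <;> simp [add_smul]⟩
    | neg x _ hx =>
      obtain ⟨m, rfl⟩ := hx
      exact ⟨-m, by rw [Finsupp.sum_neg_index] <;> simp [Finsupp.sum]⟩
  obtain ⟨n, hn⟩ := h1
  have hpair : ∀ g, pair f g = ∑ χ ∈ n.support, (n χ : ℂ) * pair χ.1 g := by
    intro g
    rw [hn, Finsupp.sum]
    induction n.support using Finset.induction_on with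
    | empty => simp [pair_zero_left]
    | insert a s ha ih => rw [sum_insert ha, sum_insert ha, pair_add_left, pair_smul_left, ih]
  have hcoef : ∀ χ : Irr G, pair f χ.1 = n χ := by
    intro χ
    rw [hpair]
    simp only [pair_irr (Subtype.prop _) χ.2, mul_ite, mul_one, mul_zero]
    rw [sum_eq_single χ]
    · simp
    · grind
    · simpa using h
  have hsq : ∑ χ ∈ n.support, n χ * n χ = 1 := by
    have := hpair f
    rw [hf1] at this
    simp only [pair_comm _ f, hcoef] at this
    exact_mod_cast this.symm
  obtain ⟨χ, hχ⟩ : n.support.Nonempty := by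
    by_contra h
    simp_all
  have hpos : ∀ ψ ∈ n.support, 1 ≤ n ψ * n ψ := fun ψ hψ => by
    have h0 : n ψ ≠ 0 := by simpa using hψ
    have := mul_self_pos.mpr h0
    omega
  have hsupp : n.support = {χ} := by
    refine eq_singleton_iff_unique_mem.mpr ⟨hχ, fun ψ hψ => ?_⟩
    have hle : ∑ ψ ∈ ({χ, ψ} : Finset (Irr G)), n ψ * n ψ ≤ ∑ ψ ∈ n.support, n ψ * n ψ := by
      apply sum_le_sum_of_subset_of_nonneg
      · grind
      · intros; exact mul_self_nonneg _
    grind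
  rw [hsupp, sum_singleton] at hsq
  have hf' : f = (n χ : ℂ) • χ.1 := by rw [hn, Finsupp.sum, hsupp, sum_singleton]
  have hnat : ∀ c ∈ AddSubmonoid.closure (Irr G), ∃ m : ℕ, pair c χ.1 = m := by
    intro c hc
    induction hc using AddSubmonoid.closure_induction with
    | mem x hx =>
      rw [pair_irr hx χ.2]
      split_ifs
      · exact ⟨1, by simp⟩
      · exact ⟨0, by simp⟩
    | zero => exact ⟨0, by simp [pair_zero_left]⟩
    | add x y _ _ hx hy =>
      obtain ⟨a, ha⟩ := hx
      obtain ⟨b, hb⟩ := hy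
      exact ⟨a + b, by rw [pair_add_left, ha, hb]; simp⟩
  obtain ⟨m, hm⟩ := hnat c hc
  rw [pair_comm, hf', pair_smul_left, pair_comm, hm] at hcf
  have hcf' : n χ * (m : ℤ) = 1 := by exact_mod_cast hcf
  have : n χ = 1 := by
    rcases mul_self_eq_one_iff.mp hsq with h | h
    · exact h
    · rw [h] at hcf'
      omega
  rw [hf', this]
  simp

end Irreducible

/-! ### Alternating functions and the Pieri rule -/

section Alternating
open Finset

variable {r : ℕ}

variable {φ : (Fin r → ℕ) → ℂ} {e : Fin r → ℕ}

/-- Functions of `r` exponents that change sign under exchange of two of them. -/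
def IsAlt (φ : (Fin r → ℕ) → ℂ) : Prop :=
  ∀ (e : Fin r → ℕ) (i j : Fin r), i ≠ j → φ (e ∘ Equiv.swap i j) = -φ e

/-- The coefficient of `x ^ t` in the alternant of the monomial `x ^ e`. -/
def altDelta (t e : Fin r → ℕ) : ℂ :=
  ∑ u : Perm (Fin r), ((Perm.sign u : ℤ) : ℂ) * if e ∘ u = t then 1 else 0

/-- The dual of multiplication with the complete symmetric polynomial of degree `d`. -/
def shiftSum {C : Type} [Fintype C] [DecidableEq C] (d : ℕ) (φ : (C → ℕ) → ℂ) (e : C → ℕ) : ℂ :=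
  ∑ β ∈ piAntidiag univ d, φ (e + β)

theorem IsAlt.perm (hφ : IsAlt φ) (e : Fin r → ℕ)
    (u : Perm (Fin r)) : φ (e ∘ u) = ((Perm.sign u : ℤ) : ℂ) * φ e := by
  induction u using Perm.swap_induction_on' generalizing e with
  | one => simp
  | mul_swap f x y hxy ih =>
    rw [Perm.coe_mul, ← comp_assoc, hφ _ x y hxy, ih, Perm.sign_mul, Perm.sign_swap hxy]
    simp

theorem IsAlt.eq_zero (hφ : IsAlt φ)
    (he : ¬ Injective e) : φ e = 0 := by
  rw [Injective] at he
  push Not at he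
  obtain ⟨i, j, hij, hne⟩ := he
  have h := hφ e i j hne
  have : e ∘ Equiv.swap i j = e := by grind
  rw [this] at h
  exact self_eq_neg.mp h

theorem isAlt_altDelta (t : Fin r → ℕ) : IsAlt (altDelta t) := by
  intro e i j hij
  unfold altDelta
  rw [← sum_neg_distrib]
  refine Fintype.sum_equiv (Equiv.mulLeft (Equiv.swap i j)) _ _ fun u => ?_
  have h1 : (e ∘ Equiv.swap i j) ∘ u = e ∘ (Equiv.mulLeft (Equiv.swap i j) u) := rfl
  rw [h1, Equiv.coe_mulLeft, Perm.sign_mul, Perm.sign_swap hij]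
  simp

theorem IsAlt.shiftSum (hφ : IsAlt φ) (d : ℕ) :
    IsAlt (TypeB.shiftSum d φ) := by
  intro e i j hij
  unfold TypeB.shiftSum
  rw [← sum_neg_distrib]
  refine sum_nbij' (fun β => β ∘ Equiv.swap i j) (fun β => β ∘ Equiv.swap i j) ?_ ?_ ?_ ?_ ?_
  · intro β hβ
    simp only [mem_piAntidiag, mem_univ, implies_true, and_true] at hβ ⊢
    rw [← hβ]
    exact Equiv.sum_comp (Equiv.swap i j) β
  · intro β hβ
    simp only [mem_piAntidiag, mem_univ, implies_true, and_true] at hβ ⊢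
    rw [← hβ]
    exact Equiv.sum_comp (Equiv.swap i j) β
  · intro β _; ext k; simp
  · intro β _; ext k; simp
  · intro β _
    rw [← hφ _ i j hij]
    congr 1
    ext k; simp

/-- The only increasing rearrangement of an increasing sequence is the sequence itself, so just the
identity contributes to the signed sum. -/
theorem altDelta_of_strictMono {t : Fin r → ℕ} (ht : StrictMono t) (he : StrictMono e) :
    altDelta t e = if e = t then 1 else 0 := by
  unfold altDelta
  rw [sum_eq_single 1]
  · simp
  · intro u _ hu
    rw [if_neg, mul_zero]
    intro h
    apply hu
    have hmono : StrictMono u := by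
      intro i j hij
      have := ht hij
      rw [← h] at this
      exact he.lt_iff_lt.mp this
    ext i
    have h1 : (u : Fin r → Fin r) = id :=
      hmono.range_inj strictMono_id |>.mp (by simp [u.surjective.range_eq])
    simp [h1]
  · simp

/-- The **Pieri rule** for the evaluation of alternating functions. -/
theorem IsAlt.pieri (hφ : IsAlt φ) {l : Fin r → ℕ} (hl : StrictMono l)
    (d : ℕ) :
    TypeB.shiftSum d φ l = ∑ β ∈ (piAntidiag univ d).filter
      (fun β : Fin r → ℕ => ∀ i j, i < j → l i + β i < l j), φ (l + β) := by
  classical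
  unfold TypeB.shiftSum
  rw [← sum_filter_add_sum_filter_not _ (fun β : Fin r → ℕ => ∀ i j, i < j → l i + β i < l j)]
  rw [add_eq_left]
  -- The terms that are not strips cancel in pairs. At the first `k` where `β` pushes an exponent to
  -- or beyond the next one of `l`, exchange the values of `l + β` at `k` and `k + 1`. This changes
  -- the sign of `φ`, keeps the sum of `β` and the first bad position, and is therefore a
  -- sign-reversing involution.
  let bad (β : Fin r → ℕ) (k : ℕ) : Prop :=
    ∃ (hk : k + 1 < r), l ⟨k + 1, hk⟩ ≤ l ⟨k, by omega⟩ + β ⟨k, by omega⟩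
  have hex : ∀ β : Fin r → ℕ, ¬ (∀ i j, i < j → l i + β i < l j) → ∃ k, bad β k := by
    intro β hβ
    push Not at hβ
    obtain ⟨i, j, hij, h⟩ := hβ
    have hi : i.1 + 1 < r := by omega
    refine ⟨i, hi, le_trans (hl.monotone ?_) h⟩
    grind
  have hnot : ∀ (β : Fin r → ℕ) k, bad β k → ¬ (∀ i j, i < j → l i + β i < l j) := by
    rintro β k ⟨hk, h⟩ hall
    exact absurd (hall ⟨k, by omega⟩ ⟨k + 1, hk⟩ (by simp)) (not_lt.mpr h)
  let sw (β : Fin r → ℕ) (k : ℕ) (hk : k + 1 < r) : Fin r → ℕ :=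
    fun x => ((l + β) ∘ Equiv.swap ⟨k, by omega⟩ ⟨k + 1, hk⟩) x - l x
  have hsw : ∀ (β : Fin r → ℕ) k (hk : k + 1 < r), bad β k →
      l + sw β k hk = (l + β) ∘ Equiv.swap ⟨k, by omega⟩ ⟨k + 1, hk⟩ := by
    rintro β k hk ⟨_, h⟩
    ext x
    simp only [sw, Pi.add_apply, comp]
    have hlt : l ⟨k, by omega⟩ < l ⟨k + 1, hk⟩ := hl (by simp)
    grind
  have hswbad : ∀ (β : Fin r → ℕ) k (hk : k + 1 < r), bad β k → ∀ k' ≤ k,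
      (bad (sw β k hk) k' ↔ bad β k') := by
    intro β k hk hb k' hk'
    have h := hsw β k hk hb
    rcases hk'.lt_or_eq with hlt | rfl
    · have h1 := congrFun h ⟨k', by omega⟩
      rw [comp, Equiv.swap_apply_of_ne_of_ne (by simp; omega) (by simp; omega)] at h1
      simp only [Pi.add_apply] at h1
      grind
    · have h1 := congrFun h ⟨k', by omega⟩
      refine iff_of_true ⟨hk, ?_⟩ hb
      simp_all
  refine sum_involution (fun β hβ => sw β (Nat.find (hex β (mem_filter.mp hβ).2))
    (Nat.find_spec (hex β (mem_filter.mp hβ).2)).1) ?_ ?_ ?_ ?_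
  · intro β hβ
    have hs := Nat.find_spec (hex β (mem_filter.mp hβ).2)
    rw [hsw _ _ hs.1 hs, hφ _ _ _ (by simp)]
    simp
  · intro β hβ hne heq
    have hs := Nat.find_spec (hex β (mem_filter.mp hβ).2)
    have h := hsw _ _ hs.1 hs
    rw [heq] at h
    have h2 := hφ (l + β) ⟨Nat.find (hex β (mem_filter.mp hβ).2),
      (Nat.lt_succ_self _).trans hs.1⟩ ⟨_, hs.1⟩ (by simp)
    grind
  · intro β hβ
    have hs := Nat.find_spec (hex β (mem_filter.mp hβ).2)
    rw [mem_filter] at hβ ⊢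
    refine ⟨?_, hnot _ _ ((hswbad _ _ hs.1 hs _ le_rfl).mpr hs)⟩
    have h := hsw _ _ hs.1 hs
    have h3 := congrArg (fun f : Fin r → ℕ => ∑ x, f x) h
    simp only [Function.comp_apply] at h3
    rw [Equiv.sum_comp (Equiv.swap _ _) (l + β)] at h3
    simp only [Pi.add_apply, sum_add_distrib] at h3
    simp_all
  · intro β hβ
    have hs := Nat.find_spec (hex β (mem_filter.mp hβ).2)
    have hfind : ∀ (hE : ∃ k, bad (sw β (Nat.find (hex β (mem_filter.mp hβ).2)) hs.1) k),
        Nat.find hE = Nat.find (hex β (mem_filter.mp hβ).2) := by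
      intro hE
      rw [Nat.find_eq_iff]
      refine ⟨(hswbad _ _ hs.1 hs _ le_rfl).mpr hs, fun k hk hb => ?_⟩
      exact Nat.find_min _ hk ((hswbad _ _ hs.1 hs _ hk.le).mp hb)
    have h := hsw _ _ hs.1 hs
    have gen : ∀ k (hk : k + 1 < r),
        l + sw β k hk = (l + β) ∘ Equiv.swap ⟨k, by omega⟩ ⟨k + 1, hk⟩ →
        ∀ k' (hk' : k' + 1 < r), k' = k → sw (sw β k hk) k' hk' = β := by
      rintro k hk h k' hk' rfl
      ext x
      have h2 : sw (sw β k' hk) k' hk' x =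
        ((l + sw β k' hk) ∘ Equiv.swap ⟨k', by omega⟩ ⟨k' + 1, hk⟩) x - l x := rfl
      rw [h2, h]
      simp
    exact gen _ _ h _ _ (hfind _)

end Alternating

/-! ### Kostka numbers and their unitriangularity. -/

section Kostka
open Finset

variable {r : ℕ}

variable {φ : (Fin r → ℕ) → ℂ} {l β t : Fin r → ℕ} {j : ℕ}

/-- The iterated dual of multiplication with complete symmetric polynomials. -/
def shifts {C : Type} [Fintype C] [DecidableEq C] (ds : List ℕ) (φ : (C → ℕ) → ℂ) :
    (C → ℕ) → ℂ := ds.foldr shiftSum φ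

theorem IsAlt.shifts (hφ : IsAlt φ) (ds : List ℕ) :
    IsAlt (TypeB.shifts ds φ) := by
  induction ds with
  | nil => exact hφ
  | cons d ds ih => exact ih.shiftSum d

/-- The exponents `0, 1, …, r - 1`. -/
def stair (r : ℕ) : Fin r → ℕ := fun i => i

theorem stair_strictMono (r : ℕ) : StrictMono (stair r) := fun _ _ h => h

theorem StrictMono.stair_le (hl : StrictMono l) (i : Fin r) : i.1 ≤ l i := by
  obtain ⟨i, hi⟩ := i
  induction i with
  | zero => simp
  | succ k ih =>
    have h1 := ih (by omega)
    have h2 : l ⟨k, by omega⟩ < l ⟨k + 1, hi⟩ := hl (by simp)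
    simp only at h1 ⊢
    omega

theorem strip_zero_below (hj : j + 1 ≤ r)
    (hl0 : ∀ i : Fin r, i.1 < j + 1 → l i = i) (hβ : ∀ i k, i < k → l i + β i < l k)
    (i : Fin r) (hi : i.1 < j) : β i = 0 := by
  have h1 := hβ i ⟨i + 1, by omega⟩ (by rw [Fin.lt_def]; simp)
  grind

theorem strip_strictMono (hβ : ∀ i k, i < k → l i + β i < l k) :
    StrictMono (l + β) := fun i k h => by
  have := hβ i k h
  simp only [Pi.add_apply]
  omega

/-- A strip cannot move an exponent whose successor is still at its initial place, so the strip of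
size `κ k`, added after those with larger index, lies in the positions `≥ k`. This is the dominance
condition for the existence of semistandard tableaux, in terms of tail sums. -/
theorem shifts_ne_zero (ht : StrictMono t) (κ : ℕ → ℕ) (hj : j ≤ r) (hl : StrictMono l)
    (hl0 : ∀ i : Fin r, i.1 < j → l i = i)
    (h : shifts ((List.range j).reverse.map κ) (altDelta t) l ≠ 0) :
    (∀ i, l i ≤ t i) ∧ ∀ m ≤ j, ∑ i with m ≤ (i : Fin r).1, l i + ∑ k ∈ Ico m j, κ k ≤
      ∑ i with m ≤ (i : Fin r).1, t i := by
  induction j generalizing l with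
  | zero =>
    simp only [List.range_zero, List.reverse_nil, map_nil, shifts, List.foldr_nil] at h
    rw [altDelta_of_strictMono ht hl] at h
    simp_all
  | succ j ih =>
    rw [List.range_succ, List.reverse_append, List.reverse_singleton, List.singleton_append,
      List.map_cons] at h
    change shiftSum (κ j) (shifts ((List.range j).reverse.map κ) (altDelta t)) l ≠ 0 at h
    rw [((isAlt_altDelta t).shifts _).pieri hl] at h
    obtain ⟨β, hβ, hne⟩ := exists_ne_zero_of_sum_ne_zero h
    rw [mem_filter, mem_piAntidiag] at hβ
    obtain ⟨⟨hsum, -⟩, hβ⟩ := hβ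
    have hz := strip_zero_below hj hl0 hβ
    obtain ⟨h1, h2⟩ := ih (by omega) (strip_strictMono hβ) (by
      intro i hi
      simp [hz i hi, hl0 i (by omega)]) hne
    have hle : ∀ i, l i ≤ t i := fun i => le_trans (by simp) (h1 i)
    refine ⟨hle, fun m hm => ?_⟩
    rcases Nat.lt_or_ge j m with hm' | hm'
    · have : m = j + 1 := by omega
      subst this
      simp only [Ico_self, sum_empty, add_zero]
      exact sum_le_sum fun i _ => hle i
    · have h3 := h2 m hm'
      have h4 : ∑ i with m ≤ (i : Fin r).1, β i = κ j := by
        rw [← hsum, sum_filter]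
        refine sum_congr rfl fun i _ => ?_
        grind
      rw [sum_Ico_succ_top hm']
      simp only [Pi.add_apply, sum_add_distrib] at h3
      omega

/-- Only one chain of strips survives: the positions above `j` have already reached their final
values, which by `shifts_ne_zero` must not be exceeded, and those below `j` cannot move. So the
strip of size `κ j` sits in position `j`. -/
theorem shifts_self (ht : StrictMono t) (hj : j ≤ r) (κ : ℕ → ℕ)
    (hκ : ∀ i : Fin r, κ i + i = t i) :
    shifts ((List.range j).reverse.map κ) (altDelta t)
      (fun i => if i.1 < j then i.1 else t i) = 1 := by
  induction j with
  | zero =>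
    simp only [List.range_zero, List.reverse_nil, map_nil, shifts, List.foldr_nil,
      Nat.not_lt_zero, if_false]
    rw [altDelta_of_strictMono ht ht, if_pos rfl]
  | succ j ih =>
    have hlt : StrictMono (fun i : Fin r => if i.1 < j + 1 then i.1 else t i) := by
      intro a b hab
      have h2 := ht hab
      grind
    rw [List.range_succ, List.reverse_append, List.reverse_singleton, List.singleton_append,
      List.map_cons]
    change shiftSum (κ j) (shifts ((List.range j).reverse.map κ) (altDelta t)) _ = 1
    rw [((isAlt_altDelta t).shifts _).pieri hlt, sum_eq_single (Pi.single ⟨j, hj⟩ (κ j))]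
    · rw [← ih (by omega)]
      congr 1
      ext i
      simp only [Pi.add_apply]
      grind
    · intro β hβ hne
      rw [mem_filter, mem_piAntidiag] at hβ
      obtain ⟨⟨hsum, -⟩, hβ⟩ := hβ
      by_contra h
      have hz := strip_zero_below hj (by intro i hi; simp [hi]) hβ
      have h1 := (shifts_ne_zero ht κ (by omega) (strip_strictMono hβ) (by
        intro i hi
        simp [hz i hi, hi.le]) h).1
      have hz' : ∀ i, i ≠ ⟨j, hj⟩ → β i = 0 := by
        intro i hi
        have : i.1 ≠ j := fun h => hi (Fin.ext h)
        rcases Nat.lt_or_ge i.1 j with h2 | h2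
        · exact hz i h2
        · have := h1 i
          simp only [Pi.add_apply, if_neg (show ¬ i.1 < j + 1 by omega)] at this
          omega
      apply hne
      ext i
      rcases eq_or_ne i ⟨j, hj⟩ with rfl | hi
      · rw [Pi.single_eq_same, ← hsum, sum_eq_single (⟨j, hj⟩ : Fin r)]
        · intro i _ hi; exact hz' i hi
        · simp
      · rw [Pi.single_eq_of_ne hi, hz' i hi]
    · intro h
      exfalso
      apply h
      rw [mem_filter, mem_piAntidiag]
      refine ⟨⟨?_, by simp⟩, ?_⟩
      · simp
      · intro a b hab
        have h2 := ht hab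
        grind

/-- The coefficient of `x ^ t` in the product of the Vandermonde polynomial and the complete
symmetric polynomials of degrees `κ i`. -/
def kostka (t κ : Fin r → ℕ) : ℂ := shifts (ofFn κ).reverse (altDelta t) (stair r)

theorem ofFn_reverse_eq (κ : Fin r → ℕ) (κ' : ℕ → ℕ) (h : ∀ i : Fin r, κ' i = κ i) :
    (ofFn κ).reverse = (List.range r).reverse.map κ' := by
  apply ext_getElem
  · simp
  · simp [← h]

theorem kostka_ne_zero (ht : StrictMono t) (κ : Fin r → ℕ) (h : kostka t κ ≠ 0)
    (m : ℕ) : ∑ i with m ≤ (i : Fin r).1, (i.1 + κ i) ≤ ∑ i with m ≤ (i : Fin r).1, t i := by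
  rcases Nat.lt_or_ge r m with hm | hm
  · rw [filter_false_of_mem]
    · simp
    · intro i _; omega
  let κ' : ℕ → ℕ := fun k => if hk : k < r then κ ⟨k, hk⟩ else 0
  have hκ' : ∀ i : Fin r, κ' i = κ i := fun i => by simp [κ']
  rw [kostka, ofFn_reverse_eq κ κ' hκ'] at h
  have h1 := (shifts_ne_zero ht κ' le_rfl (stair_strictMono r) (fun _ _ => rfl) h).2 m hm
  refine le_trans (le_of_eq ?_) h1
  rw [sum_add_distrib]
  congr 1
  simp only [sum_filter, ← hκ']
  rw [Fin.sum_univ_eq_sum_range (fun k => if m ≤ k then κ' k else 0) r, ← sum_filter]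
  congr 1
  ext k
  simp [and_comm]

theorem kostka_self (ht : StrictMono t) : kostka t (fun i => t i - i) = 1 := by
  let κ' : ℕ → ℕ := fun k => if hk : k < r then t ⟨k, hk⟩ - k else 0
  have hκ' : ∀ i : Fin r, κ' i = t i - i := fun i => by simp [κ']
  rw [kostka, ofFn_reverse_eq _ κ' hκ', ← shifts_self ht le_rfl κ' (fun i => by
    have := StrictMono.stair_le ht i
    rw [hκ']; omega)]
  congr 1
  ext i
  simp [stair]

theorem sum_perm_ge_le (u : Perm (Fin r)) (m : ℕ) :
    ∑ i with m ≤ (i : Fin r).1, (u i).1 ≤ ∑ i with m ≤ (i : Fin r).1, i.1 := by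
  have hm : Monovary (fun i : Fin r => if m ≤ i.1 then 1 else 0) (fun i : Fin r => i.1) := by
    apply Monotone.monovary
    · intro a b hab
      grind
    · intro a b hab; exact hab
  have := hm.sum_mul_comp_perm_le_sum_mul (σ := u)
  simpa [sum_filter] using this

/-- The scalar product of two characters of symmetric groups, in terms of the exponents in their
Frobenius formulas. -/
def gram (t' t : Fin r → ℕ) : ℂ := ∑ u : Perm (Fin r), ((Perm.sign u : ℤ) : ℂ) *
    if ∀ i, (u i).1 ≤ t i then kostka t' (fun i => t i - u i) else 0

/-- For a permutation the tail sums are at most those of the identity, so the dominance given by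
`kostka_ne_zero` holds for `t` in every term of the determinant. Applied in both directions this
yields orthogonality. -/
theorem gram_ne_zero {t' : Fin r → ℕ} (ht' : StrictMono t') (h : gram t' t ≠ 0) (m : ℕ) :
    ∑ i with m ≤ (i : Fin r).1, t i ≤ ∑ i with m ≤ (i : Fin r).1, t' i := by
  obtain ⟨u, -, hu⟩ := exists_ne_zero_of_sum_ne_zero h
  have hu' := right_ne_zero_of_mul hu
  split_ifs at hu' with hle
  · have h1 := kostka_ne_zero ht' _ hu' m
    have h2 := sum_perm_ge_le u m
    have h3 : ∑ i with m ≤ (i : Fin r).1, (i.1 + (t i - u i)) + ∑ i with m ≤ (i : Fin r).1, (u i).1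
        = ∑ i with m ≤ (i : Fin r).1, i.1 + ∑ i with m ≤ (i : Fin r).1, t i := by
      rw [← sum_add_distrib, ← sum_add_distrib]
      exact sum_congr rfl fun i _ => by have := hle i; omega
    omega
  · exact absurd rfl hu'

theorem sum_ge_eq_add (f : Fin r → ℕ) (i : Fin r) :
    ∑ k with i.1 ≤ (k : Fin r).1, f k = f i + ∑ k with i.1 + 1 ≤ (k : Fin r).1, f k := by
  rw [← sum_insert (by simp)]
  congr 1
  grind

theorem eq_of_sum_ge_eq {f g : Fin r → ℕ}
    (h : ∀ m, ∑ i with m ≤ (i : Fin r).1, f i = ∑ i with m ≤ (i : Fin r).1, g i) : f = g := by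
  ext i
  have h1 := sum_ge_eq_add f i
  have h2 := sum_ge_eq_add g i
  rw [h, h] at h1
  omega

/-- In a non-zero term dominance leaves no room, so the tail sums of the permutation equal those of
the identity; the remaining term is `kostka_self`. -/
theorem gram_self (ht : StrictMono t) : gram t t = 1 := by
  unfold gram
  rw [sum_eq_single 1]
  · have h1 : ∀ i, ((1 : Perm (Fin r)) i).1 ≤ t i := fun i => StrictMono.stair_le ht i
    rw [if_pos h1]
    simpa using kostka_self ht
  · intro u _ hu
    by_contra hne
    have hu' := right_ne_zero_of_mul hne
    split_ifs at hu' with hle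
    · apply hu
      have : (fun i => (u i).1) = fun i : Fin r => i.1 := by
        apply eq_of_sum_ge_eq
        intro m
        apply le_antisymm (sum_perm_ge_le u m)
        have h1 := kostka_ne_zero ht _ hu' m
        have h3 : ∑ i with m ≤ (i : Fin r).1, (i.1 + (t i - u i)) +
            ∑ i with m ≤ (i : Fin r).1, (u i).1
            = ∑ i with m ≤ (i : Fin r).1, i.1 + ∑ i with m ≤ (i : Fin r).1, t i := by
          rw [← sum_add_distrib, ← sum_add_distrib]
          grind
        omega
      ext i
      exact congrFun this i
    · exact absurd rfl hu'
  · simp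

end Kostka

/-! ### Counting invariant colourings -/

section Colourings
open Finset

/-- The number of elements of each colour. -/
def content {ι C : Type} [Fintype ι] [DecidableEq C] (F : ι → C) (c : C) : ℕ :=
  (univ.filter fun i => F i = c).card

theorem exists_perm_of_content_eq {ι C : Type} [Fintype ι] [DecidableEq C] {F G : ι → C}
    (h : content F = content G) : ∃ τ : Perm ι, G ∘ τ = F := by
  have : ∀ c, Nonempty ({i // F i = c} ≃ {i // G i = c}) := fun c => by
    rw [← Fintype.card_eq, Fintype.card_subtype, Fintype.card_subtype]
    exact congrFun h c
  let e := fun c => (this c).some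
  refine ⟨(Equiv.sigmaFiberEquiv F).symm.trans
    ((Equiv.sigmaCongrRight fun c => (e c)).trans (Equiv.sigmaFiberEquiv G)), ?_⟩
  ext i
  exact ((e (F i)) ⟨i, rfl⟩).2

variable {ι B C : Type} [Fintype ι] [DecidableEq ι] [Fintype B] [DecidableEq B] [Fintype C]
  [DecidableEq C]

theorem sum_content (F : ι → C) : ∑ c, content F c = Fintype.card ι := by
  exact (card_eq_sum_card_fiberwise (fun _ _ => mem_univ _)).symm

theorem content_comp (F : ι → C) (σ : Perm ι) : content (F ∘ σ) = content F := by
  ext c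
  refine card_bij (fun i _ => σ i) ?_ ?_ ?_
  · simp
  · intro a _ b _ h; exact σ.injective h
  · intro b hb
    exact ⟨σ.symm b, by simpa using hb, by simp⟩

theorem exists_content_eq {κ : C → ℕ} (h : ∑ c, κ c = Fintype.card ι) :
    ∃ F : ι → C, content F = κ := by
  have e : ι ≃ Σ c, Fin (κ c) := Fintype.equivOfCardEq (by simp [h])
  refine ⟨fun i => (e i).1, ?_⟩
  ext c
  unfold content
  rw [← Fintype.card_subtype]
  have e2 : {i // (e i).1 = c} ≃ Fin (κ c) :=
    (e.subtypeEquiv (fun i => Iff.rfl)).trans (Equiv.sigmaSubtype c)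
  rw [card_congr e2, Fintype.card_fin]

/-- The numbers of elements with given value of `f` and given colour. -/
def jointContent (f : ι → B) (F : ι → C) (b : B) (c : C) : ℕ :=
  (univ.filter fun i => f i = b ∧ F i = c).card

theorem jointContent_eq (f : ι → B) (F : ι → C) (b : B) (c : C) :
    jointContent f F b c = content (fun i => (f i, F i)) (b, c) := by
  simp [jointContent, content]

theorem sum_jointContent (f : ι → B) (F : ι → C) (b : B) :
    ∑ c, jointContent f F b c = content f b := by
  unfold jointContent content
  rw [card_eq_sum_card_fiberwise (f := F) (t := univ) (fun _ _ => mem_univ _)]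
  simp [filter_filter]

theorem sum_jointContent' (f : ι → B) (F : ι → C) (c : C) :
    ∑ b, jointContent f F b c = content F c := by
  unfold jointContent content
  rw [card_eq_sum_card_fiberwise (f := f) (t := univ) (fun _ _ => mem_univ _)]
  simp [filter_filter, and_comm]

theorem card_stabilizer (F : ι → C) :
    (univ.filter fun σ : Perm ι => F ∘ σ = F).card = ∏ c, (content F c).factorial := by
  rw [← Fintype.card_subtype, DomMulAct.stabilizer_card]
  simp [content, Fintype.card_subtype]

theorem exists_jointContent_eq {f : ι → B} {β : B → C → ℕ} (h : ∀ b, ∑ c, β b c = content f b) :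
    ∃ F : ι → C, jointContent f F = β := by
  obtain ⟨G, hG⟩ := exists_content_eq (ι := ι) (κ := fun p : B × C => β p.1 p.2) (by
    rw [sum_prod_type, sum_congr rfl fun b _ => h b, sum_content])
  have h1 : content (fun i => (G i).1) = content f := by
    ext b
    rw [← sum_jointContent (fun i => (G i).1) (fun i => (G i).2) b, ← h b]
    exact sum_congr rfl fun c _ => by rw [jointContent_eq]; exact congrFun hG (b, c)
  obtain ⟨τ, hτ⟩ := exists_perm_of_content_eq h1.symm
  refine ⟨fun i => (G (τ i)).2, ?_⟩
  ext b c
  rw [jointContent_eq, ← hτ]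
  exact (congrFun (content_comp G τ) (b, c)).trans (congrFun hG (b, c))

/-- Orbit counting: the permutations preserving `f` act transitively on the colourings with joint
content `β`, and the stabilizer of a colouring is a product of symmetric groups of orders `(β b
c)!`. -/
theorem card_jointContent {f : ι → B} {β : B → C → ℕ} (h : ∀ b, ∑ c, β b c = content f b) :
    (univ.filter fun F : ι → C => jointContent f F = β).card * ∏ b, ∏ c, (β b c).factorial =
      ∏ b, (content f b).factorial := by
  classical
  obtain ⟨F₀, hF₀⟩ := exists_jointContent_eq h
  rw [← card_stabilizer f]
  rw [card_eq_sum_card_fiberwise (f := fun σ : Perm ι => F₀ ∘ σ)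
    (t := univ.filter fun F : ι → C => jointContent f F = β)]
  · rw [← smul_eq_mul, ← sum_const]
    refine sum_congr rfl fun F hF => ?_
    rw [mem_filter] at hF
    have h1 : content (fun i => (f i, F i)) = content (fun i => (f i, F₀ i)) := by
      ext ⟨b, c⟩
      rw [← jointContent_eq, ← jointContent_eq, hF.2, hF₀]
    obtain ⟨τ, hτ⟩ := exists_perm_of_content_eq h1
    have h2 : ∏ b, ∏ c, (β b c).factorial =
        ∏ p : B × C, (content (fun i => (f i, F₀ i)) p).factorial := by
      rw [Fintype.prod_prod_type]
      refine prod_congr rfl fun b _ => prod_congr rfl fun c _ => ?_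
      rw [← jointContent_eq, hF₀]
    rw [h2, ← card_stabilizer]
    refine card_bij (fun σ _ => σ * τ) ?_ ?_ ?_
    · intro σ hσ
      simp only [mem_filter, mem_univ, true_and, funext_iff, comp,
        Prod.mk.injEq, Perm.mul_apply] at hσ hτ ⊢
      grind
    · simp_all
    · intro σ hσ
      refine ⟨σ * τ⁻¹, ?_, by simp⟩
      simp only [mem_filter, mem_univ, true_and, funext_iff, comp,
        Prod.mk.injEq, Perm.mul_apply] at hσ hτ ⊢
      intro i
      have h3 := hτ (τ⁻¹ i)
      simp_all
  · intro σ hσ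
    simp only [coe_filter, mem_univ, true_and, Set.mem_ofPred_eq] at hσ ⊢
    ext b c
    rw [← hF₀, jointContent_eq, jointContent_eq]
    refine Eq.trans ?_ (congrFun (content_comp (fun i => (f i, F₀ i)) σ) (b, c))
    congr 1
    ext i
    · exact (congrFun hσ i).symm
    · rfl

/-- Sums over the colourings invariant under a permutation, averaged over the permutations that
preserve `f`. -/
theorem sum_stabilizer_sum_invariant (f : ι → B) (ψ : (B → C → ℕ) → ℂ) :
    ∑ σ ∈ univ.filter fun σ : Perm ι => f ∘ σ = f,
       ∑ F ∈ univ.filter fun F : ι → C => F ∘ σ = F, ψ (jointContent f F) =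
      (∏ b, ((content f b).factorial : ℂ)) *
        ∑ β ∈ piFinset fun b => piAntidiag univ (content f b), ψ β := by
  classical
  -- As in Burnside's lemma the order of summation is exchanged: the permutations fixing both `f`
  -- and `F` are those fixing the pair, and their number depends on the joint content only.
  have h1 : ∑ σ ∈ univ.filter fun σ : Perm ι => f ∘ σ = f,
       ∑ F ∈ univ.filter fun F : ι → C => F ∘ σ = F, ψ (jointContent f F) =
      ∑ F : ι → C, ((∏ b, ∏ c, (jointContent f F b c).factorial : ℕ) : ℂ) *
        ψ (jointContent f F) := by
    rw [sum_comm' (t' := univ) (s' := fun F => univ.filter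
      fun σ : Perm ι => (fun i => (f i, F i)) ∘ σ = fun i => (f i, F i))]
    · refine sum_congr rfl fun F _ => ?_
      rw [sum_const, nsmul_eq_mul, card_stabilizer, Fintype.prod_prod_type]
      simp only [jointContent_eq]
    · simp [funext_iff, forall_and]
  rw [h1, ← sum_fiberwise_of_maps_to (g := fun F : ι → C => jointContent f F)
    (t := piFinset fun b => piAntidiag univ (content f b)), mul_sum]
  · refine sum_congr rfl fun β hβ => ?_
    have hβ' : ∀ b, ∑ c, β b c = content f b := by simp_all
    have h2 : ∀ F ∈ univ.filter fun F : ι → C => jointContent f F = β,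
        ((∏ b, ∏ c, (jointContent f F b c).factorial : ℕ) : ℂ) * ψ (jointContent f F) =
        ((∏ b, ∏ c, (β b c).factorial : ℕ) : ℂ) * ψ β := by
      simp_all
    rw [sum_congr rfl h2, sum_const, nsmul_eq_mul, ← mul_assoc, ← Nat.cast_mul,
      card_jointContent hβ', Nat.cast_prod]
  · intro F _
    rw [mem_piFinset]
    intro b
    rw [mem_piAntidiag]
    exact ⟨sum_jointContent f F b, by simp⟩

end Colourings

/-! ### Iterated shifts as sums over families of exponents. -/

section Shifts
open Finset

variable {C : Type} [Fintype C] [DecidableEq C]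

variable {k : ℕ}

theorem shiftSum_comm (d d' : ℕ) (φ : (C → ℕ) → ℂ) :
    shiftSum d (shiftSum d' φ) = shiftSum d' (shiftSum d φ) := by
  ext e
  unfold shiftSum
  rw [sum_comm]
  refine sum_congr rfl fun β _ => sum_congr rfl fun γ _ => ?_
  rw [add_right_comm]

theorem shifts_perm {L L' : List ℕ} (h : L.Perm L') (φ : (C → ℕ) → ℂ) :
    shifts L φ = shifts L' φ := by
  have : LeftCommutative (shiftSum (C := C)) := ⟨fun a b φ => shiftSum_comm a b φ⟩
  exact h.foldr_eq φ

theorem sum_piFinset_succ {E : Type} (S : Fin (k + 1) → Finset E)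
    (g : (Fin (k + 1) → E) → ℂ) : ∑ β ∈ piFinset S, g β =
      ∑ x ∈ S 0, ∑ β ∈ piFinset (fun i => S i.succ), g (Fin.cons x β) := by
  rw [← sum_product']
  refine sum_nbij' (fun β => (β 0, fun i => β i.succ)) (fun p => Fin.cons p.1 p.2) ?_ ?_ ?_ ?_ ?_
  · grind
  · rintro ⟨x, β⟩ h
    simp only [mem_product, mem_piFinset] at h ⊢
    intro i
    refine Fin.cases ?_ (fun i => ?_) i
    · exact h.1
    · exact h.2 i
  · intro β _
    ext i
    refine Fin.cases ?_ (fun i => ?_) i <;> rfl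
  · simp
  · intro β _
    congr 1
    ext i
    refine Fin.cases ?_ (fun i => ?_) i <;> rfl

theorem shifts_ofFn (κ : Fin k → ℕ) (φ : (C → ℕ) → ℂ) (e : C → ℕ) : shifts (ofFn κ) φ e =
      ∑ β ∈ piFinset fun i => piAntidiag univ (κ i), φ (e + ∑ i, β i) := by
  induction k generalizing e with
  | zero => simp [shifts]
  | succ k ih =>
    rw [sum_piFinset_succ, ofFn_succ]
    change shiftSum (κ 0) (shifts _ φ) e = _
    refine sum_congr rfl fun x _ => ?_
    rw [ih]
    refine sum_congr rfl fun β _ => ?_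
    rw [Fin.sum_univ_succ, add_assoc]
    simp

theorem kostka_eq_sum {r : ℕ} (t κ : Fin r → ℕ) : kostka t κ =
    ∑ β ∈ piFinset fun i => piAntidiag univ (κ i), altDelta t (stair r + ∑ i, β i) := by
  rw [kostka, shifts_perm (List.reverse_perm _), shifts_ofFn]

end Shifts

/-! ### Scalar products of the characters of the Weyl group of type `B` -/

section Characters
open Finset

variable {ι : Type} [Fintype ι] [DecidableEq ι] {r t : ℕ}

variable {a a' : Fin r → ℕ} {b b' : Fin t → ℕ}

/-- The product of the signs of `w` over the elements with a colour of the second kind. -/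
def signWeight (w : W ι) (F : ι → Fin r ⊕ Fin t) : ℂ :=
  ∏ i, Sum.elim (fun _ => 1) (fun _ => ((w.left i : ℤ) : ℂ)) (F i)

/-- The signed sum of `Ψ` over the contents of the colourings invariant under `w`. -/
def colourSum (Ψ : (Fin r ⊕ Fin t → ℕ) → ℂ) (w : W ι) : ℂ :=
  ∑ F ∈ univ.filter fun F : ι → Fin r ⊕ Fin t => F ∘ w.right = F, signWeight w F * Ψ (content F)

/-- The monomial character with given content. -/
def monoChar (κ : Fin r ⊕ Fin t → ℕ) : W ι → ℂ := colourSum fun k => if k = κ then 1 else 0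

/-- The product of two alternating functions, shifted by the exponents `0, 1, …`. -/
def altPair (φ : (Fin r → ℕ) → ℂ) (φ' : (Fin t → ℕ) → ℂ) (k : Fin r ⊕ Fin t → ℕ) : ℂ :=
  φ (stair r + k ∘ inl) * φ' (stair t + k ∘ inr)

/-- The character attached to two increasing sequences of exponents. -/
def seqChar (a : Fin r → ℕ) (b : Fin t → ℕ) : W ι → ℂ :=
  colourSum (altPair (altDelta a) (altDelta b))

theorem sum_W (f : W ι → ℂ) : ∑ w, f w = ∑ σ : Perm ι, ∑ ε : ι → ℤˣ, f ⟨ε, σ⟩ := by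
  rw [Fintype.sum_equiv SemidirectProduct.equivProd f
    (fun p : (ι → ℤˣ) × Perm ι => f ⟨p.1, p.2⟩) (fun w => rfl), sum_prod_type,
    sum_comm]

theorem card_W : Fintype.card (W ι) = 2 ^ Fintype.card ι * (Fintype.card ι).factorial := by
  rw [card_congr SemidirectProduct.equivProd, card_prod, Fintype.card_perm, Fintype.card_pi]
  simp

theorem sum_signWeight_mul (σ : Perm ι) (F F' : ι → Fin r ⊕ Fin t) :
    ∑ ε : ι → ℤˣ, signWeight (⟨ε, σ⟩ : W ι) F * signWeight (⟨ε, σ⟩ : W ι) F' =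
      if ∀ i, (F i).isRight = (F' i).isRight then (2 : ℂ) ^ Fintype.card ι else 0 := by
  have h1 : ∀ ε : ι → ℤˣ, signWeight (⟨ε, σ⟩ : W ι) F * signWeight (⟨ε, σ⟩ : W ι) F' =
      ∏ i, (Sum.elim (fun _ => (1 : ℂ)) (fun _ => ((ε i : ℤ) : ℂ)) (F i) *
        Sum.elim (fun _ => (1 : ℂ)) (fun _ => ((ε i : ℤ) : ℂ)) (F' i)) := fun ε => by
    rw [signWeight, signWeight, ← prod_mul_distrib]
  simp only [h1]
  have h2 := prod_univ_sum (fun _ : ι => (univ : Finset ℤˣ))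
    (fun i s => (Sum.elim (fun _ => (1 : ℂ)) (fun _ => ((s : ℤ) : ℂ)) (F i) *
        Sum.elim (fun _ => (1 : ℂ)) (fun _ => ((s : ℤ) : ℂ)) (F' i)))
  rw [Fintype.piFinset_univ] at h2
  rw [← h2]
  have h3 : (univ : Finset ℤˣ) = {1, -1} := rfl
  have h4 : ∀ i, ∑ s : ℤˣ, (Sum.elim (fun _ => (1 : ℂ)) (fun _ => ((s : ℤ) : ℂ)) (F i) *
        Sum.elim (fun _ => (1 : ℂ)) (fun _ => ((s : ℤ) : ℂ)) (F' i)) =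
        if (F i).isRight = (F' i).isRight then 2 else 0 := by
    intro i
    rcases F i with x | x <;> rcases F' i with y | y <;> simp <;> norm_num
  rw [prod_congr rfl fun i _ => h4 i]
  split_ifs with h
  · simp_all
  · push Not at h
    obtain ⟨i, hi⟩ := h
    exact prod_eq_zero (mem_univ i) (if_neg hi)

/-- Families of contents in which colours of different kinds do not meet. -/
def KindPreserving (β : Fin r ⊕ Fin t → Fin r ⊕ Fin t → ℕ) : Prop :=
  ∀ c c', c.isRight ≠ c'.isRight → β c c' = 0

instance (β : Fin r ⊕ Fin t → Fin r ⊕ Fin t → ℕ) : Decidable (KindPreserving β) := by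
  unfold KindPreserving; infer_instance

theorem kindPreserving_jointContent (F F' : ι → Fin r ⊕ Fin t) :
    KindPreserving (jointContent F F') ↔ ∀ i, (F i).isRight = (F' i).isRight := by
  constructor
  · intro h i
    by_contra hne
    have := h _ _ hne
    rw [jointContent, card_eq_zero] at this
    exact notMem_empty i (this ▸ by simp)
  · intro h c c' hne
    rw [jointContent, card_eq_zero, filter_eq_empty_iff]
    grind

/-- Averaging over the signs annihilates pairs of colourings of different kinds at some element.
Averaging over the permutations fixing the first colouring replaces the second one by its possible
joint contents with the first. -/
theorem sum_monoChar_mul (κ : Fin r ⊕ Fin t → ℕ) (hκ : ∑ c, κ c = Fintype.card ι)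
    (Ψ : (Fin r ⊕ Fin t → ℕ) → ℂ) :
    ∑ w : W ι, monoChar κ w * colourSum Ψ w = Fintype.card (W ι) *
      ∑ β ∈ piFinset fun c => piAntidiag univ (κ c),
        if KindPreserving β then Ψ (∑ c, β c) else 0 := by
  set S := ∑ β ∈ piFinset fun c => piAntidiag univ (κ c),
        if KindPreserving β then Ψ (∑ c, β c) else 0 with hS
  have h1 : ∀ σ : Perm ι, ∑ ε : ι → ℤˣ, monoChar κ (⟨ε, σ⟩ : W ι) *
      colourSum Ψ (⟨ε, σ⟩ : W ι) = (2 : ℂ) ^ Fintype.card ι *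
      ∑ F ∈ univ.filter fun F : ι → Fin r ⊕ Fin t => F ∘ σ = F ∧ content F = κ,
      ∑ F' ∈ univ.filter fun F' : ι → Fin r ⊕ Fin t => F' ∘ σ = F',
        if KindPreserving (jointContent F F') then Ψ (∑ c, jointContent F F' c) else 0 := by
    intro σ
    simp only [monoChar, colourSum, sum_mul_sum]
    rw [sum_comm, mul_sum, ← filter_filter, sum_filter (p := fun F => content F = κ)]
    refine sum_congr rfl fun F _ => ?_
    split_ifs with hF
    · rw [sum_comm, mul_sum]
      refine sum_congr rfl fun F' _ => ?_
      rw [sum_congr rfl fun (ε : ι → ℤˣ) _ => (show _ = (signWeight (⟨ε, σ⟩ : W ι) F *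
        signWeight (⟨ε, σ⟩ : W ι) F') * Ψ (content F') by ring), ← sum_mul,
        sum_signWeight_mul]
      have h2 : ∑ c, jointContent F F' c = content F' := by
        ext c
        rw [Finset.sum_apply, sum_jointContent']
      rw [h2]
      simp only [kindPreserving_jointContent]
      split_ifs <;> simp
    · simp
  rw [sum_W, sum_congr rfl fun σ _ => h1 σ, ← mul_sum]
  have h2 : ∑ σ : Perm ι, ∑ F ∈ univ.filter fun F : ι → Fin r ⊕ Fin t => F ∘ σ = F ∧ content F = κ,
      ∑ F' ∈ univ.filter fun F' : ι → Fin r ⊕ Fin t => F' ∘ σ = F',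
        (if KindPreserving (jointContent F F') then Ψ (∑ c, jointContent F F' c) else 0) =
      ∑ F ∈ univ.filter fun F : ι → Fin r ⊕ Fin t => content F = κ,
        (∏ c, ((κ c).factorial : ℂ)) * S := by
    rw [sum_comm' (t' := univ.filter fun F : ι → Fin r ⊕ Fin t => content F = κ)
      (s' := fun F => univ.filter fun σ : Perm ι => F ∘ σ = F)]
    · refine sum_congr rfl fun F hF => ?_
      rw [mem_filter] at hF
      rw [sum_stabilizer_sum_invariant F (fun β => if KindPreserving β then Ψ (∑ c, β c) else 0),
        hF.2]
    · simp
  -- With a constant map in place of `f`, this is the multinomial coefficient that counts the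
  -- colourings of content `κ`.
  have h3 := card_jointContent (ι := ι) (f := fun _ => ()) (β := fun _ => κ) (by
    rw [hκ]; simp [content])
  have h4 : (univ.filter fun F : ι → Fin r ⊕ Fin t => jointContent (fun _ => ()) F =
      fun _ => κ) = univ.filter fun F : ι → Fin r ⊕ Fin t => content F = κ := by
    simp only [mem_filter, mem_univ, true_and, funext_iff, jointContent, content]
    simp
  rw [h4] at h3
  simp only [univ_unique, prod_singleton, content, filter_true, card_univ] at h3
  rw [h2, sum_const, nsmul_eq_mul, card_W, ← mul_assoc _ _ S]
  push_cast
  have h5 : ((univ.filter fun F : ι → Fin r ⊕ Fin t => content F = κ).card : ℂ) *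
      ∏ c, ((κ c).factorial : ℂ) = (Fintype.card ι).factorial := by
    exact_mod_cast h3
  rw [← h5]
  ring

theorem sum_kindPreserving (a : Fin r → ℕ) (b : Fin t → ℕ) (κ : Fin r ⊕ Fin t → ℕ) :
    (∑ β ∈ piFinset fun c => piAntidiag univ (κ c),
        if KindPreserving β then altPair (altDelta a) (altDelta b) (∑ c, β c) else 0) =
      kostka a (κ ∘ inl) * kostka b (κ ∘ inr) := by
  rw [kostka_eq_sum, kostka_eq_sum, sum_mul_sum, ← sum_product', ← sum_filter]
  refine sum_nbij' (fun β => (fun i i' => β (inl i) (inl i'), fun j j' => β (inr j) (inr j')))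
    (fun p => Sum.elim (fun i => Sum.elim (p.1 i) 0) (fun j => Sum.elim 0 (p.2 j))) ?_ ?_ ?_ ?_ ?_
  · intro β hβ
    simp only [mem_filter, mem_piFinset, mem_piAntidiag, mem_univ,
      implies_true, and_true, mem_product, comp] at hβ ⊢
    obtain ⟨h1, h2⟩ := hβ
    constructor
    · intro i
      rw [← h1, sum_sum_type, left_eq_add]
      exact sum_eq_zero fun j _ => h2 _ _ (by simp)
    · intro j
      rw [← h1, sum_sum_type, right_eq_add]
      exact sum_eq_zero fun i _ => h2 _ _ (by simp)
  · rintro ⟨β, γ⟩ h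
    simp only [mem_filter, mem_piFinset, mem_piAntidiag, mem_univ,
      implies_true, and_true, mem_product, comp] at h ⊢
    refine ⟨?_, ?_⟩
    · simp_all
    · rintro (i | i) (j | j) <;> simp
  · intro β hβ
    rw [mem_filter] at hβ
    ext (i | i) (j | j)
    · rfl
    · exact (hβ.2 _ _ (by simp)).symm
    · exact (hβ.2 _ _ (by simp)).symm
    · rfl
  · rintro ⟨β, γ⟩ _
    rfl
  · intro β hβ
    rw [mem_filter] at hβ
    unfold altPair
    congr 2
    · congr 1
      ext i
      rw [comp, Finset.sum_apply, sum_sum_type, Finset.sum_apply, add_eq_left]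
      exact sum_eq_zero fun j _ => hβ.2 _ _ (by simp)
    · congr 1
      ext i
      rw [comp, Finset.sum_apply, sum_sum_type, Finset.sum_apply, add_eq_right]
      exact sum_eq_zero fun j _ => hβ.2 _ _ (by simp)

theorem colourSum_inv (Ψ : (Fin r ⊕ Fin t → ℕ) → ℂ) (w : W ι) :
    colourSum Ψ w⁻¹ = colourSum Ψ w := by
  unfold colourSum
  have h1 : ∀ F : ι → Fin r ⊕ Fin t, F ∘ (w⁻¹).right = F ↔ F ∘ w.right = F := by
    intro F
    constructor
    · intro h
      conv_lhs => rw [← h]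
      ext i; simp
    · intro h
      conv_lhs => rw [← h]
      ext i; simp
  simp only [h1]
  refine sum_congr rfl fun F hF => ?_
  rw [mem_filter] at hF
  congr 1
  unfold signWeight
  rw [← Equiv.prod_comp w.right (fun i => Sum.elim (fun _ => (1 : ℂ))
    (fun _ => ((w.left i : ℤ) : ℂ)) (F i))]
  refine prod_congr rfl fun i _ => ?_
  have h2 : F (w.right i) = F i := congrFun hF.2 i
  have h3 : (w⁻¹).left i = w.left (w.right i) := by
    simp
    change w.left ((w.right⁻¹)⁻¹ • i) = _
    rfl
  rw [h2, h3]

/-- The Jacobi–Trudi expansion. Renaming the colours by `u` and `v` moves the permutations from the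
colours to the staircase exponents, and the condition on the content becomes that it equals `a - u`,
`b - v`. -/
theorem seqChar_eq_sum (a : Fin r → ℕ) (b : Fin t → ℕ) (w : W ι) :
    seqChar a b w = ∑ u : Perm (Fin r), ∑ v : Perm (Fin t),
      ((Perm.sign u : ℤ) : ℂ) * ((Perm.sign v : ℤ) : ℂ) *
        if (∀ i, (u i).1 ≤ a i) ∧ ∀ j, (v j).1 ≤ b j then
          monoChar (Sum.elim (fun i => a i - u i) (fun j => b j - v j)) w else 0 := by
  have h1 : seqChar a b w = ∑ u : Perm (Fin r), ∑ v : Perm (Fin t),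
      ((Perm.sign u : ℤ) : ℂ) * ((Perm.sign v : ℤ) : ℂ) *
      ∑ F ∈ univ.filter fun F : ι → Fin r ⊕ Fin t => F ∘ w.right = F,
        signWeight w F * if (stair r + content F ∘ inl) ∘ u = a ∧
          (stair t + content F ∘ inr) ∘ v = b then 1 else 0 := by
    have h2 : ∀ k : Fin r ⊕ Fin t → ℕ, altPair (altDelta a) (altDelta b) k =
        ∑ u : Perm (Fin r), ∑ v : Perm (Fin t), ((Perm.sign u : ℤ) : ℂ) * ((Perm.sign v : ℤ) : ℂ) *
          if (stair r + k ∘ inl) ∘ u = a ∧ (stair t + k ∘ inr) ∘ v = b then 1 else 0 := by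
      intro k
      rw [altPair, altDelta, altDelta, sum_mul_sum]
      grind
    simp only [seqChar, colourSum, h2]
    simp only [mul_sum]
    rw [sum_comm]
    refine sum_congr rfl fun u _ => ?_
    rw [sum_comm]
    grind
  rw [h1]
  refine sum_congr rfl fun u _ => sum_congr rfl fun v _ => ?_
  congr 1
  let e : (Fin r ⊕ Fin t) ≃ (Fin r ⊕ Fin t) := sumCongr u v
  have hc : ∀ (F : ι → Fin r ⊕ Fin t) c, content (e.symm ∘ F) c = content F (e c) := by
    intro F c
    unfold content
    congr 1
    simp [Equiv.symm_apply_eq]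
  have h2 : ∑ F ∈ univ.filter fun F : ι → Fin r ⊕ Fin t => F ∘ w.right = F,
        (signWeight w F * if (stair r + content F ∘ inl) ∘ u = a ∧
          (stair t + content F ∘ inr) ∘ v = b then (1 : ℂ) else 0) =
      ∑ F ∈ univ.filter fun F : ι → Fin r ⊕ Fin t => F ∘ w.right = F,
        (signWeight w F * if (∀ i, (u i).1 + content F (inl i) = a i) ∧
          (∀ j, (v j).1 + content F (inr j) = b j) then (1 : ℂ) else 0) := by
    refine sum_nbij' (fun F => e.symm ∘ F) (fun F => e ∘ F) ?_ ?_ ?_ ?_ ?_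
    · intro F hF
      rw [mem_filter] at hF ⊢
      refine ⟨mem_univ _, ?_⟩
      rw [comp_assoc, hF.2]
    · intro F hF
      rw [mem_filter] at hF ⊢
      refine ⟨mem_univ _, ?_⟩
      rw [comp_assoc, hF.2]
    · intro F _; ext i; simp
    · intro F _; ext i; simp
    · intro F _
      congr 1
      · refine prod_congr rfl fun i _ => ?_
        rcases h : F i with x | x <;> simp [e, h]
      · simp only [hc, funext_iff, comp, Pi.add_apply, stair]
        rfl
  rw [h2]
  split_ifs with h
  · refine sum_congr rfl fun F _ => ?_
    congr 2
    simp only [funext_iff, Sum.forall, elim_inl, elim_inr]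
    grind
  · refine sum_eq_zero fun F _ => ?_
    grind

/-- Pairs of increasing exponent sequences of total degree `n`. -/
structure IsExponent (n : ℕ) (a : Fin r → ℕ) (b : Fin t → ℕ) : Prop where
  fst : StrictMono a
  snd : StrictMono b
  sum : ∑ i, a i + ∑ j, b j = n + ∑ i, stair r i + ∑ j, stair t j

/-- Only one of the two characters is expanded into monomial characters; the pairing of these with
the other one is a product of two Kostka numbers by `sum_kindPreserving`. -/
theorem pair_seqChar (h : IsExponent (Fintype.card ι) a b) :
    pair (seqChar (ι := ι) a b) (seqChar a' b') = gram a' a * gram b' b := by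
  unfold pair
  simp only [seqChar_eq_sum a b]
  have hcard : (Fintype.card (W ι) : ℂ) ≠ 0 := by simp
  rw [inv_mul_eq_iff_eq_mul₀ hcard, gram, gram, sum_mul_sum]
  simp only [mul_sum, sum_mul]
  rw [sum_comm]
  refine sum_congr rfl fun u _ => ?_
  rw [sum_comm]
  refine sum_congr rfl fun v _ => ?_
  by_cases huv : (∀ i, (u i).1 ≤ a i) ∧ ∀ j, (v j).1 ≤ b j
  · rw [if_pos huv.1, if_pos huv.2]
    simp only [if_pos huv]
    have hsum : ∑ c, Sum.elim (fun i => a i - u i) (fun j => b j - v j) c = Fintype.card ι := by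
      rw [sum_sum_type]
      simp only [elim_inl, elim_inr]
      have h1 : ∑ i, (a i - (u i).1) + ∑ i, stair r i = ∑ i, a i := by
        rw [← Equiv.sum_comp u (stair r), ← sum_add_distrib]
        exact sum_congr rfl fun i _ => Nat.sub_add_cancel (huv.1 i)
      have h2 : ∑ j, (b j - (v j).1) + ∑ j, stair t j = ∑ j, b j := by
        rw [← Equiv.sum_comp v (stair t), ← sum_add_distrib]
        exact sum_congr rfl fun i _ => Nat.sub_add_cancel (huv.2 i)
      have := h.sum
      omega
    have h3 := sum_monoChar_mul (ι := ι) _ hsum (altPair (altDelta a') (altDelta b'))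
    rw [sum_kindPreserving] at h3
    simp only [elim_comp_inl, elim_comp_inr] at h3
    rw [sum_congr rfl fun w _ => (show _ = (((Perm.sign u : ℤ) : ℂ) *
      ((Perm.sign v : ℤ) : ℂ)) * (monoChar (Sum.elim (fun i => a i - (u i).1)
        (fun j => b j - (v j).1)) w * colourSum (altPair (altDelta a') (altDelta b')) w) by
      rw [← colourSum_inv]; rw [mul_assoc]; rfl), ← mul_sum, h3]
    ring
  · simp only [if_neg huv]
    rw [not_and_or] at huv
    rcases huv with huv | huv <;> simp [if_neg huv]

/-- A non-zero value implies dominance by `gram_ne_zero`. As the pairing is symmetric, dominance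
holds in both directions and the exponents agree. -/
theorem pair_seqChar_of_isExponent
    (h : IsExponent (Fintype.card ι) a b) (h' : IsExponent (Fintype.card ι) a' b') :
    pair (seqChar (ι := ι) a b) (seqChar a' b') = if a = a' ∧ b = b' then 1 else 0 := by
  split_ifs with heq
  · obtain ⟨rfl, rfl⟩ := heq
    rw [pair_seqChar h, gram_self h.fst, gram_self h.snd, one_mul]
  · by_contra hne
    have h1 := hne
    have h2 := hne
    rw [pair_seqChar h] at h1
    rw [pair_comm, pair_seqChar h'] at h2
    apply heq
    constructor
    · exact eq_of_sum_ge_eq fun m => le_antisymm (gram_ne_zero h'.fst (left_ne_zero_of_mul h1) m)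
        (gram_ne_zero h.fst (left_ne_zero_of_mul h2) m)
    · exact eq_of_sum_ge_eq fun m => le_antisymm (gram_ne_zero h'.snd (right_ne_zero_of_mul h1) m)
        (gram_ne_zero h.snd (right_ne_zero_of_mul h2) m)

end Characters

/-! ### Irreducible characters of the Weyl group of type `B` -/

section Irreducibles
open Finset

variable {ι : Type} [Fintype ι] [DecidableEq ι] {r t : ℕ}

variable {n : ℕ}

/-- The representation of `W` on functions of colourings with given content. -/
def monoRep (κ : Fin r ⊕ Fin t → ℕ) :
    Representation ℂ (W ι) ({F : ι → Fin r ⊕ Fin t // content F = κ} → ℂ) where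
  toFun w :=
    { toFun := fun f F => signWeight w F.1 *
        f ⟨F.1 ∘ w.right, by rw [content_comp]; exact F.2⟩
      map_add' := fun f g => by ext F; simp [mul_add]
      map_smul' := fun c f => by ext F; simp; ring }
  map_one' := by
    refine LinearMap.ext fun f => funext fun F => ?_
    have : signWeight (1 : W ι) F.1 = 1 := by
      unfold signWeight
      simp_all
    simp [this]
  map_mul' w₁ w₂ := by
    refine LinearMap.ext fun f => funext fun F => ?_
    have h : signWeight (w₁ * w₂) F.1 = signWeight w₁ F.1 * signWeight w₂ (F.1 ∘ w₁.right) := by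
      unfold signWeight
      rw [← Equiv.prod_comp w₁.right⁻¹ (fun i => Sum.elim (fun _ => (1 : ℂ))
        (fun _ => ((w₂.left i : ℤ) : ℂ)) ((F.1 ∘ w₁.right) i)), ← prod_mul_distrib]
      refine prod_congr rfl fun i _ => ?_
      have h2 : (w₁ * w₂).left i = w₁.left i * w₂.left (w₁.right⁻¹ i) := rfl
      rw [h2]
      have h3 : w₁.right (w₁.right⁻¹ i) = i := w₁.right.apply_symm_apply i
      simp only [comp, h3]
      rcases F.1 i with x | x <;> simp
    change signWeight (w₁ * w₂) F.1 * _ = signWeight w₁ F.1 *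
      (signWeight w₂ (F.1 ∘ w₁.right) * _)
    rw [h, mul_assoc]
    rfl

theorem monoRep_character (κ : Fin r ⊕ Fin t → ℕ) :
    (monoRep (ι := ι) κ).character = monoChar κ := by
  classical
  ext w
  rw [Representation.character, LinearMap.trace_eq_matrix_trace ℂ (Pi.basisFun ℂ _), Matrix.trace]
  simp only [Matrix.diag, LinearMap.toMatrix_apply, Pi.basisFun_repr, Pi.basisFun_apply]
  rw [monoChar, colourSum]
  have h1 : ∀ F : {F : ι → Fin r ⊕ Fin t // content F = κ},
      (monoRep κ) w (Pi.single F 1) F = if F.1 ∘ w.right = F.1 then signWeight w F.1 else 0 := by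
    intro F
    change signWeight w F.1 * (Pi.single F (1 : ℂ) : _ → ℂ) _ = _
    grind
  simp only [h1]
  rw [← sum_subtype (p := fun F : ι → Fin r ⊕ Fin t => content F = κ)
    (univ.filter fun F => content F = κ) (by simp)
    (fun F => if F ∘ w.right = F then signWeight w F else 0), sum_filter,
    sum_filter]
  grind

theorem monoChar_mem (κ : Fin r ⊕ Fin t → ℕ) : monoChar κ ∈ AddSubmonoid.closure (Irr (W ι)) := by
  rw [← monoRep_character]
  exact character_mem_closure _

theorem seqChar_mem (a : Fin r → ℕ) (b : Fin t → ℕ) :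
    seqChar a b ∈ AddSubgroup.closure (Irr (W ι)) := by
  have h : seqChar (ι := ι) a b = ∑ u : Perm (Fin r), ∑ v : Perm (Fin t),
      ((Perm.sign u * Perm.sign v : ℤˣ) : ℤ) • if (∀ i, (u i).1 ≤ a i) ∧ ∀ j, (v j).1 ≤ b j then
          monoChar (ι := ι) (Sum.elim (fun i => a i - u i) (fun j => b j - v j)) else 0 := by
    ext w
    rw [seqChar_eq_sum]
    simp only [Finset.sum_apply]
    refine sum_congr rfl fun u _ => sum_congr rfl fun v _ => ?_
    split_ifs <;> simp
  rw [h]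
  refine sum_mem fun u _ => sum_mem fun v _ => zsmul_mem ?_ _
  split_ifs
  · exact (AddSubmonoid.closure_le.mpr AddSubgroup.subset_closure :
      AddSubmonoid.closure _ ≤ (AddSubgroup.closure (Irr (W ι))).toAddSubmonoid) (monoChar_mem _)
  · exact zero_mem _

theorem pair_colourSum_right (f : W ι → ℂ) (Ψ : (Fin r ⊕ Fin t → ℕ) → ℂ) :
    pair f (colourSum Ψ) = (Fintype.card (W ι) : ℂ)⁻¹ * ∑ w, f w * colourSum Ψ w := by
  unfold pair
  congr 1
  refine sum_congr rfl fun w _ => ?_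
  rw [colourSum_inv]

/-- The Jacobi–Trudi expansion makes it an integral combination of irreducible characters, and its
norm is 1. The sign is settled by its leading monomial character, with which the pairing is 1 by
`kostka_self`. -/
theorem seqChar_irr {a : Fin r → ℕ} {b : Fin t → ℕ} (h : IsExponent (Fintype.card ι) a b) :
    seqChar a b ∈ Irr (W ι) := by
  let κ : Fin r ⊕ Fin t → ℕ := Sum.elim (fun i => a i - i) (fun j => b j - j)
  refine irr_of_norm_one (c := monoChar κ) (seqChar_mem a b) ?_ (monoChar_mem κ) ?_
  · rw [pair_seqChar_of_isExponent h h, if_pos ⟨rfl, rfl⟩]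
  · have hsum : ∑ c, κ c = Fintype.card ι := by
      rw [sum_sum_type]
      simp only [κ, elim_inl, elim_inr]
      have h1 : ∑ i : Fin r, (a i - i.1) + ∑ i, stair r i = ∑ i, a i := by
        rw [← sum_add_distrib]
        exact sum_congr rfl fun i _ => Nat.sub_add_cancel (StrictMono.stair_le h.fst i)
      have h2 : ∑ j : Fin t, (b j - j.1) + ∑ j, stair t j = ∑ j, b j := by
        rw [← sum_add_distrib]
        exact sum_congr rfl fun i _ => Nat.sub_add_cancel (StrictMono.stair_le h.snd i)
      have := h.sum
      omega
    rw [seqChar, pair_colourSum_right, sum_monoChar_mul κ hsum, sum_kindPreserving]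
    simp only [κ, elim_comp_inl, elim_comp_inr, kostka_self h.fst, kostka_self h.snd]
    simp_all

theorem monoChar_comp (κ : Fin r ⊕ Fin t → ℕ) (u : Perm (Fin r)) (v : Perm (Fin t))
    (w : W ι) : monoChar (κ ∘ sumCongr u v) w = monoChar κ w := by
  set e := sumCongr u v with he
  have hc : ∀ (F : ι → Fin r ⊕ Fin t), content (e ∘ F) ∘ e = content F := by
    intro F
    ext c
    unfold content
    simp
  refine sum_nbij' (fun F => e ∘ F) (fun F => e.symm ∘ F) ?_ ?_ ?_ ?_ ?_
  · intro F hF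
    rw [mem_filter] at hF ⊢
    exact ⟨mem_univ _, by rw [comp_assoc, hF.2]⟩
  · intro F hF
    rw [mem_filter] at hF ⊢
    exact ⟨mem_univ _, by rw [comp_assoc, hF.2]⟩
  · intro F _; ext i; simp
  · intro F _; ext i; simp
  · intro F _
    congr 1
    · refine prod_congr rfl fun i _ => ?_
      rcases h : F i with x | x <;> simp [e, h]
    · refine if_congr ?_ rfl rfl
      rw [← hc F]
      exact ⟨fun h => by
        have := congrArg (fun f => f ∘ e.symm) h
        simpa [comp_assoc] using this, fun h => by rw [h]⟩

theorem sum_mul_perm_lt {u : Perm (Fin r)} (hu : u ≠ 1) :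
    ∑ i : Fin r, i.1 * (u i).1 < ∑ i : Fin r, i.1 * i.1 := by
  have hm : Monovary (fun i : Fin r => i.1) (fun i : Fin r => i.1) := monovary_self _
  refine lt_of_le_of_ne (hm.sum_mul_comp_perm_le_sum_mul (σ := u)) fun h => hu ?_
  have h1 : ∑ i : Fin r, ((i.1 : ℤ) - (u i).1) ^ 2 = 0 := by
    have h2 : ∑ i : Fin r, ((u i).1 : ℤ) ^ 2 = ∑ i : Fin r, (i.1 : ℤ) ^ 2 :=
      Equiv.sum_comp u (fun i : Fin r => (i.1 : ℤ) ^ 2)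
    have h3 : ∑ i : Fin r, (i.1 : ℤ) * (u i).1 = ∑ i : Fin r, (i.1 : ℤ) * i.1 := by exact_mod_cast h
    simp only [sub_sq, sum_add_distrib, sum_sub_distrib, h2, mul_assoc, ← mul_sum, h3]
    ring
  rw [sum_eq_zero_iff_of_nonneg (fun i _ => sq_nonneg _)] at h1
  ext i
  have := h1 i (mem_univ i)
  simp only [ne_eq, OfNat.ofNat_ne_zero, not_false_eq_true, pow_eq_zero_iff] at this
  simp only [Perm.coe_one, id_eq]
  omega

/-- Exchanging two values in the wrong order would increase the weighted sum strictly. -/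
theorem monotone_of_max {f : Fin r → ℕ}
    (h : ∀ u : Perm (Fin r), ∑ i : Fin r, i.1 * f (u i) ≤ ∑ i : Fin r, i.1 * f i) :
    Monotone f := by
  intro i j hij
  by_contra hlt
  push Not at hlt
  have hne : i ≠ j := by rintro rfl; exact lt_irrefl _ hlt
  have hij' : i.1 < j.1 := lt_of_le_of_ne hij (fun h => hne (Fin.ext h))
  have h1 := h (Equiv.swap i j)
  rw [← add_sum_erase _ _ (mem_univ i), ← add_sum_erase _ _
    (show j ∈ univ.erase i by simp [hne.symm]),
    ← add_sum_erase _ (fun k : Fin r => k.1 * f k) (mem_univ i),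
    ← add_sum_erase _ (fun k : Fin r => k.1 * f k)
    (show j ∈ univ.erase i by simp [hne.symm])] at h1
  have h2 : ∑ k ∈ (univ.erase i).erase j, k.1 * f (Equiv.swap i j k) =
      ∑ k ∈ (univ.erase i).erase j, k.1 * f k := by
    refine sum_congr rfl fun k hk => ?_
    grind
  simp only [Equiv.swap_apply_left, Equiv.swap_apply_right] at h1
  obtain ⟨c, hc⟩ := Nat.exists_eq_add_of_lt hlt
  obtain ⟨d, hd⟩ := Nat.exists_eq_add_of_lt hij'
  nlinarith

/-- A function orthogonal to all `seqChar a b` is orthogonal to all monomial characters. -/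
theorem pair_monoChar_eq_zero {f : W ι → ℂ}
    (hf : ∀ (a : Fin r → ℕ) (b : Fin t → ℕ), IsExponent (Fintype.card ι) a b →
      pair f (seqChar a b) = 0) (κ : Fin r ⊕ Fin t → ℕ) (hκ : ∑ c, κ c = Fintype.card ι) :
    pair f (monoChar κ) = 0 := by
  by_contra hne
  -- Among the contents with non-zero pairing take one of maximal weight. Permuting the colours does
  -- not change the monomial character, so maximality makes this content weakly increasing, and it
  -- is the leading content of some `seqChar`.
  let weight (κ : Fin r ⊕ Fin t → ℕ) : ℕ :=
    ∑ i : Fin r, i.1 * κ (inl i) + ∑ j : Fin t, j.1 * κ (inr j)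
  let S := (piAntidiag (univ : Finset (Fin r ⊕ Fin t)) (Fintype.card ι)).filter
    fun κ => pair f (monoChar κ) ≠ 0
  have hS : κ ∈ S := by
    rw [mem_filter, mem_piAntidiag]
    exact ⟨⟨hκ, by simp⟩, hne⟩
  obtain ⟨m, hmS, hmax⟩ := S.exists_max_image weight ⟨κ, hS⟩
  rw [mem_filter, mem_piAntidiag] at hmS
  obtain ⟨⟨hm, -⟩, hm0⟩ := hmS
  have hmax' : ∀ κ' : Fin r ⊕ Fin t → ℕ, ∑ c, κ' c = Fintype.card ι → weight m < weight κ' →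
      pair f (monoChar κ') = 0 := by
    intro κ' h1 h2
    by_contra h3
    have := hmax κ' (by
      rw [mem_filter, mem_piAntidiag]
      exact ⟨⟨h1, by simp⟩, h3⟩)
    omega
  have hsym : ∀ (u : Perm (Fin r)) (v : Perm (Fin t)), weight (m ∘ sumCongr u v) ≤ weight m := by
    intro u v
    by_contra h
    push Not at h
    apply hm0
    have h1 := hmax' _ (by rw [← hm]; exact Equiv.sum_comp (sumCongr u v) m) h
    rw [← h1]
    congr 1
    ext w
    rw [monoChar_comp]
  have hmono1 : Monotone fun i => m (inl i) := by
    apply monotone_of_max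
    intro u
    have := hsym u 1
    simpa [weight] using this
  have hmono2 : Monotone fun i => m (inr i) := by
    apply monotone_of_max
    intro u
    have := hsym 1 u
    simpa [weight] using this
  have hexp : IsExponent (Fintype.card ι) (fun i => m (inl i) + i.1)
      (fun j => m (inr j) + j.1) := by
    refine ⟨?_, ?_, ?_⟩
    · intro i j h
      have h1 := hmono1 h.le
      grind
    · intro i j h
      have h1 := hmono2 h.le
      grind
    · rw [← hm, sum_sum_type, sum_add_distrib, sum_add_distrib]
      simp only [stair]
      ring
  apply hm0
  rw [← hf _ _ hexp]
  have h1 : pair f (seqChar (fun i => m (inl i) + i.1) (fun j => m (inr j) + j.1)) =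
      ∑ u : Perm (Fin r), ∑ v : Perm (Fin t),
      ((Perm.sign u : ℤ) : ℂ) * ((Perm.sign v : ℤ) : ℂ) *
        if (∀ i, (u i).1 ≤ m (inl i) + i.1) ∧ ∀ j, (v j).1 ≤ m (inr j) + j.1 then
          pair f (monoChar (Sum.elim (fun i => m (inl i) + i.1 - u i)
            (fun j => m (inr j) + j.1 - v j))) else 0 := by
    unfold pair
    simp only [seqChar_eq_sum, mul_sum]
    rw [sum_comm]
    refine sum_congr rfl fun u _ => ?_
    rw [sum_comm]
    refine sum_congr rfl fun v _ => ?_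
    split_ifs
    · rw [mul_sum]
      grind
    · simp
  -- The weight of the term of `(u, v)` exceeds that of `m` by `∑ i² - ∑ i · u i` plus the same
  -- expression for `v`, which is positive unless both permutations are trivial.
  have hzero : ∀ (u : Perm (Fin r)) (v : Perm (Fin t)), u ≠ 1 ∨ v ≠ 1 →
      (if (∀ i, (u i).1 ≤ m (inl i) + i.1) ∧ ∀ j, (v j).1 ≤ m (inr j) + j.1 then
          pair f (monoChar (Sum.elim (fun i => m (inl i) + i.1 - u i)
            (fun j => m (inr j) + j.1 - v j))) else 0) = 0 := by
    intro u v huv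
    split_ifs with hle
    · apply hmax'
      · rw [← hm, sum_sum_type, sum_sum_type]
        simp only [elim_inl, elim_inr]
        have h2 : ∑ i : Fin r, (m (inl i) + i.1 - (u i).1) + ∑ i, stair r i =
            ∑ i, m (inl i) + ∑ i, stair r i := by
          rw [← Equiv.sum_comp u (stair r), ← sum_add_distrib, Equiv.sum_comp u (stair r),
            ← sum_add_distrib]
          exact sum_congr rfl fun i _ => Nat.sub_add_cancel (hle.1 i)
        have h3 : ∑ i : Fin t, (m (inr i) + i.1 - (v i).1) + ∑ i, stair t i =
            ∑ i, m (inr i) + ∑ i, stair t i := by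
          rw [← Equiv.sum_comp v (stair t), ← sum_add_distrib, Equiv.sum_comp v (stair t),
            ← sum_add_distrib]
          exact sum_congr rfl fun i _ => Nat.sub_add_cancel (hle.2 i)
        omega
      · simp only [weight, elim_inl, elim_inr]
        have h2 : ∑ i : Fin r, i.1 * (m (inl i) + i.1 - (u i).1) + ∑ i : Fin r, i.1 * (u i).1 =
            ∑ i : Fin r, i.1 * m (inl i) + ∑ i : Fin r, i.1 * i.1 := by
          rw [← sum_add_distrib, ← sum_add_distrib]
          refine sum_congr rfl fun i _ => ?_
          rw [← mul_add, ← mul_add, Nat.sub_add_cancel (hle.1 i)]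
        have h3 : ∑ i : Fin t, i.1 * (m (inr i) + i.1 - (v i).1) + ∑ i : Fin t, i.1 * (v i).1 =
            ∑ i : Fin t, i.1 * m (inr i) + ∑ i : Fin t, i.1 * i.1 := by
          rw [← sum_add_distrib, ← sum_add_distrib]
          refine sum_congr rfl fun i _ => ?_
          rw [← mul_add, ← mul_add, Nat.sub_add_cancel (hle.2 i)]
        have h4 : ∀ {r : ℕ} (u : Perm (Fin r)),
            ∑ i : Fin r, i.1 * (u i).1 ≤ ∑ i : Fin r, i.1 * i.1 := by
          intro r u
          rcases eq_or_ne u 1 with rfl | hu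
          · simp
          · exact (sum_mul_perm_lt hu).le
        have h5 := h4 u
        have h6 := h4 v
        rcases huv with hu | hv
        · have := sum_mul_perm_lt hu
          omega
        · have := sum_mul_perm_lt hv
          omega
    · rfl
  rw [h1, sum_eq_single 1, sum_eq_single 1]
  · have h2 : (∀ i, ((1 : Perm (Fin r)) i).1 ≤ m (inl i) + i.1) ∧
        ∀ j, ((1 : Perm (Fin t)) j).1 ≤ m (inr j) + j.1 := by simp
    rw [if_pos h2]
    simp only [Perm.sign_one, Units.val_one, cast_one, one_mul, Perm.one_apply, Nat.add_sub_cancel]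
    congr 2
    ext (i | i) <;> simp
  · intro v _ hv
    rw [hzero 1 v (Or.inr hv), mul_zero]
  · simp
  · intro u _ hu
    exact sum_eq_zero fun v _ => by rw [hzero u v (Or.inl hu), mul_zero]
  · simp

/-- These contents use each number exactly once, with either kind, which gives a multiple of the
regular character. An invariant colouring would give a moved element and its image the same number.
If `w` only changes signs, switching the kind of the colour of an element with sign `-1` pairs off
opposite terms. -/
theorem colourSum_regular (w : W ι) (hw : w ≠ 1) : colourSum (fun k : Fin n ⊕ Fin n → ℕ =>
      if ∀ i, k (inl i) + k (inr i) = 1 then 1 else 0) w = 0 := by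
  have hproj : ∀ (F : ι → Fin n ⊕ Fin n) (i : Fin n), content F (inl i) + content F (inr i) =
        content (fun x => Sum.elim id id (F x)) i := by
    intro F i
    unfold content
    rw [← card_union_of_disjoint]
    · congr 1
      ext x
      simp only [mem_union, mem_filter, mem_univ, true_and]
      rcases F x with y | y <;> simp
    · rw [disjoint_filter]
      intro x _ h
      simp [h]
  by_cases hright : w.right = 1
  · have hleft : ∃ i, w.left i ≠ 1 := by
      by_contra! h
      exact hw (SemidirectProduct.ext (funext h) hright)
    obtain ⟨i₀, hi₀⟩ := hleft
    have hi₁ : w.left i₀ = -1 := (units_eq_one_or _).resolve_left hi₀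
    have hup : ∀ F : ι → Fin n ⊕ Fin n, (fun x => Sum.elim id id (update F i₀ (F i₀).swap x)) =
        fun x => Sum.elim id id (F x) := by
      intro F
      ext x
      rcases eq_or_ne x i₀ with rfl | hx
      · rw [update_self]
        rcases F x with y | y <;> rfl
      · rw [Function.update_of_ne hx]
    refine sum_involution (fun F _ => update F i₀ (F i₀).swap) ?_ ?_ ?_ ?_
    · intro F _
      simp only [hproj, hup]
      rw [← add_mul]
      have : signWeight w F + signWeight w (update F i₀ (F i₀).swap) = 0 := by
        unfold signWeight
        rw [← mul_prod_erase _ _ (mem_univ i₀),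
          ← mul_prod_erase (a := i₀) _ (fun i => Sum.elim (fun _ => (1 : ℂ))
            (fun _ => ((w.left i : ℤ) : ℂ)) (update F i₀ (F i₀).swap i))
            (mem_univ i₀)]
        rw [prod_congr rfl (g := fun i => Sum.elim (fun _ => (1 : ℂ))
            (fun _ => ((w.left i : ℤ) : ℂ)) (F i)) (s₁ := univ.erase i₀)
            (s₂ := univ.erase i₀) (f := fun i => Sum.elim (fun _ => (1 : ℂ))
            (fun _ => ((w.left i : ℤ) : ℂ)) (update F i₀ (F i₀).swap i))
            (fun i hi => by grind)]
        rcases F i₀ with y | y <;> simp [hi₁]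
      rw [this, zero_mul]
    · intro F _ _ h
      have := congrFun h i₀
      rcases hF : F i₀ with y | y <;> simp [hF] at this
    · simp_all
    · simp
  · refine sum_eq_zero fun F hF => ?_
    beta_reduce
    rw [if_neg, mul_zero]
    intro h
    apply hright
    rw [mem_filter] at hF
    ext x
    have h1 := h (Sum.elim id id (F x))
    rw [hproj, content, card_eq_one] at h1
    obtain ⟨y, hy⟩ := h1
    have hx : x ∈ ({y} : Finset ι) := by rw [← hy]; simp
    have hx' : w.right x ∈ ({y} : Finset ι) := by
      rw [← hy]
      have : F (w.right x) = F x := congrFun hF.2 x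
      simp [this]
    simp_all

theorem colourSum_one (Ψ : (Fin r ⊕ Fin t → ℕ) → ℂ) :
    colourSum Ψ (1 : W ι) = ∑ F : ι → Fin r ⊕ Fin t, Ψ (content F) := by
  unfold colourSum
  have h1 : (univ.filter fun F : ι → Fin r ⊕ Fin t => F ∘ (1 : W ι).right = F) =
      univ := filter_true_of_mem fun F _ => rfl
  rw [h1]
  refine sum_congr rfl fun F _ => ?_
  rw [signWeight, prod_eq_one, one_mul]
  simp_all

theorem colourSum_eq_sum_monoChar (Ψ : (Fin r ⊕ Fin t → ℕ) → ℂ) (w : W ι) :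
    colourSum Ψ w = ∑ κ ∈ piAntidiag univ (Fintype.card ι), Ψ κ * monoChar κ w := by
  simp only [monoChar, colourSum, mul_sum]
  rw [sum_comm]
  refine sum_congr rfl fun F _ => ?_
  rw [sum_eq_single (content F)]
  · simp; ring
  · grind
  · intro h
    exact absurd (mem_piAntidiag.mpr ⟨sum_content F, by simp⟩) h

/-- Every irreducible character is one of the `seqChar a b`. -/
theorem exists_seqChar_eq (hn : Fintype.card ι = n) {χ : W ι → ℂ} (hχ : χ ∈ Irr (W ι)) :
    ∃ (a : Fin n → ℕ) (b : Fin n → ℕ), IsExponent (Fintype.card ι) a b ∧ χ = seqChar a b := by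
  classical
  by_contra! h
  have h1 : ∀ (a : Fin n → ℕ) (b : Fin n → ℕ), IsExponent (Fintype.card ι) a b →
      pair χ (seqChar a b) = 0 := by
    intro a b hab
    rw [pair_irr hχ (seqChar_irr hab), if_neg (h a b hab)]
  have h2 := pair_monoChar_eq_zero h1
  -- A missing irreducible character would be orthogonal to all monomial characters, hence to a
  -- function supported at 1 and non-zero there, although its degree is positive.
  have h3 : pair χ (colourSum (fun k : Fin n ⊕ Fin n → ℕ =>
      if ∀ i, k (inl i) + k (inr i) = 1 then 1 else 0)) = 0 := by
    have h4 : pair χ (colourSum (fun k : Fin n ⊕ Fin n → ℕ =>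
      if ∀ i, k (inl i) + k (inr i) = 1 then 1 else 0)) =
      ∑ κ ∈ piAntidiag univ (Fintype.card ι),
        (if ∀ i : Fin n, κ (inl i) + κ (inr i) = 1 then 1 else 0) * pair χ (monoChar κ) := by
      unfold pair
      simp only [colourSum_eq_sum_monoChar, mul_sum]
      rw [sum_comm]
      grind
    rw [h4]
    refine sum_eq_zero fun κ hκ => ?_
    simp_all
  rw [pair_colourSum_right, sum_eq_single 1] at h3
  · rw [colourSum_one] at h3
    obtain ⟨d, ρ, hρ, rfl⟩ := hχ
    have hd : ρ.character 1 ≠ 0 := by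
      rw [Representation.char_one]
      simp only [Module.finrank_fintype_fun_eq_card, Fintype.card_fin, ne_eq, Nat.cast_eq_zero]
      rintro rfl
      exact (bot_ne_top (α := Subrepresentation ρ)) (by
        apply Subrepresentation.toSubmodule_injective
        exact Subsingleton.elim _ _)
    have hs : (∑ F : ι → Fin n ⊕ Fin n,
        if ∀ i, content F (inl i) + content F (inr i) = 1 then (1 : ℂ) else 0) ≠ 0 := by
      rw [sum_boole]
      have : ((univ.filter fun F : ι → Fin n ⊕ Fin n =>
          ∀ i, content F (inl i) + content F (inr i) = 1).card : ℂ) ≠ 0 := by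
        rw [Nat.cast_ne_zero, card_ne_zero]
        obtain ⟨F, hF⟩ := exists_content_eq (ι := ι)
          (κ := (Sum.elim (fun _ => 1) (fun _ => 0) : Fin n ⊕ Fin n → ℕ)) (by simp [hn])
        exact ⟨F, by simp [hF]⟩
      exact this
    have hcard : (Fintype.card (W ι) : ℂ)⁻¹ ≠ 0 := by simp
    grind
  · intro w _ hw
    rw [colourSum_regular w hw, mul_zero]
  · simp

end Irreducibles

/-! ### The characters attached to double partitions -/

section Padding
open Finset

variable {r : ℕ} {p : Multiset ℕ}

/-- The parts of `p` in increasing order, preceded by zeros. -/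
def padSeq (r : ℕ) (p : Multiset ℕ) (i : Fin r) : ℕ :=
  ((p + replicate (r - p.card) 0).sort (· ≤ ·)).getD i 0

/-- The exponents attached to a partition. -/
def expo (r : ℕ) (p : Multiset ℕ) (i : Fin r) : ℕ := padSeq r p i + i

theorem padSeq_succ (hp : p.card ≤ r) :
    padSeq (r + 1) p = Fin.cons 0 (padSeq r p) := by
  ext i
  unfold padSeq
  rw [Nat.succ_sub hp, Multiset.replicate_succ, Multiset.add_cons, Multiset.sort_cons]
  · refine Fin.cases ?_ (fun i => ?_) i <;> simp
  · simp

theorem expo_succ (hp : p.card ≤ r) :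
    expo (r + 1) p = Fin.cons 0 (fun i => expo r p i + 1) := by
  ext i
  unfold expo
  rw [padSeq_succ hp]
  refine Fin.cases ?_ (fun i => ?_) i
  · simp
  · simp; omega

theorem length_padSeq (hp : p.card ≤ r) :
    ((p + replicate (r - p.card) 0).sort (· ≤ ·)).length = r := by
  simp; omega

theorem ofFn_padSeq (hp : p.card ≤ r) :
    ofFn (padSeq r p) = (p + replicate (r - p.card) 0).sort (· ≤ ·) := by
  apply ext_getElem
  · rw [length_padSeq hp, List.length_ofFn]
  · intro i h1 h2
    simp [padSeq, List.getElem?_eq_getElem h2]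

theorem map_padSeq (hp : p.card ≤ r) :
    univ.val.map (padSeq r p) = p + replicate (r - p.card) 0 := by
  rw [Fin.univ_val_map, ofFn_padSeq hp, Multiset.sort_eq]

theorem sum_padSeq (hp : p.card ≤ r) : ∑ i, padSeq r p i = p.sum := by
  rw [sum_eq_multiset_sum, map_padSeq hp]
  simp

theorem padSeq_monotone (hp : p.card ≤ r) : Monotone (padSeq r p) := by
  intro i j hij
  have h : (ofFn (padSeq r p)).Pairwise (· ≤ ·) := by
    rw [ofFn_padSeq hp]; exact Multiset.pairwise_sort _ _
  rw [List.pairwise_ofFn] at h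
  rcases hij.lt_or_eq with h1 | rfl
  · exact h h1
  · exact le_rfl

theorem expo_strictMono (hp : p.card ≤ r) : StrictMono (expo r p) :=
  fun _ _ h => add_lt_add_of_le_of_lt (padSeq_monotone hp h.le) h

theorem sum_expo (hp : p.card ≤ r) :
    ∑ i, expo r p i = p.sum + ∑ i, stair r i := by
  unfold expo
  rw [sum_add_distrib, sum_padSeq hp]
  rfl

/-- The positive parts of a sequence. -/
def partsOf (x : Fin r → ℕ) : Multiset ℕ := (univ.val.map x).filter (· ≠ 0)

theorem card_partsOf_le (x : Fin r → ℕ) : (partsOf x).card ≤ r := by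
  refine (Multiset.card_le_card (filter_le _ _)).trans ?_
  simp

theorem zero_notMem_partsOf (x : Fin r → ℕ) : 0 ∉ partsOf x := by simp [partsOf]

theorem sum_filter_ne_zero (s : Multiset ℕ) : (s.filter (· ≠ 0)).sum = s.sum := by
  induction s using Multiset.induction with
  | empty => simp
  | cons a s ih =>
    by_cases ha : a = 0
    · simp_all
    simp_all

theorem sum_partsOf (x : Fin r → ℕ) : (partsOf x).sum = ∑ i, x i := sum_filter_ne_zero _

theorem filter_ne_zero_add_replicate (s : Multiset ℕ) :
    s.filter (· ≠ 0) + replicate (s.card - (s.filter (· ≠ 0)).card) 0 = s := by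
  have h : s.filter (fun x => ¬ x ≠ 0) = replicate (s.count 0) 0 :=
    (Multiset.filter_congr fun x _ => by simp).trans (Multiset.filter_eq' s 0)
  have h1 := filter_add_not (p := fun x => x ≠ 0) s
  have h2 : s.card = (s.filter (· ≠ 0)).card + s.count 0 := by
    conv_lhs => rw [← h1]
    rw [h]; simp
  grind

theorem padSeq_partsOf {x : Fin r → ℕ} (hx : Monotone x) : padSeq r (partsOf x) = x := by
  apply List.ofFn_injective
  rw [ofFn_padSeq (card_partsOf_le x)]
  have h : partsOf x + replicate (r - (partsOf x).card) 0 = univ.val.map x := by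
    have := filter_ne_zero_add_replicate (univ.val.map x)
    simpa [partsOf] using this
  rw [h, Fin.univ_val_map, coe_sort]
  exact List.mergeSort_eq_self _ (by
    rw [List.pairwise_ofFn]
    intro i j hij
    simpa using hx hij.le)

theorem partsOf_padSeq (hp : p.card ≤ r) (h0 : 0 ∉ p) :
    partsOf (padSeq r p) = p := by
  rw [partsOf, map_padSeq hp, filter_add]
  rw [Multiset.filter_eq_self.mpr fun a ha => ne_of_mem_of_not_mem ha h0, filter_eq_nil.mpr]
  · simp
  · intro a ha
    simp [Multiset.eq_of_mem_replicate ha]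

theorem card_le_sum (h0 : 0 ∉ p) : p.card ≤ p.sum := by
  have := Multiset.card_nsmul_le_sum (s := p) (a := 1) (fun x hx =>
    Nat.one_le_iff_ne_zero.mpr fun h => h0 (h ▸ hx))
  simpa using this

end Padding

/-! ### Comparison with the characters attached to double partitions. -/

section Characters
open Finset

variable {ι : Type} [Fintype ι] [DecidableEq ι]

variable {r : ℕ} {p : Multiset ℕ}

/-- The character of the symmetric group attached to an increasing sequence of exponents. -/
def symSeq (a : Fin r → ℕ) (σ : Perm ι) : ℂ :=
  ∑ F ∈ univ.filter fun F : ι → Fin r => F ∘ σ = F, altDelta a (stair r + content F)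

theorem altDelta_cons (a e : Fin r → ℕ) :
    altDelta (Fin.cons 0 (fun i => a i + 1) : Fin (r + 1) → ℕ)
      (Fin.cons 0 (fun i => e i + 1) : Fin (r + 1) → ℕ) = altDelta a e := by
  unfold altDelta
  rw [Fintype.sum_equiv Perm.decomposeFin _ (fun p : Fin (r + 1) × Perm (Fin r) =>
    ((Perm.sign (Perm.decomposeFin.symm p) : ℤ) : ℂ) *
    if (Fin.cons 0 (fun i => e i + 1) : Fin (r + 1) → ℕ) ∘ (Perm.decomposeFin.symm p) =
      (Fin.cons 0 (fun i => a i + 1) : Fin (r + 1) → ℕ) then 1 else 0) (fun u => by simp),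
    sum_prod_type]
  rw [sum_eq_single 0]
  · refine sum_congr rfl fun u _ => ?_
    have : ((Fin.cons 0 (fun i => e i + 1) : Fin (r + 1) → ℕ) ∘
        (Perm.decomposeFin.symm (0, u)) = (Fin.cons 0 (fun i => a i + 1) : Fin (r + 1) → ℕ)) ↔
        e ∘ u = a := by
      simp only [funext_iff, Fin.forall_fin_succ, comp]
      simp
    simp [this]
  · intro j _ hj
    refine sum_eq_zero fun u _ => ?_
    rw [if_neg, mul_zero]
    intro h
    have := congrFun h 0
    obtain ⟨k, rfl⟩ := Fin.exists_succ_eq.mpr hj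
    simp at this
  · simp

/-- A zero part is harmless: exponent 0 in position 0 can only arise from the staircase exponent 0
with an unused colour, so the colourings are those by the other colours. This frees the number of
variables in the Frobenius formula. -/
theorem symSeq_cons (a : Fin r → ℕ) (σ : Perm ι) :
    symSeq (Fin.cons 0 (fun i => a i + 1) : Fin (r + 1) → ℕ) σ = symSeq a σ := by
  symm
  refine sum_of_injOn (fun F i => (F i).succ) ?_ ?_ ?_ ?_
  · intro F _ G _ h
    ext i
    have := congrFun h i
    simpa [Fin.ext_iff] using this
  · intro F hF
    simp only [coe_filter, mem_univ, true_and, Set.mem_ofPred_eq] at hF ⊢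
    ext i
    have := congrFun hF i
    grind
  · intro F hF hF'
    by_contra hne
    obtain ⟨u, -, hu⟩ := exists_ne_zero_of_sum_ne_zero hne
    have hu' := right_ne_zero_of_mul hu
    split_ifs at hu' with h
    · have h0 := congrFun h 0
      simp only [comp, Pi.add_apply, stair, Fin.cons_zero] at h0
      have hu0 : u 0 = 0 := by apply Fin.ext; rw [Fin.val_zero]; omega
      rw [hu0] at h0
      have hc : ∀ i, F i ≠ 0 := by
        have : content F 0 = 0 := by omega
        rw [content, card_eq_zero] at this
        simp_all
      apply hF'
      choose G hG using fun i => Fin.exists_succ_eq.mpr (hc i)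
      refine ⟨G, ?_, funext hG⟩
      simp only [coe_filter, mem_univ, true_and, Set.mem_ofPred_eq, mem_filter] at hF ⊢
      ext i
      have := congrFun hF i
      grind
    · exact hu' rfl
  · intro F _
    rw [← altDelta_cons]
    congr 1
    ext i
    refine Fin.cases ?_ (fun j => ?_) i
    · simp [stair, content, Fin.succ_ne_zero]
    · simp [stair, content]; omega

/-- Recolouring by `u` transfers the permutation of the exponents of the Vandermonde determinant to
the colours. -/
theorem symChar_eq (p : Multiset ℕ) (σ : Perm ι) : symChar p σ = symSeq (expo p.card p) σ := by
  unfold symChar symSeq altDelta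
  rw [sum_comm]
  refine sum_congr rfl fun u _ => ?_
  rw [← mul_sum]
  congr 1
  rw [← sum_filter, filter_filter, sum_const, nsmul_eq_mul, mul_one,
    Nat.subtype_card (s := univ.filter fun f : ι → Fin p.card => (∀ x, f (σ x) = f x) ∧
      ∀ i, Nat.card {x // f x = i} + (u i : ℕ) = (p.sort (· ≤ ·)).getD i 0 + i) (by simp)]
  congr 1
  have hc : ∀ (f : ι → Fin p.card) i, Nat.card {x // f x = i} = content f i := fun f i =>
    Nat.subtype_card _ (by simp)
  have hcc : ∀ (f : ι → Fin p.card) i, content (u ∘ f) (u i) = content f i := by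
    simp [content]
  refine card_bij' (fun f _ => u ∘ f) (fun f _ => u.symm ∘ f) ?_ ?_ ?_ ?_
  · intro f hf
    simp only [mem_filter, mem_univ, true_and, hc] at hf ⊢
    refine ⟨?_, ?_⟩
    · ext i; simp [hf.1]
    · ext i
      have := hf.2 i
      simp only [comp, Pi.add_apply, stair, expo, padSeq, Nat.sub_self]
      rw [hcc f i]
      simp at this ⊢
      omega
  · intro f hf
    simp only [mem_filter, mem_univ, true_and, hc] at hf ⊢
    refine ⟨fun x => ?_, fun i => ?_⟩
    · have := congrFun hf.1 x
      grind
    · have := congrFun hf.2 i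
      simp only [comp, Pi.add_apply, stair, expo, padSeq, Nat.sub_self] at this
      have h2 := hcc (u.symm ∘ f) i
      have h3 : u ∘ (u.symm ∘ f) = f := by ext; simp
      rw [h3] at h2
      simp at this ⊢
      omega
  · intro f _; ext; simp
  · intro f _; ext; simp

theorem symSeq_expo (hr : p.card ≤ r) (σ : Perm ι) :
    symSeq (expo r p) σ = symChar p σ := by
  induction r, hr using Nat.le_induction with
  | base => exact (symChar_eq p σ).symm
  | succ r hr ih => rw [expo_succ hr, symSeq_cons, ih]

theorem symSeq_ne_zero {a : Fin r → ℕ} {σ : Perm ι} (h : symSeq a σ ≠ 0) :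
    ∑ i, a i = Fintype.card ι + ∑ i, stair r i := by
  obtain ⟨F, -, hF⟩ := exists_ne_zero_of_sum_ne_zero h
  obtain ⟨u, -, hu⟩ := exists_ne_zero_of_sum_ne_zero hF
  have hu' := right_ne_zero_of_mul hu
  split_ifs at hu' with h'
  · rw [← h', comp_def, Equiv.sum_comp u (fun i => (stair r + content F) i)]
    simp only [Pi.add_apply, sum_add_distrib, sum_content]
    ring
  · exact absurd rfl hu'

/-- The colourings are sorted by the set `S` of the elements with a colour of the first kind; this
set is invariant when the colouring is, and the signs enter through its complement only. -/
theorem seqChar_eq_sum_subsets {t : ℕ} (a : Fin r → ℕ) (b : Fin t → ℕ) (w : W ι) :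
    seqChar a b w = ∑ S : Finset ι,
    if hS : ∀ x, w.right x ∈ S ↔ x ∈ S then symSeq a (w.right.subtypePerm (p := (· ∈ S)) hS) *
      (symSeq b (w.right.subtypePerm (p := (· ∉ S)) fun x => not_congr (hS x)) *
        ∏ i ∈ Sᶜ, ((w.left i : ℤ) : ℂ))
    else 0 := by
  unfold seqChar colourSum
  rw [← sum_fiberwise _ (fun F : ι → Fin r ⊕ Fin t => univ.filter fun i => (F i).isLeft)]
  refine sum_congr rfl fun S _ => ?_
  split_ifs with hS
  · unfold symSeq
    rw [← mul_assoc, sum_mul_sum, ← sum_product', sum_mul]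
    symm
    refine sum_bij (fun (p : (S → Fin r) × ({x // x ∉ S} → Fin t)) _ (i : ι) =>
      if hi : i ∈ S then inl (p.1 ⟨i, hi⟩) else inr (p.2 ⟨i, hi⟩)) ?_ ?_ ?_ ?_
    · rintro ⟨F, G⟩ hFG
      simp only [mem_product, mem_filter, mem_univ, true_and] at hFG ⊢
      refine ⟨?_, ?_⟩
      · ext i : 1
        by_cases hi : i ∈ S
        · have := congrFun hFG.1 ⟨i, hi⟩
          simp_all
        · have := congrFun hFG.2 ⟨i, hi⟩
          simp_all
      grind
    · rintro ⟨F, G⟩ _ ⟨F', G'⟩ _ h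
      simp only [Prod.mk.injEq]
      constructor
      · ext ⟨i, hi⟩ : 1
        have := congrFun h i
        simpa [hi] using this
      · ext ⟨i, hi⟩ : 1
        have := congrFun h i
        simpa [hi] using this
    · intro H hH
      simp only [mem_filter, mem_univ, true_and] at hH
      obtain ⟨hinv, hSS⟩ := hH
      have h1 : ∀ i : S, ∃ j, inl j = H i.1 := by
        rintro ⟨i, hi⟩
        rw [← hSS] at hi
        simp only [mem_filter, mem_univ, true_and] at hi
        obtain ⟨j, hj⟩ := Sum.isLeft_iff.mp hi
        exact ⟨j, hj.symm⟩
      have h2 : ∀ i : {x // x ∉ S}, ∃ j, inr j = H i.1 := by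
        rintro ⟨i, hi⟩
        rw [← hSS] at hi
        simp only [mem_filter, mem_univ, true_and, Sum.not_isLeft] at hi
        obtain ⟨j, hj⟩ := Sum.isRight_iff.mp hi
        exact ⟨j, hj.symm⟩
      choose F hF using h1
      choose G hG using h2
      refine ⟨(F, G), ?_, ?_⟩
      · simp only [mem_product, mem_filter, mem_univ, true_and]
        constructor
        · ext x : 1
          have := congrFun hinv x.1
          apply Sum.inl_injective (β := Fin t)
          simp_all
        · ext x : 1
          have := congrFun hinv x.1
          apply Sum.inr_injective (α := Fin r)
          simp_all
      grind
    · rintro ⟨F, G⟩ _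
      have hw : ∏ i ∈ Sᶜ, ((w.left i : ℤ) : ℂ) = signWeight w (fun i =>
          if hi : i ∈ S then inl (F ⟨i, hi⟩) else inr (G ⟨i, hi⟩)) := by
        unfold signWeight
        rw [← prod_mul_prod_compl S, prod_eq_one (s := S), one_mul]
        · refine prod_congr rfl fun i hi => ?_
          simp_all
        · intro i hi; simp [hi]
      rw [mul_comm, hw]
      unfold altPair
      have hl : content (fun i => if hi : i ∈ S then (inl (F ⟨i, hi⟩) : Fin r ⊕ Fin t)
          else inr (G ⟨i, hi⟩)) ∘ inl = content F := by
        ext j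
        symm
        refine card_bij (fun i _ => i.1) ?_ ?_ ?_
        · grind
        · intro i _ i' _ h; exact Subtype.ext h
        · intro i hi
          by_cases h : i ∈ S
          · simp_all
          · simp [h] at hi
      have hr : content (fun i => if hi : i ∈ S then (inl (F ⟨i, hi⟩) : Fin r ⊕ Fin t)
          else inr (G ⟨i, hi⟩)) ∘ inr = content G := by
        ext j
        symm
        refine card_bij (fun i _ => i.1) ?_ ?_ ?_
        · grind
        · intro i _ i' _ h; exact Subtype.ext h
        · intro i hi
          by_cases h : i ∈ S
          · simp [h] at hi
          simp_all
      rw [hl, hr]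
  · refine sum_eq_zero fun F hF => absurd ?_ hS
    simp only [mem_filter, mem_univ, true_and] at hF
    intro x
    have := congrFun hF.1 x
    grind

theorem bChar_eq {q : Multiset ℕ} {t : ℕ} (hp : p.card ≤ r) (hq : q.card ≤ t) :
    bChar (ι := ι) p q = seqChar (expo r p) (expo t q) := by
  ext w
  rw [seqChar_eq_sum_subsets, bChar]
  refine sum_congr rfl fun S _ => ?_
  by_cases hS : ∀ x, w.right x ∈ S ↔ x ∈ S
  · rw [dif_pos hS]
    by_cases hc : S.card = p.sum
    · rw [dif_pos ⟨hc, hS⟩, symSeq_expo hp, symSeq_expo hq]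
    -- The condition on the size of `S` is automatic, because the Frobenius formula gives 0 when the
    -- degrees do not fit.
    · rw [dif_neg fun h => hc h.1]
      by_contra hne
      have := symSeq_ne_zero (left_ne_zero_of_mul (Ne.symm hne))
      rw [sum_expo hp, card_coe] at this
      omega
  grind

end Characters

/-! ### Orthogonality and reproducing property -/

section Reproducing
open Finset

variable {ι : Type} [Fintype ι] [DecidableEq ι] {r t : ℕ}

/-- Functions of two rows of exponents that are alternating in each row. -/
def IsAltRows (Θ : (Fin r ⊕ Fin t → ℕ) → ℂ) : Prop :=
  (∀ f, IsAlt fun e => Θ (Sum.elim e f)) ∧ ∀ e, IsAlt fun f => Θ (Sum.elim e f)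

/-- The exponents of the empty double partition. -/
def stairs (r t : ℕ) : Fin r ⊕ Fin t → ℕ := Sum.elim (stair r) (stair t)

/-- The indicator of a pair of exponent sequences, made alternating. -/
def altDeltaRows (a : Fin r → ℕ) (b : Fin t → ℕ) (e : Fin r ⊕ Fin t → ℕ) : ℂ :=
  altDelta a (e ∘ inl) * altDelta b (e ∘ inr)

theorem isAltRows_altDeltaRows (a : Fin r → ℕ) (b : Fin t → ℕ) : IsAltRows (altDeltaRows a b) := by
  constructor
  · intro f e i j hij
    simp only [altDeltaRows, elim_comp_inl, elim_comp_inr]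
    rw [isAlt_altDelta a e i j hij, neg_mul]
  · intro f e i j hij
    simp only [altDeltaRows, elim_comp_inl, elim_comp_inr]
    rw [isAlt_altDelta b e i j hij, mul_neg]

theorem seqChar_eq_colourSum (a : Fin r → ℕ) (b : Fin t → ℕ) :
    seqChar (ι := ι) a b = colourSum fun k => altDeltaRows a b (stairs r t + k) := rfl

theorem card_strictMono_comp {e : Fin r → ℕ} (he : Injective e) :
    ∑ u : Perm (Fin r), (if StrictMono (e ∘ u) then (1 : ℂ) else 0) = 1 := by
  classical
  rw [sum_eq_single (Tuple.sort e)]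
  · rw [if_pos]
    exact (Tuple.monotone_sort e).strictMono_of_injective (he.comp (Tuple.sort e).injective)
  · intro u _ hu
    rw [if_neg]
    intro h
    apply hu
    have := Tuple.comp_sort_eq_comp_iff_monotone.mpr h.monotone
    ext i
    exact congrArg Fin.val (he (congrFun this i))
  · simp

/-- Expansion of a function that is alternating in each row. -/
theorem IsAltRows.expand {Θ : (Fin r ⊕ Fin t → ℕ) → ℂ} (hΘ : IsAltRows Θ)
    (S : Finset ((Fin r → ℕ) × (Fin t → ℕ))) (e : Fin r → ℕ) (f : Fin t → ℕ)
    (hS : ∀ (u : Perm (Fin r)) (v : Perm (Fin t)),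
      (e ∘ u, f ∘ v) ∈ S ↔ StrictMono (e ∘ u) ∧ StrictMono (f ∘ v)) :
    Θ (Sum.elim e f) = ∑ p ∈ S, altDeltaRows p.1 p.2 (Sum.elim e f) * Θ (Sum.elim p.1 p.2) := by
  classical
  by_cases he : Injective e
  swap
  · rw [(hΘ.1 f).eq_zero he, sum_eq_zero]
    intro p _
    rw [altDeltaRows, elim_comp_inl, (isAlt_altDelta p.1).eq_zero he]
    simp
  by_cases hf : Injective f
  swap
  · rw [(hΘ.2 e).eq_zero hf, sum_eq_zero]
    intro p _
    rw [altDeltaRows, elim_comp_inr, (isAlt_altDelta p.2).eq_zero hf]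
    simp
  have h1 : ∀ p ∈ S, altDeltaRows p.1 p.2 (Sum.elim e f) * Θ (Sum.elim p.1 p.2) =
      ∑ u : Perm (Fin r), ∑ v : Perm (Fin t),
        if (e ∘ u, f ∘ v) = p then Θ (Sum.elim e f) else 0 := by
    rintro ⟨a, b⟩ _
    have h0 : altDeltaRows a b (Sum.elim e f) = altDelta a e * altDelta b f := rfl
    rw [h0, altDelta, altDelta, sum_mul_sum, sum_mul]
    refine sum_congr rfl fun u _ => ?_
    rw [sum_mul]
    refine sum_congr rfl fun v _ => ?_
    by_cases h : (e ∘ u, f ∘ v) = (a, b)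
    · obtain ⟨rfl, rfl⟩ := Prod.mk.inj h
      have h2 : Θ (Sum.elim (e ∘ u) (f ∘ v)) = _ := (hΘ.1 (f ∘ v)).perm e u
      have h3 : Θ (Sum.elim e (f ∘ v)) = _ := (hΘ.2 e).perm f v
      have hs : ∀ s : ℤˣ, ((s : ℤ) : ℂ) * ((s : ℤ) : ℂ) = 1 := by
        intro s; rcases units_eq_one_or s with rfl | rfl <;> simp
      grind
    grind
  rw [sum_congr rfl h1, sum_comm]
  have h2 : ∀ u : Perm (Fin r), ∑ p ∈ S, ∑ v : Perm (Fin t),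
      (if (e ∘ u, f ∘ v) = p then Θ (Sum.elim e f) else 0) = ∑ v : Perm (Fin t),
      (if StrictMono (e ∘ u) then 1 else 0) * (if StrictMono (f ∘ v) then 1 else 0) *
        Θ (Sum.elim e f) := by
    intro u
    rw [sum_comm]
    refine sum_congr rfl fun v _ => ?_
    rw [sum_ite_eq]
    grind
  rw [sum_congr rfl fun u _ => h2 u]
  simp only [← sum_mul, ← mul_sum]
  rw [card_strictMono_comp he, card_strictMono_comp hf]
  simp

theorem pair_sum_right (f : W ι → ℂ) {T : Type} (S : Finset T) (g : T → W ι → ℂ) (c : T → ℂ) :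
    pair f (fun w => ∑ p ∈ S, g p w * c p) = ∑ p ∈ S, pair f (g p) * c p := by
  unfold pair
  simp only [mul_sum, sum_mul]
  rw [sum_comm]
  grind

/-- A reproducing property: expanding `Θ` by its values on increasing pairs expands the class
function in the orthonormal system `seqChar`, and the pairing reads off one coefficient.
Multiplicities in restrictions to parabolic subgroups are evaluated in this way. -/
theorem pair_colourSum_of_isAltRows {a : Fin r → ℕ} {b : Fin t → ℕ}
    (h : IsExponent (Fintype.card ι) a b) {Θ : (Fin r ⊕ Fin t → ℕ) → ℂ} (hΘ : IsAltRows Θ) :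
    pair (seqChar (ι := ι) a b) (colourSum fun k => Θ (stairs r t + k)) = Θ (Sum.elim a b) := by
  classical
  set M := Fintype.card ι + ∑ i, stair r i + ∑ j, stair t j with hM
  -- All exponents that occur have total `M`, which bounds each of them; hence a finite set of
  -- increasing pairs suffices.
  let S : Finset ((Fin r → ℕ) × (Fin t → ℕ)) := (piFinset (fun _ : Fin r => range (M + 1)) ×ˢ
      piFinset (fun _ : Fin t => range (M + 1))).filter
        fun p => StrictMono p.1 ∧ StrictMono p.2 ∧ ∑ i, p.1 i + ∑ j, p.2 j = M
  have hmem : ∀ a' b', (a', b') ∈ S ↔ StrictMono a' ∧ StrictMono b' ∧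
      ∑ i, a' i + ∑ j, b' j = M := by
    intro a' b'
    simp only [S, mem_filter, mem_product, mem_piFinset, mem_range, and_iff_right_iff_imp]
    rintro ⟨-, -, hs⟩
    constructor
    · intro i
      have := single_le_sum (f := a') (fun _ _ => Nat.zero_le _) (mem_univ i)
      omega
    · intro i
      have := single_le_sum (f := b') (fun _ _ => Nat.zero_le _) (mem_univ i)
      omega
  have hexp : (colourSum fun k => Θ (stairs r t + k) : W ι → ℂ) =
      fun w => ∑ p ∈ S, seqChar p.1 p.2 w * Θ (Sum.elim p.1 p.2) := by
    ext w
    simp only [seqChar_eq_colourSum, colourSum, sum_mul]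
    rw [sum_comm]
    refine sum_congr rfl fun F _ => ?_
    have hs : stairs r t + content F = Sum.elim (stair r + content F ∘ inl)
        (stair t + content F ∘ inr) := by
      ext (i | i) <;> rfl
    rw [hs, hΘ.expand S, mul_sum]
    · grind
    · intro u v
      have : ∑ i, ((stair r + content F ∘ inl) ∘ u) i +
          ∑ j, ((stair t + content F ∘ inr) ∘ v) j = M := by
        have h1 := Equiv.sum_comp u (stair r + content F ∘ inl)
        have h2 := Equiv.sum_comp v (stair t + content F ∘ inr)
        have h3 := sum_content F
        rw [sum_sum_type] at h3
        simp only [Pi.add_apply, sum_add_distrib, comp] at h1 h2 h3 ⊢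
        omega
      grind
  rw [hexp, pair_sum_right, sum_eq_single (a, b)]
  · rw [pair_seqChar_of_isExponent h h, if_pos ⟨rfl, rfl⟩, one_mul]
  · rintro ⟨a', b'⟩ hp hne
    rw [hmem] at hp
    rw [pair_seqChar_of_isExponent h ⟨hp.1, hp.2.1, hp.2.2⟩, if_neg, zero_mul]
    rintro ⟨rfl, rfl⟩
    exact hne rfl
  · intro hn
    exact absurd ((hmem a b).mpr ⟨h.fst, h.snd, h.sum⟩) hn

theorem conj_altDelta (a e : Fin r → ℕ) : starRingEnd ℂ (altDelta a e) = altDelta a e := by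
  unfold altDelta
  rw [map_sum]
  refine sum_congr rfl fun u _ => ?_
  split_ifs <;> simp

theorem conj_seqChar (a : Fin r → ℕ) (b : Fin t → ℕ) (w : W ι) :
    starRingEnd ℂ (seqChar a b w) = seqChar a b w := by
  unfold seqChar colourSum altPair signWeight
  rw [map_sum]
  refine sum_congr rfl fun F _ => ?_
  rw [map_mul, map_mul, conj_altDelta, conj_altDelta, map_prod]
  congr 1
  refine prod_congr rfl fun i _ => ?_
  rcases F i with x | x <;> simp

theorem isExponent_expo {p q : Multiset ℕ} {n : ℕ} (h : p.sum + q.sum = n) (hp : p.card ≤ r)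
    (hq : q.card ≤ t) : IsExponent n (expo r p) (expo t q) where
  fst := expo_strictMono hp
  snd := expo_strictMono hq
  sum := by rw [sum_expo hp, sum_expo hq]; omega

theorem Bipartition.card_fst_le {n : ℕ} (A : Bipartition n) : A.fst.card ≤ n :=
  (card_le_sum A.fst_pos).trans (by have := A.sum_eq; omega)

theorem Bipartition.card_snd_le {n : ℕ} (A : Bipartition n) : A.snd.card ≤ n :=
  (card_le_sum A.snd_pos).trans (by have := A.sum_eq; omega)

theorem chi_eq_seqChar {n : ℕ} (A : Bipartition n) (hr : n ≤ r) (ht : n ≤ t) :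
    chi A = seqChar (expo r A.fst) (expo t A.snd) :=
  bChar_eq (A.card_fst_le.trans hr) (A.card_snd_le.trans ht)

theorem chi_mem_irr {n : ℕ} (A : Bipartition n) : chi A ∈ Irr (W (Fin n)) := by
  rw [chi_eq_seqChar A le_rfl le_rfl]
  exact seqChar_irr (by
    rw [Fintype.card_fin]
    exact isExponent_expo A.sum_eq A.card_fst_le A.card_snd_le)

theorem Bipartition.ext' {n : ℕ} {A B : Bipartition n} (h1 : A.fst = B.fst) (h2 : A.snd = B.snd) :
    A = B := by
  cases A; simp_all

theorem partsOf_expo_sub {p : Multiset ℕ} (hp : p.card ≤ r) (h0 : 0 ∉ p) :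
    partsOf (fun i => expo r p i - i) = p := by
  have : (fun i => expo r p i - i) = padSeq r p := by simp [expo]
  rw [this, partsOf_padSeq hp h0]

theorem chi_injective {n : ℕ} : Injective (chi (n := n)) := by
  intro A B h
  rw [chi_eq_seqChar A le_rfl le_rfl, chi_eq_seqChar B le_rfl le_rfl] at h
  have hA := isExponent_expo A.sum_eq A.card_fst_le A.card_snd_le
  have hB := isExponent_expo B.sum_eq B.card_fst_le B.card_snd_le
  have h1 := pair_seqChar_of_isExponent (ι := Fin n) (by rwa [Fintype.card_fin])
    (by rwa [Fintype.card_fin] : IsExponent (Fintype.card (Fin n)) (expo n B.fst) (expo n B.snd))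
    (a := expo n A.fst) (b := expo n A.snd)
  rw [← h, pair_seqChar_of_isExponent (by rwa [Fintype.card_fin]) (by rwa [Fintype.card_fin]),
    if_pos ⟨rfl, rfl⟩] at h1
  split_ifs at h1 with h2
  · refine Bipartition.ext' ?_ ?_
    · rw [← partsOf_expo_sub A.card_fst_le A.fst_pos, h2.1, partsOf_expo_sub B.card_fst_le B.fst_pos]
    · rw [← partsOf_expo_sub A.card_snd_le A.snd_pos, h2.2, partsOf_expo_sub B.card_snd_le B.snd_pos]
  · exact absurd h1 one_ne_zero

theorem StrictMono.monotone_sub {a : Fin r → ℕ} (ha : StrictMono a) :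
    Monotone fun i => a i - i := by
  have key : ∀ (d : ℕ) (i j : Fin r), j.1 = i.1 + d → a i + d ≤ a j := by
    intro d
    induction d with
    | zero => grind
    | succ d ih =>
      intro i j h
      have h1 := ih i ⟨i.1 + d, by omega⟩ rfl
      have h2 := ha (show (⟨i.1 + d, by omega⟩ : Fin r) < j from Fin.lt_def.mpr (by simp; omega))
      omega
  intro i j hij
  have := key (j.1 - i.1) i j (by omega)
  grind

/-- Together with `chi_mem_irr` and `chi_injective` this is the classification of the irreducible
characters by double partitions. -/
theorem exists_chi_eq {n : ℕ} {χ : W (Fin n) → ℂ} (hχ : χ ∈ Irr (W (Fin n))) :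
    ∃ A : Bipartition n, χ = chi A := by
  obtain ⟨a, b, h, rfl⟩ := exists_seqChar_eq (Fintype.card_fin n) hχ
  rw [Fintype.card_fin] at h
  have h1 : ∀ {a : Fin n → ℕ}, StrictMono a →
      ∑ i, (a i - i.1) + ∑ i, stair n i = ∑ i, a i := fun {a} ha => by
    rw [← sum_add_distrib]
    exact sum_congr rfl fun i _ => Nat.sub_add_cancel (StrictMono.stair_le ha i)
  have h2 : ∀ {a : Fin n → ℕ}, StrictMono a → expo n (partsOf fun i => a i - i) = a :=
    fun {a} ha => by
      ext i
      rw [expo, padSeq_partsOf (StrictMono.monotone_sub ha)]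
      exact Nat.sub_add_cancel (StrictMono.stair_le ha i)
  refine ⟨⟨partsOf fun i => a i - i, partsOf fun i => b i - i, zero_notMem_partsOf _,
    zero_notMem_partsOf _, ?_⟩, ?_⟩
  · rw [sum_partsOf, sum_partsOf]
    have := h.sum
    have := h1 h.fst
    have := h1 h.snd
    omega
  · rw [chi_eq_seqChar _ le_rfl le_rfl, h2 h.fst, h2 h.snd]

theorem charInner_chi {n : ℕ} (f : W (Fin n) → ℂ) (A : Bipartition n) :
    charInner f (chi A) = (Fintype.card (W (Fin n)) : ℂ)⁻¹ * ∑ g, f g * chi A g := by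
  unfold charInner
  rw [chi_eq_seqChar A le_rfl le_rfl]
  simp only [conj_seqChar]

theorem chi_conj {n : ℕ} (A : Bipartition n) (x g : W (Fin n)) : chi A (x * g * x⁻¹) = chi A g := by
  obtain ⟨d, ρ, -, h⟩ := chi_mem_irr A
  rw [h, Representation.char_conj]

/-- Frobenius reciprocity; `f` need not be a class function, since only the invariance of `chi A`
under conjugation is used. -/
theorem charInner_indChar {n : ℕ} (H : Subgroup (W (Fin n))) [DecidablePred (· ∈ H)]
    (f : W (Fin n) → ℂ) (A : Bipartition n) :
    charInner (indChar H f) (chi A) = (Nat.card H : ℂ)⁻¹ * ∑ g with g ∈ H, f g * chi A g := by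
  rw [charInner_chi]
  unfold indChar
  simp only [mul_assoc, mul_sum, sum_mul]
  rw [sum_comm]
  have h1 : ∀ x : W (Fin n), ∑ g, (Fintype.card (W (Fin n)) : ℂ)⁻¹ * ((Nat.card H : ℂ)⁻¹ *
      ((if x⁻¹ * (g * x) ∈ H then f (x⁻¹ * (g * x)) else 0) * chi A g)) =
      (Fintype.card (W (Fin n)) : ℂ)⁻¹ * ∑ g with g ∈ H, (Nat.card H : ℂ)⁻¹ * (f g * chi A g) := by
    intro x
    rw [← mul_sum, sum_filter]
    congr 1
    refine Fintype.sum_equiv (MulAut.conj x⁻¹).toEquiv _ _ fun g => ?_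
    have : (MulAut.conj x⁻¹).toEquiv g = x⁻¹ * (g * x) := by simp [mul_assoc]
    rw [this]
    have h2 : chi A (x⁻¹ * (g * x)) = chi A g := by
      have := chi_conj A x⁻¹ g
      rwa [inv_inv, mul_assoc] at this
    rw [h2]
    split_ifs <;> simp
  simp_all

end Reproducing

/-! ### Chains of strips -/

section Chains
open Finset

variable {r t : ℕ}

/-- The double Pieri rule: a pair of rows arises from another one by adding `d` boxes, no two of
them in the same column of a row. -/
structure Strip (d : ℕ) (x : Fin r → ℕ) (y : Fin t → ℕ) (x' : Fin r → ℕ) (y' : Fin t → ℕ) :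
    Prop where
  fst_le : ∀ i, x i ≤ x' i
  snd_le : ∀ i, y i ≤ y' i
  fst_lt : ∀ i j, i < j → x' i ≤ x j
  snd_lt : ∀ i j, i < j → y' i ≤ y j
  sum_eq : ∑ i, x' i + ∑ j, y' j = ∑ i, x i + ∑ j, y j + d

/-- Iterated strips. -/
inductive Chain : List ℕ → (Fin r → ℕ) → (Fin t → ℕ) → (Fin r → ℕ) → (Fin t → ℕ) → Prop
  | nil (x y) : Chain [] x y x y
  | cons {d ds x y x' y' x'' y''} : Strip d x y x' y' → Chain ds x' y' x'' y'' →
      Chain (d :: ds) x y x'' y''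

theorem sum_piAntidiag_sum (d : ℕ) (g : (Fin r ⊕ Fin t → ℕ) → ℂ) :
    ∑ β ∈ piAntidiag univ d, g β = ∑ p ∈ HasAntidiagonal.antidiagonal d,
      ∑ β ∈ piAntidiag univ p.1, ∑ γ ∈ piAntidiag univ p.2, g (Sum.elim β γ) := by
  simp only [← sum_product']
  rw [sum_sigma']
  symm
  refine sum_bij' (fun p _ => Sum.elim p.2.1 p.2.2)
    (fun β _ => ⟨(∑ i, β (inl i), ∑ j, β (inr j)), (β ∘ inl, β ∘ inr)⟩)
    ?_ ?_ ?_ ?_ ?_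
  · simp_all
  · simp_all
  · simp_all
  · intro β h
    ext (i | i) <;> rfl
  · intros; rfl

theorem IsAltRows.shiftSum {Θ : (Fin r ⊕ Fin t → ℕ) → ℂ} (hΘ : IsAltRows Θ) (d : ℕ) :
    IsAltRows (TypeB.shiftSum d Θ) := by
  have h0 : ∀ e f, TypeB.shiftSum d Θ (Sum.elim e f) = ∑ p ∈ HasAntidiagonal.antidiagonal d,
      ∑ γ ∈ piAntidiag univ p.2, TypeB.shiftSum p.1 (fun e => Θ (Sum.elim e (f + γ))) e := by
    intro e f
    unfold TypeB.shiftSum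
    rw [sum_piAntidiag_sum]
    refine sum_congr rfl fun p _ => ?_
    rw [sum_comm]
    refine sum_congr rfl fun γ _ => sum_congr rfl fun β _ => ?_
    congr 1
    ext (i | i) <;> rfl
  have h1 : ∀ e f, TypeB.shiftSum d Θ (Sum.elim e f) = ∑ p ∈ HasAntidiagonal.antidiagonal d,
      ∑ β ∈ piAntidiag univ p.1, TypeB.shiftSum p.2 (fun f => Θ (Sum.elim (e + β) f)) f := by
    intro e f
    unfold TypeB.shiftSum
    rw [sum_piAntidiag_sum]
    refine sum_congr rfl fun p _ => sum_congr rfl fun γ _ => sum_congr rfl fun β _ => ?_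
    congr 1
    ext (i | i) <;> rfl
  constructor
  · intro f e i j hij
    simp only [h0, ← sum_neg_distrib]
    exact sum_congr rfl fun p _ => sum_congr rfl fun γ _ => ((hΘ.1 (f + γ)).shiftSum p.1) e i j hij
  · intro e f i j hij
    simp only [h1, ← sum_neg_distrib]
    exact sum_congr rfl fun p _ => sum_congr rfl fun γ _ => ((hΘ.2 (e + γ)).shiftSum p.2) f i j hij

theorem IsAltRows.shifts {Θ : (Fin r ⊕ Fin t → ℕ) → ℂ} (hΘ : IsAltRows Θ) (ds : List ℕ) :
    IsAltRows (TypeB.shifts ds Θ) := by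
  induction ds with
  | nil => exact hΘ
  | cons d ds ih => exact ih.shiftSum d

theorem IsAltRows.pieri {Θ : (Fin r ⊕ Fin t → ℕ) → ℂ} (hΘ : IsAltRows Θ) {e : Fin r → ℕ}
    {f : Fin t → ℕ} (he : StrictMono e) (hf : StrictMono f) (d : ℕ) :
    TypeB.shiftSum d Θ (Sum.elim e f) = ∑ p ∈ HasAntidiagonal.antidiagonal d,
      ∑ β ∈ (piAntidiag univ p.1).filter (fun β : Fin r → ℕ => ∀ i j, i < j → e i + β i < e j),
      ∑ γ ∈ (piAntidiag univ p.2).filter (fun β : Fin t → ℕ => ∀ i j, i < j → f i + β i < f j),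
        Θ (Sum.elim (e + β) (f + γ)) := by
  unfold TypeB.shiftSum
  rw [sum_piAntidiag_sum]
  refine sum_congr rfl fun p _ => ?_
  have h1 : ∀ β : Fin r → ℕ, ∑ γ ∈ (piAntidiag univ p.2),
        Θ (Sum.elim e f + Sum.elim β γ) = ∑ γ ∈ (piAntidiag univ p.2).filter
          (fun β : Fin t → ℕ => ∀ i j, i < j → f i + β i < f j),
        Θ (Sum.elim (e + β) (f + γ)) := by
    intro β
    rw [← (hΘ.2 (e + β)).pieri hf]
    refine sum_congr rfl fun γ _ => ?_
    congr 1
    ext (i | i) <;> rfl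
  rw [sum_congr rfl fun β _ => h1 β, sum_comm]
  have h2 : ∀ γ : Fin t → ℕ, ∑ β ∈ (piAntidiag univ p.1),
        Θ (Sum.elim (e + β) (f + γ)) = ∑ β ∈ (piAntidiag univ p.1).filter
          (fun β : Fin r → ℕ => ∀ i j, i < j → e i + β i < e j),
        Θ (Sum.elim (e + β) (f + γ)) := fun γ => (hΘ.1 (f + γ)).pieri he _
  rw [sum_congr rfl fun γ _ => h2 γ, sum_comm]

theorem Strip.of_add {x β : Fin r → ℕ} {y γ : Fin t → ℕ}
    (hβ : ∀ i j, i < j → x i + i + β i < x j + j) (hβ' : ∀ i j, i < j → y i + i + γ i < y j + j)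
    (hx : Monotone x) (hy : Monotone y) :
    Strip (∑ i, β i + ∑ j, γ j) x y (x + β) (y + γ) where
  fst_le i := Nat.le_add_right _ _
  snd_le i := Nat.le_add_right _ _
  fst_lt i j h := by
    have := hβ i ⟨i.1 + 1, by omega⟩ (Fin.lt_def.mpr (by simp))
    have h2 := hx (show (⟨i.1 + 1, by omega⟩ : Fin r) ≤ j from Fin.le_def.mpr (by simp; omega))
    simp only [Pi.add_apply] at this h2 ⊢
    omega
  snd_lt i j h := by
    have := hβ' i ⟨i.1 + 1, by omega⟩ (Fin.lt_def.mpr (by simp))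
    have h2 := hy (show (⟨i.1 + 1, by omega⟩ : Fin t) ≤ j from Fin.le_def.mpr (by simp; omega))
    simp only [Pi.add_apply] at this h2 ⊢
    omega
  sum_eq := by simp only [Pi.add_apply, sum_add_distrib]; omega

theorem Strip.monotone_fst {d : ℕ} {x x' : Fin r → ℕ} {y y' : Fin t → ℕ}
    (h : Strip d x y x' y') : Monotone x' := fun i j hij => by
  rcases hij.lt_or_eq with h1 | rfl
  · exact (h.fst_lt i j h1).trans (h.fst_le j)
  · exact le_rfl

theorem Strip.monotone_snd {d : ℕ} {x x' : Fin r → ℕ} {y y' : Fin t → ℕ}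
    (h : Strip d x y x' y') : Monotone y' := fun i j hij => by
  rcases hij.lt_or_eq with h1 | rfl
  · exact (h.snd_lt i j h1).trans (h.snd_le j)
  · exact le_rfl

/-- The number of chains of strips. -/
theorem shifts_altDeltaRows (ds : List ℕ) {x x' : Fin r → ℕ} {y y' : Fin t → ℕ}
    (hx : Monotone x) (hy : Monotone y) (hx' : Monotone x') (hy' : Monotone y') :
    ∃ c : ℕ, shifts ds (altDeltaRows (x' + stair r) (y' + stair t))
      (Sum.elim (x + stair r) (y + stair t)) = c ∧ (c ≠ 0 ↔ Chain ds x y x' y') := by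
  have hsm : ∀ {k : ℕ} {x : Fin k → ℕ}, Monotone x → StrictMono (x + stair k) :=
    fun hx i j h => add_lt_add_of_le_of_lt (hx h.le) h
  induction ds generalizing x y with
  | nil =>
    change ∃ c : ℕ, altDeltaRows _ _ _ = _ ∧ _
    rw [altDeltaRows, elim_comp_inl, elim_comp_inr,
      altDelta_of_strictMono (hsm hx') (hsm hx), altDelta_of_strictMono (hsm hy') (hsm hy)]
    refine ⟨(if x + stair r = x' + stair r then 1 else 0) *
      (if y + stair t = y' + stair t then 1 else 0), by push_cast; rfl, ?_⟩
    simp only [add_left_inj]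
    constructor
    · intro h
      have h1 := left_ne_zero_of_mul h
      have h2 := right_ne_zero_of_mul h
      split_ifs at h1 h2 with h3 h4
      · subst h3 h4; exact Chain.nil _ _
      all_goals simp at h1 h2
    · rintro ⟨⟩
      simp
  | cons d ds ih =>
    change ∃ c : ℕ, shiftSum d (shifts ds _) _ = _ ∧ _
    rw [((isAltRows_altDeltaRows _ _).shifts ds).pieri (hsm hx) (hsm hy)]
    have h1 : ∀ (β : Fin r → ℕ) (γ : Fin t → ℕ), ∃ c : ℕ,
        (∀ i j, i < j → (x + stair r) i + β i < (x + stair r) j) →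
        (∀ i j, i < j → (y + stair t) i + γ i < (y + stair t) j) →
        shifts ds (altDeltaRows (x' + stair r) (y' + stair t))
          (Sum.elim (x + stair r + β) (y + stair t + γ)) = c ∧
          (c ≠ 0 ↔ Chain ds (x + β) (y + γ) x' y') := by
      intro β γ
      by_cases hβ : ∀ i j, i < j → (x + stair r) i + β i < (x + stair r) j
      swap
      · exact ⟨0, fun h => absurd h hβ⟩
      by_cases hγ : ∀ i j, i < j → (y + stair t) i + γ i < (y + stair t) j
      swap
      · exact ⟨0, fun _ h => absurd h hγ⟩
      have hs := Strip.of_add hβ hγ hx hy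
      obtain ⟨c, hc⟩ := ih hs.monotone_fst hs.monotone_snd
      refine ⟨c, fun _ _ => ?_⟩
      rw [add_right_comm, add_right_comm y]
      exact hc
    choose c hc using h1
    -- After the Pieri rule the value is a sum of natural numbers. No cancellation can happen, so it
    -- is non-zero as soon as one chain exists.
    refine ⟨∑ p ∈ HasAntidiagonal.antidiagonal d, ∑ β ∈ (piAntidiag univ p.1).filter
          (fun β : Fin r → ℕ => ∀ i j, i < j → (x + stair r) i + β i < (x + stair r) j),
      ∑ γ ∈ (piAntidiag univ p.2).filter
          (fun β : Fin t → ℕ => ∀ i j, i < j → (y + stair t) i + β i < (y + stair t) j),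
        c β γ, ?_, ?_⟩
    · push_cast
      refine sum_congr rfl fun p _ => sum_congr rfl fun β hβ => sum_congr rfl fun γ hγ => ?_
      grind
    · constructor
      · intro h
        obtain ⟨p, hp, h⟩ := exists_ne_zero_of_sum_ne_zero h
        obtain ⟨β, hβ, h⟩ := exists_ne_zero_of_sum_ne_zero h
        obtain ⟨γ, hγ, h⟩ := exists_ne_zero_of_sum_ne_zero h
        rw [mem_filter, mem_piAntidiag] at hβ hγ
        rw [HasAntidiagonal.mem_antidiagonal] at hp
        refine Chain.cons (x' := x + β) (y' := y + γ) ?_ (((hc β γ hβ.2 hγ.2).2).mp h)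
        have := Strip.of_add hβ.2 hγ.2 hx hy
        rwa [hβ.1.1, hγ.1.1, hp] at this
      · rintro (_ | ⟨hs, hch⟩)
        rename_i x₁ y₁
        obtain ⟨β, rfl⟩ : ∃ β, x₁ = x + β :=
          ⟨x₁ - x, (add_tsub_cancel_of_le (fun i => hs.fst_le i)).symm⟩
        obtain ⟨γ, rfl⟩ : ∃ γ, y₁ = y + γ :=
          ⟨y₁ - y, (add_tsub_cancel_of_le (fun i => hs.snd_le i)).symm⟩
        have hβ : ∀ i j, i < j → (x + stair r) i + β i < (x + stair r) j := fun i j h => by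
          have h1 := hs.fst_lt i j h
          simp only [Pi.add_apply, stair] at h1 ⊢
          omega
        have hγ : ∀ i j, i < j → (y + stair t) i + γ i < (y + stair t) j := fun i j h => by
          have h1 := hs.snd_lt i j h
          simp only [Pi.add_apply, stair] at h1 ⊢
          omega
        have hd := hs.sum_eq
        simp only [Pi.add_apply, sum_add_distrib] at hd
        have hne := ((hc β γ hβ hγ).2).mpr hch
        intro h0
        rw [sum_eq_zero_iff] at h0
        have h1 := h0 (∑ i, β i, ∑ j, γ j) (by rw [HasAntidiagonal.mem_antidiagonal]; omega)
        rw [sum_eq_zero_iff] at h1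
        have h2 := h1 β (mem_filter.mpr ⟨mem_piAntidiag.mpr ⟨rfl, by simp⟩, hβ⟩)
        rw [sum_eq_zero_iff] at h2
        exact hne (h2 γ (mem_filter.mpr ⟨mem_piAntidiag.mpr ⟨rfl, by simp⟩, hγ⟩))

end Chains

/-! ### The parabolic subgroup of a subspace -/

section Parabolic
open Finset

variable {n : ℕ} (L : AffineSubspace ℝ (Fin n → ℝ))

variable {i j : Fin n} {α : Fin n → ℝ} {g : W (Fin n)}

/-- The vectors whose scalar product with the points of `L` is constant. -/
def constOn : Submodule ℝ (Fin n → ℝ) where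
  carrier := {v | ∀ x ∈ L, ∀ y ∈ L, v ⬝ᵥ x = v ⬝ᵥ y}
  add_mem' := fun {u v} hu hv x hx y hy => by
    rw [add_dotProduct, add_dotProduct, hu x hx y hy, hv x hx y hy]
  zero_mem' := fun x _ y _ => by simp
  smul_mem' := fun c v hv x hx y hy => by rw [smul_dotProduct, smul_dotProduct, hv x hx y hy]

variable {L}

theorem mem_constOn {v : Fin n → ℝ} : v ∈ constOn L ↔ ∀ x ∈ L, ∀ y ∈ L, v ⬝ᵥ x = v ⬝ᵥ y := Iff.rfl

theorem mem_bPart : i ∈ bPart L ↔ Pi.single i 1 ∈ constOn L := by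
  classical
  unfold bPart
  rw [mem_filter]
  constructor
  · rintro ⟨-, -, h⟩; exact h
  · exact fun h => ⟨mem_univ _, Or.inl ⟨i, 1, by simp⟩, h⟩

theorem single_unit (i : Fin n) (s : ℤˣ) :
    (Pi.single i ((s : ℤ) : ℝ) : Fin n → ℝ) = ((s : ℤ) : ℝ) • Pi.single i 1 := by
  rw [← Pi.single_smul']; simp

theorem unit_mul_self (s : ℤˣ) : ((s : ℤ) : ℝ) * ((s : ℤ) : ℝ) = 1 := by
  rcases units_eq_one_or s with rfl | rfl <;> simp

theorem single_unit_mem {s : ℤˣ} :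
    (Pi.single i ((s : ℤ) : ℝ) : Fin n → ℝ) ∈ constOn L ↔ i ∈ bPart L := by
  rw [mem_bPart, single_unit]
  constructor
  · intro h
    have := (constOn L).smul_mem ((s : ℤ) : ℝ) h
    rwa [smul_smul, unit_mul_self, one_smul] at this
  · exact fun h => (constOn L).smul_mem _ h

theorem longRoot_mem_rootsOf (hij : i ≠ j) (s t : ℤˣ) :
    (Pi.single i ((s : ℤ) : ℝ) + Pi.single j ((t : ℤ) : ℝ) : Fin n → ℝ) ∈ rootsOf L ↔
      (Pi.single i ((s : ℤ) : ℝ) + Pi.single j ((t : ℤ) : ℝ) : Fin n → ℝ) ∈ constOn L :=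
  ⟨fun h => h.2, fun h => ⟨Or.inr ⟨i, j, s, t, hij, rfl⟩, h⟩⟩

variable (L) in
/-- The coordinates that are linked to `i` by the roots that are constant on `L`. -/
def blockOf (i : Fin n) : Finset (Fin n) := @filter _ (fun j => ∃ s : ℤˣ,
    (Pi.single i 1 - Pi.single j ((s : ℤ) : ℝ) : Fin n → ℝ) ∈ constOn L)
    (Classical.decPred _) univ

theorem mem_blockOf : j ∈ blockOf L i ↔
    ∃ s : ℤˣ, (Pi.single i 1 - Pi.single j ((s : ℤ) : ℝ) : Fin n → ℝ) ∈ constOn L := by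
  simp [blockOf]

theorem single_neg_unit (j : Fin n) (s : ℤˣ) :
    (Pi.single j (((-s : ℤˣ) : ℤ) : ℝ) : Fin n → ℝ) = -Pi.single j ((s : ℤ) : ℝ) := by
  rw [← Pi.single_neg]; simp

theorem aType_eq : aType L = ((bPart L)ᶜ.image (blockOf L)).val.map card := by
  classical
  have : blockOf L = fun i : Fin n => univ.filter fun j =>
      j = i ∨ (Pi.single i 1 + Pi.single j 1 : Fin n → ℝ) ∈ rootsOf L ∨
      (Pi.single i 1 - Pi.single j 1 : Fin n → ℝ) ∈ rootsOf L := by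
    ext i j
    rw [mem_blockOf, mem_filter]
    simp only [mem_univ, true_and]
    by_cases hij : j = i
    · subst hij
      simp only [true_or, iff_true]
      exact ⟨1, by simp⟩
    · have h1 := longRoot_mem_rootsOf (L := L) (Ne.symm hij) 1 1
      have h2 := longRoot_mem_rootsOf (L := L) (Ne.symm hij) 1 (-1)
      rw [single_neg_unit] at h2
      simp only [Units.val_one, cast_one, ← sub_eq_add_neg] at h1 h2
      rw [h1, h2]
      constructor
      · rintro ⟨s, hs⟩
        rcases units_eq_one_or s with rfl | rfl
        · right; right; simpa using hs
        · right; left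
          rw [single_neg_unit] at hs
          simpa using hs
      · rintro (h | h | h)
        · exact absurd h hij
        · exact ⟨-1, by rw [single_neg_unit]; simpa using h⟩
        · exact ⟨1, by simpa using h⟩
  unfold aType
  rw [this]

theorem self_mem_blockOf (i : Fin n) : i ∈ blockOf L i := mem_blockOf.mpr ⟨1, by simp⟩

theorem mem_blockOf_comm (h : j ∈ blockOf L i) : i ∈ blockOf L j := by
  rw [mem_blockOf] at h ⊢
  obtain ⟨s, hs⟩ := h
  refine ⟨s, ?_⟩
  have := (constOn L).smul_mem (-((s : ℤ) : ℝ)) hs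
  rw [single_unit] at this ⊢
  rw [smul_sub, smul_smul, neg_mul, unit_mul_self, neg_smul, neg_smul, one_smul] at this
  rw [show (Pi.single j 1 - ((s : ℤ) : ℝ) • Pi.single i 1 : Fin n → ℝ) =
    -(((s : ℤ) : ℝ) • Pi.single i 1) - -Pi.single j 1 by abel]
  exact this

theorem mem_blockOf_trans {k : Fin n} (h : j ∈ blockOf L i) (h' : k ∈ blockOf L j) :
    k ∈ blockOf L i := by
  rw [mem_blockOf] at h h' ⊢
  obtain ⟨s, hs⟩ := h
  obtain ⟨t, ht⟩ := h'
  refine ⟨s * t, ?_⟩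
  have := (constOn L).add_mem hs ((constOn L).smul_mem ((s : ℤ) : ℝ) ht)
  rw [smul_sub, ← single_unit, single_unit k t, smul_smul] at this
  rw [single_unit k]
  simp_all

theorem mem_blockOf_iff : j ∈ blockOf L i ↔ blockOf L j = blockOf L i := by
  constructor
  · intro h
    ext k
    exact ⟨fun hk => mem_blockOf_trans h hk, fun hk => mem_blockOf_trans (mem_blockOf_comm h) hk⟩
  · intro h
    rw [← h]
    exact self_mem_blockOf j

theorem mem_bPart_of_mem_blockOf (h : j ∈ blockOf L i) (hj : j ∈ bPart L) :
    i ∈ bPart L := by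
  rw [mem_blockOf] at h
  obtain ⟨s, hs⟩ := h
  have := (constOn L).add_mem hs (single_unit_mem (s := s).mpr hj)
  rw [sub_add_cancel] at this
  rwa [mem_bPart]

variable (L) in
/-- The first coordinate of the block of `i`. -/
def repOf (i : Fin n) : Fin n := (blockOf L i).min' ⟨i, self_mem_blockOf i⟩

theorem repOf_eq (h : blockOf L i = blockOf L j) : repOf L i = repOf L j := by
  unfold repOf
  congr 1

theorem repOf_mem (i : Fin n) : repOf L i ∈ blockOf L i := min'_mem _ _

variable (L) in
/-- The sign by which the coordinate `i` is linked to the first one of its block. -/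
def signOf (i : Fin n) : ℤˣ := (mem_blockOf.mp (repOf_mem (L := L) i)).choose

theorem signOf_spec (i : Fin n) :
    (Pi.single i 1 - Pi.single (repOf L i) ((signOf L i : ℤ) : ℝ) : Fin n → ℝ) ∈ constOn L :=
  (mem_blockOf.mp (repOf_mem (L := L) i)).choose_spec

/-- Outside the B-part two linked coordinates have only one relative sign: with both signs, twice a
unit vector would be constant on `L`. Therefore the relative signs are coherent and given by
`signOf`. -/
theorem sub_mem_constOn_iff (hi : i ∉ bPart L) (s t : ℤˣ) :
    (Pi.single i ((s : ℤ) : ℝ) - Pi.single j ((t : ℤ) : ℝ) : Fin n → ℝ) ∈ constOn L ↔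
      blockOf L i = blockOf L j ∧ s * signOf L i = t * signOf L j := by
  have key : blockOf L i = blockOf L j →
      ((Pi.single i ((s : ℤ) : ℝ) - Pi.single j ((t : ℤ) : ℝ) : Fin n → ℝ) ∈ constOn L ↔
      ((((s * signOf L i : ℤˣ) : ℤ) : ℝ) - (((t * signOf L j : ℤˣ) : ℤ) : ℝ)) •
        (Pi.single (repOf L i) 1 : Fin n → ℝ) ∈ constOn L) := by
    intro h
    have h1 := (constOn L).smul_mem ((s : ℤ) : ℝ) (signOf_spec (L := L) i)
    have h2 := (constOn L).smul_mem ((t : ℤ) : ℝ) (signOf_spec (L := L) j)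
    rw [← repOf_eq h] at h2
    have h3 := (constOn L).sub_mem h1 h2
    have h4 : (Pi.single i ((s : ℤ) : ℝ) - Pi.single j ((t : ℤ) : ℝ) : Fin n → ℝ) -
      ((((s * signOf L i : ℤˣ) : ℤ) : ℝ) - (((t * signOf L j : ℤˣ) : ℤ) : ℝ)) •
        (Pi.single (repOf L i) 1 : Fin n → ℝ) ∈ constOn L := by
      convert h3 using 1
      rw [single_unit i, single_unit j, single_unit _ (signOf L i), single_unit _ (signOf L j)]
      module
    exact ⟨fun hA => by simpa using (constOn L).sub_mem hA h4,
      fun hB => by simpa using (constOn L).add_mem h4 hB⟩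
  constructor
  · intro h
    have hb : blockOf L i = blockOf L j := by
      symm
      rw [← mem_blockOf_iff, mem_blockOf]
      refine ⟨s * t, ?_⟩
      have := (constOn L).smul_mem ((s : ℤ) : ℝ) h
      rw [single_unit, single_unit, smul_sub, smul_smul, unit_mul_self, one_smul, smul_smul] at this
      rw [single_unit]
      push_cast
      exact this
    refine ⟨hb, ?_⟩
    by_contra hne
    rw [key hb] at h
    apply hi
    have hc : ((((s * signOf L i : ℤˣ) : ℤ) : ℝ) - (((t * signOf L j : ℤˣ) : ℤ) : ℝ)) ≠ 0 := by
      rw [sub_ne_zero]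
      intro h
      exact hne (Units.ext (by exact_mod_cast h))
    have := (smul_mem_iff _ hc).mp h
    exact mem_bPart_of_mem_blockOf (repOf_mem i) (mem_bPart.mpr this)
  · rintro ⟨hb, hs⟩
    simp_all

theorem act_single (w : W (Fin n)) (i : Fin n) (c : ℝ) :
    act w (Pi.single i c) = Pi.single (w.right i) (((w.left (w.right i) : ℤ) : ℝ) * c) := by
  ext j
  unfold act
  by_cases h : j = w.right i
  · subst h; simp
  · have : w.right⁻¹ j ≠ i := fun h' => h (by rw [← h']; exact (w.right.apply_symm_apply j).symm)
    grind

theorem act_add (w : W (Fin n)) (u v : Fin n → ℝ) : act w (u + v) = act w u + act w v := by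
  ext i; simp [act, mul_add]

theorem act_smul (w : W (Fin n)) (c : ℝ) (v : Fin n → ℝ) : act w (c • v) = c • act w v := by
  ext i; simp [act, mul_left_comm]

theorem act_mul (w w' : W (Fin n)) (v : Fin n → ℝ) : act (w * w') v = act w (act w' v) := by
  ext i
  have h : (w * w').left i = w.left i * w'.left (w.right⁻¹ i) := rfl
  unfold act
  rw [h, SemidirectProduct.mul_right, mul_inv_rev]
  push_cast
  rw [mul_assoc]
  rfl

theorem act_one (v : Fin n → ℝ) : act (1 : W (Fin n)) v = v := by ext i; simp [act]

theorem exists_reflection (hα : α ∈ shortRoots n ∪ longRoots n) :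
    ∃ w : W (Fin n), ∀ x, act w x = x - (2 * (α ⬝ᵥ x) / (α ⬝ᵥ α)) • α := by
  rcases hα with ⟨i, s, rfl⟩ | ⟨i, j, s, t, hij, rfl⟩
  · refine ⟨⟨update 1 i (-1), 1⟩, fun x => ?_⟩
    ext k
    have hs := unit_mul_self s
    simp only [act, single_dotProduct, Pi.sub_apply, Pi.smul_apply, Pi.single_eq_same, hs, div_one,
      smul_eq_mul]
    by_cases hk : k = i
    · subst hk
      simp
      linear_combination (2 * x k) * hs
    · simp [hk]
  · refine ⟨⟨update (update 1 i (-(s * t))) j (-(s * t)), Equiv.swap i j⟩, fun x => ?_⟩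
    ext k
    have hs := unit_mul_self s
    have ht := unit_mul_self t
    have hα : (Pi.single i ((s : ℤ) : ℝ) + Pi.single j ((t : ℤ) : ℝ) : Fin n → ℝ) ⬝ᵥ
        (Pi.single i ((s : ℤ) : ℝ) + Pi.single j ((t : ℤ) : ℝ)) = 2 := by
      simp [hij, hij.symm, hs, ht]
      norm_num
    rw [hα]
    simp only [act, add_dotProduct, single_dotProduct, Pi.sub_apply, Pi.smul_apply, Pi.add_apply,
      smul_eq_mul, Equiv.swap_inv]
    by_cases hk : k = j
    · subst hk
      simp [hij.symm]
      linear_combination x k * ht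
    · by_cases hk' : k = i
      · subst hk'
        simp [hij]
        linear_combination x k * hs
      · simp [hk, hk', Equiv.swap_apply_of_ne_of_ne hk' hk]

theorem reflection_mem_weylOf (hα : α ∈ rootsOf L) {w : W (Fin n)}
    (hw : ∀ x, act w x = x - (2 * (α ⬝ᵥ x) / (α ⬝ᵥ α)) • α) : w ∈ weylOf L :=
  Subgroup.subset_closure ⟨α, hα, hw⟩

theorem sub_mem_constOn_of_mem_weylOf (hg : g ∈ weylOf L) (v : Fin n → ℝ) :
    act g v - v ∈ constOn L := by
  induction hg using Subgroup.closure_induction generalizing v with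
  | mem w hw =>
    obtain ⟨α, hα, h⟩ := hw
    rw [h, sub_sub_cancel_left]
    exact neg_mem ((constOn L).smul_mem _ hα.2)
  | one => rw [act_one, sub_self]; exact zero_mem _
  | mul x y _ _ hx hy =>
    rw [act_mul]
    simpa using (constOn L).add_mem (hx (act y v)) (hy v)
  | inv x _ hx =>
    have h := (constOn L).neg_mem (hx (act x⁻¹ v))
    rwa [← act_mul, mul_inv_cancel, act_one, neg_sub] at h

/-- The vector `e_i - g e_i` is proportional to a root constant on `L`. Its reflection carries `g
e_i` back to `e_i`, and it fixes the unit vectors fixed by `g` because they are orthogonal to this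
root. -/
theorem exists_root_fixing (hg : ∀ v, act g v - v ∈ constOn L)
    (hi : act g (Pi.single i 1) ≠ Pi.single i 1) :
    ∃ α ∈ rootsOf L, ∀ r : W (Fin n), (∀ x, act r x = x - (2 * (α ⬝ᵥ x) / (α ⬝ᵥ α)) • α) →
      act r (act g (Pi.single i 1)) = Pi.single i 1 ∧
      ∀ k, act g (Pi.single k 1) = Pi.single k 1 → act r (Pi.single k 1) = Pi.single k 1 := by
  have hc := unit_mul_self (g.left (g.right i))
  have hgi : act g (Pi.single i 1) =
      Pi.single (g.right i) ((g.left (g.right i) : ℤ) : ℝ) := by rw [act_single, mul_one]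
  by_cases hj : g.right i = i
  · have hs : g.left (g.right i) = -1 := by
      rcases units_eq_one_or (g.left (g.right i)) with h | h
      · simp_all
      · exact h
    rw [hs, hj] at hgi
    refine ⟨Pi.single i 1, ⟨Or.inl ⟨i, 1, by simp⟩, ?_⟩, fun r hr => ⟨?_, fun k hk => ?_⟩⟩
    · have h := hg (Pi.single i 1)
      rw [hgi, single_neg_unit] at h
      have h2 := (constOn L).smul_mem (-(1 / 2 : ℝ)) h
      have : (Pi.single i 1 : Fin n → ℝ) = -(1 / 2 : ℝ) • (-Pi.single i (((1 : ℤˣ) : ℤ) : ℝ) -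
        Pi.single i 1) := by
        ext k; by_cases hk : k = i
        · subst hk; norm_num
        · simp [hk]
      exact mem_constOn.mp (this ▸ h2)
    · rw [hr, hgi]
      ext k; by_cases hk : k = i
      · subst hk; norm_num
      · simp [hk]
    · have : k ≠ i := by rintro rfl; exact hi hk
      simp_all
  · set j := g.right i with hjdef
    set c : ℝ := ((g.left j : ℤ) : ℝ) with hcdef
    have hα : (Pi.single i (((1 : ℤˣ) : ℤ) : ℝ) + Pi.single j (((-(g.left j) : ℤˣ) : ℤ) : ℝ) :
        Fin n → ℝ) = Pi.single i 1 - Pi.single j c := by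
      rw [single_neg_unit]; simp [sub_eq_add_neg, hcdef]
    have hji : j ≠ i := hj
    refine ⟨Pi.single i 1 - Pi.single j c, ⟨Or.inr ⟨i, j, 1, -(g.left j), Ne.symm hj, hα.symm⟩, ?_⟩,
      fun r hr => ?_⟩
    · have h := hg (Pi.single i 1)
      rw [hgi] at h
      have := neg_mem h
      rw [neg_sub] at this
      exact mem_constOn.mp this
    have h2 : (Pi.single i 1 - Pi.single j c : Fin n → ℝ) ⬝ᵥ (Pi.single i 1 - Pi.single j c) = 2 := by
      simp [hji, hji.symm, hc]
      norm_num
    refine ⟨?_, fun k hk => ?_⟩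
    · simp_all
    · have hki : k ≠ i := by rintro rfl; exact hi hk
      have hkj : k ≠ j := by
        rintro h
        rw [act_single] at hk
        have h3 : g.right k = k := by
          by_contra hne
          have := congrFun hk (g.right k)
          simp [hne] at this
        simp_all
      simp_all

theorem eq_one_of_act (h : ∀ i, act g (Pi.single i 1) = Pi.single i 1) : g = 1 := by
  have h1 : ∀ i, g.right i = i := by
    intro i
    by_contra hne
    have := congrFun (h i) (g.right i)
    rw [act_single] at this
    simp [hne] at this
  refine SemidirectProduct.ext ?_ ?_
  · ext i
    have := congrFun (h i) i
    rw [act_single, h1] at this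
    simp at this
    simp [this]
  · ext i
    rw [h1]; rfl

/-- Induction on the number of moved unit vectors, which drops when `g` is multiplied by the
reflection of `exists_root_fixing`. -/
theorem mem_weylOf_of_sub_mem (hg : ∀ v, act g v - v ∈ constOn L) :
    g ∈ weylOf L := by
  classical
  induction hk : (univ.filter fun i : Fin n => act g (Pi.single i 1) ≠ Pi.single i 1).card
    using Nat.strong_induction_on generalizing g with
  | _ k ih =>
  by_cases h : ∀ i, act g (Pi.single i 1) = Pi.single i 1
  · rw [eq_one_of_act h]
    exact one_mem _
  push Not at h
  obtain ⟨i, hi⟩ := h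
  obtain ⟨α, hα, hr⟩ := exists_root_fixing hg hi
  obtain ⟨r, hr'⟩ := exists_reflection hα.1
  have hrm := reflection_mem_weylOf hα hr'
  obtain ⟨h1, h2⟩ := hr r hr'
  have : r * g ∈ weylOf L := by
    refine ih _ ?_ ?_ rfl
    · rw [← hk]
      apply card_lt_card
      rw [ssubset_iff_of_subset]
      · refine ⟨i, by simpa using hi, ?_⟩
        simp [act_mul, h1]
      · intro k hk
        rw [mem_filter] at hk ⊢
        refine ⟨hk.1, fun h => hk.2 ?_⟩
        rw [act_mul, h, h2 k h]
    · intro v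
      rw [act_mul]
      simpa using (constOn L).add_mem (sub_mem_constOn_of_mem_weylOf hrm (act g v)) (hg v)
  simpa using mul_mem (inv_mem hrm) this

/-- This makes the group generated by reflections explicit: all signed permutations of the B-part,
times the permutations of each block, which come with signs forced by `signOf`. -/
theorem mem_weylOf_iff : g ∈ weylOf L ↔
    (∀ i, g.right i ∈ bPart L ↔ i ∈ bPart L) ∧ ∀ i ∉ bPart L,
      blockOf L (g.right i) = blockOf L i ∧
        g.left (g.right i) = signOf L (g.right i) * signOf L i := by
  have h0 : g ∈ weylOf L ↔ ∀ i, (Pi.single (g.right i) ((g.left (g.right i) : ℤ) : ℝ) -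
      Pi.single i (((1 : ℤˣ) : ℤ) : ℝ) : Fin n → ℝ) ∈ constOn L := by
    have h1 : ∀ i, (Pi.single (g.right i) ((g.left (g.right i) : ℤ) : ℝ) -
      Pi.single i (((1 : ℤˣ) : ℤ) : ℝ) : Fin n → ℝ) = act g (Pi.single i 1) - Pi.single i 1 := by
      intro i; rw [act_single]; simp
    simp only [h1]
    constructor
    · exact fun h i => sub_mem_constOn_of_mem_weylOf h _
    · intro h
      refine mem_weylOf_of_sub_mem fun v => ?_
      have hv : v = ∑ i, v i • (Pi.single i 1 : Fin n → ℝ) := by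
        ext j; simp [Finset.sum_apply, Pi.single_apply]
      let A : (Fin n → ℝ) →ₗ[ℝ] (Fin n → ℝ) :=
        { toFun := fun v => act g v - v
          map_add' := fun u v => by rw [act_add]; abel
          map_smul' := fun c v => by rw [act_smul, RingHom.id_apply, smul_sub] }
      change A v ∈ _
      rw [hv, map_sum]
      exact sum_mem fun i _ => by rw [map_smul]; exact (constOn L).smul_mem _ (h i)
  rw [h0]
  constructor
  · intro h
    have hB : ∀ i, g.right i ∈ bPart L ↔ i ∈ bPart L := by
      intro i
      constructor
      · intro hi
        have := (constOn L).sub_mem (single_unit_mem (s := g.left (g.right i)).mpr hi) (h i)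
        rw [sub_sub_cancel] at this
        exact single_unit_mem.mp this
      · intro hi
        have := (constOn L).add_mem (h i) (single_unit_mem (s := 1).mpr hi)
        rw [sub_add_cancel] at this
        exact single_unit_mem.mp this
    refine ⟨hB, fun i hi => ?_⟩
    obtain ⟨h1, h2⟩ := (sub_mem_constOn_iff (fun hc => hi ((hB i).mp hc)) _ _).mp (h i)
    refine ⟨h1, ?_⟩
    rw [one_mul] at h2
    rw [← h2, mul_comm, mul_assoc, Int.units_mul_self, mul_one]
  · rintro ⟨hB, h⟩ i
    by_cases hi : i ∈ bPart L
    · exact (constOn L).sub_mem (single_unit_mem.mpr ((hB i).mpr hi)) (single_unit_mem.mpr hi)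
    · obtain ⟨h1, h2⟩ := h i hi
      rw [sub_mem_constOn_iff (fun hc => hi ((hB i).mp hc))]
      refine ⟨h1, ?_⟩
      rw [h2, mul_comm, ← mul_assoc, Int.units_mul_self]

end Parabolic

/-! ### Induction from parabolic subgroups -/

section Induction
open Finset

variable {n : ℕ} {L : AffineSubspace ℝ (Fin n → ℝ)}

variable (L) in
/-- The element of the parabolic subgroup with given components. -/
def glue (τ : Perm {x // x ∉ bPart L}) (w : W {x // x ∈ bPart L}) : W (Fin n) where
  left i := if hi : i ∈ bPart L then w.left ⟨i, hi⟩ else signOf L i * signOf L (τ⁻¹ ⟨i, hi⟩).1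
  right := Perm.subtypeCongr w.right τ

theorem glue_right_of_mem (τ : Perm {x // x ∉ bPart L}) (w : W {x // x ∈ bPart L})
    (i : {x // x ∈ bPart L}) : (glue L τ w).right i = (w.right i).1 :=
  Perm.subtypeCongr.left_apply_subtype _ _ i

theorem glue_right_of_notMem (τ : Perm {x // x ∉ bPart L}) (w : W {x // x ∈ bPart L})
    (i : {x // x ∉ bPart L}) : (glue L τ w).right i = (τ i).1 :=
  Perm.subtypeCongr.right_apply_subtype _ _ i

theorem glue_right_mem_iff (τ : Perm {x // x ∉ bPart L}) (w : W {x // x ∈ bPart L})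
    (i : Fin n) : (glue L τ w).right i ∈ bPart L ↔ i ∈ bPart L := by
  by_cases hi : i ∈ bPart L
  · have := glue_right_of_mem τ w ⟨i, hi⟩
    grind
  · have := glue_right_of_notMem τ w ⟨i, hi⟩
    grind

/-- The sum over the parabolic subgroup. -/
theorem sum_weylOf [DecidablePred (· ∈ weylOf L)] (f : W (Fin n) → ℂ) :
    ∑ g with g ∈ weylOf L, f g = ∑ w : W {x // x ∈ bPart L},
      ∑ τ ∈ univ.filter fun τ : Perm {x // x ∉ bPart L} =>
        (fun i => blockOf L i.1) ∘ τ = fun i => blockOf L i.1, f (glue L τ w) := by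
  rw [← sum_product']
  symm
  refine sum_bij (fun p _ => glue L p.2 p.1) ?_ ?_ ?_ ?_
  · rintro ⟨w, τ⟩ h
    simp only [mem_product, mem_univ, true_and, mem_filter] at h ⊢
    rw [mem_weylOf_iff]
    refine ⟨glue_right_mem_iff τ w, fun i hi => ?_⟩
    have h1 := glue_right_of_notMem τ w ⟨i, hi⟩
    rw [h1]
    refine ⟨congrFun h ⟨i, hi⟩, ?_⟩
    simp only [glue]
    rw [dif_neg (τ ⟨i, hi⟩).2]
    simp
  · rintro ⟨w, τ⟩ _ ⟨w', τ'⟩ _ h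
    have h1 : w = w' := by
      refine SemidirectProduct.ext ?_ ?_
      · ext i
        have := congrFun (congrArg SemidirectProduct.left h) i.1
        simp only [glue, i.2, dite_true] at this
        rw [this]
      · ext i
        rw [← glue_right_of_mem τ w i, ← glue_right_of_mem τ' w' i]
        rw [h]
    have h2 : τ = τ' := by
      ext i
      rw [← glue_right_of_notMem τ w i, ← glue_right_of_notMem τ' w' i]
      rw [h]
    rw [h1, h2]
  · intro g hg
    rw [mem_filter, mem_weylOf_iff] at hg
    obtain ⟨-, hB, hN⟩ := hg
    refine ⟨(⟨fun i => g.left i, g.right.subtypePerm hB⟩,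
      g.right.subtypePerm fun x => not_congr (hB x)), ?_, ?_⟩
    · simp only [mem_product, mem_univ, true_and, mem_filter]
      ext i : 1
      exact (hN i.1 i.2).1
    · refine SemidirectProduct.ext ?_ ?_
      · ext i
        simp only [glue]
        by_cases hi : i ∈ bPart L
        · rw [dif_pos hi]
        · have h1 := (hN (g.right⁻¹ i) (fun hc => hi (by have := (hB _).mpr hc; simp_all))).2
          simp_all
      · ext i
        by_cases hi : i ∈ bPart L
        · have := glue_right_of_mem (L := L) (g.right.subtypePerm fun x => not_congr (hB x))
            ⟨fun i => g.left i, g.right.subtypePerm hB⟩ ⟨i, hi⟩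
          simp_all
        · have := glue_right_of_notMem (L := L) (g.right.subtypePerm fun x => not_congr (hB x))
            ⟨fun i => g.left i, g.right.subtypePerm hB⟩ ⟨i, hi⟩
          simp_all
  · intros; rfl

theorem trivTensor_glue (p q : Multiset ℕ) (τ : Perm {x // x ∉ bPart L})
    (w : W {x // x ∈ bPart L}) : trivTensor L p q (glue L τ w) = bChar p q w := by
  unfold trivTensor
  rw [dif_pos (glue_right_mem_iff τ w)]
  congr 1
  refine SemidirectProduct.ext ?_ ?_
  · ext i
    simp [glue, i.2]
  · ext i
    exact congrArg Fin.val (glue_right_of_mem τ w i)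

variable {r t : ℕ}

/-- The forced signs form a coboundary, so their product over a set of elements stable under `τ`
telescopes to 1. Consequently the factors of type A see no difference between the two kinds of
colours. -/
theorem prod_signs (τ : Perm {x // x ∉ bPart L}) (F : {x // x ∉ bPart L} → Fin r ⊕ Fin t)
    (hF : F ∘ τ = F) :
    ∏ i, Sum.elim (fun _ => (1 : ℂ))
      (fun _ => (((signOf L i.1 * signOf L (τ⁻¹ i).1 : ℤˣ) : ℤ) : ℂ)) (F i) = 1 := by
  have h1 : ∀ i, Sum.elim (fun _ => (1 : ℂ))
      (fun _ => (((signOf L i.1 * signOf L (τ⁻¹ i).1 : ℤˣ) : ℤ) : ℂ)) (F i) =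
      Sum.elim (fun _ => (1 : ℂ)) (fun _ => ((signOf L i.1 : ℤ) : ℂ)) (F i) *
      Sum.elim (fun _ => (1 : ℂ)) (fun _ => ((signOf L (τ⁻¹ i).1 : ℤ) : ℂ)) (F (τ⁻¹ i)) := by
    intro i
    have : F (τ⁻¹ i) = F i := by
      have := congrFun hF (τ⁻¹ i)
      simp_all
    rw [this]
    rcases F i with x | x <;> simp
  rw [prod_congr rfl fun i _ => h1 i, prod_mul_distrib,
    Equiv.prod_comp τ⁻¹ (fun i => Sum.elim (fun _ => (1 : ℂ))
      (fun _ => ((signOf L i.1 : ℤ) : ℂ)) (F i)), ← prod_mul_distrib]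
  refine prod_eq_one fun i _ => ?_
  rcases F i with x | x
  · simp
  · rcases units_eq_one_or (signOf L i.1) with h | h <;> simp [h]

theorem colourSum_glue (Ψ : (Fin r ⊕ Fin t → ℕ) → ℂ) (τ : Perm {x // x ∉ bPart L})
    (w : W {x // x ∈ bPart L}) :
    colourSum Ψ (glue L τ w) =
      ∑ F ∈ univ.filter fun F : {x // x ∈ bPart L} → Fin r ⊕ Fin t => F ∘ w.right = F,
      ∑ F' ∈ univ.filter fun F' : {x // x ∉ bPart L} → Fin r ⊕ Fin t => F' ∘ τ = F',
        signWeight w F * Ψ (content F + content F') := by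
  rw [← sum_product']
  refine sum_equiv (Equiv.piEquivPiSubtypeProd (· ∈ bPart L) _) ?_ ?_
  · intro F
    simp only [mem_filter, mem_univ, true_and, mem_product, Equiv.piEquivPiSubtypeProd_apply]
    constructor
    · intro h
      constructor
      · ext i : 1
        have := congrFun h i.1
        simp only [comp, glue_right_of_mem] at this ⊢
        exact this
      · ext i : 1
        have := congrFun h i.1
        simp only [comp, glue_right_of_notMem] at this ⊢
        exact this
    · rintro ⟨h1, h2⟩
      ext i : 1
      by_cases hi : i ∈ bPart L
      · have := congrFun h1 ⟨i, hi⟩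
        have h3 := glue_right_of_mem τ w ⟨i, hi⟩
        grind
      · have := congrFun h2 ⟨i, hi⟩
        have h3 := glue_right_of_notMem τ w ⟨i, hi⟩
        grind
  · intro F hF
    simp only [mem_filter, mem_univ, true_and] at hF
    simp only [Equiv.piEquivPiSubtypeProd_apply]
    have h2 : (fun i : {x // x ∉ bPart L} => F i.1) ∘ τ = fun i => F i.1 := by
      ext i : 1
      have := congrFun hF i.1
      simp only [comp, glue_right_of_notMem] at this ⊢
      exact this
    congr 1
    · unfold signWeight
      rw [← Fintype.prod_subtype_mul_prod_subtype (· ∈ bPart L)]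
      have := prod_signs τ _ h2
      conv_rhs => rw [← mul_one (∏ i, _)]
      congr 1
      · refine prod_congr (ext fun _ => by simp) fun i _ => ?_
        simp [glue, i.2]
      · refine Eq.trans ?_ this
        refine prod_congr (ext fun _ => by simp) fun i _ => ?_
        simp only [glue]
        rw [dif_neg i.2]
    · congr 1
      ext c
      simp only [content, Pi.add_apply]
      rw [← card_filter_add_card_filter_not (s := univ.filter fun i => F i = c)
        (fun i => i ∈ bPart L)]
      congr 1
      · symm
        refine card_bij (fun i _ => i.1) ?_ ?_ ?_
        · grind
        · intro i _ j _ h; exact Subtype.ext h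
        simp_all
      · symm
        refine card_bij (fun i _ => i.1) ?_ ?_ ?_
        · grind
        · intro i _ j _ h; exact Subtype.ext h
        simp_all

variable (L) in
/-- The set of blocks of coordinates outside the factor of type `B`. -/
def blocks : Finset (Finset (Fin n)) := (bPart L)ᶜ.image (blockOf L)

theorem blockOf_mem_blocks {i : Fin n} (hi : i ∉ bPart L) : blockOf L i ∈ blocks L :=
  mem_image_of_mem _ (mem_compl.mpr hi)

variable (L) in
/-- The number of the block of a coordinate. -/
def blockIndex (i : {x // x ∉ bPart L}) : Fin (blocks L).card :=
  (blocks L).equivFin ⟨blockOf L i.1, blockOf_mem_blocks i.2⟩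

theorem blockIndex_eq_iff {i j : {x // x ∉ bPart L}} :
    blockIndex L i = blockIndex L j ↔ blockOf L i.1 = blockOf L j.1 := by
  unfold blockIndex
  simp_all

theorem content_blockIndex (b : Fin (blocks L).card) :
    content (blockIndex L) b = ((blocks L).equivFin.symm b).1.card := by
  obtain ⟨i, hi, hb⟩ := mem_image.mp ((blocks L).equivFin.symm b).2
  rw [mem_compl] at hi
  have h1 : b = blockIndex L ⟨i, hi⟩ := by
    unfold blockIndex
    grind
  rw [← hb, content]
  refine card_bij (fun j _ => j.1) ?_ ?_ ?_
  · intro j hj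
    rw [mem_filter, h1, blockIndex_eq_iff] at hj
    exact mem_blockOf_iff.mpr hj.2
  · intro j _ k _ h; exact Subtype.ext h
  · intro j hj
    refine ⟨⟨j, fun hc => hi (mem_bPart_of_mem_blockOf hj hc)⟩, ?_, rfl⟩
    rw [mem_filter, h1, blockIndex_eq_iff]
    exact ⟨mem_univ _, mem_blockOf_iff.mp hj⟩

variable (L) in
/-- The sizes of the blocks. -/
def blockSizes : List ℕ := ofFn (content (blockIndex L))

theorem coe_blockSizes : (blockSizes L : Multiset ℕ) = aType L := by
  rw [aType_eq, blockSizes, ← Fin.univ_val_map]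
  have : content (blockIndex L) = (fun b : {x // x ∈ blocks L} => b.1.card) ∘
      (blocks L).equivFin.symm := by
    ext b; exact content_blockIndex b
  rw [this, ← Multiset.map_map]
  have h2 : Multiset.map (blocks L).equivFin.symm univ.val = univ.val :=
    congrArg val (map_univ_equiv (blocks L).equivFin.symm)
  rw [h2, univ_eq_attach, attach_val]
  exact Multiset.attach_map_val' (blocks L).val card

/-- The sum of the values on the parabolic subgroup, in terms of iterated shifts. -/
theorem sum_weylOf_mul [DecidablePred (· ∈ weylOf L)] (p q : Multiset ℕ)
    (Θ : (Fin r ⊕ Fin t → ℕ) → ℂ) :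
    ∑ g with g ∈ weylOf L, trivTensor L p q g * colourSum (fun k => Θ (stairs r t + k)) g =
      (∏ b, ((content (blockIndex L) b).factorial : ℂ)) * ∑ w : W {x // x ∈ bPart L},
        bChar p q w * colourSum (fun k => shifts (blockSizes L) Θ (stairs r t + k)) w := by
  rw [sum_weylOf, mul_sum]
  refine sum_congr rfl fun w _ => ?_
  simp only [trivTensor_glue, ← mul_sum]
  rw [mul_left_comm]
  congr 1
  simp only [colourSum_glue]
  rw [sum_comm, colourSum, mul_sum]
  refine sum_congr rfl fun F _ => ?_
  simp only [← mul_sum]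
  rw [mul_left_comm]
  congr 1
  rw [blockSizes, shifts_ofFn, ← sum_stabilizer_sum_invariant (blockIndex L)
    (fun β => Θ (stairs r t + content F + ∑ b, β b))]
  refine sum_congr ?_ fun τ _ => sum_congr rfl fun F' _ => ?_
  · simp only [mem_filter, mem_univ, true_and, funext_iff, comp, blockIndex_eq_iff]
  · have : ∑ b, jointContent (blockIndex L) F' b = content F' := by
      ext c
      rw [Finset.sum_apply, sum_jointContent']
    rw [this, add_assoc]

/-- The constituents of the characters induced from parabolic subgroups. -/
theorem charInner_indChar_ne_zero_iff (B : Bipartition (bPart L).card) (A : Bipartition n)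
    (hr : n ≤ r) (ht : n ≤ t) :
    charInner (indChar (weylOf L) (trivTensor L B.fst B.snd)) (chi A) ≠ 0 ↔
      Chain (blockSizes L) (padSeq r B.fst) (padSeq t B.snd) (padSeq r A.fst) (padSeq t A.snd) := by
  classical
  have hB : (bPart L).card ≤ n := by simpa using card_le_univ (bPart L)
  have h1 := B.card_fst_le.trans (hB.trans hr)
  have h2 := B.card_snd_le.trans (hB.trans ht)
  have h3 := A.card_fst_le.trans hr
  have h4 := A.card_snd_le.trans ht
  have hexp : ∀ {k : ℕ} (p : Multiset ℕ), expo k p = padSeq k p + stair k := fun p => rfl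
  obtain ⟨c, hc, hc'⟩ := shifts_altDeltaRows (blockSizes L) (padSeq_monotone h1)
    (padSeq_monotone h2) (padSeq_monotone h3) (padSeq_monotone h4)
  rw [← hc', charInner_indChar, chi_eq_seqChar A hr ht, seqChar_eq_colourSum, sum_weylOf_mul,
    bChar_eq h1 h2]
  have hexpo : IsExponent (Fintype.card {x // x ∈ bPart L}) (expo r B.fst) (expo t B.snd) := by
    rw [card_coe]
    exact isExponent_expo B.sum_eq h1 h2
  -- The factors of type A have been averaged into iterated shifts. The remaining sum over the Weyl
  -- group of the B-part is evaluated by the reproducing property at the exponents of `B`.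
  have h5 := pair_colourSum_of_isAltRows hexpo
    ((isAltRows_altDeltaRows (expo r A.fst) (expo t A.snd)).shifts (blockSizes L))
  rw [pair_colourSum_right, hexp, hexp, hexp, hexp, hc] at h5
  rw [hexp, hexp, hexp, hexp]
  rw [inv_mul_eq_iff_eq_mul₀ (by simp)] at h5
  have h7 : ∏ b, ((content (blockIndex L) b).factorial : ℂ) ≠ 0 :=
    prod_ne_zero_iff.mpr fun b _ => by exact_mod_cast Nat.factorial_ne_zero _
  simp_all

end Induction

/-! ### Sorted entries of multisets -/

section Sorted
open Finset hiding card_map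
open Multiset (card_map)

variable {l : List ℕ} {E A : Multiset ℕ} {j : ℕ} {C : Type}

/-- The `j`-th smallest entry of a multiset. -/
def entry (E : Multiset ℕ) (j : ℕ) : ℕ := (E.sort (· ≤ ·)).getD j 0

/-- The sum of the `k` smallest entries of a multiset. -/
def lowSum (E : Multiset ℕ) (k : ℕ) : ℕ := ∑ j ∈ range k, entry E j

theorem sort_coe_eq (hl : l.Pairwise (· ≤ ·)) : (l : Multiset ℕ).sort (· ≤ ·) = l := by
  exact List.mergeSort_eq_self _ (hl.imp (by simp))

theorem entry_coe (hl : l.Pairwise (· ≤ ·)) (j : ℕ) :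
    entry (l : Multiset ℕ) j = l.getD j 0 := by
  rw [entry, sort_coe_eq hl]

theorem entry_eq_getElem (hj : j < (E.sort (· ≤ ·)).length) :
    entry E j = (E.sort (· ≤ ·))[j] := by
  unfold entry
  grind

theorem entry_mono {i : ℕ} (hij : i ≤ j) (hj : j < E.card) :
    entry E i ≤ entry E j := by
  have hj' : j < (E.sort (· ≤ ·)).length := by simpa
  rw [entry_eq_getElem hj', entry_eq_getElem (hij.trans_lt hj')]
  rcases hij.lt_or_eq with h | rfl
  · exact List.pairwise_iff_getElem.mp (Multiset.pairwise_sort E (· ≤ ·)) i j _ _ h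
  · exact le_rfl

theorem map_entry (E : Multiset ℕ) : (Multiset.range E.card).map (entry E) = E := by
  conv_rhs => rw [← Multiset.sort_eq E (· ≤ ·)]
  change ((List.map _ (List.range _) : List ℕ) : Multiset ℕ) = _
  congr 1
  apply ext_getElem
  · simp
  · intro i h1 h2
    rw [List.getElem_map, List.getElem_range, entry_eq_getElem h2]

theorem entry_mem (hj : j < E.card) : entry E j ∈ E := by
  have := Multiset.mem_map_of_mem (entry E) (Multiset.mem_range.mpr hj)
  rwa [map_entry] at this

theorem exists_entry_eq {x : ℕ} (hx : x ∈ E) : ∃ j < E.card, entry E j = x := by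
  rw [← map_entry E] at hx
  simp_all

theorem card_filter_eq (E : Multiset ℕ) (p : ℕ → Prop) [DecidablePred p] :
    (E.filter p).card = ((range E.card).filter fun j => p (entry E j)).card := by
  conv_lhs => rw [← map_entry E]
  rw [Multiset.filter_map, card_map]
  rfl

theorem entry_le_iff (hj : j < E.card) (v : ℕ) :
    entry E j ≤ v ↔ j < (E.filter (· ≤ v)).card := by
  rw [card_filter_eq]
  constructor
  · intro h
    have : range (j + 1) ⊆ (range E.card).filter fun j => entry E j ≤ v := by
      intro i hi
      rw [mem_range] at hi
      rw [mem_filter, mem_range]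
      exact ⟨by omega, (entry_mono (by omega) hj).trans h⟩
    simpa using card_le_card this
  · intro h
    by_contra hlt
    have : (range E.card).filter (fun j => entry E j ≤ v) ⊆ range j := by
      intro i hi
      rw [mem_filter, mem_range] at hi
      rw [mem_range]
      by_contra hij
      exact hlt ((entry_mono (by omega) hi.1).trans hi.2)
    have := card_le_card this
    grind

theorem lt_entry_iff (hj : j < E.card) (v : ℕ) :
    entry E j < v ↔ j < (E.filter (· < v)).card := by
  rcases v with _ | v
  · simp
  · rw [Nat.lt_succ_iff, entry_le_iff hj]
    simp only [Nat.lt_succ_iff]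

theorem lowSum_succ (E : Multiset ℕ) (k : ℕ) : lowSum E (k + 1) = lowSum E k + entry E k :=
  sum_range_succ _ _

theorem lowSum_card (E : Multiset ℕ) : lowSum E E.card = E.sum := by
  conv_rhs => rw [← map_entry E]
  rfl

theorem lowSum_le_sum (h : A ≤ E) : lowSum E A.card ≤ A.sum := by
  rw [← lowSum_card A]
  refine sum_le_sum fun j hj => ?_
  rw [mem_range] at hj
  rw [entry_le_iff (hj.trans_le (Multiset.card_le_card h))]
  exact ((entry_le_iff hj _).mp le_rfl).trans_le
    (Multiset.card_le_card (Multiset.filter_le_filter _ h))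

theorem exists_le_map {v : C → ℕ} {U : Multiset C}
    (h : A ≤ U.map v) : ∃ B ≤ U, B.map v = A := by
  induction U using Quotient.inductionOn with
  | _ u =>
  induction A using Quotient.inductionOn with
  | _ l =>
  obtain ⟨l', hl, hs⟩ : List.Subperm l (u.map v) := h
  obtain ⟨b, hb, rfl⟩ := List.sublist_map_iff.mp hs
  exact ⟨(b : Multiset C), coe_le.mpr hb.subperm, Quotient.sound hl⟩

/-- With `lowSum_le_sum_finset` this identifies `lowSum` as a minimum over the sets of `k`
positions, the form in which strips can be estimated. -/
theorem exists_sum_eq_lowSum [Fintype C] (v : C → ℕ) {k : ℕ}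
    (hk : k ≤ Fintype.card C) : ∃ S : Finset C, S.card = k ∧
      ∑ c ∈ S, v c = lowSum (univ.val.map v) k := by
  set E := univ.val.map v with hE
  have hcard : E.card = Fintype.card C := by rw [hE, card_map]; rfl
  have hle : (Multiset.range k).map (entry E) ≤ E := by
    conv_rhs => rw [← map_entry E]
    exact map_le_map (range_le.mpr (by omega))
  obtain ⟨B, hB, hBm⟩ := exists_le_map hle
  refine ⟨⟨B, Multiset.nodup_of_le hB univ.nodup⟩, ?_, ?_⟩
  · have := congrArg Multiset.card hBm
    simpa using this
  · change (B.map v).sum = _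
    rw [hBm]
    rfl

theorem lowSum_le_sum_finset [Fintype C] (v : C → ℕ) (S : Finset C) :
    lowSum (univ.val.map v) S.card ≤ ∑ c ∈ S, v c := by
  have h : S.val.map v ≤ univ.val.map v := map_le_map (val_le_iff.mpr (subset_univ S))
  have := lowSum_le_sum h
  rwa [card_map] at this

/-- In increasing order the minimum of a pair is its earlier entry. Thus the `a`-function is
increasing in each partial sum of the ordered entries. -/
theorem pairMin_eq (E : Multiset ℕ) : pairMin E = ∑ k ∈ range E.card, lowSum E k := by
  refine sum_congr rfl fun i hi => sum_congr rfl fun j hj => ?_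
  rw [mem_range] at hi hj
  exact min_eq_right (entry_mono hj.le hi)

theorem eq_of_entry_eq {E' : Multiset ℕ} (hc : E.card = E'.card)
    (h : ∀ j < E.card, entry E j = entry E' j) : E = E' := by
  rw [← map_entry E, ← map_entry E', ← hc]
  exact Multiset.map_congr rfl fun j hj => h j (Multiset.mem_range.mp hj)

end Sorted

/-! ### The relation between symbols and partitions -/

section Defect
open Finset hiding card_map
open Multiset (card_map)

variable {s : ℕ} {E M : Multiset ℕ}

/-- The deviation of the partial sums of the modified entries of a symbol from the partial sums of
a partition. -/
def defect (s : ℕ) (E M : Multiset ℕ) (k : ℕ) : ℤ :=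
  ∑ j ∈ range k, (2 * (entry E j : ℤ) - 2 * j + 1 - s - entry M j)

/-- The entries `E` of a symbol and the partition `M` (with zeros) correspond to each other. -/
def Matches (s : ℕ) (E M : Multiset ℕ) : Prop :=
  E.card = M.card ∧ ∀ k ≤ M.card, 0 ≤ defect s E M k ∧ defect s E M k ≤ 1

/-- The parts congruent to `s` modulo `2` have even multiplicity. -/
def EvenParts (s : ℕ) (M : Multiset ℕ) : Prop := ∀ i, i % 2 = s → Even (M.count i)

theorem defect_succ (s : ℕ) (E M : Multiset ℕ) (k : ℕ) : defect s E M (k + 1) =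
    defect s E M k + (2 * (entry E k : ℤ) - 2 * k + 1 - s - entry M k) :=
  sum_range_succ _ _

theorem defect_zero (s : ℕ) (E M : Multiset ℕ) : defect s E M 0 = 0 := rfl

theorem defect_eq (s : ℕ) (E M : Multiset ℕ) (k : ℕ) :
    defect s E M k = 2 * lowSum E k - k * (k - 2 + s) - lowSum M k := by
  induction k with
  | zero => simp [defect, lowSum]
  | succ k ih =>
    rw [defect_succ, ih, lowSum_succ, lowSum_succ]
    push_cast
    ring

/-- By `defect_eq` the even number `2 * lowSum E k` is one of two consecutive integers depending on
`M` alone, so it is determined. -/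
theorem Matches.entries_unique {E' : Multiset ℕ} (h : Matches s E M)
    (h' : Matches s E' M) : E = E' := by
  have hf : ∀ k ≤ M.card, lowSum E k = lowSum E' k := by
    intro k hk
    have h1 := h.2 k hk
    have h2 := h'.2 k hk
    rw [defect_eq] at h1 h2
    omega
  refine eq_of_entry_eq (h.1.trans h'.1.symm) fun j hj => ?_
  rw [h.1] at hj
  have h1 := hf j hj.le
  have h2 := hf (j + 1) hj
  simp only [lowSum, sum_range_succ] at h1 h2
  omega

theorem even_card_filter {p : ℕ → Prop} [DecidablePred p]
    (h : ∀ v, p v → Even (M.count v)) : Even (M.filter p).card := by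
  rw [← Multiset.toFinset_sum_count_eq]
  refine even_sum _ fun v hv => ?_
  simp_all

theorem even_sum_range_iff (f : ℕ → ℤ) (q : ℕ) : Even (∑ j ∈ range q, f j) ↔
    Even ((range q).filter fun j => Odd (f j)).card := by
  induction q with
  | zero => simp
  | succ q ih =>
    rw [sum_range_succ, range_add_one, filter_insert, Int.even_add, ih]
    grind

/-- The defect is even where the parts of the partition increase. -/
theorem even_defect (hs : s ≤ 1) (hV : EvenParts s M) {q : ℕ}
    (hq : q ≤ M.card) (h : ∀ j, j + 1 = q → q < M.card → entry M j < entry M q) :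
    Even (defect s E M q) := by
  unfold defect
  rw [even_sum_range_iff]
  -- A summand is odd exactly when the part has the parity of `s`. In front of an ascent each part
  -- that occurs is counted with its full multiplicity, which is even for these parts.
  have h1 : (range q).filter (fun j =>
      Odd (2 * (entry E j : ℤ) - 2 * j + 1 - s - entry M j)) =
      (range q).filter fun j => entry M j % 2 = s := by
    grind
  rw [h1]
  rcases hq.lt_or_eq with hlt | rfl
  · have h2 : ((range q).filter fun j => entry M j % 2 = s).card =
        (M.filter fun v => v < entry M q ∧ v % 2 = s).card := by
      rw [card_filter_eq]
      congr 1
      ext j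
      simp only [mem_filter, mem_range]
      constructor
      · rintro ⟨hj, hm⟩
        refine ⟨hj.trans hlt, ?_, hm⟩
        rcases Nat.lt_or_ge (j + 1) q with hjq | hjq
        · have := h (q - 1) (by omega) hlt
          exact (entry_mono (by omega) (by omega)).trans_lt this
        · exact h j (by omega) hlt
      · rintro ⟨hj, hm, hm'⟩
        by_contra hjq
        have := entry_mono (E := M) (i := q) (j := j) (by omega) hj
        omega
    rw [h2]
    exact even_card_filter fun v hv => hV v hv.2
  · rw [← card_filter_eq M (fun v => v % 2 = s)]
    exact even_card_filter fun v hv => hV v hv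

/-- The partition is determined by the entries of the symbol. -/
theorem Matches.partition_unique (hs : s ≤ 1) {M' : Multiset ℕ} (h : Matches s E M)
    (h' : Matches s E M') (hV : EvenParts s M) (hV' : EvenParts s M') : M = M' := by
  have hc : M.card = M'.card := h.1.symm.trans h'.1
  have key : ∀ {M M' : Multiset ℕ}, Matches s E M → Matches s E M' → EvenParts s M →
      EvenParts s M' → ∀ k < M.card, (∀ j < k, entry M j = entry M' j) →
      entry M' k ≤ entry M k := by
    intro M M' h h' hV hV' k hk heq
    have hc : M.card = M'.card := h.1.symm.trans h'.1
    -- At the first difference, with `M_k < M'_k`, the defects at `k + 1` are 1 for `M` and 0 for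
    -- `M'`. If the common defect at `k` is 0, oddness at `k + 1` forces `M_{k+1} = M_k`, and the
    -- next defect of `M'` becomes negative. If it is 1, then `M'` must repeat its preceding part,
    -- but this is a part of `M` not exceeding `M_k`.
    by_contra hlt
    have hd : defect s E M k = defect s E M' k :=
      sum_congr rfl fun j hj => by rw [heq j (mem_range.mp hj)]
    have e1 := defect_succ s E M k
    have e2 := defect_succ s E M' k
    have b1 := h.2 (k + 1) hk
    have b2 := h'.2 (k + 1) (by omega)
    have b3 := h.2 k hk.le
    rcases (show defect s E M k = 0 ∨ defect s E M k = 1 by omega) with h0 | h0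
    · have hodd : ¬ Even (defect s E M (k + 1)) := by grind
      have : ¬ ∀ j, j + 1 = k + 1 → k + 1 < M.card → entry M j < entry M (k + 1) :=
        fun hc => hodd (even_defect hs hV hk hc)
      push Not at this
      obtain ⟨j, hj, hk1, hle⟩ := this
      obtain rfl : j = k := by omega
      have h4 := entry_mono (E := M') (Nat.le_succ j) (by omega)
      have e3 := defect_succ s E M (j + 1)
      have e4 := defect_succ s E M' (j + 1)
      have b4 := h.2 (j + 2) hk1
      have b5 := h'.2 (j + 2) (by omega)
      grind
    · have hodd : ¬ Even (defect s E M' k) := by rw [← hd, h0]; decide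
      have : ¬ ∀ j, j + 1 = k → k < M'.card → entry M' j < entry M' k :=
        fun hc => hodd (even_defect hs hV' (by omega) hc)
      push Not at this
      obtain ⟨j, hj, hk1, hle⟩ := this
      have h3 := entry_mono (E := M) (i := j) (j := k) (by omega) hk
      have h4 := heq j (by omega)
      omega
  refine eq_of_entry_eq hc fun k hk => ?_
  induction k using Nat.strong_induction_on with
  | _ k ih => grind

end Defect

/-! ### Inserting and removing a pair of equal parts -/

section Sorted
open Finset hiding mem_add mem_cons mem_singleton sort_eq
open Multiset (mem_add mem_cons mem_singleton sort_eq)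

variable {A B : Multiset ℕ} {j : ℕ}

theorem sort_add (h : ∀ x ∈ A, ∀ y ∈ B, x ≤ y) :
    (A + B).sort (· ≤ ·) = A.sort (· ≤ ·) ++ B.sort (· ≤ ·) := by
  have : A + B = ((A.sort (· ≤ ·) ++ B.sort (· ≤ ·) : List ℕ) : Multiset ℕ) := by
    rw [← Multiset.coe_add, sort_eq, sort_eq]
  conv_lhs => rw [this]
  apply sort_coe_eq
  rw [List.pairwise_append]
  simp_all

theorem entry_add_left (h : ∀ x ∈ A, ∀ y ∈ B, x ≤ y)
    (hj : j < A.card) : entry (A + B) j = entry A j := by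
  unfold entry
  rw [sort_add h, List.getD_append _ _ _ _ (by simpa)]

theorem entry_add_right (h : ∀ x ∈ A, ∀ y ∈ B, x ≤ y)
    (hj : A.card ≤ j) : entry (A + B) j = entry B (j - A.card) := by
  unfold entry
  rw [sort_add h, List.getD_append_right _ _ _ _ (by simpa)]
  simp

theorem entry_pair {a b : ℕ} (h : a ≤ b) : entry {a, b} 0 = a ∧ entry {a, b} 1 = b := by
  have h1 : ({a, b} : Multiset ℕ) = ([a, b] : List ℕ) := rfl
  rw [h1, entry_coe (by simpa), entry_coe (by simpa)]
  exact ⟨rfl, rfl⟩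

theorem entry_map_add (c : ℕ) (hj : j < A.card) :
    entry (A.map (· + c)) j = entry A j + c := by
  have h : (A.map (· + c)).sort (· ≤ ·) = (A.sort (· ≤ ·)).map (· + c) := by
    conv_lhs => rw [← sort_eq A (· ≤ ·), map_coe]
    apply sort_coe_eq
    rw [pairwise_map]
    simp_all
  have hj' : j < (A.sort (· ≤ ·)).length := by simpa
  unfold entry
  grind

end Sorted

/-! ### The defects before and after an exchange. -/

section Exchange
open Finset hiding mem_add mem_cons mem_singleton sort_eq
open Multiset (mem_add mem_cons mem_singleton sort_eq)

/-- The data of the exchange of a pair of zeros of a partition for a pair of equal parts `d`, and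
of the entries `0, s` of a symbol for `a, b`. -/
structure Exchange (s d a b : ℕ) (low high small large E M E' M' : Multiset ℕ) : Prop where
  s_le : s ≤ 1
  eqE : E = {0, s} + low.map (· + 2) + high
  eqE' : E' = low + {a, b} + high
  eqM : M = {0, 0} + small + large
  eqM' : M' = small + {d, d} + large
  low_le : ∀ x ∈ low, x + 2 ≤ a
  le_high : ∀ x ∈ high, b ≤ x
  small_le : ∀ x ∈ small, x ≤ d
  le_large : ∀ x ∈ large, d ≤ x
  card_eq : small.card = low.card
  card_eq' : high.card = large.card
  a_eq : a = low.card + (d + s) / 2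
  b_eq : a + b = d + s + 2 * low.card

variable {s d a b : ℕ} {low high small large E M E' M' : Multiset ℕ}

namespace Exchange

theorem entries_left (X : Exchange s d a b low high small large E M E' M') :
    entry E 0 = 0 ∧ entry E 1 = s ∧
    (∀ j < low.card, entry E (j + 2) = entry low j + 2) ∧
    ∀ j, entry E (low.card + 2 + j) = entry high j := by
  have h0 := X.s_le
  have h1 := X.a_eq
  have h2 := X.b_eq
  have hA : ∀ x ∈ ({0, s} + low.map (· + 2) : Multiset ℕ), ∀ y ∈ high, x ≤ y := by
    intro x hx y hy
    have hy' := X.le_high y hy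
    rw [mem_add, Multiset.mem_map] at hx
    rcases hx with hx | ⟨z, hz, rfl⟩
    · simp only [insert_eq_cons, mem_cons, mem_singleton] at hx
      omega
    · have := X.low_le z hz
      omega
  have hB : ∀ x ∈ ({0, s} : Multiset ℕ), ∀ y ∈ low.map (· + 2), x ≤ y := by
    intro x hx y hy
    rw [Multiset.mem_map] at hy
    simp only [insert_eq_cons, mem_cons, mem_singleton] at hx
    omega
  have hp := entry_pair (Nat.zero_le s)
  have hc : ({0, s} + low.map (· + 2) : Multiset ℕ).card = low.card + 2 := by simp_all
  rw [X.eqE]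
  refine ⟨?_, ?_, fun j hj => ?_, fun j => ?_⟩
  · rw [entry_add_left hA (by omega), entry_add_left hB (by simp), hp.1]
  · rw [entry_add_left hA (by omega), entry_add_left hB (by simp), hp.2]
  · rw [entry_add_left hA (by omega), entry_add_right hB (by simp)]
    exact entry_map_add 2 hj
  · rw [entry_add_right hA (by omega), hc, Nat.add_sub_cancel_left]

theorem entries_right (X : Exchange s d a b low high small large E M E' M') :
    (∀ j < low.card, entry E' j = entry low j) ∧
    entry E' low.card = a ∧ entry E' (low.card + 1) = b ∧
    ∀ j, entry E' (low.card + 2 + j) = entry high j := by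
  have h1 := X.a_eq
  have h2 := X.b_eq
  have hab : a ≤ b := by omega
  have hA : ∀ x ∈ (low + {a, b} : Multiset ℕ), ∀ y ∈ high, x ≤ y := by
    intro x hx y hy
    have hy' := X.le_high y hy
    simp only [mem_add, insert_eq_cons, mem_cons, mem_singleton] at hx
    rcases hx with hx | hx | hx
    · have := X.low_le x hx
      omega
    all_goals omega
  have hB : ∀ x ∈ low, ∀ y ∈ ({a, b} : Multiset ℕ), x ≤ y := by
    intro x hx y hy
    have := X.low_le x hx
    simp only [insert_eq_cons, mem_cons, mem_singleton] at hy
    omega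
  have hp := entry_pair hab
  have hc : (low + {a, b} : Multiset ℕ).card = low.card + 2 := by simp
  rw [X.eqE']
  refine ⟨fun j hj => ?_, ?_, ?_, fun j => ?_⟩
  · rw [entry_add_left hA (by omega), entry_add_left hB hj]
  · rw [entry_add_left hA (by omega), entry_add_right hB le_rfl, Nat.sub_self, hp.1]
  · rw [entry_add_left hA (by omega), entry_add_right hB (by omega), Nat.add_sub_cancel_left, hp.2]
  · rw [entry_add_right hA (by omega), hc, Nat.add_sub_cancel_left]

theorem parts_left (X : Exchange s d a b low high small large E M E' M') :
    entry M 0 = 0 ∧ entry M 1 = 0 ∧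
    (∀ j < low.card, entry M (j + 2) = entry small j) ∧
    ∀ j, entry M (low.card + 2 + j) = entry large j := by
  have hA : ∀ x ∈ ({0, 0} + small : Multiset ℕ), ∀ y ∈ large, x ≤ y := by
    intro x hx y hy
    have hy' := X.le_large y hy
    simp only [mem_add, insert_eq_cons, mem_cons, mem_singleton] at hx
    rcases hx with hx | hx
    · omega
    · exact (X.small_le x hx).trans hy'
  have hB : ∀ x ∈ ({0, 0} : Multiset ℕ), ∀ y ∈ small, x ≤ y := by simp_all
  have hp := entry_pair (le_refl 0)
  have hc : ({0, 0} + small : Multiset ℕ).card = low.card + 2 := by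
    have := X.card_eq
    simp_all
  rw [X.eqM]
  refine ⟨?_, ?_, fun j hj => ?_, fun j => ?_⟩
  · rw [entry_add_left hA (by omega), entry_add_left hB (by simp), hp.1]
  · rw [entry_add_left hA (by omega), entry_add_left hB (by simp), hp.2]
  · rw [entry_add_left hA (by omega), entry_add_right hB (by simp)]
    simp
  · rw [entry_add_right hA (by omega), hc, Nat.add_sub_cancel_left]

theorem parts_right (X : Exchange s d a b low high small large E M E' M') :
    (∀ j < low.card, entry M' j = entry small j) ∧
    entry M' low.card = d ∧ entry M' (low.card + 1) = d ∧
    ∀ j, entry M' (low.card + 2 + j) = entry large j := by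
  have hcs := X.card_eq
  have hA : ∀ x ∈ (small + {d, d} : Multiset ℕ), ∀ y ∈ large, x ≤ y := by
    intro x hx y hy
    have hy' := X.le_large y hy
    simp only [mem_add, insert_eq_cons, mem_cons, mem_singleton] at hx
    rcases hx with hx | hx | hx
    · exact (X.small_le x hx).trans hy'
    all_goals omega
  have hB : ∀ x ∈ small, ∀ y ∈ ({d, d} : Multiset ℕ), x ≤ y := by
    intro x hx y hy
    have := X.small_le x hx
    simp_all
  have hp := entry_pair (le_refl d)
  have hc : (small + {d, d} : Multiset ℕ).card = low.card + 2 := by simp_all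
  rw [X.eqM', ← hcs]
  refine ⟨fun j hj => ?_, ?_, ?_, fun j => ?_⟩
  · rw [entry_add_left hA (by omega), entry_add_left hB hj]
  · rw [entry_add_left hA (by omega), entry_add_right hB le_rfl, Nat.sub_self, hp.1]
  · rw [entry_add_left hA (by omega), entry_add_right hB (by omega), Nat.add_sub_cancel_left, hp.2]
  · rw [entry_add_right hA (by omega), hc, hcs, Nat.add_sub_cancel_left]

theorem card_left
    (X : Exchange s d a b low high small large E M E' M') : M.card = low.card + 2 + large.card := by
  have h1 := X.card_eq
  rw [X.eqM]
  simp
  omega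

theorem card_right (X : Exchange s d a b low high small large E M E' M') : M'.card = M.card := by
  rw [X.eqM, X.eqM']
  simp
  omega

theorem card_entries
    (X : Exchange s d a b low high small large E M E' M') : E.card = M.card ∧ E'.card = M.card := by
  have h1 := X.card_eq
  have h2 := X.card_eq'
  rw [X.eqM, X.eqE', X.eqE]
  simp
  omega

theorem defect_one
    (X : Exchange s d a b low high small large E M E' M') : defect s E M 1 = 1 - s := by
  have h1 := X.entries_left.1
  have h2 := X.parts_left.1
  rw [show (1 : ℕ) = 0 + 1 from rfl, defect_succ, defect_zero, h1, h2]
  ring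

/-- Dropping the first two entries and lowering the small ones by 2 just shifts the sequence of
defects by two places. By `defect_high` nothing changes above the inserted pair, so the place
between `a` and `b` is the only new one. -/
theorem defect_low
    (X : Exchange s d a b low high small large E M E' M') {k : ℕ} (hk : k ≤ low.card) :
    defect s E' M' k = defect s E M (k + 2) := by
  induction k with
  | zero =>
    rw [show 0 + 2 = 1 + 1 from rfl, defect_succ, X.defect_one, X.entries_left.2.1,
      X.parts_left.2.1, defect_zero]
    ring
  | succ k ih =>
    rw [defect_succ, ih (by omega), show k + 1 + 2 = k + 2 + 1 from rfl, defect_succ _ _ _ (k + 2),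
      X.entries_left.2.2.1 k hk, X.entries_right.1 k hk, X.parts_left.2.2.1 k hk,
      X.parts_right.1 k hk]
    push_cast
    ring

theorem defect_mid
    (X : Exchange s d a b low high small large E M E' M') : defect s E' M' (low.card + 1) =
    defect s E M (low.card + 2) + (2 * ((d + s) / 2 : ℕ) + 1 - s - d) := by
  rw [defect_succ, X.defect_low le_rfl, X.entries_right.2.1, X.parts_right.2.1, X.a_eq]
  push_cast
  ring

theorem defect_high
    (X : Exchange s d a b low high small large E M E' M') (k : ℕ) :
    defect s E' M' (low.card + 2 + k) =
    defect s E M (low.card + 2 + k) := by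
  induction k with
  | zero =>
    rw [Nat.add_zero, show low.card + 2 = low.card + 1 + 1 from rfl, defect_succ, X.defect_mid,
      X.entries_right.2.2.1, X.parts_right.2.2.1]
    have h1 := X.a_eq
    have h2 := X.b_eq
    grind
  | succ k ih =>
    rw [← add_assoc, defect_succ, ih, defect_succ, X.entries_left.2.2.2, X.entries_right.2.2.2,
      X.parts_left.2.2.2, X.parts_right.2.2.2]

/-- Because of the vanishing defect in front of the pair, the new defect is 1 or 0 according as `d +
s` is even or odd; the others are inherited. -/
theorem matches_right
    (X : Exchange s d a b low high small large E M E' M') (h : Matches s E M)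
    (h0 : defect s E M (low.card + 2) = 0) :
    Matches s E' M' := by
  refine ⟨X.card_entries.2.trans X.card_right.symm, fun k hk => ?_⟩
  have hc := X.card_left
  rw [X.card_right] at hk
  rcases lt_trichotomy k (low.card + 1) with hlt | rfl | hlt
  · rw [X.defect_low (by omega)]
    exact h.2 _ (by omega)
  · rw [X.defect_mid, h0]
    omega
  · obtain ⟨j, rfl⟩ := Nat.exists_eq_add_of_le (show low.card + 2 ≤ k by omega)
    rw [X.defect_high]
    exact h.2 _ hk

theorem matches_left
    (X : Exchange s d a b low high small large E M E' M') (h : Matches s E' M') : Matches s E M := by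
  refine ⟨X.card_entries.1, fun k hk => ?_⟩
  have hc' := X.card_right
  have hs := X.s_le
  rcases Nat.lt_or_ge k 2 with hlt | hge
  · rcases (show k = 0 ∨ k = 1 by omega) with rfl | rfl
    · rw [defect_zero]; omega
    · rw [X.defect_one]; omega
  · rcases Nat.lt_or_ge k (low.card + 2) with hlt | hge'
    · obtain ⟨j, rfl⟩ := Nat.exists_eq_add_of_le' hge
      rw [← X.defect_low (by omega)]
      exact h.2 _ (by omega)
    · obtain ⟨j, rfl⟩ := Nat.exists_eq_add_of_le hge'
      rw [← X.defect_high]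
      exact h.2 _ (by omega)

theorem sum_eq (X : Exchange s d a b low high small large E M E' M') : E'.sum = E.sum + d := by
  have h2 := X.b_eq
  rw [X.eqE, X.eqE', sum_add, sum_add, sum_add, sum_add, Multiset.sum_map_add]
  simp
  omega

end Exchange

end Exchange

/-! ### Rows of symbols -/

section Rows
open Finset hiding card mem_add mem_filter
open Multiset (card mem_add mem_filter)

variable {r z u v s d : ℕ} {X X' : ℕ → ℕ} {M E : Multiset ℕ}

/-- The entries of a row of length `r`. -/
def rowM (r : ℕ) (X : ℕ → ℕ) : Multiset ℕ := (Multiset.range r).map X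

/-- Successive entries of a row differ by at least `2`. -/
def Gap (r : ℕ) (X : ℕ → ℕ) : Prop := ∀ i, i + 1 < r → X i + 2 ≤ X (i + 1)

/-- The Pieri rule for the entries of a row. -/
def RowStrip (r : ℕ) (X X' : ℕ → ℕ) : Prop :=
  (∀ i < r, X i ≤ X' i) ∧ ∀ i, i + 1 < r → X' i + 2 ≤ X (i + 1)

theorem RowStrip.gap_left (h : RowStrip r X X') : Gap r X := fun i hi =>
  (Nat.add_le_add_right (h.1 i (by omega)) 2).trans (h.2 i hi)

theorem Gap.add_le (h : Gap r X) {i k : ℕ} (hk : i + k < r) :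
    X i + 2 * k ≤ X (i + k) := by
  induction k with
  | zero => simp
  | succ k ih =>
    have h2 := h (i + k) hk
    rw [← add_assoc]
    omega

theorem Gap.lt (h : Gap r X) {i j : ℕ} (hij : i < j) (hj : j < r) :
    X i + 2 ≤ X j := by
  obtain ⟨k, rfl⟩ := Nat.exists_eq_add_of_le hij.le
  have := h.add_le hj
  omega

theorem card_rowM (r : ℕ) (X : ℕ → ℕ) : (rowM r X).card = r := by simp [rowM]

theorem mem_rowM : z ∈ rowM r X ↔ ∃ i < r, X i = z := by simp [rowM]

theorem rowM_congr (h : ∀ i < r, X i = X' i) : rowM r X = rowM r X' :=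
  Multiset.map_congr rfl fun i hi => h i (Multiset.mem_range.mp hi)

theorem rowM_add (r k : ℕ) (X : ℕ → ℕ) : rowM (r + k) X = rowM r X + rowM k fun i => X (r + i) := by
  change ((List.map X (List.range (r + k)) : List ℕ) : Multiset ℕ) = _
  rw [List.range_add, map_append, ← Multiset.coe_add, List.map_map]
  rfl

theorem rowM_one (X : ℕ → ℕ) : rowM 1 X = {X 0} := rfl

theorem rowM_split (hu : u < r) (X : ℕ → ℕ) :
    rowM r X = rowM u X + {X u} + rowM (r - u - 1) fun i => X (u + 1 + i) := by
  obtain ⟨k, rfl⟩ := Nat.exists_eq_add_of_lt hu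
  rw [show u + k + 1 = u + 1 + k by ring, rowM_add (u + 1) k, rowM_add u 1, rowM_one,
    show u + 1 + k - u - 1 = k by omega]
  rfl

theorem rowM_split_zero (hu : u < r) (X : ℕ → ℕ) :
    rowM r X = {X 0} + (rowM u fun i => X (i + 1)) + rowM (r - u - 1) fun i => X (u + 1 + i) := by
  obtain ⟨k, rfl⟩ := Nat.exists_eq_add_of_lt hu
  rw [show u + k + 1 = 1 + u + k by ring, rowM_add (1 + u) k, rowM_add 1 u, rowM_one,
    show 1 + u + k - u - 1 = k by omega]
  simp only [add_comm 1]

theorem card_filter_rowM (X : ℕ → ℕ) (p : ℕ → Prop) [DecidablePred p] :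
    ((rowM r X).filter p).card = ((range r).filter fun i => p (X i)).card := by
  rw [rowM, Multiset.filter_map, Multiset.card_map]
  rfl

theorem Gap.card_filter_le (h : Gap r X) (hu : u ≤ r)
    (h1 : ∀ i < u, X i ≤ v) (h2 : u < r → v < X u) : ((rowM r X).filter (· ≤ v)).card = u := by
  rw [card_filter_rowM]
  have : (range r).filter (fun i => X i ≤ v) = range u := by
    ext i
    rw [Finset.mem_filter, mem_range, mem_range]
    constructor
    · rintro ⟨hi, hv⟩
      by_contra hiu
      rcases (show u = i ∨ u < i by omega) with rfl | hlt
      · exact absurd (h2 hi) (by omega)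
      · have := h.lt hlt hi
        omega
    grind
  rw [this, card_range]

theorem Gap.exists_cut (h : Gap r X) (v : ℕ) :
    ∃ u ≤ r, (∀ i < u, X i ≤ v) ∧ (u < r → v < X u) := by
  induction r with
  | zero => exact ⟨0, le_rfl, by simp, by simp⟩
  | succ r ih =>
    obtain ⟨u, hu, h1, h2⟩ := ih fun i hi => h i (by omega)
    grind

theorem Gap.card_filter_interval (h : Gap r X) (w : ℕ) :
    ((rowM r X).filter fun x => w ≤ x ∧ x ≤ w + 1).card ≤ 1 := by
  rw [card_filter_rowM, card_le_one]
  intro i hi j hj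
  rw [Finset.mem_filter, mem_range] at hi hj
  by_contra hne
  rcases Nat.lt_or_gt_of_ne hne with hlt | hlt
  · have := h.lt hlt hj.1
    omega
  · have := h.lt hlt hi.1
    omega

/-- Inserting an entry into a row that starts with `X 0`. -/
theorem Gap.insert (h : Gap r X) (hu : u < r) (hz : X u ≤ z)
    (hz' : u + 1 < r → z + 2 ≤ X (u + 1)) : ∃ X' low high, RowStrip r X X' ∧
      rowM r X' = low + {z} + high ∧ rowM r X = {X 0} + low.map (· + 2) + high ∧
      low.card = u ∧ (∀ x ∈ low, x + 2 ≤ X u) ∧ ∀ x ∈ high, ∃ i < r, u < i ∧ X i = x := by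
  -- The first `u` entries grow as far as a strip permits, up to 2 below their old successors; the
  -- initial entry `X 0` disappears from the multiset and makes room for `z`.
  refine ⟨fun i => if i < u then X (i + 1) - 2 else if i = u then z else X i,
    rowM u fun i => X (i + 1) - 2, rowM (r - u - 1) fun i => X (u + 1 + i), ⟨?_, ?_⟩, ?_, ?_,
    card_rowM _ _, ?_, ?_⟩
  · intro i hi
    simp only
    split_ifs with h1 h2
    · have := h i (by omega); omega
    · rw [h2]; exact hz
    · exact le_rfl
  · intro i hi
    have := h i hi
    grind
  · rw [rowM_split hu]
    congr 1
    · congr 1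
      · exact rowM_congr fun i hi => if_pos hi
      · simp
    grind
  · rw [rowM_split_zero hu]
    congr 2
    unfold rowM
    rw [Multiset.map_map]
    refine Multiset.map_congr rfl fun i hi => ?_
    have := h i (by have := Multiset.mem_range.mp hi; omega)
    simp only [comp]
    omega
  · intro x hx
    obtain ⟨i, hi, rfl⟩ := mem_rowM.mp hx
    have h1 := h i (by omega)
    rcases (show i + 1 = u ∨ i + 1 < u by omega) with h2 | h2
    · rw [← h2]; omega
    · have := h.lt h2 hu
      omega
  · intro x hx
    obtain ⟨i, hi, rfl⟩ := mem_rowM.mp hx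
    grind

/-- Removing an entry from a row. -/
theorem Gap.remove (h : Gap r X') (hu : u < r) (hs : s ≤ X' 0) :
    ∃ X low high, RowStrip r X X' ∧ X 0 = s ∧
      rowM r X' = low + {X' u} + high ∧ rowM r X = {s} + low.map (· + 2) + high ∧
      (∀ x ∈ low, x + 2 ≤ X' u) ∧ (∀ x ∈ high, X' u + 2 ≤ x) := by
  refine ⟨fun i => if i = 0 then s else if i ≤ u then X' (i - 1) + 2 else X' i,
    rowM u X', rowM (r - u - 1) fun i => X' (u + 1 + i), ⟨?_, ?_⟩, if_pos rfl, rowM_split hu X',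
    ?_, ?_, ?_⟩
  · intro i hi
    simp only
    split_ifs with h1 h2
    · rw [h1]; exact hs
    · have := h (i - 1) (by omega)
      grind
    · exact le_rfl
  · intro i hi
    simp only [Nat.add_eq_zero_iff, one_ne_zero, and_false, if_false, Nat.add_sub_cancel]
    split_ifs with h2
    · exact le_rfl
    · exact h i hi
  · rw [rowM_split_zero hu]
    congr 1
    · congr 1
      unfold rowM
      rw [Multiset.map_map]
      refine Multiset.map_congr rfl fun i hi => ?_
      simp_all
    grind
  · intro x hx
    obtain ⟨i, hi, rfl⟩ := mem_rowM.mp hx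
    exact h.lt hi hu
  · intro x hx
    obtain ⟨i, hi, rfl⟩ := mem_rowM.mp hx
    exact h.lt (by omega) (by omega)

theorem pair_le_of_count (h : 2 ≤ M.count d) : {d, d} ≤ M := by
  rw [show ({d, d} : Multiset ℕ) = replicate 2 d from rfl, ← Multiset.le_count_iff_replicate_le]
  exact h

theorem filter_lt_card_le {w : ℕ} (h : v ≤ w)
    (hc : (E.filter (· ≤ w)).card ≤ (E.filter (· ≤ v)).card) {x : ℕ} (hx : x ∈ E) (hw : x ≤ w) :
    x ≤ v := by
  have h1 : E.filter (· ≤ v) ≤ E.filter (· ≤ w) :=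
    Multiset.monotone_filter_right E fun a ha => ha.trans h
  have h2 := Multiset.eq_of_le_of_card_le h1 hc
  have h3 : x ∈ E.filter (· ≤ v) := by simp_all
  exact (mem_filter.mp h3).2

theorem zero_pair_le (hm : Matches s E M)
    (hc : 2 ≤ M.card) (h0 : 1 ≤ (E.filter (· ≤ 0)).card) (h1 : 2 ≤ (E.filter (· ≤ s)).card) :
    {0, 0} ≤ M := by
  have h0 : entry E 0 ≤ 0 := (entry_le_iff (by rw [hm.1]; omega) 0).mpr (by omega)
  have h1 : entry E 1 ≤ s := (entry_le_iff (by rw [hm.1]; omega) s).mpr (by omega)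
  have h2 := hm.2 2 hc
  rw [show 2 = 0 + 1 + 1 from rfl, defect_succ, defect_succ, defect_zero] at h2
  have hM0 : entry M 0 = 0 ∧ entry M 1 = 0 := by omega
  apply pair_le_of_count
  have h1 : (Multiset.range 2).map (entry M) ≤ M := by
    conv_rhs => rw [← map_entry M]
    exact map_le_map (range_le.mpr (by omega))
  have h2 : (Multiset.range 2).map (entry M) = {0, 0} := by simp_all
  rw [h2] at h1
  exact le_trans (by decide) (Multiset.count_le_of_le 0 h1)

/-- The pair goes behind the `p` parts smaller than `d`. There `M` increases, or ends, so the defect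
vanishes by `even_defect`, and the bounds on the neighbouring defects leave a gap of the entries
around `a`. For `b = a + 1` two further entries equal to `a + 2` would make a defect negative. -/
theorem exists_insert_position (hs : s ≤ 1) (hm : Matches s E M)
    (hV : EvenParts s M) (hd : 1 ≤ d) (hle : {0, 0} ≤ M) :
    ∃ N p a b, M = {0, 0} + N ∧ (N.filter (· < d)).card = p ∧ defect s E M (p + 2) = 0 ∧
      a = p + (d + s) / 2 ∧ a + b = d + s + 2 * p ∧
      (E.filter (· ≤ a)).card = p + 2 ∧ (∀ x ∈ E, x ≤ a + 1 → x ≤ a) ∧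
      (a + 1 = b → (E.filter (· ≤ a + 2)).card ≤ p + 3) := by
  obtain ⟨N, hN⟩ := Multiset.le_iff_exists_add.mp hle
  obtain ⟨p, hp⟩ : ∃ p, (N.filter (· < d)).card = p := ⟨_, rfl⟩
  obtain ⟨a, ha⟩ : ∃ a, a = p + (d + s) / 2 := ⟨_, rfl⟩
  obtain ⟨b, hb⟩ : ∃ b, b = d + s + 2 * p - a := ⟨_, rfl⟩
  have hE : E.card = M.card := hm.1
  have hq : (M.filter (· < d)).card = p + 2 := by
    rw [hN, filter_add, card_add, hp, Multiset.filter_eq_self.mpr]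
    · simp [add_comm]
    · intro x hx
      simp only [insert_eq_cons, Multiset.mem_cons, Multiset.mem_singleton] at hx
      omega
  have hqT : p + 2 ≤ M.card := by rw [← hq]; exact Multiset.card_le_card (filter_le _ _)
  have hlt : ∀ j < p + 2, entry M j < d := fun j hj => (lt_entry_iff (by omega) d).mpr (by omega)
  have hge : ∀ j, p + 2 ≤ j → j < M.card → d ≤ entry M j := fun j hj hj' => by
    by_contra hc
    have := (lt_entry_iff hj' d).mp (by omega)
    omega
  have hdef : defect s E M (p + 2) = 0 := by
    have h1 : Even (defect s E M (p + 2)) := even_defect hs hV hqT fun j hj hjT =>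
      (hlt j (by omega)).trans_le (hge _ le_rfl hjT)
    have h2 := hm.2 (p + 2) hqT
    rw [even_iff] at h1
    omega
  have hca : p + 2 ≤ (E.filter (· ≤ a)).card := by
    have h1 := (entry_le_iff (E := E) (j := p + 1) (by omega) a).mp (by
      have e1 := defect_succ s E M (p + 1)
      have e2 := hm.2 (p + 1) (by omega)
      grind)
    omega
  have hca' : (E.filter (· ≤ a + 1)).card ≤ p + 2 := by
    rcases hqT.lt_or_eq with h1 | h1
    · by_contra hc
      have h2 := (entry_le_iff (E := E) (j := p + 2) (by omega) (a + 1)).mpr (by omega)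
      have e1 := defect_succ s E M (p + 2)
      have e2 := hm.2 (p + 2 + 1) h1
      grind
    · rw [h1, ← hm.1]
      exact Multiset.card_le_card (filter_le _ _)
  refine ⟨N, p, a, b, hN, hp, hdef, ha, by omega, ?_, fun x hx h =>
    filter_lt_card_le (Nat.le_succ a) (hca'.trans hca) hx h, fun hab => ?_⟩
  · refine le_antisymm (le_trans (Multiset.card_le_card ?_) hca') hca
    exact Multiset.monotone_filter_right E fun x hx => hx.trans (Nat.le_succ a)
  · by_contra hc
    have hcE : (E.filter (· ≤ a + 2)).card ≤ E.card := Multiset.card_le_card (filter_le _ _)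
    have h2 := (entry_le_iff (E := E) (j := p + 2) (by omega) (a + 2)).mpr (by omega)
    have h3 := (entry_le_iff (E := E) (j := p + 3) (by omega) (a + 2)).mpr (by omega)
    have e1 := defect_succ s E M (p + 2)
    have e1' := defect_succ s E M (p + 3)
    have e2 := hm.2 (p + 4) (by omega)
    grind

theorem card_filter_rowM_le (hu : u ≤ r) (h : ∀ i < u, X i ≤ v) :
    u ≤ ((rowM r X).filter (· ≤ v)).card := by
  rw [card_filter_rowM]
  have : range u ⊆ (range r).filter fun i => X i ≤ v := by grind
  simpa using card_le_card this

/-- Inserting a pair of parts `d`: the symbol can be changed accordingly by a strip. -/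
theorem exists_insert {t : ℕ} {Y : ℕ → ℕ} (hs : s ≤ 1) (hX : Gap r X)
    (hY : Gap t Y) (hr : 0 < r) (ht : 0 < t) (hX0 : X 0 = 0) (hY0 : Y 0 = s)
    (hm : Matches s (rowM r X + rowM t Y) M) (hV : EvenParts s M) (hd : 1 ≤ d) :
    ∃ X' Y' N, RowStrip r X X' ∧ RowStrip t Y Y' ∧
      (rowM r X' + rowM t Y').sum = (rowM r X + rowM t Y).sum + d ∧ M = {0, 0} + N ∧
      Matches s (rowM r X' + rowM t Y') (N + {d, d}) := by
  obtain ⟨E, hE⟩ : ∃ E, E = rowM r X + rowM t Y := ⟨_, rfl⟩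
  rw [← hE] at hm ⊢
  have hEc : E.card = r + t := by rw [hE, card_add, card_rowM, card_rowM]
  have hmemX : ∀ i < r, X i ∈ E := fun i hi => by
    rw [hE]; exact mem_add.mpr (Or.inl (mem_rowM.mpr ⟨i, hi, rfl⟩))
  have hmemY : ∀ i < t, Y i ∈ E := fun i hi => by
    rw [hE]; exact mem_add.mpr (Or.inr (mem_rowM.mpr ⟨i, hi, rfl⟩))
  have hfilt : ∀ v, (E.filter (· ≤ v)).card = ((rowM r X).filter (· ≤ v)).card +
      ((rowM t Y).filter (· ≤ v)).card := fun v => by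
    simp_all
  have hposX : ∀ v, 0 < ((rowM r X).filter (· ≤ v)).card := fun v =>
    card_filter_rowM_le (u := 1) hr fun i hi => by rw [show i = 0 by omega]; omega
  have hposY : ∀ v, s ≤ v → 0 < ((rowM t Y).filter (· ≤ v)).card := fun v hv =>
    card_filter_rowM_le (u := 1) ht fun i hi => by rw [show i = 0 by omega]; omega
  have hle : {0, 0} ≤ M := zero_pair_le hm (by rw [← hm.1]; omega)
    (by rw [hfilt]; have := hposX 0; omega)
    (by rw [hfilt]; have := hposX s; have := hposY s le_rfl; omega)
  obtain ⟨N, p, a, b, hN, hp, hdef, ha, hb, hcount, hno, hsum⟩ :=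
    exists_insert_position hs hm hV hd hle
  obtain ⟨u', hu', hu1, hu2⟩ := hX.exists_cut a
  obtain ⟨v', hv', hv1, hv2⟩ := hY.exists_cut a
  have hcX := hX.card_filter_le hu' hu1 hu2
  have hcY := hY.card_filter_le hv' hv1 hv2
  have h0u : 0 < u' := by rw [← hcX]; exact hposX a
  have h0v : 0 < v' := by rw [← hcY]; exact hposY a (by omega)
  obtain ⟨u, rfl⟩ : ∃ u, u' = u + 1 := ⟨u' - 1, by omega⟩
  obtain ⟨v, rfl⟩ : ∃ v, v' = v + 1 := ⟨v' - 1, by omega⟩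
  have huv : u + v = p := by
    have := hfilt a
    omega
  have hu3 : u + 1 < r → a + 2 ≤ X (u + 1) := fun h => by
    grind
  have hv3 : v + 1 < t → a + 2 ≤ Y (v + 1) := fun h => by
    grind
  -- the entries to be inserted
  obtain ⟨z₁, z₂, hz, hz1, hz2⟩ : ∃ z₁ z₂, (z₁ = a ∧ z₂ = b ∨ z₁ = b ∧ z₂ = a) ∧
      (u + 1 < r → z₁ + 2 ≤ X (u + 1)) ∧ (v + 1 < t → z₂ + 2 ≤ Y (v + 1)) := by
    -- One of `a`, `b` goes into each row. Both distributions fail only if `b = a + 1` and `a + 2`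
    -- occurs in both rows, which `hsum` excludes by counting.
    by_cases hc : u + 1 < r → b + 2 ≤ X (u + 1)
    · grind
    · push Not at hc
      refine ⟨a, b, Or.inl ⟨rfl, rfl⟩, hu3, fun hv => ?_⟩
      by_contra hlt'
      have hab : a + 1 = b := by omega
      have h3 : u + 2 ≤ ((rowM r X).filter (· ≤ a + 2)).card :=
        card_filter_rowM_le (by omega) fun i hi => by
          grind
      have h4 : v + 2 ≤ ((rowM t Y).filter (· ≤ a + 2)).card :=
        card_filter_rowM_le (by omega) fun i hi => by
          grind
      have h5 := hsum hab
      rw [hfilt] at h5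
      omega
  have hsl : N.filter (· < d) + N.filter (fun x => ¬ x < d) = N :=
    filter_add_not (· < d) N
  have hXu := hu1 u (by omega)
  have hYv := hv1 v (by omega)
  obtain ⟨X', lowX, highX, hsX, hX', hXX, hlX, hlX', hhX⟩ :=
    hX.insert (z := z₁) (by omega) (by omega) hz1
  obtain ⟨Y', lowY, highY, hsY, hY', hYY, hlY, hlY', hhY⟩ :=
    hY.insert (z := z₂) (by omega) (by omega) hz2
  have hzz : ({z₁} + {z₂} : Multiset ℕ) = {a, b} := by
    rcases hz with ⟨rfl, rfl⟩ | ⟨rfl, rfl⟩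
    · rfl
    · exact add_comm _ _
  have hhigh : ∀ x ∈ highX + highY, b ≤ x := by
    intro x hx
    have : x ∈ E ∧ a < x := by
      rcases mem_add.mp hx with hx | hx
      · obtain ⟨i, hi, hui, rfl⟩ := hhX x hx
        refine ⟨hmemX i hi, ?_⟩
        rcases (show u + 1 = i ∨ u + 1 < i by omega) with rfl | h
        · omega
        · have := hX.lt h hi; omega
      · obtain ⟨i, hi, hui, rfl⟩ := hhY x hx
        refine ⟨hmemY i hi, ?_⟩
        rcases (show v + 1 = i ∨ v + 1 < i by omega) with rfl | h
        · omega
        · have := hY.lt h hi; omega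
    omega
  have hlow : (lowX + lowY).card = p := by rw [card_add, hlX, hlY, huv]
  have hEE : E = {0, s} + (lowX + lowY).map (· + 2) + (highX + highY) := by
    rw [hE, hXX, hYY, hX0, hY0, Multiset.map_add,
      show ({0, s} : Multiset ℕ) = {0} + {s} from rfl]
    abel
  have hEE' : rowM r X' + rowM t Y' = (lowX + lowY) + {a, b} + (highX + highY) := by
    rw [hX', hY', ← hzz]
    abel
  have ex : Exchange s d a b (lowX + lowY) (highX + highY) (N.filter (· < d))
      (N.filter fun x => ¬ x < d) E M
      (rowM r X' + rowM t Y') (N + {d, d}) :=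
    { s_le := hs
      eqE := hEE
      eqE' := hEE'
      eqM := by rw [hN, add_assoc, hsl]
      eqM' := by grind
      low_le := fun x hx => by
        grind
      le_high := hhigh
      small_le := fun x hx => (mem_filter.mp hx).2.le
      le_large := fun x hx => not_lt.mp (mem_filter.mp hx).2
      card_eq := hlow.trans hp.symm |>.symm
      card_eq' := by
        have h1 := congrArg card hEE
        have h2 := congrArg card hN
        have h3 := congrArg card hsl
        have h4 := hm.1
        simp only [card_add, Multiset.card_pair, Multiset.card_map] at h1 h2 h3 hlow ⊢
        omega
      a_eq := by rw [hlow, ha]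
      b_eq := by omega }
  refine ⟨X', Y', N, hsX, hsY, ex.sum_eq, hN, ex.matches_right hm ?_⟩
  rw [hlow]
  exact hdef

/-- Removing a pair of parts `d`: the symbol arises by a strip from a symbol corresponding to the
remaining partition. -/
theorem exists_remove {t : ℕ} {Y' : ℕ → ℕ} {N : Multiset ℕ} (hs : s ≤ 1)
    (hX : Gap r X') (hY : Gap t Y') (hY0 : s ≤ Y' 0)
    (hm : Matches s (rowM r X' + rowM t Y') (N + {d, d})) (hV : EvenParts s (N + {d, d}))
    (hd : 1 ≤ d) :
    0 < r ∧ 0 < t ∧ ∃ X Y, RowStrip r X X' ∧ RowStrip t Y Y' ∧ X 0 = 0 ∧ Y 0 = s ∧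
      (rowM r X' + rowM t Y').sum = (rowM r X + rowM t Y).sum + d ∧
      Matches s (rowM r X + rowM t Y) ({0, 0} + N) := by
  set E' := rowM r X' + rowM t Y' with hE'
  set M' := N + {d, d} with hM'
  have hMc : M'.card = N.card + 2 := by simp_all
  have hc := hm.1
  set small := N.filter (· < d) with hsmall
  set large := N.filter (fun x => ¬ x < d) with hlarge
  have hsl : small + large = N := filter_add_not (· < d) N
  set p := small.card with hp
  have hpN : p ≤ N.card := Multiset.card_le_card (filter_le _ _)
  have hq : (M'.filter (· < d)).card = p := by
    simp_all
  have hq' : p + 2 ≤ (M'.filter (· ≤ d)).card := by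
    rw [hM', filter_add, card_add]
    have h1 : p ≤ (N.filter (· ≤ d)).card :=
      Multiset.card_le_card (Multiset.monotone_filter_right N fun x hx => hx.le)
    have h2 : (({d, d} : Multiset ℕ).filter (· ≤ d)).card = 2 := by
      rw [Multiset.filter_eq_self.mpr]
      · simp
      simp_all
    omega
  have hlt : ∀ j < p, entry M' j < d := fun j hj =>
    (lt_entry_iff (by omega) d).mpr (by omega)
  have hge : ∀ j, p ≤ j → j < M'.card → d ≤ entry M' j := fun j hj hj' => by
    by_contra hc
    have := (lt_entry_iff hj' d).mp (by omega)
    omega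
  have hP : entry M' p = d ∧ entry M' (p + 1) = d := by
    have h1 := (entry_le_iff (E := M') (j := p) (by omega) d).mpr (by omega)
    have h2 := (entry_le_iff (E := M') (j := p + 1) (by omega) d).mpr (by omega)
    grind
  have hdef : defect s E' M' p = 0 := by
    have h1 : Even (defect s E' M' p) := even_defect hs hV (by omega) fun j hj hjT =>
      (hlt j (by omega)).trans_le (hge _ le_rfl hjT)
    have h2 := hm.2 p (by omega)
    rw [even_iff] at h1
    omega
  set a := p + (d + s) / 2 with ha
  set b := d + s + 2 * p - a with hb
  have hab : a ≤ b := by omega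
  have hab' : b ≤ a + 1 := by omega
  have e0 := defect_succ s E' M' p
  have e1 := defect_succ s E' M' (p + 1)
  have b0 := hm.2 (p + 1) (by omega)
  have b1 := hm.2 (p + 1 + 1) (by omega)
  -- The defect is 0 in front of the two parts `d` and remains in `{0, 1}` behind each of them; this
  -- leaves no choice for the two entries at these places.
  have hea : entry E' p = a := by omega
  have heb : entry E' (p + 1) = b := by
    omega
  -- The preceding part is less than `d` and the defect is 0 behind it, so the preceding entry is at
  -- most `a - 2`. This lets the smaller entries be raised by 2.
  have hlow' : ∀ j < p, entry E' j + 2 ≤ a := by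
    intro j hj
    have h1 := entry_mono (E := E') (i := j) (j := p - 1) (by omega) (by omega)
    have e2 := defect_succ s E' M' (p - 1)
    have b2 := hm.2 (p - 1) (by omega)
    grind
  have hcnt : (E'.filter (· < a)).card = p := by
    refine le_antisymm ?_ ?_
    · by_contra hlt'
      have := (lt_entry_iff (E := E') (j := p) (by omega) a).mpr (by omega)
      omega
    · rcases Nat.eq_zero_or_pos p with h0 | h0
      · omega
      · have := (lt_entry_iff (E := E') (j := p - 1) (by omega) a).mp (by
          have := hlow' (p - 1) (by omega); omega)
        omega
  have hdich : ∀ x ∈ E', x < a → x + 2 ≤ a := by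
    intro x hx hxa
    obtain ⟨j, hj, rfl⟩ := exists_entry_eq hx
    refine hlow' j ?_
    by_contra hjp
    have := entry_mono (E := E') (i := p) (j := j) (by omega) hj
    omega
  have haE : a ∈ E' := hea ▸ entry_mem (by omega)
  have hbE : b ∈ E' := heb ▸ entry_mem (by omega)
  -- the two entries lie in different rows
  have hcnt2 : 2 ≤ (E'.filter fun x => a ≤ x ∧ x ≤ a + 1).card := by
    rw [card_filter_eq]
    have : ({p, p + 1} : Finset ℕ) ⊆ (range E'.card).filter
        fun j => a ≤ entry E' j ∧ entry E' j ≤ a + 1 := by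
      grind
    have h2 := card_le_card this
    rwa [card_pair (by omega)] at h2
  have hfX := hX.card_filter_interval a
  have hfY := hY.card_filter_interval a
  obtain ⟨u, v, hu, hv, hz⟩ : ∃ u v, u < r ∧ v < t ∧
      (X' u = a ∧ Y' v = b ∨ X' u = b ∧ Y' v = a) := by
    have h1 : ((rowM r X').filter fun x => a ≤ x ∧ x ≤ a + 1).card = 1 ∧
        ((rowM t Y').filter fun x => a ≤ x ∧ x ≤ a + 1).card = 1 := by
      rw [hE', filter_add, card_add] at hcnt2
      omega
    obtain ⟨z₁, hz₁⟩ := Multiset.card_eq_one.mp h1.1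
    obtain ⟨z₂, hz₂⟩ := Multiset.card_eq_one.mp h1.2
    have m1 : z₁ ∈ (rowM r X').filter fun x => a ≤ x ∧ x ≤ a + 1 := by rw [hz₁]; simp
    have m2 : z₂ ∈ (rowM t Y').filter fun x => a ≤ x ∧ x ≤ a + 1 := by rw [hz₂]; simp
    rw [mem_filter, mem_rowM] at m1 m2
    obtain ⟨⟨u, hu, hu'⟩, -⟩ := m1
    obtain ⟨⟨v, hv, hv'⟩, -⟩ := m2
    have hall : ∀ z ∈ E', a ≤ z → z ≤ a + 1 → z = z₁ ∨ z = z₂ := by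
      intro z hz h1 h2
      have : z ∈ E'.filter fun x => a ≤ x ∧ x ≤ a + 1 := mem_filter.mpr ⟨hz, h1, h2⟩
      rw [hE', filter_add, hz₁, hz₂] at this
      simpa using this
    have ha' := hall a haE le_rfl (by omega)
    have hb' := hall b hbE hab hab'
    refine ⟨u, v, hu, hv, ?_⟩
    rcases hab.lt_or_eq with hlt' | heq
    · omega
    · have hcount : (E'.filter fun x => a ≤ x ∧ x ≤ a + 1) = {z₁} + {z₂} := by
        rw [hE', filter_add, hz₁, hz₂]
      have h3 : 2 ≤ ((E'.filter fun x => a ≤ x ∧ x ≤ a + 1).filter (· ≤ a)).card := by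
        rw [Multiset.filter_filter, card_filter_eq]
        have : ({p, p + 1} : Finset ℕ) ⊆ (range E'.card).filter
            fun j => entry E' j ≤ a ∧ a ≤ entry E' j ∧ entry E' j ≤ a + 1 := by
          grind
        have h2 := card_le_card this
        rwa [card_pair (by omega)] at h2
      rw [hcount] at h3
      have h4 := Multiset.eq_of_le_of_card_le (filter_le (· ≤ a) ({z₁} + {z₂})) (by simpa using h3)
      rw [Multiset.filter_eq_self] at h4
      have h5 := h4 z₁ (by simp)
      have h6 := h4 z₂ (by simp)
      have m1 : z₁ ∈ (rowM r X').filter fun x => a ≤ x ∧ x ≤ a + 1 := by rw [hz₁]; simp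
      have m2 : z₂ ∈ (rowM t Y').filter fun x => a ≤ x ∧ x ≤ a + 1 := by rw [hz₂]; simp
      have h7 := (mem_filter.mp m1).2.1
      have h8 := (mem_filter.mp m2).2.1
      omega
  refine ⟨by omega, by omega, ?_⟩
  obtain ⟨X, lowX, highX, hsX, hX0, hX', hXX, hlX, hhX⟩ := hX.remove hu (Nat.zero_le (X' 0))
  obtain ⟨Y, lowY, highY, hsY, hY0', hY', hYY, hlY, hhY⟩ := hY.remove hv hY0
  have hzz : ({X' u} + {Y' v} : Multiset ℕ) = {a, b} := by
    rcases hz with ⟨h1, h2⟩ | ⟨h1, h2⟩ <;> rw [h1, h2]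
    · rfl
    · exact add_comm _ _
  have hEE : rowM r X + rowM t Y = {0, s} + (lowX + lowY).map (· + 2) + (highX + highY) := by
    rw [hXX, hYY, Multiset.map_add, show ({0, s} : Multiset ℕ) = {0} + {s} from rfl]
    abel
  have hEE' : E' = (lowX + lowY) + {a, b} + (highX + highY) := by
    rw [hE', hX', hY', ← hzz]
    abel
  have hlow : ∀ x ∈ lowX + lowY, x + 2 ≤ a := by
    grind
  have hhigh : ∀ x ∈ highX + highY, b ≤ x := by
    grind
  have hcl : (lowX + lowY).card = p := by
    have h1 : Multiset.filter (· < a) (highX + highY) = 0 :=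
      filter_eq_nil.mpr fun x hx => by have := hhigh x hx; omega
    have h2 : Multiset.filter (· < a) ({a, b} : Multiset ℕ) = 0 :=
      filter_eq_nil.mpr fun x hx => by
        simp only [insert_eq_cons, Multiset.mem_cons, Multiset.mem_singleton] at hx
        omega
    rw [← hcnt, hEE', filter_add, filter_add,
      Multiset.filter_eq_self.mpr (fun x hx => by have := hlow x hx; omega),
      h1, h2]
    simp
  have ex : Exchange s d a b (lowX + lowY) (highX + highY) small large (rowM r X + rowM t Y)
      ({0, 0} + N) E' M' :=
    { s_le := hs
      eqE := hEE
      eqE' := hEE'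
      eqM := by rw [add_assoc, hsl]
      eqM' := by rw [hM', ← hsl]; abel
      low_le := hlow
      le_high := hhigh
      small_le := fun x hx => (mem_filter.mp hx).2.le
      le_large := fun x hx => not_lt.mp (mem_filter.mp hx).2
      card_eq := hcl.symm
      card_eq' := by
        have h1 := congrArg card hEE'
        have h2 := congrArg card hsl
        simp only [card_add, Multiset.card_pair] at h1 h2 hcl ⊢
        omega
      a_eq := by rw [hcl]
      b_eq := by omega }
  exact ⟨X, Y, hsX, hsY, hX0, hY0', ex.sum_eq, ex.matches_left hm⟩

end Rows

/-! ### Strips and partitions -/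

section Symbols
open Finset hiding mem_cons
open Multiset (mem_cons)

variable {r t : ℕ}

variable {s c d : ℕ} {x x' : Fin r → ℕ} {y y' : Fin t → ℕ} {X X' : ℕ → ℕ} {M N : Multiset ℕ}

/-- The entries of the symbol with rows `x_i + 2 i` and `y_j + 2 j + s`. -/
def rowEntry (s : ℕ) (x : Fin r → ℕ) (y : Fin t → ℕ) : Fin r ⊕ Fin t → ℕ :=
  Sum.elim (fun i => x i + 2 * i) fun j => y j + 2 * j + s

/-- The multiset of entries of the symbol with rows `x_i + 2 i` and `y_j + 2 j + s`. -/
def symbolOf (s : ℕ) (x : Fin r → ℕ) (y : Fin t → ℕ) : Multiset ℕ := univ.val.map (rowEntry s x y)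

theorem card_symbolOf (s : ℕ) (x : Fin r → ℕ) (y : Fin t → ℕ) : (symbolOf s x y).card = r + t := by
  rw [symbolOf, Multiset.card_map]
  simp

theorem symbolOf_eq_add (s : ℕ) (x : Fin r → ℕ) (y : Fin t → ℕ) :
    symbolOf s x y = univ.val.map (fun i : Fin r => x i + 2 * i) +
      univ.val.map fun j : Fin t => y j + 2 * j + s := by
  unfold symbolOf
  rw [← univ_disjSum_univ, val_disjSum, Multiset.disjSum, Multiset.map_add,
    Multiset.map_map, Multiset.map_map]
  rfl

theorem sum_symbolOf (s : ℕ) (x : Fin r → ℕ) (y : Fin t → ℕ) : (symbolOf s x y).sum =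
    ∑ i, x i + ∑ j, y j + (∑ i : Fin r, 2 * (i : ℕ) + ∑ j : Fin t, (2 * (j : ℕ) + s)) := by
  change ∑ c, rowEntry s x y c = _
  rw [sum_sum_type]
  simp only [rowEntry, elim_inl, elim_inr, sum_add_distrib]
  ring

/-- The row of a symbol, extended by zero. -/
def extRow (c : ℕ) (x : Fin r → ℕ) (i : ℕ) : ℕ := if h : i < r then x ⟨i, h⟩ + 2 * i + c else 0

theorem extRow_coe (c : ℕ) (x : Fin r → ℕ) (i : Fin r) : extRow c x i = x i + 2 * i + c := by
  simp [extRow]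

theorem rowM_eq (X : ℕ → ℕ) : rowM r X = univ.val.map fun i : Fin r => X i := by
  rw [rowM, Fin.univ_val_map, List.ofFn_eq_map, Multiset.range, map_coe,
    ← List.map_coe_finRange_eq_range, List.map_map]
  rfl

theorem symbolOf_eq_rowM {Y : ℕ → ℕ}
    (hX : ∀ i : Fin r, X i = x i + 2 * i + 0) (hY : ∀ j : Fin t, Y j = y j + 2 * j + s) :
    symbolOf s x y = rowM r X + rowM t Y := by
  rw [symbolOf_eq_add, rowM_eq, rowM_eq]
  simp only [hX, hY, add_zero]

theorem gap_extRow (hx : Monotone x) : Gap r (extRow c x) := by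
  intro i hi
  have h1 := hx (show (⟨i, by omega⟩ : Fin r) ≤ ⟨i + 1, hi⟩ from Nat.le_succ i)
  rw [extRow, extRow, dif_pos (by omega : i < r), dif_pos hi]
  omega

theorem RowStrip.lift_right (hx : Monotone x)
    (hX : ∀ i : Fin r, X i = x i + 2 * i + c) (h : RowStrip r X X') :
    ∃ x' : Fin r → ℕ, (∀ i : Fin r, X' i = x' i + 2 * i + c) ∧ (∀ i, x i ≤ x' i) ∧
      ∀ i j, i < j → x' i ≤ x j := by
  refine ⟨fun i => X' i - 2 * i - c, fun i => ?_, fun i => ?_, fun i j hij => ?_⟩ <;> beta_reduce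
  · have h1 := h.1 i i.2
    have h2 := hX i
    omega
  · have h1 := h.1 i i.2
    have h2 := hX i
    omega
  · have h1 := h.2 i (by omega)
    have h2 := hX ⟨i + 1, by omega⟩
    have h3 := hx (show (⟨i + 1, by omega⟩ : Fin r) ≤ j from hij)
    dsimp only at h2
    omega

theorem RowStrip.lift_left
    (hX : ∀ i : Fin r, X' i = x' i + 2 * i + c) (h : RowStrip r X X') (h0 : X 0 = c) :
    ∃ x : Fin r → ℕ, (∀ i : Fin r, X i = x i + 2 * i + c) ∧ (∀ i, x i ≤ x' i) ∧
      ∀ i j, i < j → x' i ≤ x j := by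
  have h2 : ∀ i < r, 2 * i + c ≤ X i := fun i hi => by
    have := h.gap_left.add_le (i := 0) (k := i) (by omega)
    rw [Nat.zero_add] at this
    omega
  have h3 : ∀ i : Fin r, X i = (X i - 2 * i - c) + 2 * i + c := fun i => by have := h2 i i.2; omega
  refine ⟨fun i => X i - 2 * i - c, h3, fun i => ?_, fun i j hij => ?_⟩ <;> beta_reduce
  · have h1 := h.1 i i.2
    have h2 := hX i
    omega
  · have h1 := h.2 i (by omega)
    have h4 := hX i
    obtain ⟨k, hk⟩ := Nat.exists_eq_add_of_le (show (i : ℕ) + 1 ≤ j from hij)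
    have h5 := h.gap_left.add_le (i := i + 1) (k := k) (by omega)
    rw [← hk] at h5
    omega

theorem exists_strip_right
    (hs : s ≤ 1) (hx : Monotone x) (hy : Monotone y) (hr : 0 < r) (ht : 0 < t)
    (hx0 : x ⟨0, hr⟩ = 0) (hy0 : y ⟨0, ht⟩ = 0) (hm : Matches s (symbolOf s x y) M)
    (hV : EvenParts s M) (hd : 1 ≤ d) : ∃ x' y' N, Strip d x y x' y' ∧ M = {0, 0} + N ∧
      Matches s (symbolOf s x' y') (N + {d, d}) := by
  have hE := symbolOf_eq_rowM (extRow_coe 0 x) (extRow_coe s y)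
  rw [hE] at hm
  obtain ⟨X', Y', N, hX, hY, hsum, hM, hm'⟩ := exists_insert hs (gap_extRow hx) (gap_extRow hy)
    hr ht (by simp [extRow, hr, hx0]) (by simp [extRow, ht, hy0]) hm hV hd
  obtain ⟨x', hx', h1, h2⟩ := hX.lift_right hx (extRow_coe 0 x)
  obtain ⟨y', hy', h3, h4⟩ := hY.lift_right hy (extRow_coe s y)
  have hE' := symbolOf_eq_rowM hx' hy'
  refine ⟨x', y', N, ⟨h1, h3, h2, h4, ?_⟩, hM, hE' ▸ hm'⟩
  rw [← hE, ← hE', sum_symbolOf, sum_symbolOf] at hsum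
  omega

theorem exists_strip_left
    (hs : s ≤ 1) (hx : Monotone x') (hy : Monotone y')
    (hm : Matches s (symbolOf s x' y') (N + {d, d})) (hV : EvenParts s (N + {d, d}))
    (hd : 1 ≤ d) : ∃ x y, Strip d x y x' y' ∧ Matches s (symbolOf s x y) ({0, 0} + N) := by
  have hE := symbolOf_eq_rowM (extRow_coe 0 x') (extRow_coe s y')
  rw [hE] at hm
  by_cases ht : 0 < t
  · obtain ⟨hr, -, X, Y, hX, hY, hX0, hY0, hsum, hm'⟩ := exists_remove hs (gap_extRow hx)
      (gap_extRow hy) (by simp [extRow, ht]) hm hV hd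
    obtain ⟨x, hx', h1, h2⟩ := hX.lift_left (extRow_coe 0 x') hX0
    obtain ⟨y, hy', h3, h4⟩ := hY.lift_left (extRow_coe s y') hY0
    have hE' := symbolOf_eq_rowM hx' hy'
    refine ⟨x, y, ⟨h1, h3, h2, h4, ?_⟩, hE' ▸ hm'⟩
    rw [← hE, ← hE', sum_symbolOf, sum_symbolOf] at hsum
    omega
  · obtain rfl : t = 0 := by omega
    have hY : rowM 0 (extRow s y') = rowM 0 fun _ => s := rfl
    rw [hY] at hm
    obtain ⟨-, ht', -⟩ := exists_remove hs (gap_extRow hx) (fun i hi => absurd hi (by omega))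
      le_rfl hm hV hd
    exact absurd ht' (lt_irrefl 0)

theorem Strip.monotone_left
    (h : Strip d x y x' y') : Monotone x ∧ Monotone y := by
  refine ⟨fun i j hij => ?_, fun i j hij => ?_⟩
  · rcases hij.lt_or_eq with hlt | rfl
    · exact (h.fst_le i).trans (h.fst_lt i j hlt)
    · exact le_rfl
  · rcases hij.lt_or_eq with hlt | rfl
    · exact (h.snd_le i).trans (h.snd_lt i j hlt)
    · exact le_rfl

/-! #### Dominance -/

/-- The `k` positions with the smallest old entries receive at most all the `d` boxes, and their new
sum bounds the minimum. -/
theorem lowSum_strip_le {k : ℕ}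
    (h : Strip d x y x' y') (hk : k ≤ r + t) :
    lowSum (symbolOf s x' y') k ≤ lowSum (symbolOf s x y) k + d := by
  have hle : ∀ c, rowEntry s x y c ≤ rowEntry s x' y' c := by
    rintro (i | j)
    · have := h.fst_le i; simp only [rowEntry, elim_inl]; omega
    · have := h.snd_le j; simp only [rowEntry, elim_inr]; omega
  obtain ⟨S, hS, hsum⟩ := exists_sum_eq_lowSum (rowEntry s x y) (k := k) (by simpa using hk)
  have h1 := lowSum_le_sum_finset (rowEntry s x' y') S
  rw [hS] at h1
  have h2 : ∑ c ∈ S, rowEntry s x' y' c + ∑ c, rowEntry s x y c ≤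
      ∑ c ∈ S, rowEntry s x y c + ∑ c, rowEntry s x' y' c := by
    rw [← sum_add_sum_compl S (rowEntry s x y), ← sum_add_sum_compl S (rowEntry s x' y')]
    have := sum_le_sum (s := Sᶜ) fun c _ => hle c
    omega
  have h3 : ∑ c, rowEntry s x' y' c = ∑ c, rowEntry s x y c + d := by
    have e1 := sum_symbolOf s x y
    have e2 := sum_symbolOf s x' y'
    have := h.sum_eq
    change ∑ c, rowEntry s x y c = _ at e1
    change ∑ c, rowEntry s x' y' c = _ at e2
    omega
  unfold symbolOf
  omega

/-- The preceding position in the same row. -/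
def predPos : Fin r ⊕ Fin t → Fin r ⊕ Fin t :=
  Sum.map (fun i => ⟨i - 1, by omega⟩) fun j => ⟨j - 1, by omega⟩

/-- The index of a position in its row. -/
def rowIndex : Fin r ⊕ Fin t → ℕ := Sum.elim (fun i => i) fun j => j

/-- Among the `k + 2` positions with the smallest old entries at most two begin a row. For `k` of
the others the strip condition makes the new entry at the preceding position at least 2 smaller than
the old entry. The two positions left over contribute at least `s`, since at most one of them is the
start of the first row. -/
theorem lowSum_strip_le' {k : ℕ} (hs : s ≤ 1)
    (h : Strip d x y x' y') (hk : k + 2 ≤ r + t) :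
    lowSum (symbolOf s x' y') k + s + 2 * k ≤ lowSum (symbolOf s x y) (k + 2) := by
  obtain ⟨S, hS, hsum⟩ := exists_sum_eq_lowSum (rowEntry s x y) (k := k + 2) (by simpa using hk)
  have hz : (S.filter fun c => rowIndex c = 0).card ≤ 2 := by
    have h1 : ∀ c ∈ S.filter (fun c => rowIndex c = 0), Sum.isLeft c ∈ ({true, false} : Finset Bool) :=
      fun c _ => by cases Sum.isLeft c <;> simp
    refine (card_le_card_of_injOn _ h1 ?_).trans (by simp)
    rintro (i | i) hi (j | j) hj hij
    · have h2 := (mem_filter.mp hi).2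
      have h3 := (mem_filter.mp hj).2
      rw [Fin.ext (h2.trans h3.symm)]
    · simp at hij
    · simp at hij
    · have h2 := (mem_filter.mp hi).2
      have h3 := (mem_filter.mp hj).2
      rw [Fin.ext (h2.trans h3.symm)]
  have hc : k ≤ (S.filter fun c => rowIndex c ≠ 0).card := by
    have := card_filter_add_card_filter_not (s := S) fun c => rowIndex c = 0
    simp only [ne_eq]
    omega
  obtain ⟨U, hU, hUc⟩ := exists_subset_card_eq hc
  have hU0 : ∀ c ∈ U, rowIndex c ≠ 0 := fun c hc => (mem_filter.mp (hU hc)).2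
  have hUS : U ⊆ S := hU.trans (filter_subset _ _)
  have hinj : Set.InjOn (predPos (r := r) (t := t)) U := by
    intro c hc c' hc' hcc
    have h1 := hU0 c hc
    have h2 := hU0 c' hc'
    rcases c with i | i <;> rcases c' with j | j <;>
      simp only [predPos, Sum.map_inl, Sum.map_inr, inl.injEq, inr.injEq, Fin.mk.injEq,
        reduceCtorEq, rowIndex, elim_inl, elim_inr] at hcc h1 h2
    · rw [Fin.ext (by omega : (i : ℕ) = j)]
    grind
  have hpred : ∀ c ∈ U, rowEntry s x' y' (predPos c) + 2 ≤ rowEntry s x y c := by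
    intro c hc
    have h1 := hU0 c hc
    rcases c with i | j
    · simp only [rowIndex, elim_inl] at h1
      have := h.fst_lt ⟨i - 1, by omega⟩ i (Fin.lt_def.mpr (by simp only; omega))
      simp only [rowEntry, predPos, Sum.map_inl, elim_inl]
      omega
    · simp only [rowIndex, elim_inr] at h1
      have := h.snd_lt ⟨j - 1, by omega⟩ j (Fin.lt_def.mpr (by simp only; omega))
      simp only [rowEntry, predPos, Sum.map_inr, elim_inr]
      omega
  have h1 := lowSum_le_sum_finset (rowEntry s x' y') (U.image predPos)
  rw [card_image_of_injOn hinj, hUc, sum_image hinj] at h1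
  have h2 := sum_le_sum hpred
  rw [sum_add_distrib, sum_const, hUc, smul_eq_mul] at h2
  have h3 := sum_sdiff (f := rowEntry s x y) hUS
  have h4 : s ≤ ∑ c ∈ S \ U, rowEntry s x y c := by
    have hcard : 1 < (S \ U).card := by grind
    obtain ⟨c, hc, c', hc', hne⟩ := one_lt_card.mp hcard
    have key : s ≤ rowEntry s x y c ∨ s ≤ rowEntry s x y c' := by
      rcases c with i | i
      · rcases c' with j | j
        · have : (i : ℕ) ≠ j := fun hij => hne (by rw [Fin.ext hij])
          simp only [rowEntry, elim_inl]
          omega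
        · simp only [rowEntry, elim_inr]; omega
      · simp only [rowEntry, elim_inr]; omega
    rcases key with hle | hle
    · exact hle.trans (single_le_sum (f := rowEntry s x y) (fun _ _ => Nat.zero_le _) hc)
    · exact hle.trans (single_le_sum (f := rowEntry s x y) (fun _ _ => Nat.zero_le _) hc')
  unfold symbolOf
  omega

/-- The upper half of the relation `Matches`. -/
def Dominated (s : ℕ) (E M : Multiset ℕ) : Prop :=
  E.card = M.card ∧ ∀ k ≤ M.card, defect s E M k ≤ 1

theorem Matches.dominated {E : Multiset ℕ} (h : Matches s E M) : Dominated s E M :=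
  ⟨h.1, fun k hk => (h.2 k hk).2⟩

theorem lowSum_pair_left (N : Multiset ℕ) {j : ℕ} (hj : j ≤ (N.filter (· < d)).card) :
    lowSum (N + {d, d}) j = lowSum ({0, 0} + N) (j + 2) := by
  obtain ⟨A, hA⟩ : ∃ A, A = N.filter (· < d) := ⟨_, rfl⟩
  obtain ⟨B, hB⟩ : ∃ B, B = N.filter (fun x => ¬ x < d) := ⟨_, rfl⟩
  have hN : A + B = N := by rw [hA, hB]; exact filter_add_not (· < d) N
  have hA' : ∀ x ∈ A, x < d := fun x hx => by simp_all
  have hB' : ∀ x ∈ B, d ≤ x := fun x hx => by simp_all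
  rw [← hA] at hj
  have e1 : lowSum (N + {d, d}) j = lowSum A j := by
    rw [← hN, add_assoc]
    refine sum_congr rfl fun i hi => entry_add_left (fun x hx y hy => ?_)
      (by have := mem_range.mp hi; omega)
    have h1 := hA' x hx
    rcases Multiset.mem_add.mp hy with hy | hy
    · have := hB' y hy; omega
    · simp only [insert_eq_cons, mem_cons, Multiset.mem_singleton] at hy
      omega
  have e2 : ∀ i < j, entry ({0, 0} + N) (i + 2) = entry A i := fun i hi => by
    rw [entry_add_right (fun x hx y _ => ?_) (by simp), Multiset.card_pair, Nat.add_sub_cancel,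
      ← hN, entry_add_left (fun x hx y hy => (hA' x hx).le.trans (hB' y hy)) (by omega)]
    simp_all
  have e3 : ∀ i < 2, entry ({0, 0} + N) i = 0 := fun i hi => by
    rw [entry_add_left (fun x hx y _ => ?_) (by exact hi)]
    · have := entry_pair (le_refl 0)
      grind
    simp_all
  rw [e1, lowSum, lowSum, sum_range_succ', sum_range_succ', e3 0 (by omega),
    e3 (0 + 1) (by omega), add_zero, add_zero]
  exact sum_congr rfl fun i hi => (e2 i (mem_range.mp hi)).symm

theorem lowSum_pair_right (N : Multiset ℕ) (j : ℕ) :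
    entry (N + {d, d}) (N.filter (· < d)).card = d ∧
    entry (N + {d, d}) ((N.filter (· < d)).card + 1) = d ∧
    lowSum (N + {d, d}) ((N.filter (· < d)).card + 2 + j) =
      lowSum ({0, 0} + N) ((N.filter (· < d)).card + 2 + j) + 2 * d := by
  obtain ⟨A, hA⟩ : ∃ A, A = N.filter (· < d) := ⟨_, rfl⟩
  obtain ⟨B, hB⟩ : ∃ B, B = N.filter (fun x => ¬ x < d) := ⟨_, rfl⟩
  have hN : A + B = N := by rw [hA, hB]; exact filter_add_not (· < d) N
  have hA' : ∀ x ∈ A, x < d := fun x hx => by simp_all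
  have hB' : ∀ x ∈ B, d ≤ x := fun x hx => by simp_all
  have hl : N + {d, d} = A + ({d, d} + B) := by rw [← hN]; abel
  have h1 : ∀ x ∈ A, ∀ y ∈ ({d, d} + B : Multiset ℕ), x ≤ y := fun x hx y hy => by
    have h1 := hA' x hx
    rcases Multiset.mem_add.mp hy with hy | hy
    · simp only [insert_eq_cons, mem_cons, Multiset.mem_singleton] at hy
      omega
    · have := hB' y hy; omega
  have h2 : ∀ x ∈ ({d, d} : Multiset ℕ), ∀ y ∈ B, x ≤ y := fun x hx y hy => by simp_all
  have hp := entry_pair (le_refl d)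
  rw [← hA]
  have e1 : entry (N + {d, d}) A.card = d := by
    rw [hl, entry_add_right h1 le_rfl, Nat.sub_self, entry_add_left h2 (by simp), hp.1]
  have e2 : entry (N + {d, d}) (A.card + 1) = d := by
    rw [hl, entry_add_right h1 (by omega), Nat.add_sub_cancel_left, entry_add_left h2 (by simp),
      hp.2]
  refine ⟨e1, e2, ?_⟩
  induction j with
  | zero =>
    rw [add_zero, lowSum_succ, lowSum_succ, e1, e2, lowSum_pair_left N (by rw [hA])]
    · ring
  | succ j ih =>
    rw [← add_assoc, lowSum_succ, ih, lowSum_succ _ (A.card + 2 + j), hl,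
      entry_add_right h1 (by omega), entry_add_right h2 (by simp; omega),
      entry_add_right (fun x hx y _ => ?_) (by simp; omega), ← hN,
      entry_add_right (fun x hx y hy => (hA' x hx).le.trans (hB' y hy)) (by simp; omega)]
    · simp only [Multiset.card_pair]
      grind
    simp_all

/-- The two estimates for strips compare the defects below the inserted pair with the old ones two
places further on, and those above it with the old ones at the same place. Only the place between
the two new parts needs a separate argument. -/
theorem Dominated.strip (hs : s ≤ 1)
    (h : Strip d x y x' y') (hm : Dominated s (symbolOf s x y) ({0, 0} + N))
    (hV : EvenParts s ({0, 0} + N)) (hd : 1 ≤ d) :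
    Dominated s (symbolOf s x' y') (N + {d, d}) := by
  obtain ⟨hc, hm⟩ := hm
  rw [card_symbolOf] at hc
  have hcN : ({0, 0} + N : Multiset ℕ).card = (N + {d, d}).card := by simp [add_comm]
  refine ⟨by rw [card_symbolOf, hc, hcN], fun k hk => ?_⟩
  obtain ⟨p, hp⟩ : ∃ p, p = (N.filter (· < d)).card := ⟨_, rfl⟩
  have hpT : p + 2 ≤ r + t := by
    have : p ≤ N.card := by rw [hp]; exact Multiset.card_le_card (filter_le _ _)
    simp_all
  obtain ⟨e1, e2, -⟩ := lowSum_pair_right (d := d) N 0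
  rw [← hp] at e1 e2
  have hlow : ∀ k ≤ p, defect s (symbolOf s x' y') (N + {d, d}) k ≤
      defect s (symbolOf s x y) ({0, 0} + N) (k + 2) := fun k hk => by
    have h1 := lowSum_strip_le' hs h (k := k) (by omega)
    have h2 := lowSum_pair_left (d := d) N (j := k) (by omega)
    rw [defect_eq, defect_eq, h2]
    push_cast
    linarith
  have hhigh : ∀ k, p + 2 ≤ k → k ≤ r + t → defect s (symbolOf s x' y') (N + {d, d}) k ≤
      defect s (symbolOf s x y) ({0, 0} + N) k := fun k hk hk' => by
    have h1 := lowSum_strip_le (s := s) h hk'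
    obtain ⟨j, rfl⟩ := Nat.exists_eq_add_of_le hk
    have h2 := (lowSum_pair_right (d := d) N j).2.2
    rw [← hp] at h2
    rw [defect_eq, defect_eq, h2]
    push_cast
    linarith
  have heven : defect s (symbolOf s x y) ({0, 0} + N) (p + 2) ≤ 0 := by
    have hq : (({0, 0} + N : Multiset ℕ).filter (· < d)).card = p + 2 := by
      rw [filter_add, card_add, ← hp, Multiset.filter_eq_self.mpr]
      · simp [add_comm]
      · intro x hx
        simp only [insert_eq_cons, mem_cons, Multiset.mem_singleton] at hx
        omega
    have h1 : Even (defect s (symbolOf s x y) ({0, 0} + N) (p + 2)) :=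
      even_defect hs hV (by omega) fun j hj hjT => by
        have h1 := (lt_entry_iff (E := {0, 0} + N) (j := j) (by omega) d).mpr (by omega)
        have h2 := (lt_entry_iff (E := {0, 0} + N) hjT d).not.mpr (by omega)
        omega
    grind
  rcases lt_trichotomy k (p + 1) with hlt | rfl | hlt
  · grind
  -- The neighbouring defects are at most 0. As the entries increase, the second increment is at
  -- least the first one minus 2, so a defect of at least 2 in the middle would leave the next one
  -- positive.
  · have h1 := (hlow p le_rfl).trans heven
    have h2 := (hhigh (p + 2) le_rfl hpT).trans heven
    have h3 := entry_mono (E := symbolOf s x' y') (i := p) (j := p + 1) (by omega)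
      (by rw [card_symbolOf]; omega)
    rw [show p + 2 = p + 1 + 1 from rfl, defect_succ, defect_succ, e1, e2] at h2
    rw [defect_succ, e1]
    omega
  grind

end Symbols

/-! ### Chains of strips and partitions -/

section Chains
open Finset hiding card_pair
open Multiset (card_pair)

variable {T : ℕ} {l : Multiset ℕ} {ds : List ℕ}

/-- The parts of a partition together with zeros, `T` numbers altogether. -/
def padTo (T : ℕ) (l : Multiset ℕ) : Multiset ℕ := l + replicate (T - l.card) 0

theorem card_padTo (h : l.card ≤ T) : (padTo T l).card = T := by
  simp [padTo, h]

theorem zero_pair_add_padTo (h : l.card ≤ T) :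
    {0, 0} + padTo T l = padTo (T + 2) l := by
  unfold padTo
  rw [show T + 2 - l.card = 2 + (T - l.card) by omega, Multiset.replicate_add,
    show replicate 2 0 = ({0, 0} : Multiset ℕ) from rfl]
  abel

theorem padTo_add_pair (d : ℕ) :
    padTo T l + {d, d} = padTo (T + 2) (l + {d, d}) := by
  unfold padTo
  rw [card_add, card_pair, Nat.add_sub_add_right]
  abel

theorem evenParts_add_pair {s : ℕ} (d : ℕ) (N : Multiset ℕ) :
    EvenParts s (N + {d, d}) ↔ EvenParts s N := by
  refine forall₂_congr fun i _ => ?_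
  rw [count_add, show ({d, d} : Multiset ℕ) = replicate 2 d from rfl, count_replicate]
  split_ifs <;> simp [Nat.even_add]

theorem evenParts_zero_pair_add {s : ℕ} (N : Multiset ℕ) :
    EvenParts s ({0, 0} + N) ↔ EvenParts s N := by
  rw [add_comm, evenParts_add_pair]

theorem add_pair_add_nsmul (l : Multiset ℕ) (d : ℕ) (ds : List ℕ) :
    l + {d, d} + 2 • (ds : Multiset ℕ) = l + 2 • ((d :: ds : List ℕ) : Multiset ℕ) := by
  rw [← cons_coe, ← Multiset.singleton_add, nsmul_add, two_nsmul ({d} : Multiset ℕ), add_assoc]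
  rfl

variable {r t s : ℕ}

theorem eq_zero_of_sum_lt {x : Fin r → ℕ} (hx : Monotone x) (hr : 0 < r) (h : ∑ i, x i < r) :
    x ⟨0, hr⟩ = 0 := by
  by_contra hc
  have h1 : ∑ _i : Fin r, 1 ≤ ∑ i, x i := sum_le_sum fun i _ =>
    (Nat.one_le_iff_ne_zero.mpr hc).trans (hx (Fin.mk_le_of_le_val (Nat.zero_le _)))
  simp at h1
  omega

theorem Chain.sum_eq {x x' : Fin r → ℕ} {y y' : Fin t → ℕ}
    (h : Chain ds x y x' y') : ∑ i, x' i + ∑ j, y' j = ∑ i, x i + ∑ j, y j + ds.sum := by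
  induction h with
  | nil => simp
  | cons h1 _ ih => rw [ih, h1.sum_eq, List.sum_cons, add_assoc]

theorem Chain.monotone {x x' : Fin r → ℕ} {y y' : Fin t → ℕ}
    (h : Chain ds x y x' y') (hx : Monotone x) (hy : Monotone y) : Monotone x' ∧ Monotone y' := by
  induction h with
  | nil => exact ⟨hx, hy⟩
  | cons h1 _ ih => exact ih h1.monotone_fst h1.monotone_snd

theorem Chain.swap {x x' : Fin r → ℕ} {y y' : Fin t → ℕ}
    (h : Chain ds x y x' y') : Chain ds y x y' x' := by
  induction h with
  | nil x y => exact Chain.nil y x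
  | cons h1 _ ih =>
    exact Chain.cons ⟨h1.snd_le, h1.fst_le, h1.snd_lt, h1.fst_lt, by
      rw [add_comm, h1.sum_eq]; ring⟩ ih

/-- Iteration of `exists_strip_right`. The rows are at least as long as the final number of boxes,
so before each strip both of them still begin with a zero part. -/
theorem exists_chain_right (hs : s ≤ 1) (htr : t ≤ r) (ds : List ℕ) (hds : ∀ d ∈ ds, 1 ≤ d)
    {x : Fin r → ℕ} {y : Fin t → ℕ} (hx : Monotone x) (hy : Monotone y)
    (hsum : ∑ i, x i + ∑ j, y j + ds.sum ≤ t) (hc : l.card + 2 * ds.length ≤ r + t)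
    (hm : Matches s (symbolOf s x y) (padTo (r + t) l)) (hV : EvenParts s (padTo (r + t) l)) :
    ∃ x' y', Chain ds x y x' y' ∧
      Matches s (symbolOf s x' y') (padTo (r + t) (l + 2 • (ds : Multiset ℕ))) := by
  induction ds generalizing x y l with
  | nil => exact ⟨x, y, Chain.nil x y, by simpa using hm⟩
  | cons d ds ih =>
    have hd := hds d (by simp)
    rw [List.sum_cons] at hsum
    rw [length_cons] at hc
    obtain ⟨T, hT⟩ : ∃ T, r + t = T + 2 := ⟨r + t - 2, by omega⟩
    obtain ⟨x', y', N, hstrip, hN, hm'⟩ := exists_strip_right hs hx hy (by omega) (by omega)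
      (eq_zero_of_sum_lt hx (by omega) (by omega)) (eq_zero_of_sum_lt hy (by omega) (by omega))
      hm hV hd
    rw [hT, ← zero_pair_add_padTo (by omega), add_right_inj] at hN
    rw [hT, ← zero_pair_add_padTo (by omega), evenParts_zero_pair_add] at hV
    rw [← hN, padTo_add_pair, ← hT] at hm'
    obtain ⟨x'', y'', hch, hm''⟩ := ih (fun d hd => hds d (by simp [hd])) hstrip.monotone_fst
      hstrip.monotone_snd (by rw [hstrip.sum_eq]; omega)
      (by rw [card_add, card_pair]; omega) hm'
      (by rw [hT, ← padTo_add_pair, evenParts_add_pair]; exact hV)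
    refine ⟨x'', y'', hch.cons hstrip, ?_⟩
    rwa [add_pair_add_nsmul] at hm''

theorem exists_chain_left (hs : s ≤ 1) (ds : List ℕ) (hds : ∀ d ∈ ds, 1 ≤ d)
    {x' : Fin r → ℕ} {y' : Fin t → ℕ} (hx : Monotone x') (hy : Monotone y')
    (hc : l.card + 2 * ds.length ≤ r + t)
    (hm : Matches s (symbolOf s x' y') (padTo (r + t) (l + 2 • (ds : Multiset ℕ))))
    (hV : EvenParts s (padTo (r + t) l)) :
    ∃ x y, Monotone x ∧ Monotone y ∧ Chain ds x y x' y' ∧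
      Matches s (symbolOf s x y) (padTo (r + t) l) := by
  induction ds generalizing l with
  | nil => exact ⟨x', y', hx, hy, Chain.nil x' y', by simpa using hm⟩
  | cons d ds ih =>
    have hd := hds d (by simp)
    rw [length_cons] at hc
    obtain ⟨T, hT⟩ : ∃ T, r + t = T + 2 := ⟨r + t - 2, by omega⟩
    rw [hT, ← zero_pair_add_padTo (by omega), evenParts_zero_pair_add] at hV
    have hV' : EvenParts s (padTo (r + t) (l + {d, d})) := by
      rw [hT, ← padTo_add_pair, evenParts_add_pair]; exact hV
    rw [← add_pair_add_nsmul] at hm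
    obtain ⟨x, y, hx1, hy1, hch, hm'⟩ := ih (fun d hd => hds d (by simp [hd]))
      (by rw [card_add, card_pair]; omega) hm hV'
    rw [hT, ← padTo_add_pair] at hm' hV'
    obtain ⟨x₀, y₀, hstrip, hm''⟩ := exists_strip_left hs hx1 hy1 hm' hV' hd
    refine ⟨x₀, y₀, hstrip.monotone_left.1, hstrip.monotone_left.2, hch.cons hstrip, ?_⟩
    rwa [zero_pair_add_padTo (by omega), ← hT] at hm''

theorem Dominated.chain (hs : s ≤ 1) (hds : ∀ d ∈ ds, 1 ≤ d)
    {x x' : Fin r → ℕ} {y y' : Fin t → ℕ} (h : Chain ds x y x' y')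
    (hc : l.card + 2 * ds.length ≤ r + t)
    (hm : Dominated s (symbolOf s x y) (padTo (r + t) l)) (hV : EvenParts s (padTo (r + t) l)) :
    Dominated s (symbolOf s x' y') (padTo (r + t) (l + 2 • (ds : Multiset ℕ))) := by
  induction h generalizing l with
  | nil => simpa using hm
  | @cons d ds x y x' y' x'' y'' hstrip _ ih =>
    have hd := hds d (by simp)
    rw [length_cons] at hc
    obtain ⟨T, hT⟩ : ∃ T, r + t = T + 2 := ⟨r + t - 2, by omega⟩
    rw [hT, ← zero_pair_add_padTo (by omega)] at hm hV
    have hm' := hm.strip hs hstrip hV hd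
    rw [evenParts_zero_pair_add] at hV
    rw [padTo_add_pair, ← hT] at hm'
    have := ih (fun d hd => hds d (by simp [hd])) (by rw [card_add, card_pair]; omega) hm'
      (by rw [hT, ← padTo_add_pair, evenParts_add_pair]; exact hV)
    rwa [add_pair_add_nsmul] at this

end Chains

/-! ### Symbols of double partitions -/

section Bipartitions
open Finset hiding card_pair
open Multiset (card_pair)

variable {s N : ℕ} {p l : Multiset ℕ}

theorem symbolRow_eq (hp : p.card ≤ N) :
    symbolRow s N p = univ.val.map fun i : Fin N => padSeq N p i + 2 * i + s := by
  unfold symbolRow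
  rw [← ofFn_padSeq hp, Fin.univ_val_map]
  congr 1
  apply ext_getElem
  · simp
  · simp [add_assoc]

/-- The partition giving the longer row of the `m`-symbol. -/
def Bipartition.row₁ {n : ℕ} (h : ℤ) (A : Bipartition n) : Multiset ℕ :=
  if 0 ≤ h then A.fst else A.snd

/-- The partition giving the shorter row of the `m`-symbol. -/
def Bipartition.row₂ {n : ℕ} (h : ℤ) (A : Bipartition n) : Multiset ℕ :=
  if 0 ≤ h then A.snd else A.fst

namespace Bipartition

variable {n : ℕ} {h : ℤ}

theorem card_row₁_le (A : Bipartition n) : (A.row₁ h).card ≤ n := by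
  unfold row₁; split_ifs
  exacts [A.card_fst_le, A.card_snd_le]

theorem card_row₂_le (A : Bipartition n) : (A.row₂ h).card ≤ n := by
  unfold row₂; split_ifs
  exacts [A.card_snd_le, A.card_fst_le]

theorem sum_rows (A : Bipartition n) : (A.row₁ h).sum + (A.row₂ h).sum = n := by
  have := A.sum_eq
  unfold row₁ row₂; split_ifs <;> omega

theorem symbolEntries_eq (A : Bipartition n) (hN : n ≤ N) :
    symbolEntries h N A.fst A.snd = symbolOf (h.natAbs % 2)
      (padSeq (N + (h.natAbs + 1) / 2) (A.row₁ h)) (padSeq N (A.row₂ h)) := by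
  rw [symbolOf_eq_add]
  unfold symbolEntries row₁ row₂
  have h1 := A.card_fst_le
  have h2 := A.card_snd_le
  split_ifs
  all_goals
    rw [symbolRow_eq (by omega), symbolRow_eq (by omega)]
    simp only [add_zero]

theorem exists_rows_eq {q : Multiset ℕ} (hp : 0 ∉ p) (hq : 0 ∉ q) (hn : p.sum + q.sum = n) :
    ∃ A : Bipartition n, A.row₁ h = p ∧ A.row₂ h = q := by
  by_cases hh : 0 ≤ h
  · exact ⟨⟨p, q, hp, hq, hn⟩, if_pos hh, if_pos hh⟩
  · exact ⟨⟨q, p, hq, hp, by omega⟩, if_neg hh, if_neg hh⟩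

theorem exists_of_rows {r t : ℕ} {x : Fin r → ℕ} {y : Fin t → ℕ} (hx : Monotone x)
    (hy : Monotone y) (hn : ∑ i, x i + ∑ j, y j = n) :
    ∃ A : Bipartition n, padSeq r (A.row₁ h) = x ∧ padSeq t (A.row₂ h) = y := by
  obtain ⟨A, h1, h2⟩ := exists_rows_eq (h := h) (zero_notMem_partsOf x) (zero_notMem_partsOf y)
    (by rw [sum_partsOf, sum_partsOf, hn])
  exact ⟨A, by rw [h1, padSeq_partsOf hx], by rw [h2, padSeq_partsOf hy]⟩

end Bipartition

theorem symbolOf_cons {r t : ℕ} (x : Fin r → ℕ) (y : Fin t → ℕ) :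
    symbolOf s (Fin.cons 0 x : Fin (r + 1) → ℕ) (Fin.cons 0 y : Fin (t + 1) → ℕ) =
      {0, s} + (symbolOf s x y).map (· + 2) := by
  rw [symbolOf_eq_add, symbolOf_eq_add, Multiset.map_add, Multiset.map_map, Multiset.map_map,
    Fin.univ_val_map, Fin.univ_val_map, Fin.univ_val_map, Fin.univ_val_map, ofFn_succ,
    ofFn_succ, ← cons_coe, ← cons_coe, ← Multiset.singleton_add,
    ← Multiset.singleton_add]
  simp only [Fin.cons_zero, Fin.cons_succ, Fin.val_zero, Fin.val_succ, comp_def]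
  rw [show ({0, s} : Multiset ℕ) = {0 + 2 * 0} + {0 + 2 * 0 + s} by simp]
  grind

/-- Lengthening both rows by one adds the entries `0, s` and raises the others by 2. The defects
then begin with `0, 1 - s` and continue with the old sequence, so the relation does not depend on
the chosen length of the rows. -/
theorem matches_zero_pair_iff (hs : s ≤ 1) {E M : Multiset ℕ} :
    Matches s ({0, s} + E.map (· + 2)) ({0, 0} + M) ↔ Matches s E M := by
  have hE : ∀ x ∈ ({0, s} : Multiset ℕ), ∀ y ∈ E.map (· + 2), x ≤ y := by
    intro x hx y hy
    obtain ⟨z, -, rfl⟩ := Multiset.mem_map.mp hy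
    simp only [insert_eq_cons, Multiset.mem_cons, Multiset.mem_singleton] at hx
    omega
  have hM : ∀ x ∈ ({0, 0} : Multiset ℕ), ∀ y ∈ M, x ≤ y := by simp_all
  have hp := entry_pair (Nat.zero_le s)
  have hq := entry_pair (le_refl 0)
  have d1 : defect s ({0, s} + E.map (· + 2)) ({0, 0} + M) 1 = 1 - s := by
    rw [show (1 : ℕ) = 0 + 1 from rfl, defect_succ, defect_zero, entry_add_left hE (by simp),
      entry_add_left hM (by simp), hp.1, hq.1]
    ring
  have key : ∀ k, k ≤ E.card → E.card = M.card →
      defect s ({0, s} + E.map (· + 2)) ({0, 0} + M) (k + 2) = defect s E M k := by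
    intro k hk hc
    induction k with
    | zero =>
      rw [show 0 + 2 = 1 + 1 from rfl, defect_succ, d1, entry_add_left hE (by simp),
        entry_add_left hM (by simp), hp.2, hq.2, defect_zero]
      ring
    | succ k ih =>
      rw [show k + 1 + 2 = k + 2 + 1 from rfl, defect_succ, ih (by omega), defect_succ,
        entry_add_right hE (by simp), entry_add_right hM (by simp), card_pair,
        card_pair, Nat.add_sub_cancel, entry_map_add 2 (by omega)]
      push_cast
      ring
  have hcE : ({0, s} + E.map (· + 2) : Multiset ℕ).card = E.card + 2 := by simp_all
  have hcM : ({0, 0} + M : Multiset ℕ).card = M.card + 2 := by simp_all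
  unfold Matches
  rw [hcE, hcM, Nat.add_right_cancel_iff]
  refine and_congr_right fun hc => ⟨fun H k hk => ?_, fun H k hk => ?_⟩
  · grind
  · rcases (show k = 0 ∨ k = 1 ∨ 2 ≤ k by omega) with rfl | rfl | hk2
    · rw [defect_zero]; omega
    · omega
    · obtain ⟨j, rfl⟩ := Nat.exists_eq_add_of_le' hk2
      grind

theorem evenParts_stable {n c : ℕ} (hl : l.card ≤ 2 * n + c) (k : ℕ) :
    EvenParts s (padTo (n + k + c + (n + k)) l) ↔ EvenParts s (padTo (n + c + n) l) := by
  induction k with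
  | zero => exact Iff.rfl
  | succ k ih =>
    rw [show n + (k + 1) + c + (n + (k + 1)) = n + k + c + (n + k) + 2 by ring,
      ← zero_pair_add_padTo (by omega), evenParts_zero_pair_add, ih]

theorem matches_stable {c : ℕ} (hs : s ≤ 1) {q : Multiset ℕ} (hp : p.card ≤ N + c)
    (hq : q.card ≤ N) (hl : l.card ≤ 2 * N + c) (k : ℕ) :
    Matches s (symbolOf s (padSeq (N + k + c) p) (padSeq (N + k) q))
        (padTo (N + k + c + (N + k)) l) ↔
      Matches s (symbolOf s (padSeq (N + c) p) (padSeq N q)) (padTo (N + c + N) l) := by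
  induction k with
  | zero => exact Iff.rfl
  | succ k ih =>
    rw [show N + (k + 1) + c + (N + (k + 1)) = N + k + c + (N + k) + 2 by ring,
      ← zero_pair_add_padTo (by omega), ← ih, show N + (k + 1) + c = N + k + c + 1 by ring,
      ← add_assoc N k 1, padSeq_succ (by omega), padSeq_succ (by omega), symbolOf_cons,
      matches_zero_pair_iff hs]

end Bipartitions

/-! ### Springer correspondents of residual subspaces -/

section Correspondents
open Finset

variable {n : ℕ} {L : AffineSubspace ℝ (Fin n → ℝ)}

variable {h : ℤ} {l : Multiset ℕ} {B : Bipartition (bPart L).card}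

theorem one_le_of_mem_blockSizes {d : ℕ} (hd : d ∈ blockSizes L) : 1 ≤ d := by
  have h1 : d ∈ (blockSizes L : Multiset ℕ) := hd
  rw [coe_blockSizes, aType_eq] at h1
  obtain ⟨B, hB, rfl⟩ := Multiset.mem_map.mp h1
  obtain ⟨i, hi, rfl⟩ := mem_image.mp (mem_val.mp hB)
  exact card_pos.mpr ⟨i, self_mem_blockOf i⟩

theorem sum_blockSizes : (bPart L).card + (blockSizes L).sum = n := by
  rw [blockSizes, List.sum_ofFn, sum_content, Fintype.card_subtype_compl]
  have := (bPart L).card_le_univ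
  simp at this ⊢
  omega

theorem length_blockSizes_le : (bPart L).card + (blockSizes L).length ≤ n := by
  have h1 := sum_blockSizes (L := L)
  have h2 := List.length_le_sum_of_one_le (blockSizes L) fun d => one_le_of_mem_blockSizes
  omega

/-- The double partitions of `n` whose symbol corresponds to the partition `l`. -/
def Corresponds (h : ℤ) {n : ℕ} (A : Bipartition n) (l : Multiset ℕ) : Prop :=
  Matches (h.natAbs % 2) (symbolEntries h n A.fst A.snd) (padTo (n + (h.natAbs + 1) / 2 + n) l)

theorem charInner_indChar_ne_zero_iff_rows (h : ℤ) (B : Bipartition (bPart L).card)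
    (A : Bipartition n) : charInner (indChar (weylOf L) (trivTensor L B.fst B.snd)) (chi A) ≠ 0 ↔
      Chain (blockSizes L) (padSeq (n + (h.natAbs + 1) / 2) (B.row₁ h)) (padSeq n (B.row₂ h))
        (padSeq (n + (h.natAbs + 1) / 2) (A.row₁ h)) (padSeq n (A.row₂ h)) := by
  unfold Bipartition.row₁ Bipartition.row₂
  by_cases hh : 0 ≤ h
  · simp only [if_pos hh]
    exact charInner_indChar_ne_zero_iff B A (by omega) le_rfl
  · simp only [if_neg hh]
    rw [charInner_indChar_ne_zero_iff B A le_rfl (show n ≤ n + (h.natAbs + 1) / 2 by omega)]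
    exact ⟨Chain.swap, Chain.swap⟩

/-- Twice a partial sum is an even number: if it exceeds the value given by the partition by at most
1, it cannot be larger than that of a matching symbol. Adding up gives the inequality of the
`a`-values, and equality forces all the partial sums to agree. -/
theorem aFun_le_iff {A A' : Bipartition n}
    (hl : l.card ≤ 2 * n + (h.natAbs + 1) / 2) (hA : Corresponds h A l)
    (hA' : Dominated (h.natAbs % 2) (symbolEntries h n A'.fst A'.snd)
      (padTo (n + (h.natAbs + 1) / 2 + n) l)) :
    aFun h A' ≤ aFun h A ∧ (aFun h A ≤ aFun h A' → Corresponds h A' l) := by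
  have hc := card_padTo (T := n + (h.natAbs + 1) / 2 + n) (l := l) (by omega)
  have c1 := hA.1
  have c2 := hA'.1
  rw [hc] at c1 c2
  have hle : ∀ k ≤ n + (h.natAbs + 1) / 2 + n, lowSum (symbolEntries h n A'.fst A'.snd) k ≤
      lowSum (symbolEntries h n A.fst A.snd) k := fun k hk => by
    have h1 := hA'.2 k (by omega)
    have h2 := (hA.2 k (by omega)).1
    rw [defect_eq] at h1 h2
    omega
  have hsum : pairMin (symbolEntries h n A'.fst A'.snd) ≤
      pairMin (symbolEntries h n A.fst A.snd) := by
    rw [pairMin_eq, pairMin_eq, c1, c2]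
    exact sum_le_sum fun k hk => hle k (mem_range.mp hk).le
  refine ⟨by unfold aFun; omega, fun H => ?_⟩
  have heq : pairMin (symbolEntries h n A'.fst A'.snd) =
      pairMin (symbolEntries h n A.fst A.snd) := by
    unfold aFun at H; omega
  rw [pairMin_eq, pairMin_eq, c1, c2, sum_eq_sum_iff_of_le fun k hk =>
    hle k (mem_range.mp hk).le] at heq
  -- The `a`-function only involves the proper partial sums; the total is the same because both are
  -- double partitions of `n`.
  have htot : lowSum (symbolEntries h n A'.fst A'.snd) (n + (h.natAbs + 1) / 2 + n) =
      lowSum (symbolEntries h n A.fst A.snd) (n + (h.natAbs + 1) / 2 + n) := by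
    rw [← c1]
    conv_lhs => rw [c1, ← c2]
    rw [lowSum_card, lowSum_card, A.symbolEntries_eq le_rfl, A'.symbolEntries_eq le_rfl,
      sum_symbolOf, sum_symbolOf]
    have e1 := A.sum_rows (h := h)
    have e2 := A'.sum_rows (h := h)
    have f1 : (A.row₁ h).card ≤ n + (h.natAbs + 1) / 2 := A.card_row₁_le.trans (by omega)
    have f2 : (A'.row₁ h).card ≤ n + (h.natAbs + 1) / 2 := A'.card_row₁_le.trans (by omega)
    rw [sum_padSeq f2, sum_padSeq A'.card_row₂_le, sum_padSeq f1, sum_padSeq A.card_row₂_le, e1, e2]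
  have hall : ∀ k ≤ n + (h.natAbs + 1) / 2 + n, lowSum (symbolEntries h n A'.fst A'.snd) k =
      lowSum (symbolEntries h n A.fst A.snd) k := fun k hk => by
    grind
  have hEE : symbolEntries h n A'.fst A'.snd = symbolEntries h n A.fst A.snd := by
    refine eq_of_entry_eq (c2.trans c1.symm) fun j hj => ?_
    have h1 := hall j (by omega)
    have h2 := hall (j + 1) (by omega)
    rw [lowSum_succ, lowSum_succ] at h2
    omega
  unfold Corresponds
  rw [hEE]
  exact hA

theorem corresponds_iff_rows {m : ℕ} (hmn : m ≤ n)
    (hl : l.card ≤ 2 * m + (h.natAbs + 1) / 2) (B : Bipartition m) : Corresponds h B l ↔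
      Matches (h.natAbs % 2) (symbolOf (h.natAbs % 2)
        (padSeq (n + (h.natAbs + 1) / 2) (B.row₁ h)) (padSeq n (B.row₂ h)))
        (padTo (n + (h.natAbs + 1) / 2 + n) l) := by
  obtain ⟨k, rfl⟩ := Nat.exists_eq_add_of_le hmn
  rw [matches_stable (by omega) (B.card_row₁_le.trans (by omega)) B.card_row₂_le hl k,
    Corresponds, B.symbolEntries_eq le_rfl]

theorem exists_corresponds
    (hl : l.card ≤ 2 * (bPart L).card + (h.natAbs + 1) / 2)
    (hV : EvenParts (h.natAbs % 2) (padTo ((bPart L).card + (h.natAbs + 1) / 2 + (bPart L).card) l))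
    (hB : Corresponds h B l) : ∃ A : Bipartition n,
      charInner (indChar (weylOf L) (trivTensor L B.fst B.snd)) (chi A) ≠ 0 ∧
        Corresponds h A (l + 2 • aType L) := by
  have hlen := length_blockSizes_le (L := L)
  have hds := sum_blockSizes (L := L)
  have hmn : (bPart L).card ≤ n := by omega
  have hVn : EvenParts (h.natAbs % 2) (padTo (n + (h.natAbs + 1) / 2 + n) l) := by
    obtain ⟨k, hk⟩ := Nat.exists_eq_add_of_le hmn
    have := (evenParts_stable hl k).mpr hV
    rwa [← hk] at this
  have f1 := B.card_row₁_le (h := h)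
  have f2 := B.card_row₂_le (h := h)
  obtain ⟨x', y', hch, hm'⟩ := exists_chain_right (by omega)
    (show n ≤ n + (h.natAbs + 1) / 2 by omega)
    (blockSizes L) (fun d => one_le_of_mem_blockSizes) (padSeq_monotone (by omega))
    (padSeq_monotone (by omega))
    (by rw [sum_padSeq (by omega), sum_padSeq (by omega), B.sum_rows]; omega)
    (by omega) ((corresponds_iff_rows hmn hl B).mp hB) hVn
  obtain ⟨hx', hy'⟩ := hch.monotone (padSeq_monotone (by omega)) (padSeq_monotone (by omega))
  obtain ⟨A', hA1, hA2⟩ := Bipartition.exists_of_rows (n := n) (h := h) hx' hy'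
    (by rw [hch.sum_eq, sum_padSeq (by omega), sum_padSeq (by omega), B.sum_rows]; omega)
  refine ⟨A', ?_, ?_⟩
  · rw [charInner_indChar_ne_zero_iff_rows h, hA1, hA2]
    exact hch
  · unfold Corresponds
    rw [A'.symbolEntries_eq le_rfl, hA1, hA2, ← coe_blockSizes]
    exact hm'

/-- Every constituent is dominated by the enlarged partition, and by `exists_corresponds` at least
one matches it. By `aFun_le_iff` the maximum of `a_m` is then attained by the matching ones only,
for each Springer correspondent of the point. -/
theorem mem_subspaceCorr_iff {k₁ : ℝ} {c : Fin n → ℝ}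
    (hl : l.card ≤ 2 * (bPart L).card + (h.natAbs + 1) / 2)
    (hm : Matches (h.natAbs % 2) (jumpSymbol h (bPart L).card (jumps h k₁ (bPart L) c))
      (padTo ((bPart L).card + (h.natAbs + 1) / 2 + (bPart L).card) l))
    (hV : EvenParts (h.natAbs % 2) (padTo ((bPart L).card + (h.natAbs + 1) / 2 + (bPart L).card) l))
    (χ : W (Fin n) → ℂ) : χ ∈ subspaceCorr h k₁ L c ↔
      ∃ A : Bipartition n, χ = chi A ∧ Corresponds h A (l + 2 • aType L) := by
  have hs : h.natAbs % 2 ≤ 1 := by omega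
  have hlen := length_blockSizes_le (L := L)
  have hds := sum_blockSizes (L := L)
  obtain ⟨k, hk⟩ := Nat.exists_eq_add_of_le (show (bPart L).card ≤ n by omega)
  have hpt : ∀ B : Bipartition (bPart L).card,
      B ∈ pointCorr h (bPart L).card (jumps h k₁ (bPart L) c) ↔ Corresponds h B l := fun B =>
    ⟨fun hB => by
      unfold Corresponds
      rw [show symbolEntries h (bPart L).card B.fst B.snd = _ from hB]
      exact hm, fun hB => hB.entries_unique hm⟩
  have hcard : (l + 2 • aType L).card ≤ 2 * n + (h.natAbs + 1) / 2 := by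
    rw [card_add, card_nsmul, ← coe_blockSizes, coe_card]
    omega
  have hVn : EvenParts (h.natAbs % 2) (padTo (n + (h.natAbs + 1) / 2 + n) l) := by
    have := (evenParts_stable hl k).mpr hV
    rwa [← hk] at this
  have hstab := corresponds_iff_rows (h := h) (show (bPart L).card ≤ n by omega) hl
  have hdom : ∀ (B : Bipartition (bPart L).card) (A : Bipartition n), Corresponds h B l →
      charInner (indChar (weylOf L) (trivTensor L B.fst B.snd)) (chi A) ≠ 0 →
      Dominated (h.natAbs % 2) (symbolEntries h n A.fst A.snd)
        (padTo (n + (h.natAbs + 1) / 2 + n) (l + 2 • aType L)) := fun B A hB hA => by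
    rw [A.symbolEntries_eq le_rfl, ← coe_blockSizes]
    exact ((hstab B).mp hB).dominated.chain hs (fun d => one_le_of_mem_blockSizes)
      ((charInner_indChar_ne_zero_iff_rows h B A).mp hA) (by omega) hVn
  unfold subspaceCorr
  rw [Set.mem_iUnion₂]
  constructor
  · rintro ⟨B, hB, A, rfl, hA, hmax⟩
    rw [hpt] at hB
    refine ⟨A, rfl, ?_⟩
    obtain ⟨A', hA1, hA'⟩ := exists_corresponds hl hV hB
    exact (aFun_le_iff hcard hA' (hdom B A hB hA)).2 (hmax A' hA1)
  -- Conversely, removing all pairs of equal parts from a matching symbol leads by a chain of strips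
  -- back to a Springer correspondent of the point.
  · rintro ⟨A, rfl, hA⟩
    have f1 := A.card_row₁_le (h := h)
    have f2 := A.card_row₂_le (h := h)
    have hA' := hA
    unfold Corresponds at hA
    rw [A.symbolEntries_eq le_rfl, ← coe_blockSizes] at hA
    obtain ⟨x, y, hx, hy, hch, hm'⟩ := exists_chain_left hs (blockSizes L)
      (fun d => one_le_of_mem_blockSizes) (padSeq_monotone (by omega))
      (padSeq_monotone (by omega)) (by omega) hA hVn
    have hsum := hch.sum_eq
    rw [sum_padSeq (by omega), sum_padSeq (by omega), A.sum_rows] at hsum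
    obtain ⟨B, hB1, hB2⟩ := Bipartition.exists_of_rows (n := (bPart L).card) (h := h) hx hy
      (by omega)
    have hB : Corresponds h B l := by
      rw [hstab, hB1, hB2]
      exact hm'
    refine ⟨B, (hpt B).mpr hB, A, rfl, ?_, fun A' hA'' =>
      (aFun_le_iff hcard hA' (hdom B A' hB hA'')).1⟩
    rw [charInner_indChar_ne_zero_iff_rows h, hB1, hB2]
    exact hch

end Correspondents

/-! ### The partition attached to a symbol -/

section Merge
open Finset

variable {B l : List ℤ} {P : List ℤ → Prop} {x y : ℤ}

/-- The only descents of the list are isolated descents by `2`. -/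
def NearlySorted : List ℤ → Prop
  | [] => True
  | x :: l => (∀ y ∈ l.head?, x ≤ y ∨ x = y + 2) ∧ (∀ z ∈ l.tail.head?, x ≤ z) ∧ NearlySorted l

theorem nearlySorted_map_range {k : ℕ} {f : ℕ → ℤ}
    (hf : ∀ i, i + 1 < k → f i ≤ f (i + 1) ∨ f i = f (i + 1) + 2)
    (hf' : ∀ i, i + 2 < k → f i ≤ f (i + 2)) : NearlySorted ((List.range k).map f) := by
  induction k generalizing f with
  | zero => trivial
  | succ k ih =>
    rw [range_succ_eq_map, List.map_cons, List.map_map]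
    refine ⟨fun y hy => ?_, fun z hz => ?_, ih (fun i hi => hf (i + 1) (by omega))
      fun i hi => hf' (i + 1) (by omega)⟩
    · rcases k with _ | k
      · simp at hy
      · rw [range_succ_eq_map] at hy
        grind
    · rcases k with _ | _ | k
      · simp at hz
      · simp at hz
      · rw [range_succ_eq_map, range_succ_eq_map] at hz
        grind

theorem NearlySorted.of_append {A : List ℤ} (h : NearlySorted (A ++ B)) : NearlySorted A := by
  induction A with
  | nil => trivial
  | cons x l ih =>
    refine ⟨fun y hy => h.1 y ?_, fun z hz => h.2.1 z ?_, ih h.2.2⟩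
    · match l with
      | y :: l => exact hy
    · match l with
      | y :: z :: l => exact hz

/-- Induction along `mergePairs`. -/
theorem mergePairs_induction (h0 : P []) (h1 : ∀ x, P [x])
    (h2 : ∀ x y l, x = y + 2 → P l → P (x :: y :: l))
    (h3 : ∀ x y l, x ≠ y + 2 → P (y :: l) → P (x :: y :: l)) (l : List ℤ) : P l := by
  induction hn : l.length using Nat.strong_induction_on generalizing l with
  | _ n ih =>
    match l with
    | [] => exact h0
    | [x] => exact h1 x
    | x :: y :: l => grind

theorem mergePairs_of_eq (l : List ℤ) (h : x = y + 2) :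
    mergePairs (x :: y :: l) = (x - 1) :: (y + 1) :: mergePairs l := by
  rw [mergePairs, if_pos h]

theorem mergePairs_of_ne (l : List ℤ) (h : x ≠ y + 2) :
    mergePairs (x :: y :: l) = x :: mergePairs (y :: l) := by
  rw [mergePairs, if_neg h]

theorem mergePairs_cons_of_le (h : ∀ z ∈ l, x ≤ z + 1) :
    mergePairs (x :: l) = x :: mergePairs l := by
  match l with
  | [] => rfl
  | y :: l =>
    refine mergePairs_of_ne l fun hxy => ?_
    have := h y (by simp)
    omega

theorem mergePairs_cons_append (h : ∀ z ∈ l, x ≤ z + 1)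
    (hB : l = [] → ∀ z ∈ B.head?, x ≤ z + 1) :
    mergePairs (x :: (l ++ B)) = x :: mergePairs (l ++ B) := by
  match l, B with
  | [], [] => rfl
  | [], b :: B =>
    refine mergePairs_of_ne _ fun hxy => ?_
    have := hB rfl b rfl
    omega
  | y :: l, B =>
    refine mergePairs_of_ne _ fun hxy => ?_
    have := h y (by simp)
    omega

theorem length_mergePairs (l : List ℤ) : (mergePairs l).length = l.length := by
  induction l using mergePairs_induction with
  | h0 => rfl
  | h1 x => rfl
  | h2 x y l h ih => rw [mergePairs_of_eq l h]; simp [ih]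
  | h3 x y l h ih => rw [mergePairs_of_ne l h]; simp [ih]

theorem le_mergePairs {a : ℤ} (h : ∀ z ∈ l, a ≤ z) : ∀ z ∈ mergePairs l, a ≤ z := by
  induction l using mergePairs_induction with
  | h0 => exact h
  | h1 x => exact h
  | h2 x y l hxy ih =>
    rw [mergePairs_of_eq l hxy]
    have hy := h y (by simp)
    grind
  | h3 x y l hxy ih =>
    rw [mergePairs_of_ne l hxy]
    grind

theorem NearlySorted.le_mergePairs (h : NearlySorted (x :: l)) :
    ∀ z ∈ mergePairs (x :: l), x - 1 ≤ z := by
  induction hn : l.length using Nat.strong_induction_on generalizing x l with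
  | _ n ih =>
    match l with
    | [] => intro z hz; simp [mergePairs] at hz; omega
    | y :: l =>
      simp only [length_cons] at hn
      by_cases hxy : x = y + 2
      · rw [mergePairs_of_eq l hxy]
        intro z hz
        simp only [List.mem_cons] at hz
        rcases hz with rfl | rfl | hz
        · exact le_rfl
        · omega
        · match l with
          | [] => simp [mergePairs] at hz
          | w :: l =>
            have h1 := ih l.length (by simp at hn; omega) h.2.2.2.2 rfl z hz
            have h2 : x ≤ w := h.2.1 w rfl
            omega
      · rw [mergePairs_of_ne l hxy]
        intro z hz
        rcases List.mem_cons.mp hz with rfl | hz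
        · omega
        · have h1 := ih l.length (by omega) h.2.2 rfl z hz
          have h2 := (h.1 y rfl).resolve_right hxy
          omega

theorem NearlySorted.le_mergePairs_tail (h : NearlySorted (x :: y :: l))
    (hxy : x ≠ y + 2) : ∀ z ∈ mergePairs (y :: l), x ≤ z := by
  induction l generalizing x y with
  | nil =>
    intro z hz
    have h2 := (h.1 y rfl).resolve_right hxy
    simp [mergePairs] at hz
    omega
  | cons w l ih =>
    have h1 := (h.1 y rfl).resolve_right hxy
    have h2 : x ≤ w := h.2.1 w rfl
    intro z hz
    by_cases hyw : y = w + 2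
    · have := NearlySorted.le_mergePairs h.2.2 z hz
      omega
    · rw [mergePairs_of_ne l hyw] at hz
      rcases List.mem_cons.mp hz with rfl | hz
      · exact h1
      · exact h1.trans (ih h.2.2 hyw z hz)

theorem NearlySorted.le_mergePairs_tail' (h : NearlySorted (x :: y :: l)) :
    ∀ z ∈ mergePairs l, x - 1 ≤ z := by
  match l with
  | [] => simp [mergePairs]
  | w :: l =>
    intro z hz
    have h1 : x ≤ w := h.2.1 w rfl
    have h2 := NearlySorted.le_mergePairs h.2.2.2.2 z hz
    omega

/-- A descent `x, x - 2` is averaged to `x - 1, x - 1`; it is isolated, so what follows is at least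
`x - 1` even after later descents have been averaged. -/
theorem NearlySorted.pairwise_mergePairs (h : NearlySorted l) :
    (mergePairs l).Pairwise (· ≤ ·) := by
  induction l using mergePairs_induction with
  | h0 => exact List.Pairwise.nil
  | h1 x => exact List.pairwise_singleton _ _
  | h2 x y l hxy ih =>
    rw [mergePairs_of_eq l hxy, List.pairwise_cons, List.pairwise_cons]
    have hl := h.le_mergePairs_tail'
    refine ⟨fun z hz => ?_, fun z hz => ?_, ih h.2.2.2.2⟩
    · grind
    · have := hl z hz; omega
  | h3 x y l hxy ih =>
    rw [mergePairs_of_ne l hxy, List.pairwise_cons]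
    exact ⟨h.le_mergePairs_tail hxy, ih h.2.2⟩

/-- Averaging a descent by 2 lowers the partial sum that ends between the two numbers by 1 and no
other one. This is the origin of the bounds in `Matches`. -/
theorem sum_take_mergePairs (l : List ℤ) (k : ℕ) :
    0 ≤ (l.take k).sum - ((mergePairs l).take k).sum ∧
      (l.take k).sum - ((mergePairs l).take k).sum ≤ 1 := by
  induction l using mergePairs_induction generalizing k with
  | h0 => simp [mergePairs]
  | h1 x => simp [mergePairs]
  | h2 x y l h ih =>
    rw [mergePairs_of_eq l h]
    match k with
    | 0 => simp
    | 1 => simp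
    | k + 2 => grind
  | h3 x y l h ih =>
    rw [mergePairs_of_ne l h]
    match k with
    | 0 => simp
    | k + 1 => grind

/-- Numbers of the other parity arise by averaging only, hence in pairs. -/
theorem even_count_mergePairs {i : ℤ} (h : ∀ z ∈ l, z % 2 ≠ i % 2) :
    Even ((mergePairs l).count i) := by
  have hx : ∀ {x : ℤ}, x % 2 ≠ i % 2 → x ≠ i := fun h e => h (by rw [e])
  induction l using mergePairs_induction with
  | h0 => simp [mergePairs]
  | h1 x =>
    rw [mergePairs, List.count_singleton, if_neg (by simpa using hx (h x (by simp)))]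
    simp
  | h2 x y l hxy ih =>
    rw [mergePairs_of_eq l hxy, List.count_cons, List.count_cons, hxy,
      show y + 2 - 1 = y + 1 by ring]
    grind
  | h3 x y l hxy ih =>
    have hl := ih fun z hz => h z (List.mem_cons_of_mem x hz)
    rw [mergePairs_of_ne l hxy, List.count_cons_of_ne (hx (h x (by simp)))]
    exact hl

/-- In the definition of `muList` an initial segment is sorted before the final replacement is
applied to the whole list. Merging it beforehand does not affect the result, as an averaged pair
takes no part in a further descent. -/
theorem NearlySorted.mergePairs_append {A : List ℤ} (h : NearlySorted (A ++ B)) :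
    mergePairs (mergePairs A ++ B) = mergePairs (A ++ B) := by
  induction A using mergePairs_induction with
  | h0 => rfl
  | h1 x => rfl
  | h2 x y l hxy ih =>
    rw [mergePairs_of_eq l hxy, cons_append, cons_append, mergePairs_of_ne _ (by omega),
      mergePairs_cons_append, ih h.2.2.2.2, cons_append, cons_append,
      mergePairs_of_eq _ hxy]
    · intro z hz
      have := h.of_append.le_mergePairs_tail' z hz; omega
    · intro hl z hz
      have hl' : l = [] := List.length_eq_zero_iff.mp (by rw [← length_mergePairs, hl]; rfl)
      subst hl'
      have : x ≤ z := h.2.1 z hz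
      omega
  | h3 x y l hxy ih =>
    rw [mergePairs_of_ne l hxy, cons_append, mergePairs_cons_append, ih h.2.2]
    · simp only [cons_append]
      rw [mergePairs_of_ne _ hxy]
    · intro z hz
      have := h.of_append.le_mergePairs_tail hxy z hz
      omega
    · intro hl
      have := congrArg List.length hl
      simp [length_mergePairs] at this

theorem mapIdx_mergePairs_perm (l : List ℤ) (c : ℕ) :
    ((mergePairs l).mapIdx fun j x => x + ((j + c : ℕ) : ℤ)).Perm
      (l.mapIdx fun j x => x + ((j + c : ℕ) : ℤ)) := by
  induction l using mergePairs_induction generalizing c with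
  | h0 => rfl
  | h1 x => rfl
  | h2 x y l h ih =>
    rw [mergePairs_of_eq l h]
    simp only [List.mapIdx_cons]
    have e : ∀ j : ℕ, j + 1 + 1 + c = j + (c + 2) := fun j => by ring
    simp only [e]
    refine ((ih (c + 2)).cons _).cons _ |>.trans ?_
    grind
  | h3 x y l h ih =>
    rw [mergePairs_of_ne l h]
    have h1 := ih (c + 1)
    grind

/-- After adding the places, a descent `x, x - 2` at `j, j + 1` becomes the inversion `x + j, x + j
- 1`. Sorting it and subtracting the places again gives `x - 1, x - 1`. -/
theorem NearlySorted.sort_mapIdx (h : NearlySorted l) {M : Multiset ℤ}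
    (hM : M = (l.mapIdx fun j x => x + (j : ℤ) : List ℤ)) :
    ((M.sort (· ≤ ·)).mapIdx fun j x => x - (j : ℤ)) = mergePairs l := by
  have hp := mapIdx_mergePairs_perm l 0
  simp only [add_zero] at hp
  have hs : ((mergePairs l).mapIdx fun j x => x + (j : ℤ)).Pairwise (· ≤ ·) := by
    have hpw := List.pairwise_iff_getElem.mp h.pairwise_mergePairs
    rw [List.pairwise_iff_getElem]
    grind
  have : M.sort (· ≤ ·) = (mergePairs l).mapIdx fun j x => x + (j : ℤ) := by
    rw [hM, ← coe_eq_coe.mpr hp, coe_sort]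
    exact List.mergeSort_eq_self _ (hs.imp (by simp))
  rw [this]
  apply ext_getElem
  · simp
  · simp

theorem perm_map_range_two_mul (g : ℕ → ℤ) (N : ℕ) : ((List.range (2 * N)).map g).Perm
    ((List.range N).map (fun k => g (2 * k)) ++ (List.range N).map fun k => g (2 * k + 1)) := by
  induction N with
  | zero => rfl
  | succ N ih =>
    rw [show 2 * (N + 1) = 2 * N + 1 + 1 by ring, List.range_succ, List.range_succ,
      List.range_succ, ← coe_eq_coe]
    rw [← coe_eq_coe] at ih
    simp only [map_append, ← Multiset.coe_add, List.map_cons, map_nil, ih]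
    abel

end Merge

/-! ### The map from symbols to partitions -/

section Psi
open Finset

variable {r t s : ℕ}

variable {x : Fin r → ℕ} {y : Fin t → ℕ} {q : ℕ}

theorem card_filter_lt_symbolOf (x : Fin r → ℕ) (y : Fin t → ℕ) (v : ℕ) :
    ((symbolOf s x y).filter (· < v)).card ≤ (v + 1) / 2 + min t ((v + 1 - s) / 2) := by
  have key : ∀ (k w : ℕ) (f : Fin k → ℕ), (∀ i, f i < v → (i : ℕ) < w) →
      ((univ.val.map f).filter (· < v)).card ≤ min k w := by
    intro k w f hf
    rw [Multiset.filter_map, Multiset.card_map]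
    change (univ.filter fun i => f i < v).card ≤ _
    refine le_min ((card_le_univ _).trans (by simp)) ?_
    have : ((univ.filter fun i => f i < v).image fun i : Fin k => (i : ℕ)) ⊆ range w := by grind
    have := card_le_card this
    rwa [card_image_of_injective _ Fin.val_injective, card_range] at this
  rw [symbolOf_eq_add, filter_add, card_add]
  have h1 := key r ((v + 1) / 2) (fun i => x i + 2 * i) fun i hi => by omega
  have h2 := key t ((v + 1 - s) / 2) (fun i => y i + 2 * i + s) fun i hi => by omega
  omega

theorem le_entry_symbolOf {v : ℕ} (hq : q < r + t)
    (h : (v + 1) / 2 + min t ((v + 1 - s) / 2) ≤ q) : v ≤ entry (symbolOf s x y) q := by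
  by_contra hc
  have h1 := (lt_entry_iff (E := symbolOf s x y) (by rwa [card_symbolOf]) v).mp (by omega)
  have h2 := card_filter_lt_symbolOf (s := s) x y v
  omega

/-- Each row has at most one entry in an interval of two consecutive integers, so three successive
entries of the symbol cannot lie in one. -/
theorem entry_add_two (hx : Monotone x) (hy : Monotone y) (hq : q + 2 < r + t) :
    entry (symbolOf s x y) q + 2 ≤ entry (symbolOf s x y) (q + 2) := by
  have hE := symbolOf_eq_rowM (extRow_coe 0 x) (extRow_coe s y)
  have hc := card_symbolOf s x y
  by_contra hlt
  obtain ⟨E, hE'⟩ : ∃ E, E = symbolOf s x y := ⟨_, rfl⟩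
  obtain ⟨w, hw⟩ : ∃ w, w = entry E q := ⟨_, rfl⟩
  have h1 : (E.filter fun z => w ≤ z ∧ z ≤ w + 1).card ≤ 2 := by
    rw [hE', hE, filter_add, card_add]
    exact add_le_add ((gap_extRow hx).card_filter_interval w)
      ((gap_extRow hy).card_filter_interval w)
  rw [card_filter_eq] at h1
  rw [← hE'] at hc hlt
  have h2 : Icc q (q + 2) ⊆ (range E.card).filter fun j => w ≤ entry E j ∧ entry E j ≤ w + 1 := by
    intro j hj
    rw [mem_Icc] at hj
    rw [mem_filter, mem_range]
    have e1 := entry_mono (E := E) hj.1 (by omega)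
    have e2 := entry_mono (E := E) hj.2 (by omega)
    omega
  have h3 := card_le_card h2
  rw [Nat.card_Icc] at h3
  omega

/-- The numbers whose prefix sums are compared with those of the parts. -/
def levels (s : ℕ) (E : Multiset ℕ) (q : ℕ) : ℤ := 2 * ((entry E q : ℤ) - q) + 1 - s

theorem nearlySorted_levels (hx : Monotone x) (hy : Monotone y)
    (a : ℕ) {k : ℕ} (hk : a + k ≤ r + t) :
    NearlySorted ((List.range k).map fun i => levels s (symbolOf s x y) (a + i)) := by
  have hc := card_symbolOf s x y
  refine nearlySorted_map_range (fun i hi => ?_) fun i hi => ?_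
  · have := entry_mono (E := symbolOf s x y) (show a + i ≤ a + (i + 1) by omega) (by omega)
    unfold levels
    omega
  · have := entry_add_two (s := s) hx hy (q := a + i) (by omega)
    rw [← add_assoc]
    unfold levels
    omega

/-- The levels are the numbers compared with the parts in `defect`. They all have the parity of `1 -
s` and are nearly sorted by `entry_add_two`, so merging yields an increasing sequence that satisfies
the bounds and the parity condition. For `s = 1` the first level is 0 and can be split off. -/
theorem toNat_mergePairs_levels (hs : s ≤ 1) (hx : Monotone x)
    (hy : Monotone y) (h0 : s = 1 → entry (symbolOf s x y) 0 = 0) :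
    let G := mergePairs ((List.range (r + t)).map (levels s (symbolOf s x y)))
    Matches s (symbolOf s x y) ((G.map Int.toNat : List ℕ) : Multiset ℕ) ∧
      EvenParts s ((G.map Int.toNat : List ℕ) : Multiset ℕ) ∧
      (s = 1 → mergePairs ((List.range (r + t)).map (levels s (symbolOf s x y))) =
        (List.replicate (min 1 (r + t)) 0) ++
          mergePairs ((List.range (r + t - 1)).map fun i => levels s (symbolOf s x y) (1 + i))) := by
  intro G
  obtain ⟨E, hE⟩ : ∃ E, E = symbolOf s x y := ⟨_, rfl⟩
  have hG : G = mergePairs ((List.range (r + t)).map (levels s E)) := by rw [hE]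
  have hcE : E.card = r + t := by rw [hE, card_symbolOf]
  have hns : NearlySorted ((List.range (r + t)).map (levels s E)) := by
    have := nearlySorted_levels (s := s) hx hy 0 (k := r + t) (by omega)
    grind
  have hlen : G.length = r + t := by rw [hG, length_mergePairs]; simp
  have hsplit : ∀ T, T + 1 = r + t → (List.range (r + t)).map (levels s E) =
      levels s E 0 :: (List.range (r + t - 1)).map fun i => levels s E (1 + i) := by
    intro T hT
    rw [← hT, range_succ_eq_map, List.map_cons, List.map_map, Nat.add_sub_cancel]
    simp only [comp_def, Nat.succ_eq_add_one, add_comm]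
  have hlow1 : s = 1 → ∀ q, 1 ≤ q → q < r + t → 0 ≤ levels s E q := by
    intro hs1 q hq hqT
    have : q ≤ entry E q := by
      rw [hE]
      exact le_entry_symbolOf hqT (by omega)
    unfold levels
    omega
  have hnn : ∀ z ∈ G, 0 ≤ z := by
    rw [hG]
    rcases hT : r + t with _ | T
    · simp [mergePairs]
    · rw [← hT, hsplit T hT.symm]
      rcases (show s = 0 ∨ s = 1 by omega) with rfl | hs1
      · intro z hz
        rw [hsplit T hT.symm] at hns
        have := hns.le_mergePairs z hz
        have h1 : levels 0 E 0 = 2 * entry E 0 + 1 := by unfold levels; ring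
        omega
      · refine le_mergePairs fun z hz => ?_
        rcases List.mem_cons.mp hz with rfl | hz
        · unfold levels; omega
        grind
  have hpw : (G.map Int.toNat).Pairwise (· ≤ ·) := by
    have : G.Pairwise (· ≤ ·) := by rw [hG]; exact hns.pairwise_mergePairs
    grind
  have hentry : ∀ j, j < r + t → (entry ((G.map Int.toNat : List ℕ) : Multiset ℕ) j : ℤ) =
      G.getD j 0 := by
    intro j hj
    have hj' : j < G.length := by omega
    rw [entry_coe hpw, List.getD_eq_getElem?_getD, List.getD_eq_getElem?_getD, List.getElem?_map,
      List.getElem?_eq_getElem hj']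
    simp_all
  have hcM : ((G.map Int.toNat : List ℕ) : Multiset ℕ).card = r + t := by simp [hlen]
  refine ⟨?_, ?_, ?_⟩
  · rw [← hE]
    refine ⟨hcE.trans hcM.symm, fun k hk => ?_⟩
    rw [hcM] at hk
    have h1 : defect s E ((G.map Int.toNat : List ℕ) : Multiset ℕ) k =
        (((List.range (r + t)).map (levels s E)).take k).sum - (G.take k).sum := by
      induction k with
      | zero => simp [defect_zero]
      | succ k ih =>
        have hk' : k < ((List.range (r + t)).map (levels s E)).length := by simpa using hk
        have hk'' : k < G.length := by omega
        rw [defect_succ, ih (by omega), List.sum_take_succ _ _ hk', List.sum_take_succ _ _ hk'',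
          hentry k (by omega), List.getD_eq_getElem?_getD, List.getElem?_eq_getElem hk'']
        simp only [List.getElem_map, List.getElem_range, Option.getD_some, levels]
        ring
    rw [h1, hG]
    exact sum_take_mergePairs _ _
  · intro i hi
    rw [Multiset.coe_count]
    have h1 : (G.map Int.toNat).count i = G.count (i : ℤ) := by
      unfold List.count
      rw [List.countP_map]
      refine List.countP_congr fun z hz => ?_
      grind
    rw [h1, hG]
    refine even_count_mergePairs fun z hz => ?_
    obtain ⟨q, -, rfl⟩ := List.mem_map.mp hz
    unfold levels
    omega
  · intro hs1
    rw [← hE] at h0 ⊢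
    rcases hT : r + t with _ | T
    · simp [mergePairs]
    · have h2 : levels s E 0 = 0 := by unfold levels; rw [h0 hs1, hs1]; simp
      rw [← hT, hsplit T hT.symm, h2, mergePairs_cons_of_le, show min 1 (r + t) = 1 by omega]
      · rfl
      grind

theorem muList_eq (h : ℤ) {N : ℕ} {E : Multiset ℕ}
    (hns : NearlySorted ((List.range (2 * N)).map fun i => levels (h.natAbs % 2) E
      (h.natAbs % 2 + i))) :
    muList h N (E.sort (· ≤ ·)) =
      mergePairs ((List.range (2 * N)).map fun i => levels (h.natAbs % 2) E (h.natAbs % 2 + i)) ++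
        (List.range (h.natAbs / 2)).map fun i => levels (h.natAbs % 2) E
          (h.natAbs % 2 + (2 * N + i)) := by
  obtain ⟨s, hs⟩ : ∃ s, s = h.natAbs % 2 := ⟨_, rfl⟩
  rw [← hs] at hns ⊢
  unfold muList
  congr 1
  · apply hns.sort_mapIdx
    have h1 : ((List.range (2 * N)).map fun i => levels s E (s + i)).mapIdx
        (fun j x => x + (j : ℤ)) =
        (List.range (2 * N)).map fun i => levels s E (s + i) + i := by
      apply ext_getElem
      · simp
      · simp
    rw [h1, coe_eq_coe]
    refine List.Perm.symm ((perm_map_range_two_mul _ N).trans ?_)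
    have hxi : ∀ k ∈ List.range N, 2 * xiStar h N (E.sort (· ≤ ·)) k + 1 =
        levels s E (s + (2 * k + s)) + (2 * k + s : ℕ) := fun k hk => by
      have hk := List.mem_range.mp hk
      unfold xiStar levels entry
      simp only
      -- For `s = 1` the omitted first part shifts the index by one. The last `k = N - 1` then uses
      -- the entry number `2 * N`, where the two descriptions of the first row coincide.
      rw [← hs, show (if k + s < N then 2 * (k + s) else N + (k + s)) = s + (2 * k + s) by
        split_ifs <;> omega]
      push_cast
      ring
    have heta : ∀ k ∈ List.range N, 2 * etaStar h (E.sort (· ≤ ·)) k =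
        levels s E (s + (2 * k + 1 - s)) + (2 * k + 1 - s : ℕ) := fun k hk => by
      unfold etaStar levels entry
      rw [← hs, show s + (2 * k + 1 - s) = 2 * k + 1 by omega,
        Nat.cast_sub (by omega : s ≤ 2 * k + 1)]
      push_cast
      ring
    rw [List.map_congr_left hxi, List.map_congr_left heta]
    rcases (show s = 0 ∨ s = 1 by omega) with h0 | h0
    · rw [h0]
      grind
    · rw [h0]
      grind
  · unfold xiStar levels entry
    grind

variable {n : ℕ} {h : ℤ}

/-- The recipe with `ξ*` and `η*` amounts to merging the list of levels: interleaving the two rows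
recovers the ordered entries, and the staircases are absorbed into the levels. -/
theorem psiBip_eq (A : Bipartition n) : ∃ l : List ℕ, psiBip h A = (l : Multiset ℕ).filter (· ≠ 0) ∧
      Matches (h.natAbs % 2) (symbolEntries h n A.fst A.snd) l ∧
      EvenParts (h.natAbs % 2) (l : Multiset ℕ) := by
  obtain ⟨s, hs⟩ : ∃ s, s = h.natAbs % 2 := ⟨_, rfl⟩
  obtain ⟨c, hc⟩ : ∃ c, c = (h.natAbs + 1) / 2 := ⟨_, rfl⟩
  have f1 : (A.row₁ h).card ≤ n + c := A.card_row₁_le.trans (by omega)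
  have f2 : (A.row₂ h).card ≤ n := A.card_row₂_le
  have hx := padSeq_monotone f1
  have hy := padSeq_monotone f2
  have h0 : s = 1 → entry (symbolOf s (padSeq (n + c) (A.row₁ h)) (padSeq n (A.row₂ h))) 0 = 0 := by
    intro hs1
    have hx0 := eq_zero_of_sum_lt hx (show 0 < n + c by omega)
      (by rw [sum_padSeq f1]; have := A.sum_rows (h := h); omega)
    have : entry (symbolOf s (padSeq (n + c) (A.row₁ h)) (padSeq n (A.row₂ h))) 0 ≤ 0 := by
      rw [entry_le_iff (by rw [card_symbolOf]; omega), Multiset.card_pos_iff_exists_mem]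
      refine ⟨0, Multiset.mem_filter.mpr ⟨Multiset.mem_map.mpr
        ⟨inl ⟨0, by omega⟩, mem_val.mpr (mem_univ _), ?_⟩, le_rfl⟩⟩
      simp [rowEntry, hx0]
    omega
  obtain ⟨h1, h2, h3⟩ := toNat_mergePairs_levels (by omega) hx hy h0
  have hns := fun a k hk => nearlySorted_levels (s := s) hx hy a (k := k) hk
  have hEA : symbolEntries h n A.fst A.snd = _ := A.symbolEntries_eq le_rfl
  rw [← hs, ← hc] at hEA
  unfold psiBip
  rw [hEA, ← hs]
  obtain ⟨E, hE⟩ : ∃ E, E = symbolOf s (padSeq (n + c) (A.row₁ h)) (padSeq n (A.row₂ h)) := ⟨_, rfl⟩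
  rw [← hE] at h1 h2 h3 hns ⊢
  refine ⟨(mergePairs ((List.range (n + c + n)).map (levels s E))).map Int.toNat, ?_, h1, h2⟩
  have e1 : (List.range (2 * n)).map (fun i => levels s E (s + i)) ++
      (List.range (h.natAbs / 2)).map (fun i => levels s E (s + (2 * n + i))) =
      (List.range (n + c + n - s)).map fun i => levels s E (s + i) := by
    rw [show n + c + n - s = 2 * n + h.natAbs / 2 by omega, List.range_add, map_append,
      List.map_map]
    rfl
  have e2 : mergePairs (muList h n (E.sort (· ≤ ·))) =
      mergePairs ((List.range (n + c + n - s)).map fun i => levels s E (s + i)) := by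
    have h4 := hns s (n + c + n - s) (by omega)
    rw [muList_eq h (by rw [← hs]; exact hns s (2 * n) (by omega)), ← hs,
      NearlySorted.mergePairs_append (by rw [e1]; exact h4), e1]
  rw [e2]
  -- For `s = 1` the full list starts with a 0, which the recipe has omitted as the first part of
  -- `ξ` and which the filter removes.
  rcases (show s = 0 ∨ s = 1 by omega) with hs0 | hs1
  · simp only [hs0, Nat.sub_zero, Nat.zero_add]
  simp_all

theorem corresponds_psiBip (A : Bipartition n) : Corresponds h A (psiBip h A) ∧
    EvenParts (h.natAbs % 2) (padTo (n + (h.natAbs + 1) / 2 + n) (psiBip h A)) ∧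
    (psiBip h A).card ≤ n + (h.natAbs + 1) / 2 + n ∧ 0 ∉ psiBip h A := by
  obtain ⟨l, hl, hm, hV⟩ := psiBip_eq (h := h) A
  have hc : (l : Multiset ℕ).card = n + (h.natAbs + 1) / 2 + n := by
    rw [← hm.1, A.symbolEntries_eq le_rfl, card_symbolOf]
  have hpad : padTo (n + (h.natAbs + 1) / 2 + n) (psiBip h A) = l := by
    rw [padTo, hl, ← hc]
    exact filter_ne_zero_add_replicate _
  unfold Corresponds
  rw [hpad]
  refine ⟨hm, hV, ?_, by rw [hl]; simp⟩
  rw [hl, ← hc]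
  exact Multiset.card_le_card (filter_le _ _)

end Psi

/-! ### Generalized unipotent classes and symbols -/

section Unipotent
open Finset hiding filter map map_map mem_range range
open Multiset (filter map map_map mem_range range)

variable {s : ℕ} {l : Multiset ℕ}

theorem evenParts_padTo_add {T : ℕ} {D : Multiset ℕ} (hc : (l + 2 • D).card ≤ T) :
    EvenParts s (padTo T (l + 2 • D)) ↔ EvenParts s (padTo T l) := by
  rw [card_add, card_nsmul] at hc
  refine forall₂_congr fun i _ => ?_
  simp only [padTo, count_add, count_nsmul, card_add, card_nsmul, count_replicate, Nat.even_iff]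
  split_ifs <;> omega

theorem corresponds_unique {n : ℕ} {h : ℤ} {A : Bipartition n} (h0 : 0 ∉ l)
    (hV : EvenParts (h.natAbs % 2) (padTo (n + (h.natAbs + 1) / 2 + n) l))
    (hA : Corresponds h A l) : psiBip h A = l := by
  obtain ⟨h1, h2, h3, h4⟩ := corresponds_psiBip (h := h) A
  have := congrArg (filter (· ≠ 0)) (h1.partition_unique (by omega) hA h2 hV)
  have key : ∀ {T : ℕ} {l : Multiset ℕ}, 0 ∉ l → (padTo T l).filter (· ≠ 0) = l := by
    intro T l h0
    rw [padTo, filter_add, Multiset.filter_eq_self.mpr, filter_eq_nil.mpr, add_zero]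
    · intro x hx; simpa using Multiset.eq_of_mem_replicate hx
    grind
  rwa [key h4, key h0] at this

/-- The last defect compares total sums, where the staircases of the rows and the quadratic term of
`defect_eq` combine to `c ^ 2 - s * c`. With `natAbs_sq_div_four` this produces the size `2 n +
⌊m²⌋`. -/
theorem sum_of_defect_eq_zero {c t : ℕ} {x : Fin (t + c) → ℕ} {y : Fin t → ℕ} {M : Multiset ℕ}
    (hc : M.card = t + c + t) (h0 : defect s (symbolOf s x y) M (t + c + t) = 0) :
    M.sum + s * c = 2 * (∑ i, x i + ∑ j, y j) + c ^ 2 := by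
  have h1 := lowSum_card M
  have h2 := lowSum_card (symbolOf s x y)
  rw [card_symbolOf] at h2
  rw [hc] at h1
  rw [defect_eq, h1, h2, sum_symbolOf] at h0
  have gauss : ∀ k : ℕ, (∑ i : Fin k, 2 * (i : ℕ) : ℤ) = k * (k - 1) := fun k => by
    induction k with
    | zero => simp
    | succ k ih => rw [Fin.sum_univ_castSucc]; simp [ih]; ring
  rw [sum_add_distrib] at h0
  push_cast at h0
  rw [gauss, gauss] at h0
  simp only [sum_const, card_univ, Fintype.card_fin, nsmul_eq_mul] at h0
  push_cast at h0
  linarith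

theorem natAbs_sq_div_four (k : ℕ) : k ^ 2 / 4 + k % 2 * ((k + 1) / 2) = ((k + 1) / 2) ^ 2 := by
  obtain ⟨c, rfl | rfl⟩ := Nat.even_or_odd' k
  · rw [show (2 * c) ^ 2 = c ^ 2 * 4 by ring, Nat.mul_div_cancel _ (by norm_num),
      show 2 * c % 2 = 0 by omega, show (2 * c + 1) / 2 = c by omega]
    ring
  · rw [show (2 * c + 1) ^ 2 = 1 + (c ^ 2 + c) * 4 by ring, Nat.add_mul_div_right _ _ (by norm_num),
      show (2 * c + 1) % 2 = 1 by omega, show (2 * c + 1 + 1) / 2 = c + 1 by omega]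
    ring

variable {n : ℕ} {h : ℤ}

/-- Half of the parts, up to parity. -/
def halfParts (l : Multiset ℕ) : Multiset ℕ := ∑ i ∈ l.toFinset, replicate (l.count i / 2) i

/-- The parts with odd multiplicity. -/
def oddParts (l : Multiset ℕ) : Finset ℕ := l.toFinset.filter fun i => Odd (l.count i)

theorem count_halfParts (l : Multiset ℕ) (d : ℕ) : (halfParts l).count d = l.count d / 2 := by
  rw [halfParts, Multiset.count_sum']
  simp only [count_replicate]
  simp_all

theorem count_oddParts (l : Multiset ℕ) (d : ℕ) : (oddParts l).val.count d = l.count d % 2 := by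
  have h1 : d ∈ (oddParts l).val ↔ 0 < l.count d ∧ l.count d % 2 = 1 := by
    rw [mem_val, oddParts, mem_filter, Multiset.mem_toFinset, ← count_pos, Nat.odd_iff]
  rw [count_eq_of_nodup (oddParts l).nodup]
  grind

theorem oddParts_add_halfParts (l : Multiset ℕ) : (oddParts l).val + 2 • halfParts l = l := by
  ext d
  rw [count_add, count_nsmul, count_halfParts, count_oddParts]
  omega

/-- A symbol cannot match a partition with too many zeros: the longer row forces the entries at the
places `2 t` and `2 t + 1` to be at least `2 t` and `2 t + 2`, and two zero parts there would raise
the defect by at least 2. -/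
theorem le_card_oddParts {c t : ℕ} (hs : s ≤ 1) {x : Fin (t + c) → ℕ} {y : Fin t → ℕ}
    {M : Finset ℕ} (h0 : 0 ∉ M) (hsc : s ≤ c)
    (hm : Matches s (symbolOf s x y) (padTo (t + c + t) M.val))
    (hV : EvenParts s (padTo (t + c + t) M.val)) : c - s ≤ M.card := by
  by_contra hlt
  obtain ⟨z, hz⟩ : ∃ z, z + M.card = t + c + t := ⟨t + c + t - M.card, by omega⟩
  have hcount : (padTo (t + c + t) M.val).count 0 = z := by
    rw [padTo, count_add, count_eq_zero.mpr (by simpa using h0),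
      Multiset.count_replicate_self, card_val]
    omega
  -- For `s = 0` counting gives one zero less, but 0 has the parity of `s`, so the number of zeros
  -- is even.
  have hz2 : 2 * t + 2 ≤ z := by
    rcases (show s = 0 ∨ s = 1 by omega) with rfl | rfl
    · have := hV 0 rfl
      grind
    · omega
  have hcM : (padTo (t + c + t) M.val).card = t + c + t := card_padTo (by simp; omega)
  have hM : ∀ q < z, entry (padTo (t + c + t) M.val) q = 0 := fun q hq => by
    have := (entry_le_iff (E := padTo (t + c + t) M.val) (j := q) (by omega) 0).mpr (by
      rw [Multiset.count_eq_card_filter_eq] at hcount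
      rw [Multiset.filter_congr (q := (0 = ·)) fun x _ => by omega, hcount]
      exact hq)
    omega
  have e1 := le_entry_symbolOf (s := s) (x := x) (y := y) (q := 2 * t) (v := 2 * t) (by omega)
    (by omega)
  have e2 := le_entry_symbolOf (s := s) (x := x) (y := y) (q := 2 * t + 1) (v := 2 * t + 2)
    (by omega) (by omega)
  have d0 := hm.2 (2 * t) (by omega)
  have d2 := hm.2 (2 * t + 1 + 1) (by omega)
  rw [defect_succ, defect_succ, hM _ (by omega), hM _ (by omega)] at d2
  omega

/-- At the end of the partition the defect is even, hence 0, which fixes the size. To bound the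
number of parts of odd multiplicity, all pairs are removed by `exists_chain_left` and
`le_card_oddParts` is applied to what remains. -/
theorem mem_unipotent_of_corresponds {A : Bipartition n} (h0 : 0 ∉ l)
    (hl : l.card ≤ n + (h.natAbs + 1) / 2 + n)
    (hV : EvenParts (h.natAbs % 2) (padTo (n + (h.natAbs + 1) / 2 + n) l))
    (hA : Corresponds h A l) : l ∈ unipotent h n := by
  obtain ⟨s, hs⟩ : ∃ s, s = h.natAbs % 2 := ⟨_, rfl⟩
  obtain ⟨c, hc⟩ : ∃ c, c = (h.natAbs + 1) / 2 := ⟨_, rfl⟩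
  have hsq := natAbs_sq_div_four h.natAbs
  rw [Corresponds, A.symbolEntries_eq le_rfl] at hA
  rw [← hs, ← hc] at hA hV hsq
  rw [← hc] at hl
  have f1 : (A.row₁ h).card ≤ n + c := A.card_row₁_le.trans (by omega)
  have f2 : (A.row₂ h).card ≤ n := A.card_row₂_le
  have hcT := card_padTo hl
  have hVl : ∀ i, i % 2 = s → Even (l.count i) := fun i hi => by
    rcases eq_or_ne i 0 with rfl | hi0
    · rw [count_eq_zero.mpr h0]; exact Even.zero
    · have := hV i hi
      rwa [padTo, count_add, count_replicate, if_neg (Ne.symm hi0), add_zero] at this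
  refine ⟨h0, ?_, fun i hi => hVl i (by omega), ?_⟩
  · have heven := even_defect (E := symbolOf s (padSeq (n + c) (A.row₁ h))
      (padSeq n (A.row₂ h))) (by omega) hV hcT.ge fun j _ hj => absurd hj (by omega)
    have h1 := hA.2 _ hcT.ge
    rw [even_iff] at heven
    have h2 := sum_of_defect_eq_zero (s := s) (x := padSeq (n + c) (A.row₁ h)) (y := padSeq n (A.row₂ h))
      hcT (by omega)
    rw [sum_padSeq f1, sum_padSeq f2, A.sum_rows, ← hsq] at h2
    have h3 : (padTo (n + c + n) l).sum = l.sum := by simp [padTo]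
    omega
  · obtain ⟨ds, hds⟩ := Quotient.exists_rep (halfParts l)
    change (ds : Multiset ℕ) = halfParts l at hds
    have hl' := oddParts_add_halfParts l
    rw [← hds] at hl'
    have h1 : ∀ d ∈ ds, 1 ≤ d := by
      intro d hd
      have h2 : d ∈ halfParts l := hds ▸ hd
      rw [← count_pos, count_halfParts] at h2
      rcases Nat.eq_zero_or_pos d with rfl | h3
      · simp_all
      · exact h3
    rw [← hl'] at hl hA hV
    rw [evenParts_padTo_add hl] at hV
    rw [card_add, card_nsmul, coe_card] at hl
    obtain ⟨x, y, -, -, -, hm⟩ := exists_chain_left (by omega) ds h1 (padSeq_monotone f1)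
      (padSeq_monotone f2) hl hA hV
    have h0' : 0 ∉ oddParts l := fun hc => by grind
    have h2 := le_card_oddParts (by omega) h0' (by omega) hm hV
    refine (show h.natAbs / 2 ≤ c - s by omega).trans (h2.trans (card_le_card ?_))
    intro i hi
    rw [oddParts, mem_filter] at hi
    grind

theorem psiBip_mem_unipotent (A : Bipartition n) : psiBip h A ∈ unipotent h n := by
  obtain ⟨h1, h2, h3, h4⟩ := corresponds_psiBip (h := h) A
  exact mem_unipotent_of_corresponds h4 h3 h2 h1

end Unipotent

/-! ### The symbol of a set of jumps -/

section Jumps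
open Finset hiding filter map map_map mem_range range
open Multiset (filter map map_map mem_range range)

variable {s c ρ : ℕ} {J : Finset ℕ}

variable {k : ℕ} {β : Type*}

theorem sort_getD_eq (J : Finset ℕ) (i : ℕ) : (J.sort (· ≤ ·)).getD i 0 = entry J.val i := rfl

theorem entry_finset_lt {i j : ℕ} (hij : i < j) (hj : j < J.card) :
    entry J.val i < entry J.val j := by
  have h1 : (J.sort (· ≤ ·)).Pairwise (· < ·) := sortedLT_sort J |>.pairwise
  have hj' : j < (J.sort (· ≤ ·)).length := by simpa
  rw [← sort_getD_eq, ← sort_getD_eq, List.getD_eq_getElem?_getD, List.getD_eq_getElem?_getD,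
    List.getElem?_eq_getElem hj', List.getElem?_eq_getElem (hij.trans hj')]
  exact List.pairwise_iff_getElem.mp h1 i j _ _ hij

theorem entry_add_le (hJ : ∀ p ∈ J, p % 2 = 1 - s) (hs : s ≤ 1) {i : ℕ} (hk : i + k < J.card) :
    entry J.val i + 2 * k ≤ entry J.val (i + k) := by
  have hpar : ∀ q < J.card, entry J.val q % 2 = 1 - s := fun q hq => hJ _ (entry_mem hq)
  induction k with
  | zero => simp
  | succ k ih =>
    have h2 := entry_finset_lt (J := J) (show i + k < i + (k + 1) by omega) hk
    grind

/-- The first row of the partition of a set of jumps. -/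
def jumpRow₁ (J : Finset ℕ) (ρ c : ℕ) (i : Fin (ρ + c)) : ℕ :=
  if (i : ℕ) < ρ then entry J.val (2 * i) / 2 else entry J.val (ρ + i) / 2 - (i - ρ)

/-- The second row of the partition of a set of jumps. -/
def jumpRow₂ (J : Finset ℕ) (ρ : ℕ) (i : Fin ρ) : ℕ := (entry J.val (2 * i + 1) + 1) / 2

theorem le_entry_div (hJ : ∀ p ∈ J, p % 2 = 1 - s) (hs : s ≤ 1) {q : ℕ} (hq : q < J.card) :
    q ≤ entry J.val q / 2 := by
  have := entry_add_le hJ hs (i := 0) (k := q) (by omega)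
  rw [Nat.zero_add] at this
  omega

theorem jumpRow₁_monotone (hJ : ∀ p ∈ J, p % 2 = 1 - s) (hs : s ≤ 1) (hc : J.card = c + 2 * ρ) :
    Monotone (jumpRow₁ J ρ c) := by
  intro i j hij
  have hij' : (i : ℕ) ≤ j := hij
  obtain ⟨k, hk⟩ := Nat.exists_eq_add_of_le hij'
  unfold jumpRow₁
  split_ifs with h1 h2
  · have := entry_add_le hJ hs (i := 2 * i) (k := 2 * k) (by omega)
    grind
  · have := entry_add_le hJ hs (i := 2 * i) (k := ρ + j - 2 * i) (by omega)
    grind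
  · omega
  · have := entry_add_le hJ hs (i := ρ + i) (k := k) (by omega)
    grind

theorem jumpRow₂_monotone (hJ : ∀ p ∈ J, p % 2 = 1 - s) (hs : s ≤ 1) (hc : J.card = c + 2 * ρ) :
    Monotone (jumpRow₂ J ρ) := by
  intro i j hij
  have hij' : (i : ℕ) ≤ j := hij
  obtain ⟨k, hk⟩ := Nat.exists_eq_add_of_le hij'
  unfold jumpRow₂
  have := entry_add_le hJ hs (i := 2 * i + 1) (k := 2 * k) (by omega)
  grind

theorem map_range_two_mul (f : ℕ → β) (ρ : ℕ) :
    (range (2 * ρ)).map f = (range ρ).map (fun k => f (2 * k)) +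
      (range ρ).map fun k => f (2 * k + 1) := by
  induction ρ with
  | zero => rfl
  | succ ρ ih =>
    rw [show 2 * (ρ + 1) = 2 * ρ + 1 + 1 by ring, range_succ, range_succ, range_succ]
    simp_all

theorem range_add_map (f : ℕ → β) (a b : ℕ) : (range (a + b)).map f =
    (range a).map f + (range b).map fun k => f (a + k) := by
  rw [Multiset.range_add, Multiset.map_add, map_map]
  rfl

theorem univ_map_fin (f : ℕ → ℕ) (k : ℕ) :
    (univ : Finset (Fin k)).val.map (fun i : Fin k => f i.val) = (range k).map f := (rowM_eq f).symm

/-- The formulas for `ξ` and `η` distribute the jumps alternately to the two rows, and the surplus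
to the first one. The corrections in these formulas compensate the staircases, so the `q`-th jump
produces the same expression in either row. -/
theorem symbolOf_jumpRows (hJ : ∀ p ∈ J, p % 2 = 1 - s) (hs : s ≤ 1) (hc : J.card = c + 2 * ρ) :
    symbolOf s (jumpRow₁ J ρ c) (jumpRow₂ J ρ) =
      (range J.card).map fun q => entry J.val q / 2 + q := by
  rw [symbolOf_eq_add, hc, add_comm c, range_add_map, map_range_two_mul]
  unfold jumpRow₁ jumpRow₂
  rw [univ_map_fin (fun i => (if i < ρ then entry J.val (2 * i) / 2 else
    entry J.val (ρ + i) / 2 - (i - ρ)) + 2 * i), univ_map_fin (fun i =>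
    (entry J.val (2 * i + 1) + 1) / 2 + 2 * i + s), range_add_map]
  have e1 : (range ρ).map (fun i => (if i < ρ then entry J.val (2 * i) / 2 else
      entry J.val (ρ + i) / 2 - (i - ρ)) + 2 * i) =
      (range ρ).map fun i => entry J.val (2 * i) / 2 + 2 * i :=
    Multiset.map_congr rfl fun i hi => by rw [if_pos (mem_range.mp hi)]
  have e2 : (range c).map (fun k => (if ρ + k < ρ then entry J.val (2 * (ρ + k)) / 2 else
      entry J.val (ρ + (ρ + k)) / 2 - (ρ + k - ρ)) + 2 * (ρ + k)) =
      (range c).map fun k => entry J.val (2 * ρ + k) / 2 + (2 * ρ + k) :=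
    Multiset.map_congr rfl fun k hk => by
      have hk := mem_range.mp hk
      have := le_entry_div hJ hs (q := 2 * ρ + k) (by omega)
      grind
  have e3 : (range ρ).map (fun i => (entry J.val (2 * i + 1) + 1) / 2 + 2 * i + s) =
      (range ρ).map fun i => entry J.val (2 * i + 1) / 2 + (2 * i + 1) :=
    Multiset.map_congr rfl fun i hi => by
      have hi := mem_range.mp hi
      have := hJ _ (entry_mem (E := J.val) (j := 2 * i + 1) (by simp; omega))
      omega
  rw [e1, e2, e3]
  abel

/-- The entry `p_q / 2 + q` has level `2 (p_q / 2) + 1 - s`, which is `p_q` by parity. Hence every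
summand vanishes. -/
theorem defect_jumpRows (hJ : ∀ p ∈ J, p % 2 = 1 - s) (hs : s ≤ 1) (hc : J.card = c + 2 * ρ)
    (hk : k ≤ J.card) :
    defect s (symbolOf s (jumpRow₁ J ρ c) (jumpRow₂ J ρ)) J.val k = 0 := by
  rw [symbolOf_jumpRows hJ hs hc]
  have hsort : ((List.range J.card).map fun q => entry J.val q / 2 + q).Pairwise (· ≤ ·) := by
    rw [pairwise_map]
    refine List.pairwise_lt_range.imp_of_mem fun {a b} ha hb hab => ?_
    have := entry_mono (E := J.val) hab.le (by simpa using hb)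
    omega
  have hentry : ∀ q < J.card, entry ((range J.card).map fun q => entry J.val q / 2 + q) q =
      entry J.val q / 2 + q := fun q hq => by
    refine (entry_coe hsort q).trans ?_
    grind
  induction k with
  | zero => rfl
  | succ k ih =>
    rw [defect_succ, ih (by omega), hentry k hk]
    have := hJ _ (entry_mem (E := J.val) (j := k) hk)
    omega

theorem xiOf_eq (h : ℤ) (hc : J.card = (h.natAbs + 1) / 2 + 2 * ρ) :
    xiOf h J = partsOf (jumpRow₁ J ρ ((h.natAbs + 1) / 2)) := by
  obtain ⟨c, hc'⟩ : ∃ c, c = (h.natAbs + 1) / 2 := ⟨_, rfl⟩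
  rw [← hc'] at hc ⊢
  unfold xiOf partsOf
  rw [← hc', hc, Nat.add_sub_cancel_left]
  congr 1
  change map _ (filter _ (range (c + 2 * ρ))) = _
  unfold jumpRow₁
  rw [univ_map_fin (fun i => if i < ρ then entry J.val (2 * i) / 2 else
    entry J.val (ρ + i) / 2 - (i - ρ)), range_add_map]
  have e0 : filter (fun i => i % 2 = 0 ∨ 2 * ρ ≤ i) (range (c + 2 * ρ)) =
      (range ρ).map (fun k => 2 * k) + (range c).map fun k => 2 * ρ + k := by
    rw [add_comm c, Multiset.range_add, filter_add]
    congr 1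
    · have := map_range_two_mul (fun k => k) ρ
      rw [map_id'] at this
      rw [this, filter_add, Multiset.filter_eq_self.mpr, filter_eq_nil.mpr, add_zero]
      · intro a ha
        obtain ⟨k, hk, rfl⟩ := Multiset.mem_map.mp ha
        have := mem_range.mp hk
        omega
      simp_all
    simp_all
  rw [e0, Multiset.map_add, map_map, map_map]
  congr 1
  · refine Multiset.map_congr rfl fun k hk => ?_
    have := mem_range.mp hk
    rw [if_pos this]
    simp only [comp, sort_getD_eq]
    omega
  · refine Multiset.map_congr rfl fun k hk => ?_
    rw [if_neg (by omega), ← add_assoc ρ, ← two_mul]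
    simp only [comp, sort_getD_eq]
    omega

theorem etaOf_eq (h : ℤ) (hc : J.card = (h.natAbs + 1) / 2 + 2 * ρ) :
    etaOf h J = partsOf (jumpRow₂ J ρ) := by
  obtain ⟨c, hc'⟩ : ∃ c, c = (h.natAbs + 1) / 2 := ⟨_, rfl⟩
  rw [← hc'] at hc
  unfold etaOf partsOf
  rw [← hc', hc, Nat.add_sub_cancel_left]
  congr 1
  change map _ (filter _ (range (c + 2 * ρ))) = _
  unfold jumpRow₂
  rw [univ_map_fin (fun i => (entry J.val (2 * i + 1) + 1) / 2)]
  have e0 : filter (fun i => i % 2 = 1 ∧ i < 2 * ρ) (range (c + 2 * ρ)) =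
      (range ρ).map fun k => 2 * k + 1 := by
    have e1 : filter (fun i => i % 2 = 1 ∧ i < 2 * ρ) ((range c).map (2 * ρ + ·)) = 0 := by simp_all
    rw [add_comm c, Multiset.range_add, filter_add, e1, add_zero]
    · have := map_range_two_mul (fun k => k) ρ
      rw [map_id'] at this
      rw [this, filter_add, add_comm, Multiset.filter_eq_self.mpr, filter_eq_nil.mpr, add_zero]
      · simp_all
      · intro a ha
        obtain ⟨k, hk, rfl⟩ := Multiset.mem_map.mp ha
        have := mem_range.mp hk
        omega
  rw [e0, map_map]
  rfl

/-- The symbol of a set of jumps corresponds to the partition with the positive jumps as parts. -/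
theorem matches_jumpSymbol (h : ℤ) {l : ℕ} (hJ : ∀ p ∈ J, p % 2 = 1 - h.natAbs % 2)
    (hc : J.card = (h.natAbs + 1) / 2 + 2 * ρ) (hsum : J.val.sum = 2 * l + h.natAbs ^ 2 / 4) :
    (J.val.filter (· ≠ 0)).card ≤ 2 * l + (h.natAbs + 1) / 2 ∧
    EvenParts (h.natAbs % 2) (padTo (l + (h.natAbs + 1) / 2 + l) (J.val.filter (· ≠ 0))) ∧
    ∃ B : Bipartition l, symbolEntries h l B.fst B.snd = jumpSymbol h l J ∧
      Corresponds h B (J.val.filter (· ≠ 0)) := by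
  obtain ⟨s, hs⟩ : ∃ s, s = h.natAbs % 2 := ⟨_, rfl⟩
  obtain ⟨c, hc'⟩ : ∃ c, c = (h.natAbs + 1) / 2 := ⟨_, rfl⟩
  have hsq := natAbs_sq_div_four h.natAbs
  have hs1 : s ≤ 1 := by omega
  have hxi := xiOf_eq h hc
  have heta := etaOf_eq h hc
  rw [← hc'] at hc hxi
  rw [← hs] at hJ
  rw [← hs, ← hc'] at hsq
  have hm1 := jumpRow₁_monotone hJ hs1 hc
  have hm2 := jumpRow₂_monotone hJ hs1 hc
  have hJc : J.val.card = ρ + c + ρ := by rw [card_val]; omega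
  have hd := fun k hk => defect_jumpRows (k := k) hJ hs1 hc hk
  have hsum2 := sum_of_defect_eq_zero hJc (hd _ (by omega))
  have hn : (partsOf (jumpRow₁ J ρ c)).sum + (partsOf (jumpRow₂ J ρ)).sum = l := by
    rw [sum_partsOf, sum_partsOf]
    omega
  have hρl : ρ ≤ l := by
    have h1 : ∑ _j : Fin ρ, 1 ≤ ∑ j, jumpRow₂ J ρ j := sum_le_sum fun j _ => by
      have := le_entry_div hJ hs1 (q := 2 * j + 1) (by omega)
      unfold jumpRow₂
      omega
    simp at h1
    omega
  obtain ⟨k, rfl⟩ := Nat.exists_eq_add_of_le hρl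
  have hcf : (J.val.filter (· ≠ 0)).card ≤ ρ + c + ρ := by
    rw [← hJc]; exact Multiset.card_le_card (filter_le _ _)
  have hpad : padTo (ρ + c + ρ) (J.val.filter (· ≠ 0)) = J.val := by
    rw [padTo, ← hJc]; exact filter_ne_zero_add_replicate _
  have hV : EvenParts s (padTo (ρ + k + c + (ρ + k)) (J.val.filter (· ≠ 0))) := by
    rw [evenParts_stable (by omega), hpad]
    intro i hi
    rw [count_eq_zero.mpr]
    · exact Even.zero
    grind
  obtain ⟨B, hB1, hB2⟩ := Bipartition.exists_rows_eq (h := h) (zero_notMem_partsOf _)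
    (zero_notMem_partsOf _) hn
  rw [← hs, ← hc']
  refine ⟨by omega, hV, B, ?_, ?_⟩
  · rw [← hB1] at hxi
    rw [← hB2] at heta
    unfold jumpSymbol
    rw [hxi, heta]
    unfold Bipartition.row₁ Bipartition.row₂
    split_ifs <;> rfl
  · rw [Corresponds, B.symbolEntries_eq le_rfl, ← hs, ← hc', hB1, hB2,
      matches_stable hs1 (card_partsOf_le _) (card_partsOf_le _) (by omega), hpad,
      padSeq_partsOf hm1, padSeq_partsOf hm2]
    refine ⟨by rw [card_symbolOf, hJc], fun k hk => ?_⟩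
    grind

end Jumps

/-! ### Fibres of a finite family of real numbers -/

section Fibres
open Finset

variable {ι : Type*} (K : Finset ι) (y : ι → ℝ)

variable {v : ℝ} {V : Finset ℝ}

open Classical in
/-- The number of `i ∈ K` with `y i = v`. -/
def fib (v : ℝ) : ℤ := ∑ i ∈ K, if y i = v then 1 else 0

/-- The difference of the multiplicities of `v` and `v + 2`. -/
def dlt (v : ℝ) : ℤ := fib K y v - fib K y (v + 2)

variable {K y}

theorem exists_of_fib_ne_zero (hv : fib K y v ≠ 0) : ∃ i ∈ K, y i = v := by
  obtain ⟨i, hi, h⟩ := exists_ne_zero_of_sum_ne_zero hv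
  grind

theorem fib_nonneg (v : ℝ) : 0 ≤ fib K y v := sum_nonneg fun i _ => by split_ifs <;> simp

theorem fib_pos {i : ι} (hi : i ∈ K) : 0 < fib K y (y i) :=
  sum_pos' (fun i _ => by split_ifs <;> simp) ⟨i, hi, by simp⟩

/-- Summation by parts; the test function `q` need not vanish anywhere as long as `V` contains the
support of the product. -/
theorem sum_dlt_mul (V : Finset ℝ) (q : ℝ → ℝ) (hV : ∀ v, dlt K y v ≠ 0 → q v ≠ 0 → v ∈ V) :
    ∑ v ∈ V, (dlt K y v : ℝ) * q v = ∑ i ∈ K, (q (y i) - q (y i - 2)) := by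
  classical
  have h0 : ∑ v ∈ V, (dlt K y v : ℝ) * q v =
      ∑ v ∈ V ∪ (K.image y ∪ K.image fun i => y i - 2), (dlt K y v : ℝ) * q v := by
    refine sum_subset subset_union_left fun v _ hv => ?_
    by_contra h
    simp_all
  obtain ⟨U, hU⟩ : ∃ U, U = V ∪ (K.image y ∪ K.image fun i => y i - 2) := ⟨_, rfl⟩
  rw [h0, ← hU]
  simp only [dlt, fib, Int.cast_sub, Int.cast_sum, Int.cast_ite, cast_one, Int.cast_zero,
    sub_mul, sum_mul, sum_sub_distrib, ite_mul, one_mul, zero_mul]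
  congr 1 <;> rw [sum_comm] <;> refine sum_congr rfl fun i hi => ?_
  · rw [sum_ite_eq, if_pos]
    grind
  · simp only [← sub_eq_iff_eq_add]
    rw [sum_ite_eq, if_pos]
    grind

theorem exists_dlt_support : ∃ V : Finset ℝ, ∀ v, dlt K y v ≠ 0 → v ∈ V := by
  classical
  refine ⟨K.image y ∪ K.image fun i => y i - 2, fun v hv => ?_⟩
  by_contra h
  rw [mem_union, not_or, mem_image, mem_image] at h
  refine hv ?_
  rw [dlt, by_contra fun h' => h.1 (exists_of_fib_ne_zero h'), by_contra fun h' => h.2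
    ((exists_of_fib_ne_zero h').imp fun i hi => ⟨hi.1, by rw [hi.2]; ring⟩), sub_zero]

theorem sum_fib_add_two : ∑ i ∈ K, fib K y (y i + 2) = ∑ i ∈ K, fib K y (y i - 2) := by
  unfold fib
  rw [sum_comm]
  grind

/-- Summation by parts with `dlt` itself as test function. The sum on the right is the number of
pairs with equal values minus the number of pairs with difference 2, the quantity that enters the
residuality of a factor of type A. -/
theorem sum_dlt_sq (hV : ∀ v, dlt K y v ≠ 0 → v ∈ V) :
    ∑ v ∈ V, dlt K y v ^ 2 = 2 * ∑ i ∈ K, dlt K y (y i) := by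
  have h := sum_dlt_mul V (fun v => (dlt K y v : ℝ)) fun v hv _ => hV v hv
  have h1 : ∑ i ∈ K, dlt K y (y i - 2) = -∑ i ∈ K, dlt K y (y i) := by
    simp only [dlt, sub_add_cancel, sum_sub_distrib, sum_fib_add_two]
    ring
  simp only [← pow_two] at h
  rw [sum_sub_distrib] at h
  have h2 : ∑ v ∈ V, dlt K y v ^ 2 = ∑ i ∈ K, dlt K y (y i) - ∑ i ∈ K, dlt K y (y i - 2) := by
    exact_mod_cast h
  rw [h2, h1]
  ring

/-- The multiplicity at `v` is the telescoping sum of `dlt` over `v, v + 2, v + 4, …`, since values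
that are large enough do not occur. -/
theorem fib_le_of_dlt_le {ι' : Type*} {K' : Finset ι'} {y' : ι' → ℝ}
    (hv : ∀ j : ℕ, dlt K y (v + 2 * j) ≤ dlt K' y' (v + 2 * j)) : fib K y v ≤ fib K' y' v := by
  have h1 : ∀ j : ℕ, fib K y v - fib K y (v + 2 * j) ≤ fib K' y' v - fib K' y' (v + 2 * j) := by
    intro j
    induction j with
    | zero => simp
    | succ j ih =>
      have := hv j
      rw [dlt, dlt] at this
      grind
  obtain ⟨M, hM⟩ : ∃ M, ∀ i ∈ K, y i < M := (K.image y).exists_le.imp' (· + 1) fun M hM i hi =>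
      (hM _ (mem_image_of_mem _ hi)).trans_lt (lt_add_one M)
  obtain ⟨j, hj⟩ := exists_nat_gt (M - v)
  have h2 : fib K y (v + 2 * j) = 0 := by
    by_contra h
    obtain ⟨i, hi, hy⟩ := exists_of_fib_ne_zero h
    grind
  have := h1 j
  have := fib_nonneg (K := K') (y := y') (v + 2 * j)
  omega

theorem fib_eq_zero_of_dlt_nonpos (hv : ∀ j : ℕ, dlt K y (v + 2 * j) ≤ 0) : fib K y v = 0 :=
  le_antisymm (fib_le_of_dlt_le (K' := (∅ : Finset ι)) (y' := y) hv) (fib_nonneg v)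

theorem sum_dlt_eq_zero (hV : ∀ v, dlt K y v ≠ 0 → v ∈ V) :
    ∑ v ∈ V, dlt K y v = 0 := by
  have := sum_dlt_mul V (fun _ => 1) fun v hv _ => hV v hv
  simp only [mul_one, sub_self, sum_const_zero] at this
  exact_mod_cast this

/-- By `sum_dlt_sq` it is half a sum of squares. These do not all vanish, because otherwise the
telescoping argument would make every multiplicity zero. -/
theorem one_le_sum_dlt (hK : K.Nonempty) : 1 ≤ ∑ i ∈ K, dlt K y (y i) := by
  obtain ⟨V, hV⟩ := exists_dlt_support (K := K) (y := y)
  have h1 := sum_dlt_sq hV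
  by_contra h
  have h2 : ∑ v ∈ V, dlt K y v ^ 2 = 0 := le_antisymm (by omega) (sum_nonneg fun v _ => sq_nonneg _)
  rw [sum_eq_zero_iff_of_nonneg fun v _ => sq_nonneg _] at h2
  have h3 : ∀ v, dlt K y v = 0 := fun v => by
    by_contra h'
    exact h' (pow_eq_zero_iff two_ne_zero |>.mp (h2 v (hV v h')))
  obtain ⟨i, hi⟩ := hK
  exact (fib_pos (y := y) hi).ne' (fib_eq_zero_of_dlt_nonpos fun j => (h3 _).le)

open Classical in
-- The squares of `dlt` add up to 2 and its values to 0, so it is `1` at one point `a`, `-1` at one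
-- point `b`, and 0 elsewhere. The first two moments give `a - b = 2 |K|` and `a² - b² = -4 |K|`,
-- hence `a + b = -2`. The family is the symmetric progression with step 2.
theorem dlt_eq_of_sum_eq_one (h1 : ∑ i ∈ K, dlt K y (y i) = 1) (h0 : ∑ i ∈ K, y i = 0) (v : ℝ) :
    dlt K y v = (if v = (K.card : ℝ) - 1 then 1 else 0) - if v = -(K.card : ℝ) - 1 then 1 else 0 := by
  obtain ⟨V, hV⟩ := exists_dlt_support (K := K) (y := y)
  have h2 := sum_dlt_sq hV
  have h3 := sum_dlt_eq_zero hV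
  obtain ⟨a, ha, ha0⟩ : ∃ a ∈ V, 0 < dlt K y a := by
    by_contra! h
    have := (sum_eq_zero_iff_of_nonpos h).mp h3
    grind
  obtain ⟨b, hb, hb0⟩ : ∃ b ∈ V, dlt K y b < 0 := by
    by_contra! h
    exact ha0.ne' ((sum_eq_zero_iff_of_nonneg h).mp h3 a ha)
  have hab : a ≠ b := fun h => by rw [h] at ha0; omega
  rw [← add_sum_erase V _ ha, ← add_sum_erase (V.erase a) _ (mem_erase.mpr ⟨hab.symm, hb⟩)] at h2
  have h5 : 0 ≤ ∑ x ∈ (V.erase a).erase b, dlt K y x ^ 2 := sum_nonneg fun v _ => sq_nonneg _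
  have h6 : ∑ x ∈ (V.erase a).erase b, dlt K y x ^ 2 = 0 := by nlinarith
  have ha1 : dlt K y a = 1 := by nlinarith
  have hb1 : dlt K y b = -1 := by nlinarith
  rw [sum_eq_zero_iff_of_nonneg fun v _ => sq_nonneg _] at h6
  have h7 : ∀ v, v ≠ a → v ≠ b → dlt K y v = 0 := fun v hva hvb => by
    by_contra h'
    exact h' (pow_eq_zero_iff two_ne_zero |>.mp (h6 v (by simp [hva, hvb, hV v h'])))
  have hab' : ∀ v, dlt K y v ≠ 0 → v ∈ ({a, b} : Finset ℝ) := fun v hv => by grind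
  have e1 := sum_dlt_mul {a, b} (fun v => v) fun v hv _ => hab' v hv
  have e2 := sum_dlt_mul {a, b} (fun v => v ^ 2) fun v hv _ => hab' v hv
  rw [sum_pair hab, ha1, hb1] at e1 e2
  have e3 : ∑ i ∈ K, (y i ^ 2 - (y i - 2) ^ 2) = -4 * (K.card : ℝ) := by
    rw [sum_congr rfl fun i _ => show y i ^ 2 - (y i - 2) ^ 2 = 4 * y i - 4 by ring,
      sum_sub_distrib, ← mul_sum, h0, sum_const, nsmul_eq_mul]
    ring
  simp only [e3, sub_sub_cancel, sum_const, nsmul_eq_mul] at e1 e2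
  grind

end Fibres

/-! ### Families of real numbers that are stable under a change of sign -/

section Symmetric
open Finset

/-- On the natural numbers, this is `-1` for `v ≥ c`, `v ≡ c (mod 2)`, and `1` otherwise. -/
def wt (c : ℕ) (v : ℝ) : ℤ := open Classical in
  if (⌊v⌋₊ : ℝ) = v then if c ≤ ⌊v⌋₊ ∧ (⌊v⌋₊ + c) % 2 = 0 then -1 else 1 else 0

theorem wt_natCast (c p : ℕ) : wt c p = if c ≤ p ∧ (p + c) % 2 = 0 then -1 else 1 := by simp [wt]

theorem wt_eq_zero {c : ℕ} {v : ℝ} (hv : ∀ p : ℕ, v ≠ p) : wt c v = 0 := if_neg fun h => hv _ h.symm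

open Classical in
theorem wt_sub (c : ℕ) (v : ℝ) : wt c v - wt c (v - 2) =
    (if v = 0 then 1 else 0) + (if v = 1 then 1 else 0) - 2 * if v = c then 1 else 0 := by
  by_cases hv : ∃ p : ℕ, v = p
  · obtain ⟨p, rfl⟩ := hv
    rw [wt_natCast]
    obtain hp | ⟨q, rfl⟩ : p < 2 ∨ ∃ q, p = q + 2 := by
      rcases lt_or_ge p 2 with h | h
      · exact Or.inl h
      · exact Or.inr ⟨p - 2, by omega⟩
    · rw [wt_eq_zero fun q h => ?_]
      · have h0 : ((p : ℝ) = 0) ↔ p = 0 := Nat.cast_eq_zero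
        have h1 : ((p : ℝ) = 1) ↔ p = 1 := Nat.cast_eq_one
        rw [if_congr h0 rfl rfl, if_congr h1 rfl rfl, if_congr (Nat.cast_inj (R := ℝ)) rfl rfl]
        split_ifs <;> omega
      · have : (p : ℝ) = (q + 2 : ℕ) := by push_cast; linarith
        have := Nat.cast_injective this
        omega
    · rw [show ((q + 2 : ℕ) : ℝ) - 2 = q by push_cast; ring, wt_natCast]
      have h0 : ¬ ((q + 2 : ℕ) : ℝ) = 0 := by
        rw [Nat.cast_eq_zero]
        omega
      have h1 : ¬ ((q + 2 : ℕ) : ℝ) = 1 := by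
        rw [Nat.cast_eq_one]
        omega
      rw [if_neg h0, if_neg h1, if_congr (Nat.cast_inj (R := ℝ)) rfl rfl]
      split_ifs <;> omega
  · push Not at hv
    rw [wt_eq_zero hv, wt_eq_zero fun p h => hv (p + 2) (by push_cast; linarith),
      if_neg (by exact_mod_cast hv 0), if_neg (by exact_mod_cast hv 1), if_neg (hv c)]
    rfl

/-- Not both of `v` and `-v - 2` are natural numbers, so the difference of the weights is `-1`, `0`
or `1`; and `d (d + w) ≥ 0` for an integer `d` and such a `w`. -/
theorem mul_add_wt_nonneg (c : ℕ) (v : ℝ) (d : ℤ) : 0 ≤ d * (d + (wt c v - wt c (-v - 2))) := by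
  have h : ∀ v : ℝ, wt c v = 0 ∨ wt c v = 1 ∨ wt c v = -1 := fun v => by
    unfold wt; split_ifs <;> simp
  have hv : wt c v = 0 ∨ wt c (-v - 2) = 0 := by
    by_contra! H
    have : 0 ≤ v := by
      by_contra hv
      exact H.1 (wt_eq_zero fun p hp => hv (hp ▸ p.cast_nonneg))
    exact H.2 (wt_eq_zero fun p hp => by grind)
  obtain ⟨w, hw⟩ : ∃ w, w = wt c v - wt c (-v - 2) := ⟨_, rfl⟩
  have : w = -1 ∨ w = 0 ∨ w = 1 := by grind
  rw [← hw]
  rcases this with rfl | rfl | rfl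
  · rcases le_or_gt d 0 with h | h <;> nlinarith
  · nlinarith [sq_nonneg d]
  · rcases le_or_gt 0 d with h | h <;> nlinarith

variable {ι : Type*} {K : Finset ι} {y : ι → ℝ}

theorem sum_ite_eq_fib (v : ℝ) [DecidablePred fun x => x = v] :
    ∑ i ∈ K, (if y i = v then (1 : ℝ) else 0) = fib K y v := by
  simp only [fib, Int.cast_sum, Int.cast_ite, cast_one, Int.cast_zero]

variable (K y) in
/-- The values of `y` on `K` are permuted by the change of sign. -/
def NegStable : Prop := ∀ q : ℝ → ℝ, ∑ i ∈ K, q (-y i) = ∑ i ∈ K, q (y i)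

theorem fib_neg (hs : NegStable K y) (v : ℝ) : fib K y (-v) = fib K y v := by
  classical
  have h := hs fun x => if x = v then 1 else 0
  simp only [neg_eq_iff_eq_neg] at h
  rw [sum_ite_eq_fib, sum_ite_eq_fib] at h
  exact_mod_cast h

theorem dlt_neg (hs : NegStable K y) (v : ℝ) : dlt K y (-v - 2) = -dlt K y v := by
  rw [dlt, dlt, sub_add_cancel, fib_neg hs, ← fib_neg hs (v + 2), neg_sub, neg_add']

/-- The first summand is quadratic in `dlt` by `sum_dlt_sq`. The weight is chosen so that, by
`wt_sub` and summation by parts, the other three are linear in `dlt`; stability under the change of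
sign allows the weight to be antisymmetrized. The result is a sum of non-negative terms. -/
theorem energy_eq (hs : NegStable K y) {V : Finset ℝ} (hV : ∀ v, dlt K y v ≠ 0 → v ∈ V) (c : ℕ) :
    2 * (∑ i ∈ K, dlt K y (y i) + fib K y 0 + fib K y 1 - 2 * fib K y c) =
      ∑ v ∈ V, dlt K y v * (dlt K y v + (wt c v - wt c (-v - 2))) := by
  classical
  have h1 := sum_dlt_mul V (fun v => (wt c v - wt c (-v - 2) : ℝ)) fun v hv _ => hV v hv
  have h2 : ∑ i ∈ K, ((wt c (y i) : ℝ) - wt c (y i - 2)) =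
      fib K y 0 + fib K y 1 - 2 * fib K y c := by
    rw [sum_congr rfl fun i _ => (Int.cast_sub _ _).symm.trans (congrArg Int.cast (wt_sub c (y i)))]
    push_cast
    rw [sum_sub_distrib, sum_add_distrib, ← mul_sum, sum_ite_eq_fib, sum_ite_eq_fib, sum_ite_eq_fib]
  have h3 := hs fun v => (wt c v : ℝ) - wt c (v - 2)
  rw [h2] at h3
  have h4 : ∑ v ∈ V, (dlt K y v : ℝ) * (wt c v - wt c (-v - 2)) =
      2 * (fib K y 0 + fib K y 1 - 2 * fib K y c) := by
    rw [h1, two_mul]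
    nth_rewrite 1 [← h2]
    rw [← h3, ← sum_add_distrib]
    grind
  have h5 : ∑ v ∈ V, dlt K y v * (wt c v - wt c (-v - 2)) =
      2 * (fib K y 0 + fib K y 1 - 2 * fib K y c) := by exact_mod_cast h4
  simp only [mul_add, sum_add_distrib, h5, ← pow_two, sum_dlt_sq hV]
  ring

theorem energy_nonneg (hs : NegStable K y) (c : ℕ) :
    0 ≤ ∑ i ∈ K, dlt K y (y i) + fib K y 0 + fib K y 1 - 2 * fib K y c := by
  obtain ⟨V, hV⟩ := exists_dlt_support (K := K) (y := y)
  have h := energy_eq hs hV c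
  have : 0 ≤ ∑ v ∈ V, dlt K y v * (dlt K y v + (wt c v - wt c (-v - 2))) :=
    sum_nonneg fun v _ => mul_add_wt_nonneg c v _
  omega

theorem energy_eq_zero_iff (hs : NegStable K y) (c : ℕ) :
    ∑ i ∈ K, dlt K y (y i) + fib K y 0 + fib K y 1 - 2 * fib K y c = 0 ↔
      ∀ v, dlt K y v = 0 ∨ dlt K y v = -(wt c v - wt c (-v - 2)) := by
  obtain ⟨V, hV⟩ := exists_dlt_support (K := K) (y := y)
  have h := energy_eq hs hV c
  rw [← mul_eq_zero_iff_left (two_ne_zero' ℤ), h,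
    sum_eq_zero_iff_of_nonneg fun v _ => mul_add_wt_nonneg c v _]
  constructor
  · intro H v
    by_cases hv : v ∈ V
    · exact (mul_eq_zero.mp (H v hv)).imp_right eq_neg_of_add_eq_zero_left
    grind
  grind

end Symmetric

/-! ### Jumps of families of real numbers that are stable under a change of sign -/

section Jumps
open Finset

/-- The positive integers `p < c` with `p ≢ c (mod 2)`. -/
def lowSet (c : ℕ) : Finset ℕ := (range c).filter fun p => 0 < p ∧ (p + c) % 2 = 1

theorem mem_lowSet {c p : ℕ} : p ∈ lowSet c ↔ p < c ∧ 0 < p ∧ (p + c) % 2 = 1 := by simp [lowSet]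

theorem lowSet_card_sum (c : ℕ) : (lowSet c).card = c / 2 ∧ ∑ p ∈ lowSet c, p = c ^ 2 / 4 := by
  induction c using Nat.twoStepInduction with
  | zero => simp [lowSet]
  | one => simp [lowSet]
  | more c ih _ =>
    have h : lowSet (c + 2) = insert (c + 1) (lowSet c) := by
      ext p; rw [mem_insert, mem_lowSet, mem_lowSet]; omega
    have h' : c + 1 ∉ lowSet c := by rw [mem_lowSet]; omega
    grind

variable {ι : Type*} {K : Finset ι} {y : ι → ℝ} {c : ℕ} {J : Finset ℕ}

open Classical in
variable (K y c J) in
/-- `J` is the set of the positive jumps of `y`. -/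
def IsJumps : Prop := (∀ p ∈ J, 0 < p ∧ (p + c) % 2 = 1) ∧ ∀ v, -1 < v → dlt K y v =
  (if ∃ p ∈ J, (p : ℝ) = v + 1 then 1 else 0) - if ∃ p ∈ lowSet c, (p : ℝ) = v + 1 then 1 else 0

theorem exists_natCast_mem (S : Finset ℕ) (p : ℕ) : (∃ q ∈ S, (q : ℝ) = p + 1) ↔ p + 1 ∈ S := by
  constructor
  · rintro ⟨q, hq, h⟩
    have : q = p + 1 := by exact_mod_cast h
    exact this ▸ hq
  grind

theorem IsJumps.dlt_natCast (hJ : IsJumps K y c J) (p : ℕ) : dlt K y p =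
    (if p + 1 ∈ J then 1 else 0) - if p + 1 ∈ lowSet c then 1 else 0 := by
  rw [hJ.2 p (by grind)]
  simp only [exists_natCast_mem]

theorem IsJumps.fib_eq_zero (hJ : IsJumps K y c J) {v : ℝ} (hv : 0 ≤ v)
    (h : ∀ p : ℕ, v = p → (p + c) % 2 = 1) : fib K y v = 0 := by
  refine fib_eq_zero_of_dlt_nonpos fun j => ?_
  rw [hJ.2 _ (by linarith), if_neg]
  · split_ifs <;> simp
  · rintro ⟨p, hp, h'⟩
    have h1 := hJ.1 p hp
    have h2 : 2 * j + 1 ≤ p := by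
      have : ((2 * j + 1 : ℕ) : ℝ) ≤ p := by push_cast; linarith
      exact_mod_cast this
    have := h (p - (2 * j + 1)) (by simp_all)
    omega

/-- Positive jumps describe `dlt` only for `v > -1`, so test functions vanishing on `v ≤ -1` are
allowed. Suitable choices give the number and the sum of the jumps. -/
theorem IsJumps.sum (hJ : IsJumps K y c J) (q : ℝ → ℝ) (hq : ∀ v, v ≤ -1 → q v = 0) :
    ∑ p ∈ J, q (p - 1) - ∑ p ∈ lowSet c, q (p - 1) = ∑ i ∈ K, (q (y i) - q (y i - 2)) := by
  classical
  rw [← sum_dlt_mul ((J ∪ lowSet c).image fun p : ℕ => (p : ℝ) - 1) q, sum_image (by simp)]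
  · have h1 : ∀ S ⊆ J ∪ lowSet c, ∑ p ∈ S, q (p - 1) =
        ∑ p ∈ J ∪ lowSet c, if p ∈ S then q (p - 1) else 0 := fun S hS => by
      rw [← sum_filter, filter_mem_eq_inter, inter_eq_right.mpr hS]
    rw [h1 _ subset_union_left, h1 _ subset_union_right, ← sum_sub_distrib]
    refine sum_congr rfl fun p hp => ?_
    have hp0 : 0 < p := (mem_union.mp hp).elim (fun h => (hJ.1 p h).1)
      fun h => (mem_lowSet.mp h).2.1
    obtain ⟨r, rfl⟩ := Nat.exists_eq_add_of_lt hp0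
    rw [zero_add, Nat.cast_add_one, add_sub_cancel_right, hJ.dlt_natCast]
    split_ifs <;> simp
  · intro v hv hqv
    have hv1 : -1 < v := by grind
    rw [hJ.2 v hv1] at hv
    grind

theorem IsJumps.exists_natCast (hs : NegStable K y) (hJ : IsJumps K y c J) {i : ι} (hi : i ∈ K) :
    ∃ p : ℕ, |y i| = p ∧ (p + c) % 2 = 0 := by
  have h : fib K y |y i| ≠ 0 := by
    rcases abs_choice (y i) with h | h <;> rw [h]
    · exact (fib_pos hi).ne'
    · rw [fib_neg hs]; exact (fib_pos hi).ne'
  by_contra! H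
  exact h (hJ.fib_eq_zero (abs_nonneg _) fun p hp => by have := H p hp; omega)

theorem IsJumps.card_eq (hs : NegStable K y) (hJ : IsJumps K y c J) :
    (J.card : ℤ) = c / 2 + fib K y 0 + fib K y 1 := by
  classical
  -- The values are integers, so the difference of this test function at `y` and `y - 2` counts the
  -- values 0 and 1.
  have h := hJ.sum (fun v => if 0 ≤ v then 1 else 0) fun v hv => if_neg (by linarith)
  have h1 : ∀ S : Finset ℕ, (∀ p ∈ S, 0 < p) →
      ∑ p ∈ S, (if (0 : ℝ) ≤ (p : ℝ) - 1 then (1 : ℝ) else 0) = S.card := fun S hS => by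
    rw [sum_congr rfl fun p hp => if_pos (sub_nonneg.mpr (by exact_mod_cast hS p hp))]
    simp
  rw [h1 J fun p hp => (hJ.1 p hp).1, h1 (lowSet c) fun p hp => (mem_lowSet.mp hp).2.1,
    (lowSet_card_sum c).1] at h
  have h2 : ∑ i ∈ K, ((if 0 ≤ y i then (1 : ℝ) else 0) - if 0 ≤ y i - 2 then 1 else 0) =
      ∑ i ∈ K, ((if y i = 0 then (1 : ℝ) else 0) + if y i = 1 then 1 else 0) := by
    refine sum_congr rfl fun i hi => ?_
    obtain ⟨p, hp, -⟩ := hJ.exists_natCast hs hi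
    rcases le_or_gt 0 (y i) with h0 | h0
    · rw [abs_of_nonneg h0] at hp
      rw [hp]
      obtain rfl | rfl | ⟨q, rfl⟩ : p = 0 ∨ p = 1 ∨ ∃ q, p = q + 2 := by
        rcases p with _ | _ | p
        · simp
        · simp
        · exact Or.inr (Or.inr ⟨p, rfl⟩)
      · norm_num
      · norm_num
      grind
    grind
  rw [h2, sum_add_distrib, sum_ite_eq_fib, sum_ite_eq_fib] at h
  have h3 : ((J.card : ℤ) : ℝ) = (((c / 2 : ℕ) : ℤ) + fib K y 0 + fib K y 1 : ℤ) := by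
    rw [Int.cast_add, Int.cast_add, Int.cast_natCast, Int.cast_natCast]
    linarith
  exact_mod_cast h3

theorem IsJumps.sum_eq (hs : NegStable K y) (hJ : IsJumps K y c J) :
    ∑ p ∈ J, p = K.card + c ^ 2 / 4 := by
  -- At `p - 1` this test function is `p`, and its differences at `y` and at `-y` add up to 2 for
  -- every real `y`.
  have h := hJ.sum (fun v => max (v + 1) 0) fun v hv => max_eq_right (by linarith)
  simp only [sub_add_cancel, Nat.cast_nonneg, max_eq_left] at h
  have h2 := hs fun v => max (v + 1) 0 - max (v - 2 + 1) 0
  have h3 : 2 * ∑ i ∈ K, (max (y i + 1) 0 - max (y i - 2 + 1) 0) = 2 * (K.card : ℝ) := by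
    rw [two_mul]
    nth_rewrite 1 [← h2]
    rw [← sum_add_distrib, sum_congr rfl fun i _ => ?_, sum_const, nsmul_eq_mul, mul_comm]
    grind
  have h4 : (∑ p ∈ J, p : ℕ) = ((K.card + ∑ p ∈ lowSet c, p : ℕ) : ℝ) := by
    push_cast
    linarith
  rw [← (lowSet_card_sum c).2]
  exact_mod_cast h4

/-- Minimal energy leaves at a natural number `v` the choices 0 and 1 for `dlt` if `v ≥ c` and `v ≡
c (mod 2)`, and 0 and `-1` otherwise. For `v ≡ c` this is the choice whether `v + 1` is a jump,
where the absence of a jump below `c` costs `-1`. -/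
theorem exists_isJumps_iff (hs : NegStable K y) : (∃ J, IsJumps K y c J) ↔
    ∑ i ∈ K, dlt K y (y i) + fib K y 0 + fib K y 1 - 2 * fib K y c = 0 := by
  classical
  rw [energy_eq_zero_iff hs]
  have hw : ∀ p : ℕ, wt c (-(p : ℝ) - 2) = 0 := fun p => wt_eq_zero fun q hq => by grind
  constructor
  · rintro ⟨J, hJ⟩ v
    have main : ∀ v : ℝ, -1 < v → dlt K y v = 0 ∨ dlt K y v = -(wt c v - wt c (-v - 2)) := by
      intro v hv
      by_cases hv' : ∃ p : ℕ, v = p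
      · obtain ⟨p, rfl⟩ := hv'
        have h2 := hJ.1 (p + 1)
        simp only [hJ.dlt_natCast, hw, wt_natCast, mem_lowSet]
        grind
      · left
        rw [hJ.2 v hv, if_neg, if_neg, sub_zero] <;> rintro ⟨p, hp, h⟩
        · exact hv' ⟨p - 1, by rw [Nat.cast_sub (mem_lowSet.mp hp).2.1]; push_cast; linarith⟩
        · exact hv' ⟨p - 1, by rw [Nat.cast_sub (hJ.1 p hp).1]; push_cast; linarith⟩
    rcases lt_trichotomy (-1) v with hv | hv | hv
    · exact main v hv
    · have := dlt_neg hs v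
      grind
    · have h1 := main (-v - 2) (by linarith)
      rw [dlt_neg hs, show -(-v - 2) - 2 = v by ring] at h1
      omega
  · intro H
    obtain ⟨V, hV⟩ := exists_dlt_support (K := K) (y := y)
    refine ⟨((V.image fun v => ⌊v + 1⌋₊) ∪ lowSet c).filter fun p => 0 < p ∧ (p + c) % 2 = 1 ∧
      dlt K y ((p : ℝ) - 1) + (if p ∈ lowSet c then 1 else 0) = 1, fun p hp =>
        ⟨(mem_filter.mp hp).2.1, (mem_filter.mp hp).2.2.1⟩, fun v hv => ?_⟩
    by_cases hv' : ∃ p : ℕ, v = p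
    · obtain ⟨p, rfl⟩ := hv'
      have hd : ∀ q : ℕ, (q + c) % 2 = 1 → dlt K y q = 0 ∨ dlt K y q = -1 := fun q hq => by
        have := H q
        rwa [hw, wt_natCast, if_neg (by omega)] at this
      -- In the wrong parity class `dlt` is nowhere positive on the natural numbers, so by
      -- telescoping these values do not occur at all.
      have hpar : (p + c) % 2 = 1 → dlt K y p = 0 := fun hp => by
        have h0 : ∀ q : ℕ, (q + c) % 2 = 1 → fib K y q = 0 := fun q hq =>
          fib_eq_zero_of_dlt_nonpos fun j => by
            have := hd (q + 2 * j) (by omega)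
            push_cast at this
            omega
        have := h0 (p + 2) (by omega)
        push_cast at this
        rw [dlt, h0 p hp, this, sub_zero]
      have h1 := H p
      rw [hw, wt_natCast] at h1
      rw [if_congr (exists_natCast_mem _ p) rfl rfl, if_congr (exists_natCast_mem _ p) rfl rfl]
      simp only [mem_filter, mem_union]
      have h2 : dlt K y p ≠ 0 → p + 1 ∈ V.image fun v => ⌊v + 1⌋₊ := fun h' =>
        mem_image.mpr ⟨p, hV _ h', by rw [← Nat.cast_add_one, Nat.floor_natCast]⟩
      have h3 := mem_lowSet (c := c) (p := p + 1)
      grind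
    · have h0 : dlt K y v = 0 := by
        have := H v
        rw [wt_eq_zero fun p hp => hv' ⟨p, hp⟩, wt_eq_zero fun p hp => by grind] at this
        omega
      rw [h0, if_neg, if_neg, sub_zero] <;> rintro ⟨p, hp, h⟩
      · exact hv' ⟨p - 1, by rw [Nat.cast_sub (mem_lowSet.mp hp).2.1]; push_cast; linarith⟩
      · exact hv' ⟨p - 1, by simp_all⟩

end Jumps

/-! ### The jumps of a point -/

section PointJumps
open Finset

variable {n : ℕ}

variable {k : ℝ}

/-- The values of `y` and of its negative. -/
def signed (y : Fin n → ℝ) (a : Fin n × ℤˣ) : ℝ := ((a.2 : ℤ) : ℝ) * y a.1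

theorem sum_units {M : Type*} [AddCommMonoid M] (f : ℤˣ → M) : ∑ s, f s = f 1 + f (-1) := by
  simp_all

theorem negStable_signed (T : Finset (Fin n)) (y : Fin n → ℝ) :
    NegStable (T ×ˢ univ) (signed y) := fun q => by
  simp only [sum_product, sum_units, signed]
  simp [add_comm]

open Classical in
theorem fib_signed_eq_card (T : Finset (Fin n)) (y : Fin n → ℝ) {v : ℝ} (hv : 0 ≤ v) :
    fib (T ×ˢ univ) (signed y) v =
      (if v = 0 then 2 else 1) * ((T.filter fun i => |y i| = v).card : ℤ) := by
  simp only [fib, sum_product, sum_units, card_filter, signed]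
  push_cast
  rw [mul_sum]
  grind

theorem fib_signed (hk : k ≠ 0) (T : Finset (Fin n)) (c : Fin n → ℝ) (p : ℕ) :
    fib (T ×ˢ univ) (signed ((2 / k) • c)) p =
      (if p = 0 then 2 else 1) * coordMult k T c (p + 1) := by
  classical
  rw [fib_signed_eq_card _ _ p.cast_nonneg, if_congr Nat.cast_eq_zero rfl rfl, coordMult]
  congr 3
  refine filter_congr fun i _ => ?_
  rw [Pi.smul_apply, smul_eq_mul, abs_mul, abs_div, abs_two, Nat.cast_succ, add_sub_cancel_right]
  grind

/-- This identifies the jumps in the definition with the positive jumps `J`, up to the extra element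
recorded as 0. The number of jumps given by `IsJumps.card_eq` explains the parity rule for adding
`0` or `-1/2`. -/
theorem IsJumps.jumps_spec {h : ℤ} (hk : k ≠ 0) {T : Finset (Fin n)} {c : Fin n → ℝ}
    {J : Finset ℕ}
    (hJ : IsJumps (T ×ˢ univ) (signed ((2 / k) • c)) h.natAbs J) :
    (∀ p, 0 < p → (p ∈ jumps h k T c ↔ p ∈ J)) ∧ (∀ p ∈ jumps h k T c, p % 2 = 1 - h.natAbs % 2) ∧
      ∃ ρ, (jumps h k T c).card = (h.natAbs + 1) / 2 + 2 * ρ := by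
  classical
  obtain ⟨b, hb⟩ : ∃ b, b = h.natAbs := ⟨_, rfl⟩
  have hd := hJ.dlt_natCast
  have hN := fib_signed hk T c
  -- The jump 0, recorded as `p = 1`, is exceptional, because zero coordinates are counted twice in
  -- `fib`. It never belongs to `jumpSet`, and it is recovered afterwards from the parity of the
  -- number of jumps.
  have hmem : ∀ p, p ∈ (jumpSet_finite h k T c).toFinset ↔ p ≠ 1 ∧ p ∈ J := by
    intro p
    rw [Set.Finite.mem_toFinset]
    simp only [jumpSet, Set.mem_ofPred_eq, ← hb]
    rcases p with _ | p
    · have := hJ.1 0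
      grind
    have h1 := hd p
    have h2 := hJ.1 (p + 1)
    have h3 := mem_lowSet (c := b) (p := p + 1)
    have hNp := hN p
    have hNp2 := hN (p + 2)
    rw [dlt, show (p : ℝ) + 2 = (p + 2 : ℕ) by push_cast; rfl, hNp, hNp2] at h1
    grind
  have hcard := hJ.card_eq (negStable_signed _ _)
  have h0 := hN 0
  have h1 := hN 1
  rw [if_pos rfl, Nat.cast_zero] at h0
  rw [if_neg one_ne_zero, Nat.cast_one] at h1
  have hS : (jumpSet_finite h k T c).toFinset = J.erase 1 := by ext p; rw [hmem, mem_erase]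
  rcases Nat.mod_two_eq_zero_or_one b with hb2 | hb2
  · have hz : coordMult k T c (1 + 1) = 0 := by
      have := hJ.fib_eq_zero zero_le_one fun p hp => by
        rw [show p = 1 by exact_mod_cast hp.symm]; omega
      omega
    have hJJ : jumps h k T c = J := by
      unfold jumps
      rw [hS, ← hb]
      by_cases h1J : 1 ∈ J
      · grind
      · rw [erase_eq_of_notMem h1J, if_pos (by omega)]
    rw [hJJ, ← hb]
    refine ⟨fun _ _ => Iff.rfl, fun p hp => ?_, coordMult k T c (0 + 1), by omega⟩
    have := hJ.1 p hp
    omega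
  · have h1J : 1 ∉ J := fun h => by have := hJ.1 1 h; omega
    have h0J : 0 ∉ J := fun h => by have := hJ.1 0 h; omega
    have hpar : ∀ p ∈ J, p % 2 = 1 - b % 2 := fun p hp => by have := hJ.1 p hp; omega
    unfold jumps
    rw [hS, ← hb, erase_eq_of_notMem h1J, show (b + 1) % 2 = 0 by omega]
    split_ifs with h5
    · exact ⟨fun _ _ => Iff.rfl, hpar, (J.card - (b + 1) / 2) / 2, by omega⟩
    · refine ⟨fun p hp => by simp [hp.ne'], fun p hp => ?_,
        (J.card + 1 - (b + 1) / 2) / 2, ?_⟩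
      · grind
      grind

end PointJumps

/-! ### Counting the roots of a subspace -/

section Counting
open Finset

variable {n : ℕ}

/-- The short root `± e_i`. -/
def unitVec (a : Fin n × ℤˣ) : Fin n → ℝ := Pi.single a.1 ((a.2 : ℤ) : ℝ)

theorem unitVec_dotProduct (a : Fin n × ℤˣ) (y : Fin n → ℝ) : unitVec a ⬝ᵥ y = signed y a :=
  single_dotProduct _ _ _

theorem unitVec_apply (a : Fin n × ℤˣ) (i : Fin n) :
    unitVec a i = if i = a.1 then ((a.2 : ℤ) : ℝ) else 0 := Pi.single_apply _ _ _

theorem unit_ne_zero (s : ℤˣ) : ((s : ℤ) : ℝ) ≠ 0 := by simp_all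

theorem unitVec_injective : Injective (unitVec (n := n)) := by
  intro a b h
  have h1 := congrFun h a.1
  rw [unitVec_apply, unitVec_apply, if_pos rfl] at h1
  split_ifs at h1 with h2
  · exact Prod.ext h2 (Units.ext (by exact_mod_cast h1))
  · exact absurd h1 (unit_ne_zero _)

open Classical in
theorem ncard_shortRoots (P : (Fin n → ℝ) → Prop) :
    (Set.ncard {α | α ∈ shortRoots n ∧ P α} : ℤ) = ∑ a, if P (unitVec a) then 1 else 0 := by
  have : {α | α ∈ shortRoots n ∧ P α} =
      ((univ.filter fun a => P (unitVec a)).image unitVec : Finset (Fin n → ℝ)) := by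
    ext α
    simp only [Set.mem_ofPred_eq, coe_image, coe_filter, mem_univ, true_and, Set.mem_image]
    constructor
    · rintro ⟨⟨i, s, rfl⟩, h⟩
      exact ⟨(i, s), h, rfl⟩
    · rintro ⟨a, h, rfl⟩
      exact ⟨⟨a.1, a.2, rfl⟩, h⟩
  rw [this, Set.ncard_coe_finset, card_image_of_injective _ unitVec_injective, card_filter]
  push_cast
  rfl

theorem unitVec_neg (a : Fin n × ℤˣ) : unitVec (a.1, -a.2) = -unitVec a := single_neg_unit a.1 a.2

/-- A long root is a difference of two short roots in exactly two ways, related by exchanging them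
and changing both signs. Ordered pairs therefore count long roots twice. -/
theorem unitVec_sub_eq {a b a' b' : Fin n × ℤˣ} (hab : a.1 ≠ b.1)
    (h : unitVec a' - unitVec b' = unitVec a - unitVec b) :
    (a' = a ∧ b' = b) ∨ (a' = (b.1, -b.2) ∧ b' = (a.1, -a.2)) := by
  obtain ⟨i, s⟩ := a
  obtain ⟨j, t⟩ := b
  obtain ⟨i', s'⟩ := a'
  obtain ⟨j', t'⟩ := b'
  have h1 := congrFun h i
  have h2 := congrFun h j
  simp only [Pi.sub_apply, unitVec_apply, if_neg hab, if_neg (Ne.symm hab), if_true, sub_zero,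
    zero_sub] at h1 h2
  simp only [Prod.mk.injEq]
  have e : ∀ s t : ℤˣ, ((s : ℤ) : ℝ) = t ↔ s = t := fun s t => by rw [Int.cast_inj, Units.val_inj]
  have hn : ∀ s : ℤˣ, -((s : ℤ) : ℝ) = ((-s : ℤˣ) : ℤ) := fun s => by simp
  dsimp only at hab
  split_ifs at h1 h2 with h3 h4 h5 h6 h7 <;> first
    | (exfalso; exact hab (by grind))
    | (grind)
    | exact absurd (by linarith : ((s : ℤ) : ℝ) = 0) (unit_ne_zero s)
    | exact absurd (by linarith : ((t : ℤ) : ℝ) = 0) (unit_ne_zero t)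

open Classical in
theorem ncard_longRoots (P : (Fin n → ℝ) → Prop) : 2 * (Set.ncard {α | α ∈ longRoots n ∧ P α} : ℤ) =
      ∑ a : Fin n × ℤˣ, ∑ b : Fin n × ℤˣ,
        if a.1 ≠ b.1 ∧ P (unitVec a - unitVec b) then 1 else 0 := by
  obtain ⟨F, hF⟩ : ∃ F, F = univ.filter fun x : (Fin n × ℤˣ) × (Fin n × ℤˣ) =>
    x.1.1 ≠ x.2.1 ∧ P (unitVec x.1 - unitVec x.2) := ⟨_, rfl⟩
  have h1 : {α | α ∈ longRoots n ∧ P α} =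
      (F.image fun x => unitVec x.1 - unitVec x.2 : Finset (Fin n → ℝ)) := by
    ext α
    simp only [Set.mem_ofPred_eq, coe_image, hF, coe_filter, mem_univ, true_and, Set.mem_image]
    constructor
    · rintro ⟨⟨i, j, s, t, hij, rfl⟩, h⟩
      have : unitVec (i, s) - unitVec (j, -t) = Pi.single i ((s : ℤ) : ℝ) +
        Pi.single j ((t : ℤ) : ℝ) := by rw [unitVec_neg (j, t), sub_neg_eq_add]; rfl
      exact ⟨((i, s), (j, -t)), ⟨hij, this ▸ h⟩, this⟩
    · rintro ⟨⟨a, b⟩, ⟨hab, h⟩, rfl⟩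
      refine ⟨⟨a.1, b.1, a.2, -b.2, hab, ?_⟩, h⟩
      rw [sub_eq_add_neg, ← unitVec_neg]; rfl
  rw [h1, Set.ncard_coe_finset, ← Fintype.sum_prod_type', sum_boole, ← hF,
    card_eq_sum_card_image (fun x : (Fin n × ℤˣ) × (Fin n × ℤˣ) =>
      unitVec x.1 - unitVec x.2) F, sum_const_nat (m := 2)]
  · push_cast; ring
  · intro α hα
    obtain ⟨⟨a, b⟩, hx, rfl⟩ := mem_image.mp hα
    rw [hF, mem_filter] at hx
    obtain ⟨-, hab, hP⟩ := hx
    have : unitVec (b.1, -b.2) - unitVec (a.1, -a.2) = unitVec a - unitVec b := by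
      rw [unitVec_neg, unitVec_neg]; abel
    rw [card_eq_two]
    refine ⟨(a, b), ((b.1, -b.2), (a.1, -a.2)), fun h => hab (congrArg (·.1.1) h), ?_⟩
    ext ⟨a', b'⟩
    simp only [hF, mem_filter, mem_univ, true_and, mem_insert, mem_singleton, Prod.mk.injEq]
    constructor
    · rintro ⟨-, h⟩
      exact unitVec_sub_eq hab h
    grind

open Classical in
theorem sum_signs (σ τ : ℤˣ) (x y r : ℝ) :
    ∑ s : ℤˣ, ∑ t : ℤˣ, (if s * σ = t * τ ∧ ((s : ℤ) : ℝ) * x - ((t : ℤ) : ℝ) * y = r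
      then (1 : ℤ) else 0) = (if ((τ : ℤ) : ℝ) * y = ((σ : ℤ) : ℝ) * x - r then 1 else 0) +
        if ((τ : ℤ) : ℝ) * y = ((σ : ℤ) : ℝ) * x + r then 1 else 0 := by
  have h1 : (1 : ℤˣ) ≠ -1 := by decide
  rw [sum_units, sum_units, sum_units]
  rcases units_eq_one_or σ with rfl | rfl <;> rcases units_eq_one_or τ with rfl | rfl <;>
    simp [h1, h1.symm] <;> grind

end Counting

/-! ### A numerical criterion for residual subspaces -/

section Residual
open Finset

variable {n : ℕ} {L : AffineSubspace ℝ (Fin n → ℝ)} {y : Fin n → ℝ}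

variable {c : Fin n → ℝ}

variable (L) in
/-- The coordinates, with signs such that the roots between linked coordinates
are differences. -/
def aligned (y : Fin n → ℝ) (i : Fin n) : ℝ := ((signOf L i : ℤ) : ℝ) * y i

theorem sum_blocks {M : Type*} [AddCommMonoid M] (f : Finset (Fin n) → Fin n → M) :
    ∑ i ∈ (bPart L)ᶜ, f (blockOf L i) i = ∑ K ∈ blocks L, ∑ i ∈ K, f K i := by
  rw [← sum_fiberwise_of_maps_to (g := blockOf L) (t := blocks L)
    fun i hi => blockOf_mem_blocks (mem_compl.mp hi)]
  refine sum_congr rfl fun K hK => ?_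
  obtain ⟨j, hj, rfl⟩ := mem_image.mp hK
  rw [mem_compl] at hj
  refine sum_congr ?_ fun i hi => ?_
  · ext i
    rw [mem_filter, mem_compl, mem_blockOf_iff]
    exact ⟨fun h => h.2, fun h => ⟨fun hi => hj (mem_bPart_of_mem_blockOf
      (mem_blockOf_iff.mpr h) hi), h⟩⟩
  · rw [mem_blockOf_iff.mp hi]

open Classical in
-- A difference of short roots is constant on `L` if both belong to the B-part, or if both belong to
-- one block and have coherent signs. In a block the two global signs account for the two values `±
-- r`.
theorem sum_pairs (r : ℝ) (f : (Fin n × ℤˣ) → (Fin n × ℤˣ) → Prop)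
    (hf : ∀ a b, f a b ↔ unitVec a - unitVec b ∈ constOn L ∧ signed y a - signed y b = r) :
    ∑ a : Fin n × ℤˣ, ∑ b : Fin n × ℤˣ, (if f a b then (1 : ℤ) else 0) =
    ∑ a ∈ bPart L ×ˢ univ, fib (bPart L ×ˢ univ) (signed y) (signed y a - r) +
    ∑ K ∈ blocks L, ∑ i ∈ K, (fib K (aligned L y) (aligned L y i - r) +
      fib K (aligned L y) (aligned L y i + r)) := by
  rw [← sum_add_sum_compl (bPart L ×ˢ univ)]
  congr 1
  · refine sum_congr rfl fun a ha => ?_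
    rw [fib, ← sum_subset (subset_univ (bPart L ×ˢ univ))]
    · refine sum_congr rfl fun b hb => if_congr ?_ rfl rfl
      have := (constOn L).sub_mem (single_unit_mem (s := a.2).mpr (mem_product.mp ha).1)
        (single_unit_mem (s := b.2).mpr (mem_product.mp hb).1)
      rw [hf]
      exact ⟨fun h => by linarith [h.2], fun h => ⟨this, by linarith⟩⟩
    · intro b _ hb
      refine if_neg fun h => hb (mem_product.mpr ⟨?_, mem_univ _⟩)
      rw [hf] at h
      have := (constOn L).sub_mem (single_unit_mem (s := a.2).mpr (mem_product.mp ha).1) h.1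
      rw [show Pi.single a.1 ((a.2 : ℤ) : ℝ) = unitVec a from rfl, sub_sub_cancel] at this
      exact single_unit_mem.mp this
  · rw [show (bPart L ×ˢ (univ : Finset ℤˣ))ᶜ = (bPart L)ᶜ ×ˢ univ by
      ext; simp only [mem_compl, mem_product, mem_univ, and_true],
      sum_product, ← sum_blocks (fun K i => fib K (aligned L y) (aligned L y i - r) +
        fib K (aligned L y) (aligned L y i + r))]
    refine sum_congr rfl fun i hi => ?_
    rw [mem_compl] at hi
    simp only [sum_prod_type]
    rw [sum_comm, fib, fib, ← sum_add_distrib, ← sum_subset (subset_univ (blockOf L i))]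
    · refine sum_congr rfl fun j hj => ?_
      rw [aligned, aligned, ← sum_signs]
      refine sum_congr rfl fun s _ => sum_congr rfl fun t _ => if_congr ?_ rfl rfl
      exact (hf _ _).trans (and_congr_left' ((sub_mem_constOn_iff hi s t).trans
        (and_iff_right (mem_blockOf_iff.mp hj).symm)))
    · intro j _ hj
      refine sum_eq_zero fun s _ => sum_eq_zero fun t _ => if_neg fun h => hj ?_
      exact mem_blockOf_iff.mpr ((sub_mem_constOn_iff hi s t).mp ((hf _ _).mp h).1).1.symm

open Classical in
-- The pairs of short roots on one coordinate do not give long roots: equal ones have difference 0,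
-- opposite ones twice a short root, constant on `L` only in the B-part.
theorem sum_diagonal (r : ℝ) (f : (Fin n × ℤˣ) → (Fin n × ℤˣ) → Prop)
    (hf : ∀ a b, f a b ↔ unitVec a - unitVec b ∈ constOn L ∧ signed y a - signed y b = r) :
    ∑ a : Fin n × ℤˣ, ∑ b : Fin n × ℤˣ, (if f a b then (1 : ℤ) else 0) =
      ∑ a : Fin n × ℤˣ, ∑ b : Fin n × ℤˣ, (if a.1 ≠ b.1 ∧ f a b then 1 else 0) +
      (if r = 0 then 2 * n else 0) + fib (bPart L ×ˢ univ) (signed y) (r / 2) := by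
  have h1 : ∀ a : Fin n × ℤˣ, ∑ b : Fin n × ℤˣ, (if f a b then (1 : ℤ) else 0) =
      ∑ b : Fin n × ℤˣ, (if a.1 ≠ b.1 ∧ f a b then 1 else 0) + ((if r = 0 then 1 else 0) +
        if a.1 ∈ bPart L ∧ signed y a = r / 2 then 1 else 0) := fun a => by
    rw [← sub_eq_iff_eq_add', ← sum_sub_distrib, sum_prod_type,
      sum_eq_single a.1 (fun i _ hi => sum_eq_zero fun s _ => by simp [Ne.symm hi]) (by simp)]
    simp only [ne_eq, not_true_eq_false, false_and, if_false, sub_zero]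
    rw [show (univ : Finset ℤˣ) = {a.2, -a.2} by
      rcases units_eq_one_or a.2 with h | h <;> rw [h] <;> decide,
      sum_pair (by simp_all)]
    have hn : signed y (a.1, -a.2) = -signed y a := by simp [signed]
    congr 1
    · refine if_congr ?_ rfl rfl
      rw [hf, sub_self, sub_self]
      exact ⟨fun h => h.2.symm, fun h => ⟨zero_mem _, h.symm⟩⟩
    · rw [hf, unitVec_neg, sub_neg_eq_add, ← two_smul ℝ (unitVec a), hn,
        smul_mem_iff _ two_ne_zero, unitVec, single_unit_mem]
      grind
  simp only [h1, sum_add_distrib, ← add_assoc]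
  congr 1
  · split_ifs <;> simp [mul_comm]
  · rw [fib, ← sum_subset (subset_univ (bPart L ×ˢ univ))]
    · refine sum_congr rfl fun a ha => if_congr ?_ rfl rfl
      grind
    grind

theorem disjoint_short_long : Disjoint (shortRoots n) (longRoots n) := by
  rw [Set.disjoint_left]
  rintro _ ⟨l, u, rfl⟩ ⟨i, j, s, t, hij, h⟩
  have h1 := congrFun h i
  have h2 := congrFun h j
  simp only [Pi.add_apply, Pi.single_apply, if_neg hij, if_neg hij.symm, if_true, add_zero,
    zero_add] at h1 h2
  split_ifs at h1 h2 with h3 h4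
  · exact hij (h3.trans h4.symm)
  · exact unit_ne_zero _ h2.symm
  · exact unit_ne_zero _ h1.symm
  · exact unit_ne_zero _ h1.symm

/-- Stated for arbitrary values `u` on short and `v` on long roots, so that it covers both the roots
with value `k_α` and those with value 0. -/
theorem ncard_roots (u v : ℝ) (f : (Fin n → ℝ) → ℝ) (hS : ∀ α ∈ shortRoots n, f α = u)
    (hT : ∀ α ∈ longRoots n, f α = v) {k : ℝ} (hk : k ≠ 0) (hc : c ∈ L) :
    2 * (Set.ncard {α | α ∈ rootsOf L ∧ ∀ x ∈ L, α ⬝ᵥ x = f α} : ℤ) +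
      (if v = 0 then 2 * n else 0) + fib (bPart L ×ˢ univ) (signed ((2 / k) • c)) (v / k) =
    2 * fib (bPart L ×ˢ univ) (signed ((2 / k) • c)) (2 * u / k) +
    (∑ a ∈ bPart L ×ˢ univ, fib (bPart L ×ˢ univ) (signed ((2 / k) • c))
      (signed ((2 / k) • c) a - 2 * v / k) +
    ∑ K ∈ blocks L, ∑ i ∈ K,
      (fib K (aligned L ((2 / k) • c)) (aligned L ((2 / k) • c) i - 2 * v / k) +
      fib K (aligned L ((2 / k) • c)) (aligned L ((2 / k) • c) i + 2 * v / k))) := by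
  classical
  obtain ⟨y, hy⟩ : ∃ y, y = (2 / k) • c := ⟨_, rfl⟩
  rw [← hy]
  have hval : ∀ (α : Fin n → ℝ) (w : ℝ), α ⬝ᵥ c = w ↔ α ⬝ᵥ y = 2 * w / k := fun α w => by
    rw [hy, dotProduct_smul, smul_eq_mul]
    grind
  have h1 : {α | α ∈ rootsOf L ∧ ∀ x ∈ L, α ⬝ᵥ x = f α} =
      {α | α ∈ shortRoots n ∧ α ∈ constOn L ∧ α ⬝ᵥ y = 2 * u / k} ∪
      {α | α ∈ longRoots n ∧ α ∈ constOn L ∧ α ⬝ᵥ y = 2 * v / k} := by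
    ext α
    simp only [rootsOf, Set.mem_ofPred_eq, Set.mem_union, ← hval]
    constructor
    · rintro ⟨⟨h | h, h'⟩, H⟩
      · exact Or.inl ⟨h, h', by rw [H c hc, hS α h]⟩
      · exact Or.inr ⟨h, h', by rw [H c hc, hT α h]⟩
    · rintro (⟨h, h', H⟩ | ⟨h, h', H⟩)
      · exact ⟨⟨Or.inl h, h'⟩, fun x hx => by rw [h' x hx c hc, H, hS α h]⟩
      · exact ⟨⟨Or.inr h, h'⟩, fun x hx => by rw [h' x hx c hc, H, hT α h]⟩
  have hfin : ∀ P : (Fin n → ℝ) → Prop, {α | α ∈ shortRoots n ∧ P α}.Finite ∧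
      {α | α ∈ longRoots n ∧ P α}.Finite := fun P => by
    constructor
    · refine (Set.finite_range (unitVec (n := n))).subset ?_
      rintro _ ⟨⟨i, s, rfl⟩, -⟩
      exact ⟨(i, s), rfl⟩
    · refine (Set.finite_range fun x : (Fin n × ℤˣ) × (Fin n × ℤˣ) =>
        unitVec x.1 + unitVec x.2).subset ?_
      rintro _ ⟨⟨i, j, s, t, -, rfl⟩, -⟩
      exact ⟨((i, s), (j, t)), rfl⟩
  rw [h1, Set.ncard_union_eq (Set.disjoint_left.mpr fun α h h' =>
    Set.disjoint_left.mp disjoint_short_long h.1 h'.1) (hfin _).1 (hfin _).2]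
  have h2 := ncard_shortRoots fun α => α ∈ constOn L ∧ α ⬝ᵥ y = 2 * u / k
  have h3 := ncard_longRoots fun α => α ∈ constOn L ∧ α ⬝ᵥ y = 2 * v / k
  simp only [unitVec_dotProduct] at h2
  have hf : ∀ a b : Fin n × ℤˣ, (unitVec a - unitVec b ∈ constOn L ∧
      (unitVec a - unitVec b) ⬝ᵥ y = 2 * v / k) ↔ _ := fun a b => by
    rw [sub_dotProduct, unitVec_dotProduct, unitVec_dotProduct]
  have h4 := sum_diagonal (L := L) (y := y) (2 * v / k) _ hf
  rw [sum_pairs _ _ hf, ← h3, show 2 * v / k / 2 = v / k by ring,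
    if_congr (show 2 * v / k = 0 ↔ v = 0 by simp [hk]) rfl rfl] at h4
  have h5 : ∑ a : Fin n × ℤˣ, (if unitVec a ∈ constOn L ∧ signed y a = 2 * u / k then (1 : ℤ)
      else 0) = fib (bPart L ×ˢ univ) (signed y) (2 * u / k) := by
    rw [fib, ← sum_subset (subset_univ (bPart L ×ˢ univ))]
    · refine sum_congr rfl fun a ha => if_congr ?_ rfl rfl
      exact and_iff_right (single_unit_mem.mpr (mem_product.mp ha).1)
    · exact fun a _ ha => if_neg fun h => ha (mem_product.mpr ⟨single_unit_mem.mp h.1, mem_univ _⟩)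
  omega

/-- After scaling by `2 / k₁` the values `k₁` and 0 of long roots become differences 2 and 0, and
the value of short roots becomes `h`. The diagonal term `2 n` in the count of zero values cancels
against the `n` in the codimension. -/
theorem isResidual_iff {h : ℤ} {k₁ k₂ : ℝ} (hk : k₁ ≠ 0) (hk₂ : k₂ = h / 2 * k₁)
    (hc : c ∈ L) : IsResidual k₁ k₂ L ↔ 2 * (Module.finrank ℝ L.direction : ℤ) =
      (∑ a ∈ bPart L ×ˢ univ, dlt (bPart L ×ˢ univ) (signed ((2 / k₁) • c))
          (signed ((2 / k₁) • c) a) +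
        fib (bPart L ×ˢ univ) (signed ((2 / k₁) • c)) 0 +
        fib (bPart L ×ˢ univ) (signed ((2 / k₁) • c)) 1 -
        2 * fib (bPart L ×ˢ univ) (signed ((2 / k₁) • c)) (h.natAbs : ℕ)) +
      2 * ∑ K ∈ blocks L, ∑ i ∈ K, dlt K (aligned L ((2 / k₁) • c))
        (aligned L ((2 / k₁) • c) i) := by
  classical
  have hP := ncard_roots (L := L) k₂ k₁ (label k₁ k₂) (fun α hα => if_pos hα) (fun α hα =>
    if_neg fun h => Set.disjoint_left.mp disjoint_short_long h hα) hk hc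
  have hZ := ncard_roots (L := L) 0 0 (fun _ => 0) (fun _ _ => rfl) (fun _ _ => rfl) hk hc
  have hle : Module.finrank ℝ L.direction ≤ n := by simpa using Submodule.finrank_le L.direction
  have hh : fib (bPart L ×ˢ univ) (signed ((2 / k₁) • c)) (2 * k₂ / k₁) =
      fib (bPart L ×ˢ univ) (signed ((2 / k₁) • c)) (h.natAbs : ℕ) := by
    rw [show 2 * k₂ / k₁ = h by rw [hk₂]; field_simp, Nat.cast_natAbs, Int.cast_abs]
    rcases abs_choice (h : ℝ) with e | e <;> rw [e]
    rw [fib_neg (negStable_signed _ _)]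
  rw [if_neg hk, hh, div_self hk, mul_div_cancel_right₀ _ hk] at hP
  rw [if_pos rfl, mul_zero, zero_div] at hZ
  simp only [sub_zero, add_zero] at hZ
  simp only [sum_add_distrib] at hP hZ
  simp only [dlt, sum_sub_distrib, sum_fib_add_two] at hP hZ ⊢
  rw [IsResidual, and_iff_right ⟨c, hc⟩]
  constructor <;> intro H <;> omega

end Residual

/-! ### The structure and the center of a residual subspace -/

section Center
open Finset

variable {n : ℕ} {L : AffineSubspace ℝ (Fin n → ℝ)}

variable {c v : Fin n → ℝ} {K : Finset (Fin n)} {i : Fin n} {h : ℤ}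

theorem mem_constOn_iff_direction (hc : c ∈ L) :
    v ∈ constOn L ↔ ∀ u ∈ L.direction, v ⬝ᵥ u = 0 := by
  constructor
  · intro h u hu
    have := h _ (AffineSubspace.vadd_mem_of_mem_direction hu hc) c hc
    simp_all
  · intro h x hx y hy
    rw [← sub_eq_zero, ← dotProduct_sub]
    exact h _ (AffineSubspace.vsub_mem_direction hx hy)

variable (L) in
/-- The vector spanning the invariants of a block of coordinates. -/
def blockVec (K : Finset (Fin n)) (i : Fin n) : ℝ := if i ∈ K then ((signOf L i : ℤ) : ℝ) else 0

theorem dotProduct_blockVec (v : Fin n → ℝ) (K : Finset (Fin n)) :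
    v ⬝ᵥ blockVec L K = ∑ i ∈ K, aligned L v i := by
  simp only [dotProduct, blockVec, mul_ite, mul_zero, sum_ite_mem, univ_inter]
  exact sum_congr rfl fun i _ => mul_comm _ _

theorem mem_of_mem_blocks (hK : K ∈ blocks L) :
    i ∈ K ↔ i ∉ bPart L ∧ blockOf L i = K := by
  obtain ⟨j, hj, rfl⟩ := mem_image.mp hK
  rw [mem_compl] at hj
  rw [mem_blockOf_iff]
  exact ⟨fun h => ⟨fun hi => hj (mem_bPart_of_mem_blockOf (mem_blockOf_iff.mpr h) hi), h⟩,
    fun h => h.2⟩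

variable (L) in
/-- The span of the invariants of the blocks. -/
def blockSpan : Submodule ℝ (Fin n → ℝ) := span ℝ ((blocks L).image (blockVec L) : Set _)

theorem blockVec_mem (hK : K ∈ blocks L) : blockVec L K ∈ blockSpan L :=
  subset_span (mem_image_of_mem _ hK)

theorem mem_blockSpan {u : Fin n → ℝ} (f : Finset (Fin n) → ℝ) (h0 : ∀ i ∈ bPart L, u i = 0)
    (h1 : ∀ i ∉ bPart L, aligned L u i = f (blockOf L i)) : u ∈ blockSpan L := by
  have : u = ∑ K ∈ blocks L, f K • blockVec L K := by
    ext i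
    rw [Finset.sum_apply]
    by_cases hi : i ∈ bPart L
    · rw [h0 i hi, sum_eq_zero]
      intro K hK
      rw [Pi.smul_apply, blockVec, if_neg fun h => ((mem_of_mem_blocks hK).mp h).1 hi, smul_zero]
    · rw [sum_eq_single_of_mem _ (blockOf_mem_blocks hi), Pi.smul_apply, blockVec,
        if_pos (self_mem_blockOf i), ← h1 i hi, aligned, smul_eq_mul, mul_right_comm,
        unit_mul_self, one_mul]
      intro K hK hne
      rw [Pi.smul_apply, blockVec, if_neg fun h => hne ((mem_of_mem_blocks hK).mp h).2.symm,
        smul_zero]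
  rw [this]
  exact sum_mem fun K hK => (blockSpan L).smul_mem _ (blockVec_mem hK)

theorem unitVec_sub_mem_constOn {j : Fin n} (hi : i ∉ bPart L) (h : blockOf L i = blockOf L j) :
    unitVec (i, signOf L i) - unitVec (j, signOf L j) ∈ constOn L :=
  (sub_mem_constOn_iff hi _ _).mpr ⟨h, by simp_all⟩

theorem direction_le (hc : c ∈ L) : L.direction ≤ blockSpan L := by
  intro u hu
  have h := fun v (hv : v ∈ constOn L) => (mem_constOn_iff_direction hc).mp hv u hu
  have h1 : ∀ K ∈ blocks L, ∃ x, ∀ i ∈ K, aligned L u i = x := fun K hK => by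
    obtain ⟨j, hj, rfl⟩ := mem_image.mp hK
    refine ⟨aligned L u j, fun i hi => ?_⟩
    obtain ⟨hi1, hi2⟩ := (mem_of_mem_blocks hK).mp hi
    have := h _ (unitVec_sub_mem_constOn hi1 hi2)
    rwa [sub_dotProduct, unitVec_dotProduct, unitVec_dotProduct, sub_eq_zero] at this
  choose! f hf using h1
  refine mem_blockSpan f (fun i hi => ?_) fun i hi => hf _ (blockOf_mem_blocks hi) i
    (self_mem_blockOf i)
  have := h _ (mem_bPart.mp hi)
  simp_all

theorem finrank_blockSpan_le : Module.finrank ℝ (blockSpan L) ≤ (blocks L).card :=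
  (finrank_span_finset_le_card _).trans card_image_le

/-- In `isResidual_iff` the B-part contributes at least 0 and each block at least 2 to `2 dim L`,
whereas `dim L` is at most the number of blocks because the direction is contained in `blockSpan L`.
Hence equality holds everywhere. -/
theorem IsResidual.structure {k₁ k₂ : ℝ} (hk : k₁ ≠ 0) (hk₂ : k₂ = h / 2 * k₁)
    (hL : IsResidual k₁ k₂ L) : L.direction = blockSpan L ∧ ∀ c ∈ L,
      (∃ J, IsJumps (bPart L ×ˢ univ) (signed ((2 / k₁) • c)) h.natAbs J) ∧
      ∀ K ∈ blocks L, ∑ i ∈ K, dlt K (aligned L ((2 / k₁) • c))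
        (aligned L ((2 / k₁) • c) i) = 1 := by
  have key : ∀ c ∈ L, (blocks L).card ≤ Module.finrank ℝ L.direction ∧
      (∃ J, IsJumps (bPart L ×ˢ univ) (signed ((2 / k₁) • c)) h.natAbs J) ∧
      ∀ K ∈ blocks L, ∑ i ∈ K, dlt K (aligned L ((2 / k₁) • c))
        (aligned L ((2 / k₁) • c) i) = 1 := by
    intro c hc
    have h1 := (isResidual_iff hk hk₂ hc).mp hL
    have h2 := energy_nonneg (negStable_signed (bPart L) ((2 / k₁) • c)) h.natAbs
    have h3 : ∀ K ∈ blocks L, 1 ≤ ∑ i ∈ K, dlt K (aligned L ((2 / k₁) • c))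
        (aligned L ((2 / k₁) • c) i) := fun K hK => by
      obtain ⟨j, -, rfl⟩ := mem_image.mp hK
      exact one_le_sum_dlt ⟨j, self_mem_blockOf j⟩
    have h4 := sum_le_sum h3
    have h5 := (Submodule.finrank_mono (direction_le hc)).trans (finrank_blockSpan_le (L := L))
    have h6 : ∑ K ∈ blocks L, (1 : ℤ) = (blocks L).card := by simp
    rw [exists_isJumps_iff (negStable_signed _ _)]
    refine ⟨by omega, by omega, fun K hK => ?_⟩
    exact ((sum_eq_sum_iff_of_le h3).mp (by omega) K hK).symm
  obtain ⟨c, hc⟩ := hL.1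
  exact ⟨Submodule.eq_of_le_of_finrank_le (direction_le hc)
    (finrank_blockSpan_le.trans (key c hc).1), fun c hc => (key c hc).2⟩

theorem mem_constOn_iff_sum (hd : L.direction = blockSpan L) (hc : c ∈ L) :
    v ∈ constOn L ↔ ∀ K ∈ blocks L, ∑ i ∈ K, aligned L v i = 0 := by
  rw [mem_constOn_iff_direction hc, hd]
  constructor
  · intro h K hK
    rw [← dotProduct_blockVec]
    exact h _ (blockVec_mem hK)
  · intro h u hu
    induction hu using Submodule.span_induction with
    | mem u hu =>
      obtain ⟨K, hK, rfl⟩ := mem_image.mp (mem_coe.mp hu)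
      rw [dotProduct_blockVec, h K hK]
    | zero => rw [dotProduct_zero]
    | add u v _ _ hu hv => rw [dotProduct_add, hu, hv, add_zero]
    | smul a u _ hu => rw [dotProduct_smul, hu, smul_zero]

/-- A functional constant on `L` has aligned coordinate sum 0 on every block, so it is a combination
of short roots of the B-part and of differences inside the blocks. The center thus becomes the point
of `L` with vanishing block sums. -/
theorem span_rootsOf (hd : L.direction = blockSpan L) (hc : c ∈ L) :
    span ℝ (rootsOf L) = constOn L := by
  refine le_antisymm (span_le.mpr fun α hα => hα.2) fun v hv => ?_
  rw [mem_constOn_iff_sum hd hc] at hv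
  have h1 : ∀ K ∈ blocks L, ∃ w : Fin n → ℝ, ∀ i ∈ K,
      unitVec (i, signOf L i) - w ∈ span ℝ (rootsOf L) := fun K hK => by
    obtain ⟨j, hj, rfl⟩ := mem_image.mp hK
    refine ⟨unitVec (j, signOf L j), fun i hi => ?_⟩
    obtain ⟨hi1, hi2⟩ := (mem_of_mem_blocks hK).mp hi
    have h2 := unitVec_sub_mem_constOn hi1 hi2
    rcases eq_or_ne i j with rfl | hij
    · rw [sub_self]; exact zero_mem _
    · refine subset_span ⟨Or.inr ⟨i, j, signOf L i, -signOf L j, hij, ?_⟩, h2⟩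
      rw [sub_eq_add_neg, ← unitVec_neg]; rfl
  choose! w hw using h1
  have h3 : v = ∑ i ∈ bPart L, v i • unitVec (i, 1) +
      ∑ K ∈ blocks L, ∑ i ∈ K, aligned L v i • (unitVec (i, signOf L i) - w K) := by
    have h4 : ∀ K ∈ blocks L, ∑ i ∈ K, aligned L v i • (unitVec (i, signOf L i) - w K) =
        ∑ i ∈ K, v i • unitVec (i, 1) := fun K hK => by
      simp only [smul_sub, sum_sub_distrib, ← sum_smul, hv K hK, zero_smul, sub_zero]
      refine sum_congr rfl fun i _ => ?_
      rw [aligned, unitVec, single_unit, smul_smul, mul_right_comm, unit_mul_self, one_mul, unitVec]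
      simp
    rw [sum_congr rfl h4, ← sum_blocks (L := L) fun _ i => v i • unitVec (i, 1), sum_add_sum_compl]
    ext j
    simp [unitVec_apply, Finset.sum_apply]
  rw [h3]
  refine add_mem (sum_mem fun i hi => smul_mem _ _ (subset_span
    ⟨Or.inl ⟨i, 1, rfl⟩, single_unit_mem.mpr hi⟩)) (sum_mem fun K hK => sum_mem fun i hi =>
      smul_mem _ _ (hw K hK i hi))

theorem isCenter_iff (hd : L.direction = blockSpan L) :
    IsCenter L c ↔ c ∈ L ∧ ∀ K ∈ blocks L, ∑ i ∈ K, aligned L c i = 0 := by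
  refine and_congr_right fun hc => ?_
  rw [span_rootsOf hd hc, mem_constOn_iff_sum hd hc]

theorem IsResidual.existsUnique_isCenter {k₁ k₂ : ℝ} (hk : k₁ ≠ 0)
    (hk₂ : k₂ = h / 2 * k₁) (hL : IsResidual k₁ k₂ L) : ∃! c, IsCenter L c := by
  have hd := (hL.structure hk hk₂).1
  obtain ⟨x, hx⟩ := hL.1
  refine existsUnique_of_exists_of_unique ?_ fun c c' hc hc' => ?_
  · obtain ⟨f, hf⟩ : ∃ f : Finset (Fin n) → ℝ, ∀ K ∈ blocks L,
        ∑ i ∈ K, (aligned L x i - f K) = 0 := by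
      -- Subtracting the average of each block moves a point within `L` to the center.
      refine ⟨fun K => (∑ i ∈ K, aligned L x i) / K.card, fun K hK => ?_⟩
      obtain ⟨j, -, rfl⟩ := mem_image.mp hK
      have : ((blockOf L j).card : ℝ) ≠ 0 :=
        Nat.cast_ne_zero.mpr (card_ne_zero_of_mem (self_mem_blockOf j))
      rw [sum_sub_distrib, sum_const, nsmul_eq_mul, mul_div_cancel₀ _ this, sub_self]
    obtain ⟨u, hu⟩ : ∃ u : Fin n → ℝ, ∀ i, u i = if i ∈ bPart L then 0 else
      ((signOf L i : ℤ) : ℝ) * f (blockOf L i) := ⟨_, fun i => rfl⟩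
    have hu1 : ∀ i ∉ bPart L, aligned L u i = f (blockOf L i) := fun i hi => by
      rw [aligned, hu, if_neg hi, ← mul_assoc, unit_mul_self, one_mul]
    have hu2 : u ∈ L.direction := by
      rw [hd]
      exact mem_blockSpan f (fun i hi => by rw [hu, if_pos hi]) hu1
    refine ⟨-u +ᵥ x, (isCenter_iff hd).mpr
      ⟨AffineSubspace.vadd_mem_of_mem_direction (neg_mem hu2) hx, fun K hK => ?_⟩⟩
    rw [← hf K hK]
    refine sum_congr rfl fun i hi => ?_
    obtain ⟨hi1, hi2⟩ := (mem_of_mem_blocks hK).mp hi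
    rw [← hi2, ← hu1 i hi1, aligned, aligned, aligned, vadd_eq_add, Pi.add_apply, Pi.neg_apply]
    ring
  -- The difference of two centers, as a functional, takes the same value at both, so it is
  -- orthogonal to itself.
  · have h1 := (constOn L).sub_mem ((span_le.mpr fun α hα => hα.2) hc.2)
      ((span_le.mpr fun α hα => hα.2) hc'.2)
    have h2 := h1 c hc.1 c' hc'.1
    rw [← sub_eq_zero, ← dotProduct_sub, dotProduct_self_eq_zero, sub_eq_zero] at h2
    exact h2

end Center

/-! ### The partition of a center -/

section HasType
open Finset

variable {n : ℕ}

variable {k : ℝ} {b : ℕ} {c : Fin n → ℝ} {l : Multiset ℕ}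

open Classical in
/-- The coordinates of `c` are those of the centers with partition `l`. -/
def HasType (k : ℝ) (b : ℕ) (c : Fin n → ℝ) (l : Multiset ℕ) : Prop :=
  ∀ v : ℝ, -1 < v → dlt (univ ×ˢ univ) (signed ((2 / k) • c)) v =
    ((l.map (Nat.cast : ℕ → ℝ)).count (v + 1) : ℤ) -
      if ∃ p ∈ lowSet b, (p : ℝ) = v + 1 then 1 else 0

theorem HasType.unique {l' : Multiset ℕ}
    (h : HasType k b c l) (h' : HasType k b c l') (h0 : 0 ∉ l) (h0' : 0 ∉ l') : l = l' := by
  classical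
  ext p
  rcases p with _ | p
  · simp_all
  · have hp : (-1 : ℝ) < p := by grind
    have := (h p hp).symm.trans (h' p hp)
    rw [← Nat.cast_add_one, Multiset.count_map_eq_count' _ _ Nat.cast_injective,
      Multiset.count_map_eq_count' _ _ Nat.cast_injective] at this
    omega

theorem fib_act (w : W (Fin n)) (y : Fin n → ℝ) (v : ℝ) : fib (univ ×ˢ univ) (signed (act w y)) v =
      fib (univ ×ˢ univ) (signed y) v := by
  simp only [fib, sum_product, sum_units, signed]
  refine Fintype.sum_equiv w.right⁻¹ _ _ fun i => ?_
  simp only [TypeB.act]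
  rcases units_eq_one_or (w.left i) with h | h <;> simp [h, add_comm]

theorem HasType.act (h : HasType k b c l)
    (w : W (Fin n)) : HasType k b (act w c) l := fun v hv => by
  rw [← h v hv, dlt, dlt, ← act_smul, fib_act, fib_act]

/-- Telescoping from above turns the prescribed jumps into the multiplicities of all absolute values
of the coordinates; points with equal multiplicities are conjugate under signed permutations. -/
theorem HasType.exists_act (hk : k ≠ 0) {c' : Fin n → ℝ}
    (h : HasType k b c l) (h' : HasType k b c' l) : ∃ w : W (Fin n), TypeB.act w c = c' := by
  classical
  have h1 : ∀ v, 0 ≤ v → fib (univ ×ˢ univ) (signed ((2 / k) • c')) v =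
      fib (univ ×ˢ univ) (signed ((2 / k) • c)) v := fun v hv => by
    have : ∀ j : ℕ, -1 < v + 2 * (j : ℝ) := fun j => by grind
    refine le_antisymm (fib_le_of_dlt_le fun j => ?_) (fib_le_of_dlt_le fun j => ?_) <;>
      rw [h _ (this j), h' _ (this j)]
  have h2 : content (fun i => |((2 / k) • c') i|) = content (fun i => |((2 / k) • c) i|) := by
    ext v
    simp only [content]
    rcases lt_or_ge v 0 with hv | hv
    · have : ∀ y : Fin n → ℝ, univ.filter (fun i => |y i| = v) = ∅ := fun y =>
        filter_eq_empty_iff.mpr fun i _ h => by linarith [abs_nonneg (y i)]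
      rw [this, this]
    · have := h1 v hv
      rw [fib_signed_eq_card _ _ hv, fib_signed_eq_card _ _ hv] at this
      split_ifs at this <;> omega
  obtain ⟨τ, hτ⟩ := exists_perm_of_content_eq h2
  have h3 : ∀ i, ∃ s : ℤˣ, ((s : ℤ) : ℝ) * c (τ i) = c' i := fun i => by
    have h4 := congrFun hτ i
    simp only [comp, Pi.smul_apply, smul_eq_mul, abs_mul] at h4
    have h5 := mul_left_cancel₀ (abs_ne_zero.mpr (div_ne_zero two_ne_zero hk)) h4
    rcases abs_eq_abs.mp h5 with h | h
    · exact ⟨1, by simp [h]⟩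
    · exact ⟨-1, by simp [h]⟩
  choose s hs using h3
  exact ⟨⟨s, τ⁻¹⟩, funext fun i => by simp only [TypeB.act, inv_inv, hs]⟩

variable {L : AffineSubspace ℝ (Fin n → ℝ)}

/-- With both signs counted, a block occurs together with its negative, whose `dlt` at `v` is minus
that of the block at `-v - 2`. -/
theorem dlt_univ (y : Fin n → ℝ) (v : ℝ) : dlt (univ ×ˢ univ) (signed y) v =
      dlt (bPart L ×ˢ univ) (signed y) v +
        ∑ K ∈ blocks L, (dlt K (aligned L y) v - dlt K (aligned L y) (-v - 2)) := by
  classical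
  have key : ∀ v, fib (univ ×ˢ univ) (signed y) v = fib (bPart L ×ˢ univ) (signed y) v +
        ∑ K ∈ blocks L, (fib K (aligned L y) v + fib K (aligned L y) (-v)) := fun v => by
    simp only [fib, sum_product, ← sum_add_distrib]
    rw [← sum_add_sum_compl (bPart L), ← sum_blocks (L := L) fun _ i =>
      (if aligned L y i = v then (1 : ℤ) else 0) + if aligned L y i = -v then 1 else 0]
    congr 1
    refine sum_congr rfl fun i _ => ?_
    rw [sum_units, aligned, signed, signed]
    rcases units_eq_one_or (signOf L i) with h | h <;> rw [h] <;> simp [neg_eq_iff_eq_neg, add_comm]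
  rw [dlt, key, key, dlt]
  have : ∀ K, dlt K (aligned L y) v - dlt K (aligned L y) (-v - 2) =
      fib K (aligned L y) v + fib K (aligned L y) (-v) -
        (fib K (aligned L y) (v + 2) + fib K (aligned L y) (-(v + 2))) := fun K => by
    rw [dlt, dlt, sub_add_cancel, neg_add']
    ring
  simp only [this, sum_sub_distrib]
  ring

/-- At the center a block of size `d` is the progression from `-(d - 1)` to `d - 1` with step 2.
Together with its negative it contributes a double jump at `d - 1`, which is recorded by the two
parts `d`. -/
theorem IsResidual.hasType {h : ℤ} {k₁ k₂ : ℝ} (hk : k₁ ≠ 0) (hk₂ : k₂ = h / 2 * k₁)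
    (hL : IsResidual k₁ k₂ L) (hc : IsCenter L c) {J : Finset ℕ}
    (hJ : IsJumps (bPart L ×ˢ univ) (signed ((2 / k₁) • c)) h.natAbs J) :
    HasType k₁ h.natAbs c (J.val + 2 • aType L) := by
  classical
  intro v hv
  obtain ⟨hd, hs⟩ := hL.structure hk hk₂
  have h0 := ((isCenter_iff hd).mp hc).2
  have h1 : ∀ K ∈ blocks L, dlt K (aligned L ((2 / k₁) • c)) v -
      dlt K (aligned L ((2 / k₁) • c)) (-v - 2) = 2 * if v + 1 = K.card then 1 else 0 := by
    intro K hK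
    have h2 : ∑ i ∈ K, aligned L ((2 / k₁) • c) i = 0 := by
      have : ∀ i, aligned L ((2 / k₁) • c) i = (2 / k₁) * aligned L c i := fun i => by
        rw [aligned, aligned, Pi.smul_apply, smul_eq_mul]; ring
      simp only [this, ← mul_sum, h0 K hK, mul_zero]
    have h3 := (hs c hc.1).2 K hK
    rw [dlt_eq_of_sum_eq_one h3 h2, dlt_eq_of_sum_eq_one h3 h2,
      if_neg (show ¬ v = -(K.card : ℝ) - 1 by linarith),
      if_neg (show ¬ -v - 2 = (K.card : ℝ) - 1 by grind),
      if_congr (show v = (K.card : ℝ) - 1 ↔ v + 1 = K.card from eq_sub_iff_add_eq) rfl rfl,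
      if_congr (show -v - 2 = -(K.card : ℝ) - 1 ↔ v + 1 = K.card by
        constructor <;> intro h <;> linarith) rfl rfl]
    split_ifs <;> norm_num
  rw [dlt_univ (L := L), sum_congr rfl h1, hJ.2 v hv, Multiset.map_add, count_add,
    Multiset.map_nsmul, count_nsmul, count_eq_of_nodup
      (Nodup.map Nat.cast_injective J.nodup), if_congr Multiset.mem_map rfl rfl, aType_eq,
    Multiset.map_map, Multiset.count_map, ← filter_val, card_val,
    card_filter, ← mul_sum]
  push_cast
  rw [add_sub_right_comm]
  congr!

end HasType

/-! ### Points with given jumps -/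

section Existence
open Finset

/-- The multiplicity of `v` in a family with positive jumps `J`. -/
def jumpMult (c : ℕ) (J : Finset ℕ) (v : ℕ) : ℕ :=
  (J.filter (v < ·)).card - ((lowSet c).filter (v < ·)).card

variable {c : ℕ} {J : Finset ℕ}

theorem card_filter_lt_add_two (J : Finset ℕ) (v : ℕ) : (J.filter (v < ·)).card =
    (J.filter (v + 2 < ·)).card + (if v + 1 ∈ J then 1 else 0) + if v + 2 ∈ J then 1 else 0 := by
  have h : ∀ w : ℕ, (J.filter (w < ·)).card =
      (J.filter (w + 1 < ·)).card + if w + 1 ∈ J then 1 else 0 := fun w => by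
    rw [← card_filter_add_card_filter_not (s := J.filter (w < ·)) (w + 1 < ·),
      filter_filter, filter_filter]
    congr 1
    · exact congrArg _ (filter_congr fun x _ => by omega)
    · rw [filter_congr (q := fun x => x = w + 1) fun x _ => by omega, filter_eq']
      split_ifs <;> rfl
  rw [h v, h (v + 1)]
  ring

/-- Below `c` the elements of `J` lie in `lowSet c`, which has `c / 2` elements; so `J` has no more
elements up to `v`, and therefore at least as many beyond it. -/
theorem card_lowSet_filter_le (hc : c / 2 ≤ J.card) (hJ : ∀ p ∈ J, 0 < p ∧ (p + c) % 2 = 1)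
    (v : ℕ) : ((lowSet c).filter (v < ·)).card ≤ (J.filter (v < ·)).card := by
  rcases Nat.lt_or_ge v c with hv | hv
  · have h1 := card_filter_add_card_filter_not (s := J) (v < ·)
    have h2 := card_filter_add_card_filter_not (s := lowSet c) (v < ·)
    rw [(lowSet_card_sum c).1] at h2
    have h3 : J.filter (¬ v < ·) ⊆ (lowSet c).filter (¬ v < ·) := fun x hx => by
      rw [mem_filter] at hx ⊢
      have := hJ x hx.1
      rw [mem_lowSet]
      omega
    have := card_le_card h3
    omega
  · rw [filter_eq_empty_iff.mpr fun x hx h => ?_]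
    · exact Nat.zero_le _
    · rw [mem_lowSet] at hx; omega

/-- The multiplicity of `v` must be the number of jumps beyond `v` minus the number of elements of
`lowSet c` beyond `v`, as telescoping shows. It has to be non-negative, and even for `v = 0`, where
each coordinate counts twice. -/
theorem exists_isJumps {l : ℕ} (hJ : ∀ p ∈ J, 0 < p ∧ (p + c) % 2 = 1) (hc : c / 2 ≤ J.card)
    (hsum : ∑ p ∈ J, p = 2 * l + c ^ 2 / 4) :
    ∃ g : Fin l → ℝ, IsJumps (univ ×ˢ univ) (signed g) c J := by
  classical
  obtain ⟨R, hR⟩ : ∃ R, ∀ p ∈ J, p < R := ⟨J.sup id + 1, fun p hp =>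
    Nat.lt_succ_of_le (le_sup (f := id) hp)⟩
  -- For `c = 2 b` the jumps are odd, so their number has the parity of their sum, which is that of
  -- `b ^ 2`, hence of `b`.
  have heven : c % 2 = 0 → jumpMult c J 0 % 2 = 0 := by
    intro hc2
    obtain ⟨b, rfl⟩ : ∃ b, c = 2 * b := ⟨c / 2, by omega⟩
    have h1 : ∑ p ∈ J, p = 2 * ∑ p ∈ J, p / 2 + J.card := by
      rw [mul_sum, card_eq_sum_ones, ← sum_add_distrib]
      exact sum_congr rfl fun p hp => by have := hJ p hp; omega
    have h2 : (2 * b) ^ 2 / 4 = b ^ 2 := by grind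
    have h3 : b ^ 2 % 2 = b % 2 := by
      rcases Nat.mod_two_eq_zero_or_one b with h | h <;> rw [Nat.pow_mod, h]
    rw [jumpMult, filter_true_of_mem fun p hp => (hJ p hp).1,
      filter_true_of_mem fun p hp => (mem_lowSet.mp hp).2.1, (lowSet_card_sum _).1]
    omega
  obtain ⟨κ, hκ⟩ : ∃ κ : Fin R → ℕ, ∀ v, κ v = if ((v : ℕ) + c) % 2 = 0 then
    jumpMult c J v / (if (v : ℕ) = 0 then 2 else 1) else 0 := ⟨_, fun _ => rfl⟩
  obtain ⟨F, hF⟩ := exists_content_eq (ι := Fin (∑ v, κ v)) (κ := κ) (by simp)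
  obtain ⟨g, hg⟩ : ∃ g : Fin (∑ v, κ v) → ℝ, ∀ i, g i = ((F i : ℕ) : ℝ) := ⟨_, fun _ => rfl⟩
  have hfib : ∀ p : ℕ, fib (univ ×ˢ univ) (signed g) p =
      if (p + c) % 2 = 0 then (jumpMult c J p : ℤ) else 0 := by
    intro p
    rw [fib_signed_eq_card _ _ p.cast_nonneg, if_congr Nat.cast_eq_zero rfl rfl]
    have h1 : ∀ i, |g i| = p ↔ (F i : ℕ) = p := fun i => by rw [hg, Nat.abs_cast, Nat.cast_inj]
    simp only [h1]
    rcases Nat.lt_or_ge p R with hp | hp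
    · have h2 := congrFun hF ⟨p, hp⟩
      rw [content, hκ] at h2
      simp only [Fin.ext_iff] at h2
      grind
    · rw [filter_eq_empty_iff.mpr fun i _ h => by omega, jumpMult,
        filter_eq_empty_iff.mpr fun x hx h => by have := hR x hx; omega]
      simp
  have hmain : IsJumps (univ ×ˢ univ) (signed g) c J := by
    refine ⟨hJ, fun v hv => ?_⟩
    by_cases hv' : ∃ p : ℕ, v = p
    · obtain ⟨p, rfl⟩ := hv'
      rw [if_congr (exists_natCast_mem _ p) rfl rfl, if_congr (exists_natCast_mem _ p) rfl rfl,
        dlt, show (p : ℝ) + 2 = (p + 2 : ℕ) by push_cast; rfl, hfib, hfib, jumpMult, jumpMult]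
      have h1 := card_filter_lt_add_two J p
      have h2 := card_filter_lt_add_two (lowSet c) p
      have h3 := card_lowSet_filter_le hc hJ p
      have h4 := card_lowSet_filter_le hc hJ (p + 2)
      by_cases hp : (p + c) % 2 = 0
      · rw [if_neg (show p + 2 ∉ lowSet c by rw [mem_lowSet]; omega)] at h2
        grind
      · rw [if_neg hp, if_neg (by omega), if_neg fun h => by have := hJ _ h; omega,
          if_neg fun h => by rw [mem_lowSet] at h; omega]
    · have h0 : ∀ v : ℝ, -1 < v → (¬ ∃ p : ℕ, v = p) →
          fib (univ ×ˢ univ) (signed g) v = 0 := fun v hv hv' => by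
        by_contra h
        obtain ⟨⟨i, s⟩, -, rfl⟩ := exists_of_fib_ne_zero h
        rw [signed, hg] at hv hv'
        rcases units_eq_one_or s with rfl | rfl
        · exact hv' ⟨F i, by simp⟩
        · rcases Nat.eq_zero_or_pos (F i : ℕ) with h | h
          · exact hv' ⟨0, by simp [h]⟩
          simp_all
      rw [dlt, h0 v hv hv', h0 (v + 2) (by linarith), if_neg, if_neg, sub_zero]
      · rintro ⟨p, hp, h⟩
        exact hv' ⟨p - 1, by rw [Nat.cast_sub (mem_lowSet.mp hp).2.1]; push_cast; linarith⟩
      · rintro ⟨p, hp, h⟩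
        exact hv' ⟨p - 1, by simp_all⟩
      · rintro ⟨p, hp⟩
        rcases Nat.lt_or_ge p 2 with h | h
        · have : (p : ℝ) ≤ 1 := by exact_mod_cast (by omega : p ≤ 1)
          linarith
        · exact hv' ⟨p - 2, by rw [Nat.cast_sub h]; push_cast; linarith⟩
  -- The number of coordinates is not prescribed in the construction; the sum of the jumps shows
  -- that it is `l`.
  have h1 := hmain.sum_eq (negStable_signed _ _)
  rw [hsum, card_product, card_univ, card_univ, Fintype.card_fin, card_units_int] at h1
  grind

end Existence

/-! ### Residual subspaces with given partition -/

section Construction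
open Finset

variable {h : ℤ} {J : Finset ℕ}

theorem fib_map {ι κ : Type*} (K : Finset ι) (φ : ι ↪ κ) (z : κ → ℝ) (v : ℝ) :
    fib (K.map φ) z v = fib K (fun i => z (φ i)) v := sum_map _ _ _

theorem sum_dlt_string {d : ℕ} (hd : 0 < d) (ε : ℤˣ) (f : Fin d → ℝ)
    (hf : ∀ t, f t = ((ε : ℤ) : ℝ) * (2 * ((t : ℕ) : ℝ) - (d - 1))) :
    ∑ t, dlt univ f (f t) = 1 := by
  obtain ⟨m, rfl⟩ : ∃ m, d = m + 1 := ⟨d - 1, by omega⟩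
  have h1 : ∀ t, fib univ f (f t) = 1 := fun t => by
    rw [fib, sum_eq_single_of_mem t (mem_univ _), if_pos rfl]
    intro t' _ ht
    refine if_neg fun h => ht ?_
    rw [hf, hf] at h
    have h2 := mul_left_cancel₀ (unit_ne_zero ε) h
    have h3 : ((t' : ℕ) : ℝ) = (t : ℕ) := by linarith
    exact Fin.ext (by exact_mod_cast h3)
  have h2 : ∀ δ : ℤˣ, (∀ t t', f t = f t' + 2 ↔ ((t : ℕ) : ℝ) = (t' : ℕ) + ((δ : ℤ) : ℝ)) →
      ∑ t, fib univ f (f t + 2) = m := fun δ hδ => by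
    unfold fib
    rcases units_eq_one_or δ with rfl | rfl
    · rw [Fin.sum_univ_castSucc, sum_eq_zero (fun t _ => if_neg fun h => ?_), add_zero,
        sum_congr rfl fun t _ => ?_, sum_const, card_univ, Fintype.card_fin,
        nsmul_one]
      · rw [sum_eq_single_of_mem t.succ (mem_univ _), if_pos]
        · rw [hδ]; simp
        · intro t' _ ht
          refine if_neg fun h => ht ?_
          rw [hδ] at h
          simp only [Units.val_one, cast_one, ← Nat.cast_add_one, Nat.cast_inj] at h
          exact Fin.ext (by simpa using h)
      · rw [hδ] at h
        simp only [Units.val_one, cast_one, ← Nat.cast_add_one, Nat.cast_inj] at h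
        grind
    · rw [sum_comm, Fin.sum_univ_castSucc, sum_eq_zero (fun t _ => if_neg fun h => ?_),
        add_zero, sum_congr rfl fun t _ => ?_, sum_const, card_univ,
        Fintype.card_fin, nsmul_one]
      · rw [sum_eq_single_of_mem t.succ (mem_univ _), if_pos]
        · rw [hδ]; simp
        · intro t' _ ht
          refine if_neg fun h => ht ?_
          rw [hδ] at h
          simp only [Units.val_neg, Units.val_one, Int.cast_neg, cast_one,
            ← sub_eq_add_neg, eq_sub_iff_add_eq, ← Nat.cast_add_one, Nat.cast_inj] at h
          exact Fin.ext (by simpa using h.symm)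
      · rw [hδ] at h
        simp only [Units.val_neg, Units.val_one, Int.cast_neg, cast_one,
          ← sub_eq_add_neg, eq_sub_iff_add_eq, ← Nat.cast_add_one, Nat.cast_inj] at h
        simp only [Fin.val_last] at h
        omega
  simp only [dlt, sum_sub_distrib, h1]
  rw [h2 ε fun t t' => ?_]
  · simp
  · rw [hf, hf]
    rcases units_eq_one_or ε with rfl | rfl <;> push_cast <;> constructor <;> intro h <;> linarith

variable {n : ℕ}

set_option maxHeartbeats 400000 in
-- The subspace passes through `c`, and its direction consists of the vectors that vanish on the
-- B-coordinates and are constant on each progression up to the signs `τ`. Its blocks are the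
-- progressions, so the numerical criterion is met with equality.
theorem exists_isResidual {k₁ k₂ : ℝ} (hk : k₁ ≠ 0) (hk₂ : k₂ = h / 2 * k₁) {l r : ℕ}
    {d : Fin r → ℕ} (hd : ∀ b, 0 < d b) (e : Fin n ≃ Fin l ⊕ Σ b, Fin (d b)) (τ : Fin n → ℤˣ)
    {g : Fin l → ℝ}
    (hg : IsJumps (univ ×ˢ univ) (signed g) h.natAbs J) {c : Fin n → ℝ}
    (hc : ∀ i, ((2 / k₁) • c) i = ((τ i : ℤ) : ℝ) *
      Sum.elim g (fun x => 2 * ((x.2 : ℕ) : ℝ) - (d x.1 - 1)) (e i)) :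
    ∃ L : AffineSubspace ℝ (Fin n → ℝ), IsResidual k₁ k₂ L ∧ IsCenter L c ∧
      aType L = univ.val.map d ∧
      IsJumps (bPart L ×ˢ univ) (signed ((2 / k₁) • c)) h.natAbs J := by
  classical
  obtain ⟨S, hS0, hS1⟩ : ∃ S : (Fin r → ℝ) → (Fin l ⊕ Σ b, Fin (d b)) → ℝ,
    (∀ f j, S f (inl j) = 0) ∧ ∀ f x, S f (inr x) = f x.1 :=
      ⟨fun f => Sum.elim (fun _ => 0) fun x => f x.1, fun _ _ => rfl, fun _ _ => rfl⟩
  obtain ⟨ψ, hψ⟩ : ∃ ψ : (Fin r → ℝ) →ₗ[ℝ] (Fin n → ℝ), ∀ f i,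
      ψ f i = ((τ i : ℤ) : ℝ) * S f (e i) := by
    refine ⟨IsLinearMap.mk' (fun f i => ((τ i : ℤ) : ℝ) * S f (e i))
      ⟨fun f f' => ?_, fun a f => ?_⟩, fun _ _ => rfl⟩ <;> ext i <;> rcases hi : e i with j | x <;>
      simp [hi, hS0, hS1, mul_add, mul_left_comm]
  obtain ⟨L, hL⟩ : ∃ L, L = AffineSubspace.mk' c (LinearMap.range ψ) := ⟨_, rfl⟩
  have hcL : c ∈ L := hL ▸ AffineSubspace.self_mem_mk' _ _
  have hdir : L.direction = LinearMap.range ψ := by rw [hL, AffineSubspace.direction_mk']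
  have hcon : ∀ v, v ∈ constOn L ↔ ∀ f, v ⬝ᵥ ψ f = 0 := fun v => by
    rw [mem_constOn_iff_direction hcL, hdir]
    simp_all
  have hB : ∀ i, i ∈ bPart L ↔ ∃ j, e i = inl j := fun i => by
    rw [mem_bPart, hcon]
    simp only [single_dotProduct, one_mul, hψ]
    rcases hi : e i with j | x
    · simp [hS0]
    · simp only [hS1]
      constructor
      · intro H
        exact absurd (H fun _ => 1) (by simp)
      · rintro ⟨j, hj⟩; cases hj
  have hblk : ∀ i x, e i = inr x → ∀ j, j ∈ blockOf L i ↔ ∃ t, e j = inr ⟨x.1, t⟩ := by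
    intro i x hi j
    rw [mem_blockOf]
    simp only [hcon, sub_dotProduct, single_dotProduct, hψ, hi, hS1, sub_eq_zero, one_mul]
    constructor
    · rintro ⟨s, hs⟩
      have h1 := hs (Pi.single x.1 1)
      rw [Pi.single_eq_same, mul_one] at h1
      rcases hj : e j with j' | ⟨b, t⟩
      · simp_all
      · by_cases hb : b = x.1
        · subst hb; exact ⟨t, rfl⟩
        simp_all
    · rintro ⟨t, ht⟩
      refine ⟨τ i * τ j, fun f => ?_⟩
      rw [ht, hS1]
      push_cast
      rw [← mul_assoc, mul_assoc (((τ i : ℤ) : ℝ)), unit_mul_self, mul_one]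
  obtain ⟨φ, hφ⟩ : ∃ φ : ∀ b, Fin (d b) ↪ Fin n, ∀ b t, φ b t = e.symm (inr ⟨b, t⟩) :=
    ⟨fun b => ⟨fun t => e.symm (inr ⟨b, t⟩), fun t t' h => by simpa using h⟩, fun _ _ => rfl⟩
  have heφ : ∀ b t, e (φ b t) = inr ⟨b, t⟩ := fun b t => by rw [hφ, e.apply_symm_apply]
  have hnB : ∀ b t, φ b t ∉ bPart L := fun b t hb => by grind
  have hK : ∀ b t, blockOf L (φ b t) = univ.map (φ b) := fun b t => by grind
  have hblocks : blocks L = univ.image fun b => univ.map (φ b) := by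
    ext K
    rw [blocks, mem_image, mem_image]
    constructor
    · rintro ⟨i, hi, rfl⟩
      rcases hi' : e i with j | ⟨b, t⟩
      · simp_all
      grind
    · rintro ⟨b, -, rfl⟩
      exact ⟨φ b ⟨0, hd b⟩, mem_compl.mpr (hnB _ _), hK b _⟩
  have hinj : Injective fun b => (univ.map (φ b) : Finset (Fin n)) := by
    intro b b' hbb
    have : φ b ⟨0, hd b⟩ ∈ univ.map (φ b') := by grind
    grind
  obtain ⟨y, hy⟩ : ∃ y, y = (2 / k₁) • c := ⟨_, rfl⟩
  rw [← hy] at hc ⊢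
  -- The signs `signOf` and `τ` need not agree, but a difference of aligned unit vectors vanishes on
  -- the direction, so their product is constant on a block.
  have hal : ∀ b t, aligned L y (φ b t) = (((signOf L (φ b ⟨0, hd b⟩) *
      τ (φ b ⟨0, hd b⟩) : ℤˣ) : ℤ) : ℝ) * (2 * ((t : ℕ) : ℝ) - (d b - 1)) := fun b t => by
    have h1 := (hcon _).mp (unitVec_sub_mem_constOn (hnB b t)
      ((hK b t).trans (hK b ⟨0, hd b⟩).symm)) fun _ => 1
    rw [sub_dotProduct, unitVec_dotProduct, unitVec_dotProduct, sub_eq_zero, signed, signed,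
      hψ, hψ, heφ, heφ, hS1, hS1, mul_one, mul_one] at h1
    rw [aligned, hc, heφ, ← mul_assoc]
    push_cast
    rw [← h1]
    rfl
  have hJ : IsJumps (bPart L ×ˢ univ) (signed y) h.natAbs J := by
    obtain ⟨ρ, hρ⟩ : ∃ ρ : Fin l ↪ Fin n, ∀ j, e (ρ j) = inl j :=
      ⟨Function.Embedding.inl.trans e.symm.toEmbedding, fun j => e.apply_symm_apply _⟩
    have h1 : bPart L = univ.map ρ := by
      ext i
      rw [hB, mem_map]
      exact ⟨fun ⟨j, hj⟩ => ⟨j, mem_univ _, e.injective ((hρ j).trans hj.symm)⟩,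
        fun ⟨j, _, hj⟩ => ⟨j, hj ▸ hρ j⟩⟩
    have h2 : ∀ v, fib (bPart L ×ˢ univ) (signed y) v =
        fib (univ ×ˢ univ) (signed g) v := fun v => by
      simp only [fib, sum_product, sum_units, signed, h1, sum_map, hc, hρ, elim_inl]
      refine sum_congr rfl fun j _ => ?_
      rcases units_eq_one_or (τ (ρ j)) with h | h <;> simp [h, add_comm]
    refine ⟨hg.1, fun v hv => ?_⟩
    rw [← hg.2 v hv, dlt, dlt, h2, h2]
  have hD : ∀ b, ∑ i ∈ univ.map (φ b), dlt (univ.map (φ b)) (aligned L y)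
      (aligned L y i) = 1 := fun b => by
    rw [sum_map, ← sum_dlt_string (hd b) _ _ (hal b)]
    simp only [dlt, fib_map]
  have hres : IsResidual k₁ k₂ L := by
    rw [isResidual_iff hk hk₂ hcL, ← hy, (exists_isJumps_iff (negStable_signed _ _)).mp ⟨J, hJ⟩,
      hblocks, sum_image hinj.injOn, sum_congr rfl fun b _ => hD b, sum_const,
      card_univ, Fintype.card_fin, hdir, LinearMap.finrank_range_of_inj, Module.finrank_fin_fun]
    · simp
    · intro f f' hff
      ext b
      have := congrFun hff (φ b ⟨0, hd b⟩)
      rw [hψ, hψ, heφ, hS1, hS1] at this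
      exact mul_left_cancel₀ (unit_ne_zero _) this
  refine ⟨L, hres, (isCenter_iff (hres.structure hk hk₂).1).mpr ⟨hcL, fun K hK' => ?_⟩, ?_, hJ⟩
  · rw [hblocks] at hK'
    obtain ⟨b, -, rfl⟩ := mem_image.mp hK'
    have h1 : ∀ i, aligned L y i = (2 / k₁) * aligned L c i := fun i => by
      rw [aligned, aligned, hy, Pi.smul_apply, smul_eq_mul]; ring
    have h2 : ∑ i ∈ univ.map (φ b), aligned L y i = 0 := by
      rw [sum_map, sum_congr rfl fun t _ => hal b t, ← mul_sum,
        Fin.sum_univ_eq_sum_range fun t : ℕ => 2 * (t : ℝ) - (d b - 1)]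
      refine mul_eq_zero_of_right _ ?_
      have h3 : ∀ m : ℕ, ∑ t ∈ range m, 2 * (t : ℝ) = m * (m - 1) := fun m => by
        induction m with
        | zero => simp
        | succ m ih => rw [sum_range_succ, ih]; push_cast; ring
      rw [sum_sub_distrib, h3, sum_const, card_range, nsmul_eq_mul, sub_self]
    simp only [h1, ← mul_sum] at h2
    grind
  · rw [aType_eq, ← blocks, hblocks, image_val_of_injOn hinj.injOn, Multiset.map_map]
    simp

/-- Both sums are written as sums over `v` of the number of elements beyond `v` and compared term by
term. This guarantees that a partition in `unipotent h n` leaves room for its A-part. -/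
theorem sum_lowSet_le {c : ℕ} (hJ : ∀ p ∈ J, 0 < p ∧ (p + c) % 2 = 1)
    (hc : c / 2 ≤ J.card) : c ^ 2 / 4 ≤ ∑ p ∈ J, p := by
  have h : ∀ S : Finset ℕ, (∀ p ∈ S, p < J.sup id + c + 1) → ∑ p ∈ S, p =
      ∑ v ∈ range (J.sup id + c + 1), (S.filter (v < ·)).card := fun S hS => by
    simp only [card_filter]
    rw [sum_comm]
    refine sum_congr rfl fun p hp => ?_
    rw [← card_filter, show (range (J.sup id + c + 1)).filter (· < p) = range p by grind,
      card_range]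
  rw [← (lowSet_card_sum c).2, h J fun p hp => ?_, h (lowSet c) fun p hp => ?_]
  · exact sum_le_sum fun v _ => card_lowSet_filter_le hc hJ v
  · rw [mem_lowSet] at hp; omega
  · have : p ≤ J.sup id := le_sup (f := id) hp
    omega

/-- The choice of `w` is left free in order that each point of the orbit, not merely one, is seen to
be the center of a subspace with the prescribed data. -/
theorem exists_center {k₁ k₂ : ℝ} (hk : k₁ ≠ 0) (hk₂ : k₂ = h / 2 * k₁) {p : Multiset ℕ}
    (hp : p ∈ unipotent h n) : ∃ c₀ : Fin n → ℝ, ∀ w : W (Fin n),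
      ∃ L : AffineSubspace ℝ (Fin n → ℝ), IsResidual k₁ k₂ L ∧ IsCenter L (act w c₀) ∧
        aType L = halfParts p ∧
        IsJumps (bPart L ×ˢ univ) (signed ((2 / k₁) • act w c₀)) h.natAbs (oddParts p) := by
  obtain ⟨h0, hsum, heven, hcard⟩ := hp
  have hmem : ∀ i, i ∈ oddParts p ↔ Odd (p.count i) := fun i => by
    have := count_oddParts p i
    rw [Nat.odd_iff, ← this, count_eq_of_nodup (oddParts p).nodup]
    simp
  have hO : ∀ i ∈ oddParts p, 0 < i ∧ (i + h.natAbs) % 2 = 1 := fun i hi => by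
    refine ⟨Nat.pos_of_ne_zero ?_, ?_⟩
    · rintro rfl
      simp_all
    grind
  have hle : h.natAbs / 2 ≤ (oddParts p).card :=
    hcard.trans (card_le_card fun i hi => (hmem i).mpr (mem_filter.mp hi).2.2)
  have hlow := sum_lowSet_le hO hle
  have hs : ∑ i ∈ oddParts p, i + 2 * (halfParts p).sum = 2 * n + h.natAbs ^ 2 / 4 := by
    rw [← hsum]
    nth_rewrite 3 [← oddParts_add_halfParts p]
    rw [sum_add, Multiset.sum_nsmul, sum_eq_multiset_sum, map_id', smul_eq_mul]
  obtain ⟨g, hg⟩ := exists_isJumps (l := n - (halfParts p).sum) hO hle (by omega)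
  obtain ⟨r, d, hdr⟩ : ∃ (r : ℕ) (d : Fin r → ℕ), univ.val.map d = halfParts p :=
    ⟨_, (halfParts p).toList.get, by rw [Fin.univ_val_map, List.ofFn_get, Multiset.coe_toList]⟩
  have hd : ∀ b, 0 < d b := fun b => by
    have h1 : d b ∈ halfParts p := hdr ▸ Multiset.mem_map_of_mem d (mem_univ b)
    rw [← count_pos, count_halfParts] at h1
    refine Nat.pos_of_ne_zero fun hb => ?_
    simp_all
  have hds : ∑ b, d b = (halfParts p).sum := by rw [← hdr]; rfl
  obtain ⟨e⟩ : Nonempty (Fin n ≃ Fin (n - (halfParts p).sum) ⊕ Σ b, Fin (d b)) := by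
    rw [← Fintype.card_eq]
    simp only [Fintype.card_fin, Fintype.card_sum, Fintype.card_sigma, hds]
    omega
  refine ⟨fun i => k₁ / 2 * Sum.elim g (fun x => 2 * ((x.2 : ℕ) : ℝ) - (d x.1 - 1)) (e i),
    fun w => ?_⟩
  have hy : ∀ i, ((2 / k₁) • act w (fun i => k₁ / 2 *
      Sum.elim g (fun x => 2 * ((x.2 : ℕ) : ℝ) - (d x.1 - 1)) (e i))) i =
      ((w.left i : ℤ) : ℝ) * Sum.elim g (fun x => 2 * ((x.2 : ℕ) : ℝ) - (d x.1 - 1))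
        (((w.right⁻¹ : Perm (Fin n)).trans e) i) := fun i => by
    simp only [Pi.smul_apply, act, smul_eq_mul, Equiv.trans_apply]
    field_simp
  obtain ⟨L, h1, h2, h3, h4⟩ := exists_isResidual hk hk₂ hd
    ((w.right⁻¹ : Perm (Fin n)).trans e) w.left hg hy
  exact ⟨L, h1, h2, h3.trans hdr, h4⟩

end Construction

/-! ### The correspondence -/

section Correspondence
open Finset

variable {n : ℕ} {h : ℤ} {k₁ k₂ : ℝ} {L : AffineSubspace ℝ (Fin n → ℝ)} {c : Fin n → ℝ}
  {p : Multiset ℕ}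

/-- The characters corresponding to the partition `p`. -/
def psiFiber (h : ℤ) (n : ℕ) (p : Multiset ℕ) : Set (W (Fin n) → ℂ) :=
  {χ | ∃ A : Bipartition n, χ = chi A ∧ psiBip h A = p}

/-- The partition determines the entries of the symbol by `Matches.entries_unique`; this makes `psi`
injective on similarity classes. -/
theorem similar_iff {A B : Bipartition n} : Similar h A B ↔ psiBip h A = psiBip h B := by
  refine ⟨fun hs => by rw [psiBip, psiBip, hs], fun hp => ?_⟩
  have hA := (corresponds_psiBip (h := h) A).1
  rw [hp] at hA
  exact hA.entries_unique (corresponds_psiBip (h := h) B).1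

theorem simClass_chi (A : Bipartition n) : simClass h (chi A) = psiFiber h n (psiBip h A) := by
  ext χ
  constructor
  · rintro ⟨-, A', B, hA, hB, hs⟩
    rw [chi_injective hA]
    exact ⟨B, hB, (similar_iff.mp hs).symm⟩
  · rintro ⟨B, rfl, hB⟩
    exact ⟨chi_mem_irr B, A, B, rfl, rfl, similar_iff.mpr hB.symm⟩

/-- The symbol of the jumps matches the partition with parts `J`, and truncated induction adds every
block size twice. Since a partition without zeros is recovered from a matching symbol by `psiBip`,
the correspondents are a full fibre, and a non-empty one. -/
theorem IsJumps.correspondence (hk : k₁ ≠ 0) {J : Finset ℕ}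
    (hJ : IsJumps (bPart L ×ˢ univ) (signed ((2 / k₁) • c)) h.natAbs J) :
    J.val + 2 • aType L ∈ unipotent h n ∧ (∃ A : Bipartition n, psiBip h A = J.val + 2 • aType L) ∧
      subspaceCorr h k₁ L c = psiFiber h n (J.val + 2 • aType L) := by
  obtain ⟨h1, h2, ρ, h3⟩ := hJ.jumps_spec hk
  have hpos := hJ.1
  have hfil : (jumps h k₁ (bPart L) c).val.filter (· ≠ 0) = J.val := by
    refine (Nodup.ext ((jumps h k₁ (bPart L) c).nodup.filter _) J.nodup).mpr fun p => ?_
    rw [Multiset.mem_filter, mem_val, mem_val]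
    grind
  have hsum : (jumps h k₁ (bPart L) c).val.sum = 2 * (bPart L).card + h.natAbs ^ 2 / 4 := by
    have h4 := hJ.sum_eq (negStable_signed _ _)
    rw [card_product, card_univ, card_units_int] at h4
    rw [mul_comm 2, ← h4, sum_eq_multiset_sum, map_id', ← hfil]
    conv_lhs => rw [← filter_add_not (· ≠ 0) (jumps h k₁ (bPart L) c).val]
    rw [sum_add, Nat.add_eq_left, Multiset.sum_eq_zero]
    simp_all
  obtain ⟨hcard, hV, B, hB, hBc⟩ := matches_jumpSymbol h h2 h3 hsum
  rw [hfil] at hcard hV hBc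
  have hlen := length_blockSizes_le (L := L)
  have hle := card_le_univ (bPart L)
  rw [Fintype.card_fin] at hle
  have h0 : 0 ∉ J.val + 2 • aType L := by
    rw [Multiset.mem_add, ← coe_blockSizes]
    rintro (h0 | h0)
    · grind
    · exact absurd (one_le_of_mem_blockSizes (Multiset.mem_coe.mp (Multiset.mem_of_mem_nsmul h0)))
        (by omega)
  have hc' : (J.val + 2 • aType L).card ≤ n + (h.natAbs + 1) / 2 + n := by
    rw [card_add, card_nsmul, ← coe_blockSizes, coe_card]
    omega
  have hV' : EvenParts (h.natAbs % 2)
      (padTo (n + (h.natAbs + 1) / 2 + n) (J.val + 2 • aType L)) := by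
    rw [evenParts_padTo_add hc']
    have := (evenParts_stable hcard (n - (bPart L).card)).mpr hV
    rwa [Nat.add_sub_cancel' hle] at this
  have key : ∀ A : Bipartition n, Corresponds h A (J.val + 2 • aType L) ↔
      psiBip h A = J.val + 2 • aType L := fun A =>
    ⟨corresponds_unique h0 hV', fun hA => hA ▸ (corresponds_psiBip A).1⟩
  obtain ⟨A, -, hA⟩ := exists_corresponds hcard hV hBc
  refine ⟨mem_unipotent_of_corresponds h0 hc' hV' hA, ⟨A, (key A).mp hA⟩, ?_⟩
  rw [Corresponds, hB] at hBc
  ext χ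
  rw [mem_subspaceCorr_iff hcard hBc hV]
  simp only [key]
  rfl

/-- Surjectivity is obtained from geometry: a residual subspace with this partition, for the
auxiliary label `k₁ = 1`, has Springer correspondents, and `psiBip` maps them to `p`. -/
theorem exists_psiBip_eq (hp : p ∈ unipotent h n) : ∃ A : Bipartition n, psiBip h A = p := by
  obtain ⟨c₀, hc₀⟩ := exists_center (h := h) one_ne_zero rfl hp
  obtain ⟨L, -, -, ha, hJ⟩ := hc₀ 1
  have := (hJ.correspondence one_ne_zero).2.1
  rwa [ha, oddParts_add_halfParts] at this

theorem psi_psiFiber (hp : p ∈ unipotent h n) : psi h (psiFiber h n p) = p := by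
  obtain ⟨A, hA⟩ := exists_psiBip_eq hp
  have hS : ∃ A : Bipartition n, chi A ∈ psiFiber h n p := ⟨A, A, rfl, hA⟩
  rw [psi, dif_pos hS]
  obtain ⟨B, hB, hBp⟩ := hS.choose_spec
  rwa [chi_injective hB]

theorem simClasses_eq : simClasses h n = psiFiber h n '' unipotent h n := by
  ext S
  constructor
  · rintro ⟨χ, hχ, rfl⟩
    obtain ⟨A, rfl⟩ := exists_chi_eq hχ
    exact ⟨_, psiBip_mem_unipotent A, (simClass_chi A).symm⟩
  · rintro ⟨p, hp, rfl⟩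
    obtain ⟨A, rfl⟩ := exists_psiBip_eq hp
    exact ⟨chi A, chi_mem_irr A, (simClass_chi A).symm⟩

theorem mem_oddParts {i : ℕ} : i ∈ oddParts p ↔ Odd (p.count i) := by
  rw [Nat.odd_iff, ← count_oddParts, count_eq_of_nodup (oddParts p).nodup]
  simp

/-- The conditions in the Bala–Carter map say that jumps and block sizes assemble to `p`, which is a
property of the point only. Conversely all points of this type are conjugate to one from
`exists_center`. -/
theorem balaCarter_eq (hk : k₁ ≠ 0) (hk₂ : k₂ = h / 2 * k₁) (hp : p ∈ unipotent h n) :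
    balaCarter h k₁ k₂ n p = {c | HasType k₁ h.natAbs c p} := by
  ext c
  constructor
  · rintro ⟨L, hL, hc, ha, hj⟩
    obtain ⟨J, hJ⟩ := ((hL.structure hk hk₂).2 c hc.1).1
    have h1 := (hJ.jumps_spec hk).1
    have : J.val + 2 • aType L = p := by
      ext d
      rw [count_add, count_nsmul, ha, count_eq_of_nodup J.nodup]
      have hd : d ∈ J.val ↔ p.count d % 2 = 1 := by
        rw [mem_val, ← Nat.odd_iff]
        rcases Nat.eq_zero_or_pos d with rfl | hd
        · rw [count_eq_zero.mpr hp.1]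
          exact iff_of_false (fun h0 => absurd (hJ.1 0 h0).1 (lt_irrefl 0)) (by decide)
        · rw [← h1 d hd, hj d hd]
      grind
    exact this ▸ hL.hasType hk hk₂ hc hJ
  · intro hc
    obtain ⟨c₀, hc₀⟩ := exists_center hk hk₂ hp
    obtain ⟨L, hL, hLc, ha, hJ⟩ := hc₀ 1
    have := hL.hasType hk hk₂ hLc hJ
    rw [ha, oddParts_add_halfParts, act_one] at this
    obtain ⟨w, rfl⟩ := this.exists_act hk hc
    obtain ⟨L, hL, hLc, ha, hJ⟩ := hc₀ w
    exact ⟨L, hL, hLc, fun d => ha ▸ count_halfParts p d,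
      fun i hi => ((hJ.jumps_spec hk).1 i hi).trans mem_oddParts⟩

theorem balaCarter_eq_orbit (hk : k₁ ≠ 0) (hk₂ : k₂ = h / 2 * k₁) (hp : p ∈ unipotent h n)
    (hc : HasType k₁ h.natAbs c p) : balaCarter h k₁ k₂ n p = orbit c := by
  rw [balaCarter_eq hk hk₂ hp]
  ext c'
  constructor
  · exact hc.exists_act hk
  · rintro ⟨w, rfl⟩
    exact hc.act w

theorem IsResidual.exists_hasType (hk : k₁ ≠ 0) (hk₂ : k₂ = h / 2 * k₁) (hL : IsResidual k₁ k₂ L)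
    (hc : IsCenter L c) : ∃ p ∈ unipotent h n, HasType k₁ h.natAbs c p ∧
      subspaceCorr h k₁ L c = psiFiber h n p := by
  obtain ⟨J, hJ⟩ := ((hL.structure hk hk₂).2 c hc.1).1
  obtain ⟨h1, -, h2⟩ := hJ.correspondence hk
  exact ⟨_, h1, hL.hasType hk hk₂ hc hJ, h2⟩

theorem centers_eq (hk : k₁ ≠ 0) (hk₂ : k₂ = h / 2 * k₁) :
    centers k₁ k₂ n = balaCarter h k₁ k₂ n '' unipotent h n := by
  ext O
  constructor
  · rintro ⟨L, c, hL, hc, rfl⟩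
    obtain ⟨p, hp, hcp, -⟩ := hL.exists_hasType hk hk₂ hc
    exact ⟨p, hp, balaCarter_eq_orbit hk hk₂ hp hcp⟩
  · rintro ⟨p, hp, rfl⟩
    obtain ⟨c₀, hc₀⟩ := exists_center hk hk₂ hp
    obtain ⟨L, hL, hLc, ha, hJ⟩ := hc₀ 1
    have := hL.hasType hk hk₂ hLc hJ
    rw [ha, oddParts_add_halfParts] at this
    exact ⟨L, _, hL, hLc, balaCarter_eq_orbit hk hk₂ hp this⟩

/-- The partition depends on the orbit only, so all subspaces whose centers lie in this orbit have
the same correspondents. -/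
theorem HasType.sigma_orbit (hk : k₁ ≠ 0) (hk₂ : k₂ = h / 2 * k₁) (hp : p ∈ unipotent h n)
    (hL : IsResidual k₁ k₂ L) (hc : IsCenter L c) (hcp : HasType k₁ h.natAbs c p) :
    Sigma h k₁ k₂ (orbit c) = psiFiber h n p := by
  have key : ∀ L' c', IsResidual k₁ k₂ L' → IsCenter L' c' → orbit c = orbit c' →
      subspaceCorr h k₁ L' c' = psiFiber h n p := fun L' c' hL' hc' ho => by
    obtain ⟨p', hp', hcp', hS⟩ := hL'.exists_hasType hk hk₂ hc'
    have hmem : c' ∈ orbit c := ho ▸ ⟨1, act_one c'⟩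
    obtain ⟨w, rfl⟩ := hmem
    rw [hS, hcp'.unique (hcp.act w) hp'.1 hp.1]
  ext χ
  constructor
  · rintro ⟨L', c', hL', hc', ho, hχ⟩
    rwa [key L' c' hL' hc' ho] at hχ
  · exact fun hχ => ⟨L, c, hL, hc, rfl, by rwa [key L c hL hc rfl]⟩

theorem sigma_balaCarter (hk : k₁ ≠ 0) (hk₂ : k₂ = h / 2 * k₁) (hp : p ∈ unipotent h n) :
    Sigma h k₁ k₂ (balaCarter h k₁ k₂ n p) = psiFiber h n p := by
  obtain ⟨c₀, hc₀⟩ := exists_center hk hk₂ hp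
  obtain ⟨L, hL, hLc, ha, hJ⟩ := hc₀ 1
  have := hL.hasType hk hk₂ hLc hJ
  rw [ha, oddParts_add_halfParts] at this
  rw [balaCarter_eq_orbit hk hk₂ hp this, this.sigma_orbit hk hk₂ hp hL hLc]

theorem psi_bijOn : Set.BijOn (psi h) (simClasses h n) (unipotent h n) := by
  rw [simClasses_eq]
  refine Set.BijOn.mk ?_ ?_ fun p hp => ⟨_, ⟨p, hp, rfl⟩, psi_psiFiber hp⟩
  · rintro _ ⟨p, hp, rfl⟩
    rwa [psi_psiFiber hp]
  · rintro _ ⟨p, hp, rfl⟩ _ ⟨q, hq, rfl⟩ hpq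
    rw [psi_psiFiber hp, psi_psiFiber hq] at hpq
    rw [hpq]

theorem psi_sigma_balaCarter (hk : k₁ ≠ 0) (hk₂ : k₂ = h / 2 * k₁) (hp : p ∈ unipotent h n) :
    psi h (Sigma h k₁ k₂ (balaCarter h k₁ k₂ n p)) = p := by
  rw [sigma_balaCarter hk hk₂ hp, psi_psiFiber hp]

theorem balaCarter_bijOn (hk : k₁ ≠ 0) (hk₂ : k₂ = h / 2 * k₁) :
    Set.BijOn (balaCarter h k₁ k₂ n) (unipotent h n) (centers k₁ k₂ n) := by
  rw [centers_eq hk hk₂]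
  refine Set.InjOn.bijOn_image fun p hp q hq hpq => ?_
  rw [← psi_sigma_balaCarter hk hk₂ hp, hpq, psi_sigma_balaCarter hk hk₂ hq]

theorem sigma_injOn (hk : k₁ ≠ 0) (hk₂ : k₂ = h / 2 * k₁) :
    Set.InjOn (Sigma h k₁ k₂) (centers k₁ k₂ n) := by
  rw [centers_eq hk hk₂]
  rintro _ ⟨p, hp, rfl⟩ _ ⟨q, hq, rfl⟩ hpq
  rw [← psi_sigma_balaCarter hk hk₂ hp, hpq, psi_sigma_balaCarter hk hk₂ hq]

theorem sigma_image_centers (hk : k₁ ≠ 0) (hk₂ : k₂ = h / 2 * k₁) :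
    {S | ∃ O ∈ centers k₁ k₂ n, S = Sigma h k₁ k₂ O} = simClasses h n := by
  rw [centers_eq hk hk₂, simClasses_eq]
  ext S
  constructor
  · rintro ⟨_, ⟨p, hp, rfl⟩, rfl⟩
    exact ⟨p, hp, (sigma_balaCarter hk hk₂ hp).symm⟩
  · rintro ⟨p, hp, rfl⟩
    exact ⟨_, ⟨p, hp, rfl⟩, (sigma_balaCarter hk hk₂ hp).symm⟩

end Correspondence

end TypeB

end

theorem mainTheorem2 (n : ℕ) (h : ℤ) (k₁ k₂ : ℝ) (hk₁ : k₁ ≠ 0)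
    (hk₂ : k₂ = ((h : ℝ) / 2) * k₁) :
    -- every residual subspace has a unique center, and its Springer correspondents depend only
    -- on the orbit of the center
    (∀ L : AffineSubspace ℝ (Fin n → ℝ), TypeB.IsResidual k₁ k₂ L →
      ∃! c, TypeB.IsCenter L c) ∧
    (∀ (L : AffineSubspace ℝ (Fin n → ℝ)) (c : Fin n → ℝ), TypeB.IsResidual k₁ k₂ L →
      TypeB.IsCenter L c →
        TypeB.Sigma h k₁ k₂ (TypeB.orbit c) = TypeB.subspaceCorr h k₁ L c) ∧
    -- the first bijection, and the second one, which is the identity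
    Set.BijOn (TypeB.Sigma h k₁ k₂) (TypeB.centers k₁ k₂ n)
      {S | ∃ O ∈ TypeB.centers k₁ k₂ n, S = TypeB.Sigma h k₁ k₂ O} ∧
    {S | ∃ O ∈ TypeB.centers k₁ k₂ n, S = TypeB.Sigma h k₁ k₂ O} = TypeB.simClasses h n ∧
    -- the generalized unipotent classes parametrize both sides
    Set.BijOn (TypeB.psi h) (TypeB.simClasses h n) (TypeB.unipotent h n) ∧
    Set.BijOn (TypeB.balaCarter h k₁ k₂ n) (TypeB.unipotent h n) (TypeB.centers k₁ k₂ n) ∧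
    -- compatibly
    ∀ O ∈ TypeB.centers k₁ k₂ n,
      TypeB.balaCarter h k₁ k₂ n (TypeB.psi h (TypeB.Sigma h k₁ k₂ O)) = O := by
  refine ⟨fun L hL => hL.existsUnique_isCenter hk₁ hk₂, fun L c hL hc => ?_,
    ⟨fun O hO => ⟨O, hO, rfl⟩, TypeB.sigma_injOn hk₁ hk₂, ?_⟩,
    TypeB.sigma_image_centers hk₁ hk₂, TypeB.psi_bijOn, TypeB.balaCarter_bijOn hk₁ hk₂, ?_⟩
  · obtain ⟨p, hp, hcp, hS⟩ := hL.exists_hasType hk₁ hk₂ hc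
    rw [hS, hcp.sigma_orbit hk₁ hk₂ hp hL hc]
  · rintro _ ⟨O, hO, rfl⟩
    exact ⟨O, hO, rfl⟩
  · rw [TypeB.centers_eq hk₁ hk₂]
    rintro _ ⟨p, hp, rfl⟩
    rw [TypeB.psi_sigma_balaCarter hk₁ hk₂ hp]
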